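/- Let $d\ge 2$ be an integer and $\nu\in\mathbb C$. On $\mathbb C^{d+1}$ put $z\cdot w=z^0w^0-z^1w^1-\dots-z^dw^d$. Let $V_+=\{y\in\mathbb R^{d+1}: y\cdot y>0,\ y^0>0\}$, $C^+=\{\xi\in\mathbb R^{d+1}:\xi\cdot\xi=0,\ \xi^0>0\}$, $dS_d^{(c)}=\{z\in\mathbb C^{d+1}: z\cdot z=-1\}$ and $\mathcal T_\pm=\{x+iy\in dS_d^{(c)}: \pm y\in V_+\}$. Let $$\alpha(\xi)=(\xi^0)^{-1}\sum_{j=1}^d(-1)^{j+1}\xi^j\,d\xi^1\wedge\dots\widehat{d\xi^j}\dots\wedge d\xi^d ,$$ and let $\gamma_0=C^+\cap\{\xi^0=1\}$ be the unit sphere $S^{d-1}$ with its canonical orientation. For a smooth singular $(d-1)$-cycle $\gamma$ in $C^+$, $z_1\in\mathcal T_-$ and $z_2\in\mathcal T_+$, set $$I_\gamma(z_1,z_2)=\int_\gamma(\xi\cdot z_1)^{-\frac{d-1}2-i\nu}(\xi\cdot z_2)^{-\frac{d-1}2+i\nu}\,\alpha(\xi)$$ with principal powers. Let $\Box$ be the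 (complexified) d'Alembertian of the de Sitter space $x\cdot x=-1$ with signature $(+,-,\dots,-)$, and $m^2=\frac{(d-1)^2}4+\nu^2$. (1) For every such cycle $\gamma$, $I_\gamma$ is holomorphic on $\mathcal T_-\times\mathcal T_+$ and satisfies there the Klein–Gordon equation $(\Box+m^2)I_\gamma=0$ in each of the two variables. (2) For every such cycle $\gamma$, $I_\gamma$ is invariant under $SO_0(1,d)$, i.e. $I_\gamma(gz_1,gz_2)=I_\gamma(z_1,z_2)$, and its value depends only on $\zeta=z_1\cdot z_2$. If $\gamma,\gamma'$ are homologous in $C^+$, then $I_\gamma=I_{\gamma'}$. (3) Suppose that $\nu$ is not a pole of $\Gamma(\frac{d-1}2+i\nu)\Gamma(\frac{d-1}2-i\nu)$. There is a function $w_\nu$, holomorphic on the cut plane $\mathbb C\setminus(-\infty,-1]$, such that $$w_\nu(\zeta)=\frac{\Gamma(\frac{d-1}2+i\nu)\Gamma(\frac{d-1}2-i\nu)}{2(2\pi)^{d/2}}\,(\zeta^2-1)^{-\frac{d-2}4}\,P^{-\frac{d-2}2}_{-\frac12+i\nu}(\zeta)\qquad(\zeta\in\mathbb C\setminus(-\infty,1]),$$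 where $P^\mu_\sigma$ is the Legendre function of the first kind on $\mathbb C\setminus(-\infty,1]$ and $(\zeta^2-1)^p=(\zeta-1)^p(\zeta+1)^p$ with principal powers; in particular $(z_1,z_2)\mapsto w_\nu(z_1\cdot z_2)$ is holomorphic on $\Delta=\{(z_1,z_2)\in dS_d^{(c)}\times dS_d^{(c)}: z_1\cdot z_2\notin(-\infty,-1]\}$. For every cycle $\gamma$ homologous to $\gamma_0$ in $C^+$ and all $z_1\in\mathcal T_-$, $z_2\in\mathcal T_+$, one has $z_1\cdot z_2\notin(-\infty,-1]$ and $$W_\nu(z_1,z_2):=\frac{\Gamma(\frac{d-1}2+i\nu)\Gamma(\frac{d-1}2-i\nu)\,e^{\pi\nu}}{2^{d+1}\pi^d}\,I_\gamma(z_1,z_2)=w_\nu(z_1\cdot z_2).$$ Moreover $W_\nu$ is canonically normalized: with $x(t,u)=(\sinh t,\cosh t\;u)$, $u\in S^{d-1}$, and $$C_\varepsilon(t,u;s,u')=W_\nu\big(x(t-i\varepsilon,u),x(s+i\varepsilon,u')\big)-W_\nu\big(x(s-i\varepsilon,u'),x(t+i\varepsilon,u)\big),$$ one has the equal-time canonical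 commutation relations: for every continuous $f:S^{d-1}\to\mathbb C$ and $u\in S^{d-1}$, the integrals over $u'\in S^{d-1}$ (surface measure) of $f(u')$ against $C_\varepsilon$, $\partial_sC_\varepsilon$ and $\partial_t\partial_sC_\varepsilon$ at $t=s=0$ tend, as $\varepsilon\to0^+$, to $0$, $i f(u)$ and $0$ respectively. -/

import Mathlib

open scoped ContDiff

noncomputable section

namespace DeSitter

/-! ### Geometry of complex de Sitter space -/

/-- The Minkowski product `x⁰y⁰ - x¹y¹ - ... - x^d y^d` on `R^(d+1)`; for `R = ℂ` it is the
complex bilinear extension. -/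
def mdot {R : Type*} [CommRing R] {d : ℕ} (x y : Fin (d + 1) → R) : R :=
  x 0 * y 0 - ∑ i : Fin d, x i.succ * y i.succ

/-- A real ambient vector regarded as a complex one. -/
def toC {d : ℕ} (x : Fin (d + 1) → ℝ) : Fin (d + 1) → ℂ := fun i => (x i : ℂ)

/-- The open future cone `V₊`. -/
def openCone (d : ℕ) : Set (Fin (d + 1) → ℝ) := {y | 0 < mdot y y ∧ 0 < y 0}

/-- The future light cone `C⁺` (without its tip). -/
def lightCone (d : ℕ) : Set (Fin (d + 1) → ℝ) := {ξ | mdot ξ ξ = 0 ∧ 0 < ξ 0}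

/-- The complex de Sitter manifold `z · z = -1`. -/
def complexDS (d : ℕ) : Set (Fin (d + 1) → ℂ) := {z | mdot z z = -1}

/-- The future tube: `z = x + iy` on the complex de Sitter manifold with `y ∈ V₊`. -/
def futureTube (d : ℕ) : Set (Fin (d + 1) → ℂ) :=
  {z | z ∈ complexDS d ∧ (fun i => (z i).im) ∈ openCone d}

/-- The past tube: `z = x + iy` on the complex de Sitter manifold with `-y ∈ V₊`. -/
def pastTube (d : ℕ) : Set (Fin (d + 1) → ℂ) :=
  {z | z ∈ complexDS d ∧ (fun i => -(z i).im) ∈ openCone d}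

/-- The de Sitter group `SO₀(1,d)`: real matrices preserving the Minkowski product, of
determinant one and preserving the direction of time. -/
def deSitterGroup (d : ℕ) : Set (Matrix (Fin (d + 1)) (Fin (d + 1)) ℝ) :=
  {L | (∀ x y, mdot (L.mulVec x) (L.mulVec y) = mdot x y) ∧ L.det = 1 ∧ 0 < L 0 0}

/-- The cut plane `ℂ \ (-∞, -1]` for the invariant `ζ = z₁ · z₂`. -/
def cutPlane : Set ℂ := {ζ | ¬ ∃ r : ℝ, r ≤ -1 ∧ ζ = (r : ℂ)}

/-- The cut domain `Δ` of pairs of points of the complex de Sitter manifold. -/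
def cutDomain (d : ℕ) : Set ((Fin (d + 1) → ℂ) × (Fin (d + 1) → ℂ)) :=
  {p | p.1 ∈ complexDS d ∧ p.2 ∈ complexDS d ∧ mdot p.1 p.2 ∈ cutPlane}

/-- Holomorphy on a (relatively open subset `S` of a) complex submanifold of a complex vector
space: locally, `f` is the restriction to `S` of a holomorphic function of the ambient variables. -/
def HolomorphicOn {V : Type*} [NormedAddCommGroup V] [NormedSpace ℂ V] (S : Set V) (f : V → ℂ) :
    Prop :=
  ∀ p ∈ S, ∃ U : Set V, IsOpen U ∧ p ∈ U ∧
    ∃ F : V → ℂ, DifferentiableOn ℂ F U ∧ ∀ q ∈ U ∩ S, F q = f q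

/-- The extension of a function on the complex de Sitter manifold that is constant along rays:
`F(z) = f(z / √(-z·z))`, near the manifold. -/
def radialExt {d : ℕ} (f : (Fin (d + 1) → ℂ) → ℂ) (z : Fin (d + 1) → ℂ) : ℂ :=
  f (((-mdot z z) ^ (-(1 / 2) : ℂ)) • z)

/-- The de Sitter d'Alembertian (signature `(+,-,...,-)`). In coordinates `Z = r z`, `z·z = -1`,
the ambient operator `∂₀² - ∂₁² - ... - ∂_d²` is `-∂_r² - (d/r) ∂_r + r⁻² □`, so `□` is the ambient
operator applied to the extension which does not depend on `r`. Derivatives are complex. -/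
def box {d : ℕ} (f : (Fin (d + 1) → ℂ) → ℂ) (z : Fin (d + 1) → ℂ) : ℂ :=
  iteratedDeriv 2 (fun s : ℂ => radialExt f (z + s • Pi.single 0 1)) 0 -
    ∑ i : Fin d, iteratedDeriv 2 (fun s : ℂ => radialExt f (z + s • Pi.single i.succ 1)) 0

/-- The squared mass `m² = (d-1)²/4 + ν²`. -/
def massSq (d : ℕ) (ν : ℂ) : ℂ := ((d : ℂ) - 1) ^ 2 / 4 + ν ^ 2

/-! ### Smooth singular cycles in the light cone -/

/-- A smooth singular `m`-cube `[0,1]^m → C⁺`. -/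
@[ext] structure SmoothCube (d m : ℕ) where
  toFun : (Fin m → unitInterval) → (Fin (d + 1) → ℝ)
  smooth' : ∃ g : (Fin m → ℝ) → (Fin (d + 1) → ℝ), ContDiff ℝ ∞ g ∧
    ∀ t, g (fun i => (t i : ℝ)) = toFun t
  mem_cone' : ∀ t, toFun t ∈ lightCone d

/-- Integral cubical chains. -/
abbrev Chain (d m : ℕ) := SmoothCube d m →₀ ℤ

/-- The face `t_i = c` of a cube. -/
def SmoothCube.face {d m : ℕ} (i : Fin (m + 1)) (c : unitInterval) (σ : SmoothCube d (m + 1)) :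
    SmoothCube d m where
  toFun t := σ.toFun (i.insertNth (α := fun _ => unitInterval) c t)
  smooth' := by
    obtain ⟨g, hg, h⟩ := σ.smooth'
    refine ⟨fun x => g (i.insertNth (α := fun _ => ℝ) (c : ℝ) x), hg.comp ?_, ?_⟩
    · rw [contDiff_pi]
      intro k
      refine Fin.succAboveCases i ?_ (fun j => ?_) k
      · simpa using contDiff_const
      · simpa using contDiff_apply ℝ ℝ j
    · intro t
      rw [← h]
      refine congrArg g (funext fun k => ?_)
      refine Fin.succAboveCases i ?_ (fun j => ?_) k <;> simp
  mem_cone' t := σ.mem_cone' _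

/-- The boundary `∂σ = Σ_i (-1)^i (σ|_{t_i = 1} - σ|_{t_i = 0})`, `i = 0, ..., m`. -/
def boundary {d m : ℕ} (γ : Chain d (m + 1)) : Chain d m :=
  γ.sum fun σ k => k • ∑ i : Fin (m + 1), (-1 : ℤ) ^ (i : ℕ) •
    (Finsupp.single (σ.face i 1) (1 : ℤ) - Finsupp.single (σ.face i 0) (1 : ℤ))

/-- A cube is degenerate if it does not depend on one of its variables. -/
def SmoothCube.IsDegenerate {d m : ℕ} (σ : SmoothCube d m) : Prop :=
  ∃ i : Fin m, ∀ t u : Fin m → unitInterval, (∀ j, j ≠ i → t j = u j) → σ.toFun t = σ.toFun u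

/-- The group spanned by the degenerate cubes; cubical homology is taken modulo this group. -/
def degenerateChains (d m : ℕ) : AddSubgroup (Chain d m) :=
  AddSubgroup.closure {γ | ∃ σ : SmoothCube d m, σ.IsDegenerate ∧ γ = Finsupp.single σ 1}

/-- A smooth singular `m`-cycle in the light cone. -/
def IsCycle {d : ℕ} : {m : ℕ} → Chain d m → Prop
  | 0, _ => True
  | m + 1, γ => boundary γ ∈ degenerateChains d m

/-- Two `m`-chains are homologous in the light cone if they differ by a boundary (modulo degenerate
cubes). -/
def Homologous {d m : ℕ} (γ γ' : Chain d m) : Prop :=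
  ∃ c : Chain d (m + 1), γ - γ' - boundary c ∈ degenerateChains d m

/-- The hyperspherical angles: `θ_i = π t_i` for `i < n - 1` and `θ_(n-1) = 2π t_(n-1)`. -/
def sphereAngle (n : ℕ) (t : Fin n → ℝ) (i : ℕ) : ℝ :=
  if h : i < n then (if i + 1 = n then 2 * Real.pi else Real.pi) * t ⟨i, h⟩ else 0

/-- Hyperspherical coordinates on the unit sphere of `ℝ^(n+1)`:
`(cos θ₀, sin θ₀ cos θ₁, ..., sin θ₀ ⋯ sin θ_(n-2) cos θ_(n-1), sin θ₀ ⋯ sin θ_(n-1))`. -/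
def sphereParam (n : ℕ) (t : Fin n → ℝ) (j : Fin (n + 1)) : ℝ :=
  (∏ i ∈ Finset.range (j : ℕ), Real.sin (sphereAngle n t i)) *
    (if (j : ℕ) < n then Real.cos (sphereAngle n t j) else 1)

lemma sum_sphereParam_sq (n : ℕ) (t : Fin n → ℝ) :
    ∑ j : Fin (n + 1), sphereParam n t j * sphereParam n t j = 1 := by
  have key : ∀ θ : ℕ → ℝ, ∀ m : ℕ,
      ∑ j ∈ Finset.range m, ((∏ i ∈ Finset.range j, Real.sin (θ i)) * Real.cos (θ j)) ^ 2
        + (∏ i ∈ Finset.range m, Real.sin (θ i)) ^ 2 = 1 := by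
    intro θ m
    induction m with
    | zero => simp
    | succ k ih =>
      rw [Finset.sum_range_succ, Finset.prod_range_succ, mul_pow _ (Real.cos _),
        mul_pow _ (Real.sin _), Real.cos_sq']
      linear_combination ih
  rw [Fin.sum_univ_castSucc, ← key (sphereAngle n t) n, Finset.sum_range]
  congr 1
  · refine Finset.sum_congr rfl fun j _ => ?_
    simp [sphereParam, sq]
  · simp [sphereParam, sq]

lemma contDiff_sphereParam (n : ℕ) (j : Fin (n + 1)) :
    ContDiff ℝ ∞ (fun t : Fin n → ℝ => sphereParam n t j) := by
  have hθ : ∀ i : ℕ, ContDiff ℝ ∞ (fun t : Fin n → ℝ => sphereAngle n t i) := by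
    intro i
    unfold sphereAngle
    by_cases h : i < n
    · simp only [h, dif_pos]
      exact contDiff_const.mul (contDiff_apply ℝ ℝ _)
    · simp only [h, dif_neg, not_false_eq_true]
      exact contDiff_const
  unfold sphereParam
  refine ContDiff.mul (contDiff_prod fun i _ => Real.contDiff_sin.comp (hθ i)) ?_
  by_cases h : (j : ℕ) < n
  · simp only [h, if_true]
    exact Real.contDiff_cos.comp (hθ _)
  · simp only [h, if_false]
    exact contDiff_const

/-- The spherical basis `γ₀ = C⁺ ∩ {ξ⁰ = 1}` (an `n`-sphere, `d = n + 1`) with its canonical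
orientation, as the singular cube given by hyperspherical coordinates. -/
def sphereCube (n : ℕ) : SmoothCube (n + 1) n where
  toFun t := Fin.cons 1 (sphereParam n fun i => (t i : ℝ))
  smooth' := by
    refine ⟨fun x => Fin.cons 1 (sphereParam n x), ?_, fun t => rfl⟩
    rw [contDiff_pi]
    intro k
    refine Fin.cases ?_ (fun j => ?_) k
    · simpa using contDiff_const
    · simpa using contDiff_sphereParam n j
  mem_cone' t := by
    refine ⟨?_, by simp⟩
    simp [mdot, sum_sphereParam_sq]

/-- The cycle `γ₀`. -/
def sphereCycle (n : ℕ) : Chain (n + 1) n := Finsupp.single (sphereCube n) 1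

/-! ### The plane wave integral -/

/-- The `(d-1)`-form (`d = n + 1`)
`α(ξ) = (ξ⁰)⁻¹ Σ_{j=1}^d (-1)^(j+1) ξ^j dξ¹ ⋯ (omit dξ^j) ⋯ dξ^d`
evaluated on the tangent vectors `v 0, ..., v (n-1)`. -/
def alphaForm {n : ℕ} (ξ : Fin (n + 1 + 1) → ℝ) (v : Fin n → (Fin (n + 1 + 1) → ℝ)) : ℝ :=
  (ξ 0)⁻¹ * ∑ j : Fin (n + 1), (-1) ^ (j : ℕ) * ξ j.succ *
    (Matrix.of fun a b : Fin n => v b (j.succAbove a).succ).det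

/-- A cube as a function on `ℝ^m` (only its values on `[0,1]^m` matter). -/
def SmoothCube.ext' {d m : ℕ} (σ : SmoothCube d m) (x : Fin m → ℝ) : Fin (d + 1) → ℝ :=
  σ.toFun fun i => Set.projIcc 0 1 zero_le_one (x i)

/-- The integral of the form `F α` over a smooth cube. -/
def cubeIntegral {n : ℕ} (F : (Fin (n + 1 + 1) → ℝ) → ℂ) (σ : SmoothCube (n + 1) n) : ℂ :=
  ∫ x in Set.Icc (0 : Fin n → ℝ) 1, F (σ.ext' x) *
    ((alphaForm (σ.ext' x) fun b =>
      fderivWithin ℝ σ.ext' (Set.Icc 0 1) x (Pi.single b 1) : ℝ) : ℂ)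

/-- The integral of the form `F α` over a chain. -/
def chainIntegral {n : ℕ} (F : (Fin (n + 1 + 1) → ℝ) → ℂ) (γ : Chain (n + 1) n) : ℂ :=
  γ.sum fun σ k => (k : ℂ) * cubeIntegral F σ

/-- The plane wave `(ξ · z)^lam = exp(lam log(ξ · z))`, principal branch. -/
def planeWave {d : ℕ} (lam : ℂ) (ξ : Fin (d + 1) → ℝ) (z : Fin (d + 1) → ℂ) : ℂ :=
  (mdot (toC ξ) z) ^ lam

/-- `∫_γ (ξ·z₁)^(-(d-1)/2 - iν) (ξ·z₂)^(-(d-1)/2 + iν) α(ξ)`, with `d = n + 1`. -/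
def waveIntegral {n : ℕ} (ν : ℂ) (γ : Chain (n + 1) n) (z₁ z₂ : Fin (n + 1 + 1) → ℂ) : ℂ :=
  chainIntegral (fun ξ =>
    planeWave (-(((n + 1 : ℕ) : ℂ) - 1) / 2 - Complex.I * ν) ξ z₁ *
      planeWave (-(((n + 1 : ℕ) : ℂ) - 1) / 2 + Complex.I * ν) ξ z₂) γ

/-- `Γ((d-1)/2 + iν) Γ((d-1)/2 - iν)`. -/
def gammaFactor (d : ℕ) (ν : ℂ) : ℂ :=
  Complex.Gamma (((d : ℂ) - 1) / 2 + Complex.I * ν) *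
    Complex.Gamma (((d : ℂ) - 1) / 2 - Complex.I * ν)

/-- `ν` is not a pole of `Γ((d-1)/2 + iν) Γ((d-1)/2 - iν)`. -/
def Regular (d : ℕ) (ν : ℂ) : Prop :=
  ∀ k : ℕ, ((d : ℂ) - 1) / 2 + Complex.I * ν ≠ -(k : ℂ) ∧
    ((d : ℂ) - 1) / 2 - Complex.I * ν ≠ -(k : ℂ)

/-- The normalized two-point function
`Γ((d-1)/2 + iν) Γ((d-1)/2 - iν) e^(πν) / (2^(d+1) π^d) ∫_γ ⋯`, with `d = n + 1`. -/
def twoPoint {n : ℕ} (ν : ℂ) (γ : Chain (n + 1) n) (z₁ z₂ : Fin (n + 1 + 1) → ℂ) : ℂ :=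
  gammaFactor (n + 1) ν * Complex.exp (Real.pi * ν) /
    (2 ^ (n + 1 + 1) * (Real.pi : ℂ) ^ (n + 1)) * waveIntegral ν γ z₁ z₂

/-! ### Legendre functions -/

open Classical in
/-- The Gauss hypergeometric function on `ℂ \ [1, ∞)`: the analytic continuation of the
hypergeometric series. -/
def hypergeometricF (a b c : ℂ) : ℂ → ℂ :=
  if h : ∃ F : ℂ → ℂ, DifferentiableOn ℂ F {x | ¬ ∃ r : ℝ, 1 ≤ r ∧ x = (r : ℂ)} ∧
      ∀ x ∈ Metric.ball (0 : ℂ) 1, F x = ordinaryHypergeometric a b c x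
  then Classical.choose h else 0

/-- The Legendre function of the first kind `P^μ_σ` on `ℂ \ (-∞, 1]` (`μ` not a positive integer):
`Γ(1-μ)⁻¹ ((ζ+1)/(ζ-1))^(μ/2) F(-σ, σ+1; 1-μ; (1-ζ)/2)`. -/
def legendreP (μ σ ζ : ℂ) : ℂ :=
  (Complex.Gamma (1 - μ))⁻¹ * ((ζ + 1) / (ζ - 1)) ^ (μ / 2) *
    hypergeometricF (-σ) (σ + 1) (1 - μ) ((1 - ζ) / 2)

/-- The Bunch-Davies function
`Γ((d-1)/2+iν) Γ((d-1)/2-iν) / (2 (2π)^(d/2)) (ζ²-1)^(-(d-2)/4) P^{-(d-2)/2}_{-1/2+iν}(ζ)`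
for `ζ ∉ (-∞, 1]`. As usual for Legendre functions, `(ζ²-1)^p` is the branch
`(ζ-1)^p (ζ+1)^p` that is positive for `ζ > 1`. -/
def bunchDavies (d : ℕ) (ν ζ : ℂ) : ℂ :=
  gammaFactor d ν / (2 * (2 * Real.pi : ℂ) ^ ((d : ℂ) / 2)) *
    ((ζ - 1) ^ (-((d : ℂ) - 2) / 4) * (ζ + 1) ^ (-((d : ℂ) - 2) / 4)) *
    legendreP (-((d : ℂ) - 2) / 2) (-(1 / 2) + Complex.I * ν) ζ

/-! ### Canonical normalization -/

/-- The point `(sinh t, cosh t u)` of (complex) de Sitter space, `u` on the unit sphere. For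
`0 < ε < π` and real `t`, the point at time `t + iε` is in the future tube and the point at time
`t - iε` is in the past tube. -/
def globalPoint {d : ℕ} (t : ℂ) (u : Metric.sphere (0 : EuclideanSpace ℝ (Fin d)) 1) :
    Fin (d + 1) → ℂ :=
  Fin.cons (Complex.sinh t) fun i => Complex.cosh t * ((u : EuclideanSpace ℝ (Fin d)) i : ℂ)

/-- The regularized commutator `W(x₁,x₂) - W(x₂,x₁)` for `x₁` at time `t` over `u` and `x₂` at time
`s` over `u'`: the first argument of `W` is moved into the past tube, the second one into the future
tube. -/
def commutator {d : ℕ} (W : (Fin (d + 1) → ℂ) → (Fin (d + 1) → ℂ) → ℂ) (ε t s : ℝ)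
    (u u' : Metric.sphere (0 : EuclideanSpace ℝ (Fin d)) 1) : ℂ :=
  W (globalPoint (t - ε * Complex.I) u) (globalPoint (s + ε * Complex.I) u') -
    W (globalPoint (s - ε * Complex.I) u') (globalPoint (t + ε * Complex.I) u)

/-- The equal time canonical commutation relations
`[φ(u), φ(u')] = 0`, `[φ(u), ∂ₜφ(u')] = i δ(u,u')`, `[∂ₜφ(u), ∂ₜφ(u')] = 0`
on the Cauchy surface `x⁰ = 0` (a unit sphere with its surface measure), for the boundary values of
`W`, smeared in `u'`. -/
def CanonicalCommutation {d : ℕ} (W : (Fin (d + 1) → ℂ) → (Fin (d + 1) → ℂ) → ℂ) : Prop :=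
  ∀ (f : C(Metric.sphere (0 : EuclideanSpace ℝ (Fin d)) 1, ℂ))
    (u : Metric.sphere (0 : EuclideanSpace ℝ (Fin d)) 1),
    Filter.Tendsto (fun ε : ℝ => ∫ u', f u' * commutator W ε 0 0 u u'
        ∂(MeasureTheory.volume : MeasureTheory.Measure (EuclideanSpace ℝ (Fin d))).toSphere)
      (nhdsWithin 0 (Set.Ioi 0)) (nhds 0) ∧
    Filter.Tendsto (fun ε : ℝ => ∫ u', f u' * deriv (fun s : ℝ => commutator W ε 0 s u u') 0
        ∂(MeasureTheory.volume : MeasureTheory.Measure (EuclideanSpace ℝ (Fin d))).toSphere)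
      (nhdsWithin 0 (Set.Ioi 0)) (nhds (Complex.I * f u)) ∧
    Filter.Tendsto (fun ε : ℝ => ∫ u', f u' *
          deriv (fun t : ℝ => deriv (fun s : ℝ => commutator W ε t s u u') 0) 0
        ∂(MeasureTheory.volume : MeasureTheory.Measure (EuclideanSpace ℝ (Fin d))).toSphere)
      (nhdsWithin 0 (Set.Ioi 0)) (nhds 0)

end DeSitter

end

open DeSitter

open scoped ContDiff

noncomputable section

namespace DeSitter

/-! Written in the spatial coordinates `x` of the cone, a density `F` homogeneous of degree `-n =
-(d-1)` turns `F α` into `G ι_x(vol)` with `G = F/|x|` of degree `-(n+1)`, so `d(F α) = div(G x) vol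
= 0`. Stokes' theorem on cubes (`IsConeDensity.stokes_cube`) then gives independence of the homology
class. Applied to the prism swept out by boosts, it also shows that integrals over cycles do not
change when `ξ` is boosted (`IsConeDensity.chainIntegral_boost`).

The two plane waves are merged by Feynman's parametrization (`feynman`): with `a, b = n/2 ± iν` of
positive real part, the product `(ξ·z₁)^(-a) (ξ·(-z₂))^(-b)` is a beta average of `(ξ·Z)^(-n)`,
where `Z = x z₁ - (1-x) z₂` lies in the convex ambient past tube. The integral of `(ξ·Z)^(-n) α`
over a cycle is boost invariant and homogeneous of degree `-n` in `Z`, hence a constant multiple of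
`(-Z·Z)^(-n/2)` (`poissonIntegral_eq`). Since `-Z·Z = 1 - 2x(1-x)(1-ζ)`, in the strip `|Im ν| < n/2`
the wave integral is a function of `ζ` alone: an Euler integral for `F(a, b; (n+1)/2; (1-ζ)/2)`.

The wave integral is entire in `ν`, so it depends only on `ζ` for every `ν`. Continuation in `ν` for
`ζ` near `1`, followed by continuation in `ζ`, extends the hypergeometric formula
(`waveIntegral_eq_waveF`). Euler's transformation identifies it with the Legendre expression, and
the constant comes from `γ₀`, on which the integrand is constant at `Z = -i e₀`. The Klein-Gordon
equation holds already for each plane wave, under the integral sign.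

For the commutation relations, `w'` is again a hypergeometric function, with `n` replaced by `n +
2`, and behaves like a constant times `(1+ζ)^(-d/2)` at `ζ = -1`; the gamma factor makes this
constant independent of `ν` (`tendsto_deriv_waveF`). At equal times `∂_s C` equals `i cos ε ·
2τ(1+c) · (-w'(ζ))` with `τ = sin ε` and `c = u·u'`. Comparison with a Poisson kernel of constant
mass, obtained from the volume of an ellipsoid, makes it an approximate delta at `u`
(`tendsto_integral_singular`). The other two brackets vanish identically for small `ε > 0` by
symmetry. -/

/-! ### Closed forms on the light cone and Stokes' theorem for cubes -/

/-- The determinant as a continuous complex-valued alternating form. -/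
def detForm (m : ℕ) : (Fin m → ℝ) [⋀^Fin m]→L[ℝ] ℂ :=
  Complex.ofRealCLM.compContinuousAlternatingMap
    { (Matrix.detRowAlternating : (Fin m → ℝ) [⋀^Fin m]→ₗ[ℝ] ℝ) with
      cont := Continuous.matrix_det (A := fun v : Fin m → Fin m → ℝ => Matrix.of v) continuous_id }

/-- The form `G(x) ι_x (dx¹ ∧ ⋯ ∧ dx^(n+1))`. -/
def radialForm {n : ℕ} (G : (Fin (n + 1) → ℝ) → ℂ) (x : Fin (n + 1) → ℝ) :
    (Fin (n + 1) → ℝ) [⋀^Fin n]→L[ℝ] ℂ :=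
  G x • (detForm (n + 1)).curryLeft x

lemma radialForm_apply {n : ℕ} (G : (Fin (n + 1) → ℝ) → ℂ) (x : Fin (n + 1) → ℝ)
    (v : Fin n → Fin (n + 1) → ℝ) :
    radialForm G x v = G x * ((Matrix.of (Fin.cons x v : Fin (n + 1) → Fin (n + 1) → ℝ)).det : ℂ) := by
  rw [radialForm, ContinuousAlternatingMap.smul_apply, smul_eq_mul]
  rfl

lemma differentiableAt_radialForm {n : ℕ} {G : (Fin (n + 1) → ℝ) → ℂ} {x : Fin (n + 1) → ℝ}
    (h : DifferentiableAt ℝ G x) : DifferentiableAt ℝ (radialForm G) x :=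
  h.smul (detForm (n + 1)).curryLeft.differentiableAt

/-- Expanding along the first row, the minor of any column other than `i` contains a zero row, and
the minor of column `i` is the identity. -/
lemma det_cons_single_succAbove {n : ℕ} (x : Fin (n + 1) → ℝ) (i : Fin (n + 1)) :
    (Matrix.of (Fin.cons x (fun a => Pi.single (i.succAbove a) 1) :
      Fin (n + 1) → Fin (n + 1) → ℝ)).det = (-1) ^ (i : ℕ) * x i := by
  rw [Matrix.det_succ_row_zero, Finset.sum_eq_single i]
  · have : ((Matrix.of (Fin.cons x (fun a => Pi.single (i.succAbove a) 1) :
      Fin (n + 1) → Fin (n + 1) → ℝ)).submatrix Fin.succ i.succAbove) = 1 := by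
      ext a b
      simp [Matrix.one_apply, Pi.single_apply, eq_comm]
    simp [this]
  · intro j _ hj
    obtain ⟨a, ha⟩ := Fin.exists_succAbove_eq hj
    refine mul_eq_zero_of_right _ (Matrix.det_eq_zero_of_row_eq_zero a fun b => ?_)
    simp [ha, Fin.succAbove_ne]
  · simp

/-- `d(G ι_x vol) = div(G x) vol`, which vanishes if `G` is homogeneous of degree `-(n+1)`. -/
lemma extDeriv_radialForm {n : ℕ} {G : (Fin (n + 1) → ℝ) → ℂ} {x : Fin (n + 1) → ℝ}
    (h : DifferentiableAt ℝ G x) (hG : fderiv ℝ G x x = -((n : ℂ) + 1) * G x) :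
    extDeriv (radialForm G) x = 0 := by
  -- A form of top degree is determined by its value on the standard basis, where the exterior
  -- derivative becomes the divergence of `G x`.
  have key : extDeriv (radialForm G) x (Pi.basisFun ℝ (Fin (n + 1))) = 0 := by
    rw [extDeriv_apply (differentiableAt_radialForm h)]
    have h1 : ∀ i : Fin (n + 1), (-1 : ℤ) ^ (i : ℕ) • fderiv ℝ (fun y => radialForm G y
        (i.removeNth (Pi.basisFun ℝ (Fin (n + 1))))) x (Pi.basisFun ℝ (Fin (n + 1)) i)
        = fderiv ℝ G x (Pi.single i 1) * (x i : ℂ) + G x := by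
      intro i
      have h2 : (fun y => radialForm G y (i.removeNth (Pi.basisFun ℝ (Fin (n + 1))))) =
          fun y => G y * (((-1) ^ (i : ℕ) * y i : ℝ) : ℂ) := by
        funext y
        rw [radialForm_apply, ← det_cons_single_succAbove]
        congr!
        simp [Fin.removeNth]
      have h3 : HasFDerivAt (fun y : Fin (n + 1) → ℝ => (((-1) ^ (i : ℕ) * y i : ℝ) : ℂ))
          (Complex.ofRealCLM.comp (((-1 : ℝ) ^ (i : ℕ)) •
            (ContinuousLinearMap.proj i : (Fin (n + 1) → ℝ) →L[ℝ] ℝ))) x :=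
        Complex.ofRealCLM.hasFDerivAt.comp x ((hasFDerivAt_apply i x).const_mul _)
      have h5 : HasFDerivAt (fun y => G y * (((-1) ^ (i : ℕ) * y i : ℝ) : ℂ)) _ x :=
        h.hasFDerivAt.mul h3
      rw [h2, h5.fderiv]
      have h4 : ((-1 : ℂ) ^ (i : ℕ)) * (-1) ^ (i : ℕ) = 1 := by
        rw [← mul_pow]; simp
      simp
      linear_combination (fderiv ℝ G x (Pi.single i 1) * (x i : ℂ) + G x) * h4
    rw [Finset.sum_congr rfl fun i _ => h1 i, Finset.sum_add_distrib]
    have h5 : fderiv ℝ G x x = ∑ i, fderiv ℝ G x (Pi.single i 1) * (x i : ℂ) := by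
      have h6 : x = ∑ i, x i • (Pi.single i 1 : Fin (n + 1) → ℝ) := by
        simpa [Pi.basisFun_apply] using ((Pi.basisFun ℝ (Fin (n + 1))).sum_repr x).symm
      conv_lhs => rw [h6]
      rw [map_sum, ← h6]
      refine Finset.sum_congr rfl fun i _ => ?_
      rw [map_smul, Complex.real_smul, mul_comm]
    rw [← h5, hG]
    simp
    ring
  apply ContinuousAlternatingMap.toAlternatingMap_injective
  refine Module.Basis.ext_alternating (Pi.basisFun ℝ (Fin (n + 1))) fun v hv => ?_
  let σ : Equiv.Perm (Fin (n + 1)) := Equiv.ofBijective v (Finite.injective_iff_bijective.1 hv)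
  have : (fun i => (Pi.basisFun ℝ (Fin (n + 1))) (v i)) = (Pi.basisFun ℝ (Fin (n + 1))) ∘ σ := rfl
  rw [this, AlternatingMap.map_perm]
  have key' : (extDeriv (radialForm G) x).toAlternatingMap (Pi.basisFun ℝ (Fin (n + 1))) = 0 := key
  rw [key']
  simp

lemma uniqueDiffOn_Icc_pi (m : ℕ) : UniqueDiffOn ℝ (Set.Icc (0 : Fin m → ℝ) 1) := by
  rw [← Set.pi_univ_Icc]
  exact UniqueDiffOn.univ_pi fun i => uniqueDiffOn_Icc zero_lt_one

namespace SmoothCube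

variable {d m : ℕ}

/-- The clamped map `ext'` is generally not smooth across the boundary of the cube; every
computation trades it for a globally smooth map that agrees with it on the cube. -/
lemma exists_extension (σ : SmoothCube d m) : ∃ g : (Fin m → ℝ) → (Fin (d + 1) → ℝ),
    ContDiff ℝ ∞ g ∧ Set.EqOn σ.ext' g (Set.Icc 0 1) := by
  obtain ⟨g, hg, h⟩ := σ.smooth'
  refine ⟨g, hg, fun x hx => ?_⟩
  rw [ext', ← h]
  congr
  funext i
  exact congrArg Subtype.val (Set.projIcc_of_mem zero_le_one ⟨hx.1 i, hx.2 i⟩)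

lemma ext'_mem (σ : SmoothCube d m) (x : Fin m → ℝ) : σ.ext' x ∈ lightCone d :=
  σ.mem_cone' _

/-- Unique differentiability of the closed cube makes the choice of extension irrelevant, also at
boundary points. -/
lemma fderivWithin_ext' {σ : SmoothCube d m} {g : (Fin m → ℝ) → (Fin (d + 1) → ℝ)}
    (hg : ContDiff ℝ ∞ g) (h : Set.EqOn σ.ext' g (Set.Icc 0 1)) {x : Fin m → ℝ}
    (hx : x ∈ Set.Icc (0 : Fin m → ℝ) 1) :
    fderivWithin ℝ σ.ext' (Set.Icc 0 1) x = fderiv ℝ g x := by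
  rw [fderivWithin_congr h (h hx), DifferentiableAt.fderivWithin
    (hg.differentiable (by simp) x) (uniqueDiffOn_Icc_pi m x hx)]

lemma face_ext' (σ : SmoothCube d (m + 1)) (i : Fin (m + 1)) (c : unitInterval) (x : Fin m → ℝ) :
    (σ.face i c).ext' x = σ.ext' (i.insertNth (c : ℝ) x) := by
  refine congrArg σ.toFun (funext fun k => ?_)
  refine Fin.succAboveCases i ?_ (fun j => ?_) k
  · simp
  · simp

end SmoothCube

/-! ### Spatial coordinates on the light cone -/

lemma mem_lightCone_tail {n : ℕ} {ξ : Fin (n + 1) → ℝ} (h : ξ ∈ lightCone n) :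
    ξ 0 = √(∑ i, Fin.tail ξ i * Fin.tail ξ i) := by
  have h1 : ∑ i, Fin.tail ξ i * Fin.tail ξ i = ξ 0 * ξ 0 := (sub_eq_zero.1 h.1).symm
  rw [h1, Real.sqrt_mul_self h.2.le]

/-- The point of the light cone over a given spatial vector. -/
def coneLift {n : ℕ} (x : Fin n → ℝ) : Fin (n + 1) → ℝ := Fin.cons (√(∑ i, x i * x i)) x

lemma coneLift_tail {n : ℕ} {ξ : Fin (n + 1) → ℝ} (h : ξ ∈ lightCone n) :
    coneLift (Fin.tail ξ) = ξ := by
  rw [coneLift, ← mem_lightCone_tail h, Fin.cons_self_tail]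

lemma sum_mul_self_pos {n : ℕ} {x : Fin n → ℝ} (hx : x ≠ 0) : 0 < ∑ i, x i * x i := by
  obtain ⟨i, hi⟩ := Function.ne_iff.1 hx
  exact Finset.sum_pos' (fun i _ => mul_self_nonneg _) ⟨i, Finset.mem_univ _,
    mul_self_pos.2 hi⟩

lemma coneLift_mem {n : ℕ} {x : Fin n → ℝ} (hx : x ≠ 0) : coneLift x ∈ lightCone n := by
  have h := sum_mul_self_pos hx
  refine ⟨?_, by simpa [coneLift] using h⟩
  simp [mdot, coneLift, Real.mul_self_sqrt h.le]

lemma tail_ne_zero {n : ℕ} {ξ : Fin (n + 1) → ℝ} (h : ξ ∈ lightCone n) : Fin.tail ξ ≠ 0 := by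
  intro h0
  have h1 := mem_lightCone_tail h
  have h2 := h.2
  simp [h0] at h1
  exact h2.ne' h1

lemma coneLift_smul {n : ℕ} {r : ℝ} (hr : 0 ≤ r) (x : Fin n → ℝ) :
    coneLift (r • x) = r • coneLift x := by
  have h : ∑ i, (r • x) i * (r • x) i = r ^ 2 * ∑ i, x i * x i := by
    rw [Finset.mul_sum]
    exact Finset.sum_congr rfl fun i _ => by simp only [Pi.smul_apply, smul_eq_mul]; ring
  simp only [Pi.smul_apply, smul_eq_mul] at h
  funext k
  refine Fin.cases ?_ (fun j => ?_) k
  · simp only [coneLift, Fin.cons_zero, Pi.smul_apply, smul_eq_mul]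
    rw [h, Real.sqrt_mul (sq_nonneg r), Real.sqrt_sq hr]
  · simp [coneLift]

lemma differentiableAt_coneLift {n : ℕ} {x : Fin n → ℝ} (hx : x ≠ 0) :
    DifferentiableAt ℝ (coneLift : (Fin n → ℝ) → _) x := by
  rw [differentiableAt_pi]
  intro k
  refine Fin.cases ?_ (fun j => ?_) k
  · simp only [coneLift, Fin.cons_zero]
    exact DifferentiableAt.sqrt (by fun_prop) (sum_mul_self_pos hx).ne'
  · simp only [coneLift, Fin.cons_succ]
    fun_prop

/-- A function on the light cone such that `F α` is a closed form: differentiable and homogeneous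
of degree `-n`. -/
def IsConeDensity {n : ℕ} (F : (Fin (n + 1 + 1) → ℝ) → ℂ) : Prop :=
  ∀ ξ ∈ lightCone (n + 1), DifferentiableAt ℝ F ξ ∧
    ∀ r : ℝ, 0 < r → F (r • ξ) = ((r : ℂ) ^ n)⁻¹ * F ξ

/-- A density on the light cone in spatial coordinates. -/
def coneDensity {n : ℕ} (F : (Fin (n + 1 + 1) → ℝ) → ℂ) (x : Fin (n + 1) → ℝ) : ℂ :=
  (((√(∑ i, x i * x i))⁻¹ : ℝ) : ℂ) * F (coneLift x)

lemma IsConeDensity.differentiableAt {n : ℕ} {F : (Fin (n + 1 + 1) → ℝ) → ℂ}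
    (hF : IsConeDensity F) {x : Fin (n + 1) → ℝ} (hx : x ≠ 0) :
    DifferentiableAt ℝ (coneDensity F) x := by
  have h := sum_mul_self_pos hx
  refine DifferentiableAt.mul ?_ ?_
  · refine Complex.ofRealCLM.differentiableAt.comp x ?_
    have h1 : DifferentiableAt ℝ (fun y : Fin (n + 1) → ℝ => √(∑ i, y i * y i)) x :=
      DifferentiableAt.sqrt (by fun_prop) h.ne'
    exact h1.fun_inv (Real.sqrt_ne_zero'.2 h)
  · exact DifferentiableAt.comp x ((hF _ (coneLift_mem hx)).1) (differentiableAt_coneLift hx)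

/-- Euler's identity. The factor `1/|x|` lowers the degree from `-n` to `-(n+1)`, exactly the degree
at which `G x` is divergence free in dimension `n + 1`. -/
lemma IsConeDensity.fderiv_coneDensity {n : ℕ} {F : (Fin (n + 1 + 1) → ℝ) → ℂ}
    (hF : IsConeDensity F) {x : Fin (n + 1) → ℝ} (hx : x ≠ 0) :
    fderiv ℝ (coneDensity F) x x = -((n : ℂ) + 1) * coneDensity F x := by
  have h1 : HasDerivAt (fun r : ℝ => coneDensity F (r • x)) (fderiv ℝ (coneDensity F) x x) 1 := by
    have h2 : HasDerivAt (fun r : ℝ => r • x) x 1 := by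
      simpa using (hasDerivAt_id (1 : ℝ)).smul_const x
    have h3 : HasFDerivAt (coneDensity F) (fderiv ℝ (coneDensity F) x) ((1 : ℝ) • x) := by
      rw [one_smul]; exact (hF.differentiableAt hx).hasFDerivAt
    exact h3.comp_hasDerivAt 1 h2
  have h4 : (fun r : ℝ => coneDensity F (r • x)) =ᶠ[nhds 1]
      fun r : ℝ => (((r ^ (n + 1))⁻¹ : ℝ) : ℂ) * coneDensity F x := by
    filter_upwards [lt_mem_nhds (zero_lt_one : (0 : ℝ) < 1)] with r hr
    have h5 : √(∑ i, (r • x) i * (r • x) i) = r * √(∑ i, x i * x i) := by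
      simpa [coneLift] using congrFun (coneLift_smul hr.le x) 0
    rw [coneDensity, coneDensity, h5, coneLift_smul hr.le, (hF _ (coneLift_mem hx)).2 r hr]
    push_cast
    rw [pow_succ, mul_inv, mul_inv]
    ring
  have h6 : HasDerivAt (fun r : ℝ => (((r ^ (n + 1))⁻¹ : ℝ) : ℂ) * coneDensity F x)
      (((-((n : ℝ) + 1) : ℝ) : ℂ) * coneDensity F x) 1 := by
    refine HasDerivAt.mul_const (HasDerivAt.ofReal_comp ?_) _
    have := (hasDerivAt_pow (n + 1) (1 : ℝ)).fun_inv (by simp)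
    simpa using this
  have := h1.unique (h6.congr_of_eventuallyEq h4)
  rw [this]
  push_cast
  ring

/-- The sum defining `alphaForm` is a cofactor expansion along the first row, so `α` is `(ξ⁰)⁻¹`
times the spatial volume form contracted with the position vector. -/
lemma alphaForm_eq_det {n : ℕ} (ξ : Fin (n + 1 + 1) → ℝ) (v : Fin n → Fin (n + 1 + 1) → ℝ) :
    alphaForm ξ v = (ξ 0)⁻¹ * (Matrix.of (Fin.cons (Fin.tail ξ) (fun b => Fin.tail (v b)) :
      Fin (n + 1) → Fin (n + 1) → ℝ)).det := by
  rw [alphaForm, Matrix.det_succ_row_zero]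
  congr 1
  refine Finset.sum_congr rfl fun j _ => ?_
  rw [← Matrix.det_transpose]
  rfl

/-- On the cone `ξ⁰ = |x|`, so the prefactor of `α` is the one built into `coneDensity`. -/
lemma density_mul_alphaForm {n : ℕ} (F : (Fin (n + 1 + 1) → ℝ) → ℂ) {ξ : Fin (n + 1 + 1) → ℝ}
    (hξ : ξ ∈ lightCone (n + 1)) (v : Fin n → Fin (n + 1 + 1) → ℝ) :
    F ξ * (alphaForm ξ v : ℂ) =
      radialForm (coneDensity F) (Fin.tail ξ) (fun b => Fin.tail (v b)) := by
  rw [radialForm_apply, coneDensity, coneLift_tail hξ, ← mem_lightCone_tail hξ, alphaForm_eq_det]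
  push_cast
  ring

/-- The integrand of `cubeIntegral` as the pull-back of a form. -/
lemma cubeIntegral_eq {n : ℕ} (F : (Fin (n + 1 + 1) → ℝ) → ℂ) (σ : SmoothCube (n + 1) n)
    {g : (Fin n → ℝ) → (Fin (n + 1 + 1) → ℝ)} (hg : ContDiff ℝ ∞ g)
    (h : Set.EqOn σ.ext' g (Set.Icc 0 1)) :
    cubeIntegral F σ = ∫ x in Set.Icc (0 : Fin n → ℝ) 1,
      radialForm (coneDensity F) (Fin.tail (g x)) fun b => Fin.tail (fderiv ℝ g x (Pi.single b 1)) := by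
  refine MeasureTheory.setIntegral_congr_fun measurableSet_Icc fun x hx => ?_
  have := density_mul_alphaForm F (σ.ext'_mem x)
    (fun b => fderivWithin ℝ σ.ext' (Set.Icc 0 1) x (Pi.single b 1))
  rw [this, SmoothCube.fderivWithin_ext' hg h hx, h hx]

/-- Forgetting the time component. -/
def tailL (m : ℕ) : (Fin (m + 1) → ℝ) →L[ℝ] (Fin m → ℝ) :=
  ContinuousLinearMap.pi fun i => ContinuousLinearMap.proj i.succ

lemma tailL_apply (m : ℕ) (x : Fin (m + 1) → ℝ) : tailL m x = Fin.tail x := rfl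

/-- Inserting a zero coordinate. -/
def insertZeroL {m : ℕ} (i : Fin (m + 1)) : (Fin m → ℝ) →L[ℝ] (Fin (m + 1) → ℝ) :=
  LinearMap.toContinuousLinearMap
    { toFun := fun x => i.insertNth (α := fun _ => ℝ) 0 x
      map_add' := fun x y => by
        funext k
        refine Fin.succAboveCases i ?_ (fun j => ?_) k <;> simp
      map_smul' := fun c x => by
        funext k
        refine Fin.succAboveCases i ?_ (fun j => ?_) k <;> simp }

lemma hasFDerivAt_insertNth {m : ℕ} (i : Fin (m + 1)) (c : ℝ) (x : Fin m → ℝ) :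
    HasFDerivAt (fun y : Fin m → ℝ => (i.insertNth c y : Fin (m + 1) → ℝ)) (insertZeroL i) x := by
  have h : (fun y : Fin m → ℝ => (i.insertNth c y : Fin (m + 1) → ℝ)) =
      fun y => insertZeroL i y + Pi.single i c := by
    funext y k
    refine Fin.succAboveCases i ?_ (fun j => ?_) k <;>
      simp [insertZeroL, Fin.succAbove_ne]
  rw [h]
  exact (insertZeroL i).hasFDerivAt.add_const _

lemma insertZeroL_single {m : ℕ} (i : Fin (m + 1)) (b : Fin m) :
    insertZeroL i (Pi.single b 1) = Pi.single (i.succAbove b) 1 := by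
  funext k
  refine Fin.succAboveCases i ?_ (fun j => ?_) k
  · simp [insertZeroL, (Fin.succAbove_ne i b).symm]
  · simp [insertZeroL, Pi.single_apply]

/-- **Stokes' theorem** for the closed form `F α` over a cube in the light cone. -/
theorem IsConeDensity.stokes_cube {n : ℕ} {F : (Fin (n + 1 + 1) → ℝ) → ℂ}
    (hF : IsConeDensity F) (τ : SmoothCube (n + 1) (n + 1)) :
    ∑ i : Fin (n + 1), (-1 : ℂ) ^ (i : ℕ) *
      (cubeIntegral F (τ.face i 1) - cubeIntegral F (τ.face i 0)) = 0 := by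
  obtain ⟨g, hg, hτ⟩ := τ.exists_extension
  let y : (Fin (n + 1) → ℝ) → (Fin (n + 1) → ℝ) := fun t => tailL (n + 1) (g t)
  have hy : ContDiff ℝ ∞ y := (tailL (n + 1)).contDiff.comp hg
  have hfy : ∀ t, fderiv ℝ y t = (tailL (n + 1)).comp (fderiv ℝ g t) := fun t =>
    ((tailL (n + 1)).hasFDerivAt.comp t (hg.differentiable (by simp) t).hasFDerivAt).fderiv
  have hy0 : ∀ t ∈ Set.Icc (0 : Fin (n + 1) → ℝ) 1, y t ≠ 0 := fun t ht => by
    have := tail_ne_zero (τ.ext'_mem t)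
    rwa [hτ ht] at this
  -- The pull-back of the closed form to the parameter cube.
  let η : (Fin (n + 1) → ℝ) → (Fin (n + 1) → ℝ) [⋀^Fin n]→L[ℝ] ℂ := fun t =>
    (radialForm (coneDensity F) (y t)).compContinuousLinearMap (fderiv ℝ y t)
  let e : Fin (n + 1) → Fin (n + 1) → ℝ := fun j => Pi.single j 1
  have hdη : ∀ t ∈ Set.Icc (0 : Fin (n + 1) → ℝ) 1, DifferentiableAt ℝ η t := by
    intro t ht
    have h1 : DifferentiableAt ℝ (fun s => radialForm (coneDensity F) (y s)) t :=
      (differentiableAt_radialForm (hF.differentiableAt (hy0 t ht))).comp t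
        (hy.differentiable (by simp) t)
    have h2 : DifferentiableAt ℝ (fderiv ℝ y) t :=
      (hy.fderiv_right (m := ∞) (by simp)).differentiable (by simp) t
    exact (h1.hasFDerivAt.continuousAlternatingMapCompContinuousLinearMap
      h2.hasFDerivAt).differentiableAt
  -- Exterior derivative commutes with pull-back, and the form on the spatial side is closed.
  have hext : ∀ t ∈ Set.Icc (0 : Fin (n + 1) → ℝ) 1, extDeriv η t = 0 := by
    intro t ht
    have := extDeriv_pullback (r := 2) (differentiableAt_radialForm (hF.differentiableAt (hy0 t ht)))
      (mod_cast (contDiff_infty.1 hy 2).contDiffAt (x := t)) (by simp)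
    rw [extDeriv_radialForm (hF.differentiableAt (hy0 t ht)) (hF.fderiv_coneDensity (hy0 t ht))]
      at this
    rw [this]
    ext v
    simp
  -- The divergence of this vector field is `dη` evaluated on the standard frame, so the divergence
  -- theorem on the cube is Stokes' theorem for `η`.
  let f : Fin (n + 1) → (Fin (n + 1) → ℝ) → ℂ := fun i t =>
    (-1 : ℂ) ^ (i : ℕ) * η t (i.removeNth e)
  have hη : ∀ i : Fin (n + 1), ∀ t ∈ Set.Icc (0 : Fin (n + 1) → ℝ) 1,
      DifferentiableAt ℝ (fun s => η s (i.removeNth e)) t := fun i t ht =>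
    ((hdη t ht).hasFDerivAt.continuousAlternatingMap_apply_const (i.removeNth e)).differentiableAt
  have hf : ∀ i, ∀ t ∈ Set.Icc (0 : Fin (n + 1) → ℝ) 1, DifferentiableAt ℝ (f i) t := by
    intro i t ht
    exact (hη i t ht).const_mul _
  have hdiv : ∀ t ∈ Set.Icc (0 : Fin (n + 1) → ℝ) 1, ∑ i, fderiv ℝ (f i) t (e i) = 0 := by
    intro t ht
    have := extDeriv_apply (hdη t ht) e
    rw [hext t ht] at this
    refine Eq.trans (Finset.sum_congr rfl fun i _ => ?_) this.symm
    have h1 : HasFDerivAt (fun s => (-1 : ℂ) ^ (i : ℕ) * η s (i.removeNth e)) _ t :=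
      (hη i t ht).hasFDerivAt.const_mul ((-1 : ℂ) ^ (i : ℕ))
    rw [h1.fderiv]
    rcases Nat.even_or_odd (i : ℕ) with h | h <;> simp [h.neg_one_pow]
  -- The tangent vectors of the `i`-th face are the frame vectors with `e i` removed, so the face
  -- integral is the flux of the component `f i`.
  have hface : ∀ (i : Fin (n + 1)) (c : unitInterval), (-1 : ℂ) ^ (i : ℕ) * cubeIntegral F (τ.face i c)
      = ∫ x in Set.Icc (0 : Fin n → ℝ) 1, f i (i.insertNth (c : ℝ) x) := by
    intro i c
    have hins : ContDiff ℝ ∞ (fun x : Fin n → ℝ => (i.insertNth (c : ℝ) x : Fin (n + 1) → ℝ)) := by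
      rw [contDiff_pi]
      intro k
      refine Fin.succAboveCases i ?_ (fun j => ?_) k
      · simpa using contDiff_const
      · simpa using contDiff_apply ℝ ℝ j
    rw [cubeIntegral_eq F (τ.face i c) (hg.comp hins), ← MeasureTheory.integral_const_mul]
    · refine MeasureTheory.setIntegral_congr_fun measurableSet_Icc fun x hx => ?_
      simp only [f, η]
      rw [ContinuousAlternatingMap.compContinuousLinearMap_apply]
      congr 2
      funext b
      simp only [hfy, Fin.removeNth, e, Function.comp_apply, ContinuousLinearMap.comp_apply]
      have := ((hg.differentiable (by simp) (i.insertNth (c : ℝ) x)).hasFDerivAt.comp x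
        (hasFDerivAt_insertNth i c x)).fderiv
      rw [this, ContinuousLinearMap.comp_apply, insertZeroL_single, tailL_apply]
    · intro x hx
      rw [SmoothCube.face_ext']
      refine hτ ⟨fun k => ?_, fun k => ?_⟩
      · refine Fin.succAboveCases i ?_ (fun j => ?_) k
        · simpa using c.2.1
        · simpa using hx.1 j
      · refine Fin.succAboveCases i ?_ (fun j => ?_) k
        · simpa using c.2.2
        · simpa using hx.2 j
  have := MeasureTheory.integral_divergence_of_hasFDerivAt_off_countable' (0 : Fin (n + 1) → ℝ) 1
    zero_le_one f (fun i => fderiv ℝ (f i)) ∅ Set.countable_empty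
    (fun i t ht => (hf i t ht).continuousAt.continuousWithinAt)
    (fun t ht i => (hf i t ⟨fun k => (ht.1 k trivial).1.le, fun k => (ht.1 k trivial).2.le⟩).hasFDerivAt) ?_
  · simp_rw [mul_sub, hface]
    rw [MeasureTheory.setIntegral_congr_fun measurableSet_Icc hdiv] at this
    simp only [Finset.sum_sub_distrib]
    simp [Function.comp_def] at this
    exact this.symm
  · exact (MeasureTheory.integrableOn_congr_fun hdiv measurableSet_Icc).2 (by simp)

/-! ### Integration over chains -/

/-- The additive extension to chains of a function on cubes. -/
def chainSum {d m : ℕ} (φ : SmoothCube d m → ℂ) : Chain d m →+ ℂ :=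
  Finsupp.liftAddHom fun σ => (AddMonoidHom.mulRight (φ σ)).comp (Int.castAddHom ℂ)

lemma chainSum_apply {d m : ℕ} (φ : SmoothCube d m → ℂ) (γ : Chain d m) :
    chainSum φ γ = γ.sum fun σ k => (k : ℂ) * φ σ := rfl

@[simp] lemma chainSum_single {d m : ℕ} (φ : SmoothCube d m → ℂ) (σ : SmoothCube d m) (k : ℤ) :
    chainSum φ (Finsupp.single σ k) = k * φ σ := by
  simp [chainSum_apply]

lemma chainIntegral_eq_chainSum {n : ℕ} (F : (Fin (n + 1 + 1) → ℝ) → ℂ) (γ : Chain (n + 1) n) :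
    chainIntegral F γ = chainSum (cubeIntegral F) γ := rfl

lemma chainSum_eq_zero_of_mem_degenerate {d m : ℕ} {φ : SmoothCube d m → ℂ}
    (hφ : ∀ σ, σ.IsDegenerate → φ σ = 0) {γ : Chain d m} (hγ : γ ∈ degenerateChains d m) :
    chainSum φ γ = 0 := by
  have : degenerateChains d m ≤ (chainSum φ).ker := by
    rw [degenerateChains, AddSubgroup.closure_le]
    rintro _ ⟨σ, hσ, rfl⟩
    simp [AddMonoidHom.mem_ker, hφ σ hσ]
  exact this hγ

lemma chainSum_boundary {d m : ℕ} (φ : SmoothCube d m → ℂ) (γ : Chain d (m + 1)) :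
    chainSum φ (boundary γ) = chainSum (fun σ => ∑ i : Fin (m + 1), (-1 : ℂ) ^ (i : ℕ) *
      (φ (σ.face i 1) - φ (σ.face i 0))) γ := by
  rw [boundary, Finsupp.sum, map_sum, chainSum_apply, Finsupp.sum]
  refine Finset.sum_congr rfl fun σ _ => ?_
  rw [map_zsmul, map_sum, zsmul_eq_mul]
  congr 1
  refine Finset.sum_congr rfl fun i _ => ?_
  rw [map_zsmul, map_sub, zsmul_eq_mul]
  simp

/-- A degenerate cube factors through a coordinate projection, so one of its tangent vectors is zero
and the determinant in `α` has a zero row. -/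
lemma cubeIntegral_eq_zero_of_isDegenerate {n : ℕ} (F : (Fin (n + 1 + 1) → ℝ) → ℂ)
    {σ : SmoothCube (n + 1) n} (hσ : σ.IsDegenerate) : cubeIntegral F σ = 0 := by
  obtain ⟨i, hi⟩ := hσ
  obtain ⟨g, hg, h⟩ := σ.exists_extension
  -- Resets the redundant coordinate to zero, which does not change the cube.
  let P : (Fin n → ℝ) →L[ℝ] (Fin n → ℝ) :=
    ContinuousLinearMap.pi fun j => if j = i then 0 else ContinuousLinearMap.proj j
  have hP : ∀ x, σ.ext' (P x) = σ.ext' x := fun x =>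
    hi _ _ fun j hj => by simp [P, hj]
  have hPm : Set.MapsTo P (Set.Icc 0 1) (Set.Icc 0 1) := fun x hx => by
    constructor <;> intro j <;> by_cases hj : j = i <;> simp [P, hj]
    · exact hx.1 j
    · exact hx.2 j
  rw [cubeIntegral]
  refine MeasureTheory.setIntegral_eq_zero_of_forall_eq_zero fun x hx => ?_
  have hd : ∀ y ∈ Set.Icc (0 : Fin n → ℝ) 1, HasFDerivWithinAt σ.ext' (fderiv ℝ g y)
      (Set.Icc 0 1) y := fun y hy =>
    ((hg.differentiable (by simp) y).hasFDerivAt.hasFDerivWithinAt).congr h (h hy)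
  have h1 : HasFDerivWithinAt σ.ext' ((fderiv ℝ g (P x)).comp P) (Set.Icc 0 1) x := by
    have := (hd (P x) (hPm hx)).comp x P.hasFDerivWithinAt hPm
    refine this.congr (fun y _ => (hP y).symm) (hP x).symm
  have h2 : fderivWithin ℝ σ.ext' (Set.Icc 0 1) x (Pi.single i 1) = 0 := by
    rw [h1.fderivWithin (uniqueDiffOn_Icc_pi n x hx)]
    have : P (Pi.single i 1) = 0 := by
      funext j; by_cases hj : j = i <;> simp [P, hj]
    simp [this]
  rw [alphaForm_eq_det, Matrix.det_eq_zero_of_row_eq_zero i.succ]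
  · simp
  · intro j
    simp [h2, Fin.tail]

/-- Stokes disposes of the boundary and the preceding vanishing result of the degenerate remainder.
-/
theorem IsConeDensity.chainIntegral_eq_of_homologous {n : ℕ} {F : (Fin (n + 1 + 1) → ℝ) → ℂ}
    (hF : IsConeDensity F) {γ γ' : Chain (n + 1) n} (h : Homologous γ γ') :
    chainIntegral F γ = chainIntegral F γ' := by
  obtain ⟨c, hc⟩ := h
  have h1 := chainSum_eq_zero_of_mem_degenerate
    (fun σ hσ => cubeIntegral_eq_zero_of_isDegenerate F hσ) hc
  rw [map_sub, map_sub, chainSum_boundary] at h1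
  have h2 : chainSum (fun σ => ∑ i : Fin (n + 1), (-1 : ℂ) ^ (i : ℕ) *
      (cubeIntegral F (σ.face i 1) - cubeIntegral F (σ.face i 0))) c = 0 := by
    simp [chainSum_apply, hF.stokes_cube]
  rw [h2, sub_zero, sub_eq_zero] at h1
  exact h1

/-! ### The Minkowski product and boosts -/

section mdot

variable {R : Type*} [CommRing R] {d : ℕ}

lemma mdot_comm (x y : Fin (d + 1) → R) : mdot x y = mdot y x := by
  simp only [mdot, mul_comm]

lemma mdot_add_left (x y z : Fin (d + 1) → R) : mdot (x + y) z = mdot x z + mdot y z := by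
  simp only [mdot, Pi.add_apply, add_mul, Finset.sum_add_distrib]
  ring

lemma mdot_smul_left (c : R) (x y : Fin (d + 1) → R) : mdot (c • x) y = c * mdot x y := by
  simp only [mdot, Pi.smul_apply, smul_eq_mul, mul_sub, Finset.mul_sum, mul_assoc]

lemma mdot_add_right (x y z : Fin (d + 1) → R) : mdot x (y + z) = mdot x y + mdot x z := by
  rw [mdot_comm, mdot_add_left, mdot_comm y, mdot_comm z]

lemma mdot_smul_right (c : R) (x y : Fin (d + 1) → R) : mdot x (c • y) = c * mdot x y := by
  rw [mdot_comm, mdot_smul_left, mdot_comm]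

lemma mdot_neg_left (x y : Fin (d + 1) → R) : mdot (-x) y = -mdot x y := by
  rw [← neg_one_smul R, mdot_smul_left, neg_one_mul]

lemma mdot_neg_right (x y : Fin (d + 1) → R) : mdot x (-y) = -mdot x y := by
  rw [mdot_comm, mdot_neg_left, mdot_comm]

/-- The boost with hyperbolic cosine `C` and sine `S` in the plane of the time axis and the `j`-th
space axis. -/
def boost (C S : R) (j : Fin d) : (Fin (d + 1) → R) →ₗ[R] (Fin (d + 1) → R) where
  toFun ξ := Fin.cons (C * ξ 0 + S * ξ j.succ)
    fun i => if i = j then S * ξ 0 + C * ξ j.succ else ξ i.succ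
  map_add' x y := by
    funext k
    refine Fin.cases ?_ (fun i => ?_) k
    · simp; ring
    · by_cases h : i = j <;> simp [h]; ring
  map_smul' c x := by
    funext k
    refine Fin.cases ?_ (fun i => ?_) k
    · simp; ring
    · by_cases h : i = j <;> simp [h]; ring

lemma boost_zero (C S : R) (j : Fin d) (ξ : Fin (d + 1) → R) :
    boost C S j ξ 0 = C * ξ 0 + S * ξ j.succ := rfl

lemma boost_succ (C S : R) (j i : Fin d) (ξ : Fin (d + 1) → R) :
    boost C S j ξ i.succ = if i = j then S * ξ 0 + C * ξ j.succ else ξ i.succ := rfl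

lemma mdot_boost {C S : R} (h : C ^ 2 - S ^ 2 = 1) (j : Fin d) (x y : Fin (d + 1) → R) :
    mdot (boost C S j x) (boost C S j y) = mdot x y := by
  simp only [mdot, boost_zero, boost_succ]
  rw [← Finset.add_sum_erase _ _ (Finset.mem_univ j), ← Finset.add_sum_erase _ (fun i : Fin d =>
    x i.succ * y i.succ) (Finset.mem_univ j)]
  have : ∑ i ∈ Finset.univ.erase j, (if i = j then S * x 0 + C * x j.succ else x i.succ) *
      (if i = j then S * y 0 + C * y j.succ else y i.succ) =
      ∑ i ∈ Finset.univ.erase j, x i.succ * y i.succ := by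
    refine Finset.sum_congr rfl fun i hi => ?_
    simp [Finset.ne_of_mem_erase hi]
  rw [this]
  simp only [if_true]
  linear_combination (x 0 * y 0 - x j.succ * y j.succ) * h

lemma boost_boost (C S C' S' : R) (j : Fin d) (ξ : Fin (d + 1) → R) :
    boost C S j (boost C' S' j ξ) = boost (C * C' + S * S') (S * C' + C * S') j ξ := by
  funext k
  refine Fin.cases ?_ (fun i => ?_) k
  · simp only [boost_zero, boost_succ, if_true]; ring
  · by_cases h : i = j
    · simp only [boost_zero, boost_succ, h, if_true]; ring
    · simp [boost_succ, h]

end mdot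

/-! ### Integrals over chains depending on complex parameters -/

/-- The density of `α` on a cube. -/
def cubeWeight {n : ℕ} (σ : SmoothCube (n + 1) n) (x : Fin n → ℝ) : ℂ :=
  ((alphaForm (σ.ext' x) fun b =>
      fderivWithin ℝ σ.ext' (Set.Icc 0 1) x (Pi.single b 1) : ℝ) : ℂ)

lemma cubeIntegral_eq_weight {n : ℕ} (F : (Fin (n + 1 + 1) → ℝ) → ℂ) (σ : SmoothCube (n + 1) n) :
    cubeIntegral F σ = ∫ x in Set.Icc (0 : Fin n → ℝ) 1, F (σ.ext' x) * cubeWeight σ x := rfl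

lemma continuousOn_ext' {d m : ℕ} (σ : SmoothCube d m) : ContinuousOn σ.ext' (Set.Icc 0 1) := by
  obtain ⟨g, hg, h⟩ := σ.exists_extension
  exact hg.continuous.continuousOn.congr h

lemma continuousOn_cubeWeight {n : ℕ} (σ : SmoothCube (n + 1) n) :
    ContinuousOn (cubeWeight σ) (Set.Icc 0 1) := by
  obtain ⟨g, hg, h⟩ := σ.exists_extension
  have h1 : ContinuousOn (fun x => ((alphaForm (g x) fun b => fderiv ℝ g x (Pi.single b 1) : ℝ) : ℂ))
      (Set.Icc (0 : Fin n → ℝ) 1) := by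
    refine Complex.continuous_ofReal.comp_continuousOn ?_
    have hc : ∀ b : Fin n, Continuous fun x => fderiv ℝ g x (Pi.single b 1) := fun b =>
      (hg.continuous_fderiv (by simp)).clm_apply continuous_const
    simp only [alphaForm_eq_det]
    refine ContinuousOn.mul ?_ (Continuous.continuousOn ?_)
    · refine ContinuousOn.inv₀ ((continuous_apply 0).comp hg.continuous).continuousOn fun x hx => ?_
      rw [← h hx]
      exact (σ.ext'_mem x).2.ne'
    · refine Continuous.matrix_det (continuous_pi fun i => continuous_pi fun j => ?_)
      refine Fin.cases ?_ (fun b => ?_) i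
      · exact (continuous_apply j.succ).comp hg.continuous
      · exact (continuous_apply j.succ).comp (hc b)
  refine h1.congr fun x hx => ?_
  simp only [cubeWeight]
  rw [SmoothCube.fderivWithin_ext' hg h hx, h hx]

lemma continuous_toC {d : ℕ} : Continuous (toC : (Fin (d + 1) → ℝ) → _) :=
  continuous_pi fun i => Complex.continuous_ofReal.comp (continuous_apply i)

-- Differentiation under the integral sign, the integrand being controlled on an open set of pairs
-- (parameter, cone point). Compactness of the image of the cube supplies the uniform domination.
open MeasureTheory in
lemma hasFDerivAt_cubeIntegral {n : ℕ} {P : Type*} [NormedAddCommGroup P] [NormedSpace ℂ P]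
    {O : Set (P × (Fin (n + 1 + 1) → ℂ))} (hO : IsOpen O) {Ψ : P × (Fin (n + 1 + 1) → ℂ) → ℂ}
    (hΨ : ContDiffOn ℂ 1 Ψ O) {p₀ : P} (hp : ∀ ξ ∈ lightCone (n + 1), (p₀, toC ξ) ∈ O)
    (σ : SmoothCube (n + 1) n) :
    ∃ L : P →L[ℂ] ℂ, HasFDerivAt (fun p => cubeIntegral (fun ξ => Ψ (p, toC ξ)) σ) L p₀ ∧
      ∀ v, L v = cubeIntegral (fun ξ => fderiv ℂ Ψ (p₀, toC ξ) (v, 0)) σ := by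
  let q : (Fin n → ℝ) → (Fin (n + 1 + 1) → ℂ) := fun x => toC (σ.ext' x)
  have hq : ContinuousOn q (Set.Icc 0 1) := continuous_toC.comp_continuousOn (continuousOn_ext' σ)
  have hK : IsCompact (q '' Set.Icc 0 1) := isCompact_Icc.image_of_continuousOn hq
  have hf' : ContinuousOn (fderiv ℂ Ψ) O := hΨ.continuousOn_fderiv_of_isOpen hO le_rfl
  have hsub : ({p₀} : Set P) ×ˢ (q '' Set.Icc 0 1) ⊆ O := by
    rintro ⟨p, y⟩ ⟨rfl, x, hx, rfl⟩
    exact hp _ (σ.ext'_mem x)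
  obtain ⟨C, hC⟩ := (isCompact_singleton.prod hK).exists_bound_of_continuousOn (hf'.mono hsub)
  have hV : IsOpen (O ∩ (fun y => ‖fderiv ℂ Ψ y‖) ⁻¹' Set.Iio (C + 1)) :=
    hf'.norm.isOpen_inter_preimage hO isOpen_Iio
  -- The tube lemma upgrades the bound on the slice over `p₀` to a full neighbourhood `u` of `p₀`,
  -- at the cost of replacing `C` by `C + 1`.
  obtain ⟨u, v, hu, hv, hpu, hKv, huv⟩ := generalized_tube_lemma isCompact_singleton hK hV
    (fun y hy => ⟨hsub hy, (hC y hy).trans_lt (lt_add_one C)⟩)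
  have hu' : u ∈ nhds p₀ := hu.mem_nhds (hpu rfl)
  have hmem : ∀ p ∈ u, ∀ x ∈ Set.Icc (0 : Fin n → ℝ) 1, (p, q x) ∈ O ∧
      ‖fderiv ℂ Ψ (p, q x)‖ < C + 1 := fun p hp x hx =>
    huv ⟨hp, hKv ⟨x, hx, rfl⟩⟩
  let F' : P → (Fin n → ℝ) → P →L[ℂ] ℂ := fun p x =>
    cubeWeight σ x • (fderiv ℂ Ψ (p, q x)).comp (ContinuousLinearMap.inl ℂ P _)
  have hw := continuousOn_cubeWeight σ
  have hcF : ∀ p ∈ u, ContinuousOn (fun x => Ψ (p, q x) * cubeWeight σ x) (Set.Icc 0 1) := by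
    intro p hp
    refine ContinuousOn.mul ?_ hw
    exact hΨ.continuousOn.comp (continuousOn_const.prodMk hq) fun x hx => (hmem p hp x hx).1
  have hcF' : ContinuousOn (F' p₀) (Set.Icc 0 1) := by
    refine hw.smul ?_
    refine ContinuousOn.clm_comp ?_ continuousOn_const
    exact hf'.comp (continuousOn_const.prodMk hq) fun x hx => (hmem p₀ (mem_of_mem_nhds hu') x hx).1
  have key := hasFDerivAt_integral_of_dominated_of_fderiv_le (𝕜 := ℂ) (F' := F')
    (μ := volume.restrict (Set.Icc (0 : Fin n → ℝ) 1)) (x₀ := p₀) (s := u)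
    (F := fun p x => Ψ (p, q x) * cubeWeight σ x)
    (bound := fun x => ‖cubeWeight σ x‖ * ((C + 1) * ‖ContinuousLinearMap.inl ℂ P (Fin (n + 1 + 1) → ℂ)‖))
    hu' (Filter.eventually_of_mem hu' fun p hp =>
      ((hcF p hp).integrableOn_compact isCompact_Icc).aestronglyMeasurable)
    ((hcF p₀ (mem_of_mem_nhds hu')).integrableOn_compact isCompact_Icc)
    (hcF'.integrableOn_compact isCompact_Icc).aestronglyMeasurable
    (by
      refine (ae_restrict_iff' measurableSet_Icc).2 (Filter.Eventually.of_forall fun x hx p hp => ?_)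
      rw [norm_smul]
      refine mul_le_mul_of_nonneg_left ?_ (norm_nonneg _)
      refine (ContinuousLinearMap.opNorm_comp_le _ _).trans ?_
      exact mul_le_mul_of_nonneg_right (hmem p hp x hx).2.le (norm_nonneg _))
    ((hw.norm.mul continuousOn_const).integrableOn_compact isCompact_Icc)
    (by
      refine (ae_restrict_iff' measurableSet_Icc).2 (Filter.Eventually.of_forall fun x hx p hp => ?_)
      have h1 : HasFDerivAt Ψ (fderiv ℂ Ψ (p, q x)) (p, q x) :=
        ((hΨ.differentiableOn one_ne_zero).differentiableAt (hO.mem_nhds (hmem p hp x hx).1)).hasFDerivAt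
      have h2 : HasFDerivAt (fun p => (p, q x)) (ContinuousLinearMap.inl ℂ P _) p :=
        hasFDerivAt_prodMk_left p (q x)
      exact (h1.comp p h2).mul_const _)
  refine ⟨_, key, fun v => ?_⟩
  rw [ContinuousLinearMap.integral_apply (hcF'.integrableOn_compact isCompact_Icc)]
  rw [cubeIntegral_eq_weight]
  refine integral_congr_ae (Filter.Eventually.of_forall fun x => ?_)
  simp [F', q, mul_comm]

lemma hasFDerivAt_chainIntegral {n : ℕ} {P : Type*} [NormedAddCommGroup P] [NormedSpace ℂ P]
    {O : Set (P × (Fin (n + 1 + 1) → ℂ))} (hO : IsOpen O) {Ψ : P × (Fin (n + 1 + 1) → ℂ) → ℂ}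
    (hΨ : ContDiffOn ℂ 1 Ψ O) {p₀ : P} (hp : ∀ ξ ∈ lightCone (n + 1), (p₀, toC ξ) ∈ O)
    (γ : Chain (n + 1) n) :
    ∃ L : P →L[ℂ] ℂ, HasFDerivAt (fun p => chainIntegral (fun ξ => Ψ (p, toC ξ)) γ) L p₀ ∧
      ∀ v, L v = chainIntegral (fun ξ => fderiv ℂ Ψ (p₀, toC ξ) (v, 0)) γ := by
  choose L hL hLv using hasFDerivAt_cubeIntegral hO hΨ hp
  refine ⟨∑ σ ∈ γ.support, ((γ σ : ℤ) : ℂ) • L σ, ?_, fun v => ?_⟩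
  · exact HasFDerivAt.fun_sum fun σ _ => (hL σ).const_mul _
  · simp [hLv, chainIntegral, Finsupp.sum]

lemma cubeIntegral_congr {n : ℕ} {F G : (Fin (n + 1 + 1) → ℝ) → ℂ}
    (h : ∀ ξ ∈ lightCone (n + 1), F ξ = G ξ) (σ : SmoothCube (n + 1) n) :
    cubeIntegral F σ = cubeIntegral G σ := by
  simp only [cubeIntegral, h _ (σ.ext'_mem _)]

lemma chainIntegral_congr {n : ℕ} {F G : (Fin (n + 1 + 1) → ℝ) → ℂ}
    (h : ∀ ξ ∈ lightCone (n + 1), F ξ = G ξ) (γ : Chain (n + 1) n) :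
    chainIntegral F γ = chainIntegral G γ := by
  simp only [chainIntegral, cubeIntegral_congr h]

lemma chainIntegral_const_mul {n : ℕ} (c : ℂ) (F : (Fin (n + 1 + 1) → ℝ) → ℂ)
    (γ : Chain (n + 1) n) :
    chainIntegral (fun ξ => c * F ξ) γ = c * chainIntegral F γ := by
  simp only [chainIntegral, cubeIntegral, mul_assoc, MeasureTheory.integral_const_mul]
  rw [Finsupp.mul_sum]
  exact Finsupp.sum_congr fun σ _ => by ring

/-! ### Lorentz invariance of `α` and of integrals over cycles -/

/-- Cauchy-Schwarz for the spatial parts. Strictness comes from `y` being timelike, so `x` may be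
lightlike. -/
lemma mdot_pos {d : ℕ} {x y : Fin (d + 1) → ℝ} (hx : 0 ≤ mdot x x) (hx0 : 0 < x 0)
    (hy : y ∈ openCone d) : 0 < mdot x y := by
  obtain ⟨h1, h2⟩ := hy
  have hcs := Finset.sum_mul_sq_le_sq_mul_sq Finset.univ (fun i : Fin d => x i.succ)
    (fun i => y i.succ)
  simp only [mdot, ← sq] at hx h1 ⊢
  have hX : ∑ i : Fin d, x i.succ ^ 2 ≤ x 0 ^ 2 := by linarith
  have hY : ∑ i : Fin d, y i.succ ^ 2 < y 0 ^ 2 := by linarith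
  have h3 : (∑ i : Fin d, x i.succ * y i.succ) ^ 2 < (x 0 * y 0) ^ 2 := by
    refine hcs.trans_lt ?_
    rw [mul_pow]
    calc _ ≤ x 0 ^ 2 * ∑ i : Fin d, y i.succ ^ 2 :=
          mul_le_mul_of_nonneg_right hX (Finset.sum_nonneg fun i _ => sq_nonneg _)
      _ < _ := mul_lt_mul_of_pos_left hY (by positivity)
  have := abs_lt_of_sq_lt_sq h3 (by positivity)
  linarith [(abs_lt.1 this).2]

lemma mdot_lightCone_pos {d : ℕ} {ξ y : Fin (d + 1) → ℝ} (hξ : ξ ∈ lightCone d)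
    (hy : y ∈ openCone d) : 0 < mdot ξ y :=
  mdot_pos hξ.1.ge hξ.2 hy

/-- The matrix of the Minkowski product. -/
def minkowski (R : Type*) [CommRing R] (d : ℕ) : Matrix (Fin (d + 1)) (Fin (d + 1)) R :=
  Matrix.diagonal (Fin.cons 1 fun _ => -1)

lemma mdot_eq_dotProduct {R : Type*} [CommRing R] {d : ℕ} (x y : Fin (d + 1) → R) :
    mdot x y = x ⬝ᵥ (minkowski R d).mulVec y := by
  simp [mdot, minkowski, Matrix.mulVec_diagonal, dotProduct, Fin.sum_univ_succ, sub_eq_add_neg]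

lemma det_sq_of_mdot {d : ℕ} {L : Matrix (Fin (d + 1)) (Fin (d + 1)) ℝ}
    (hL : ∀ x y, mdot (L.mulVec x) (L.mulVec y) = mdot x y) : L.det ^ 2 = 1 := by
  have h1 : L.transpose * minkowski ℝ d * L = minkowski ℝ d := by
    ext i j
    have := hL (Pi.single i 1) (Pi.single j 1)
    simp only [mdot_eq_dotProduct, Matrix.mulVec_mulVec] at this
    rw [← Matrix.vecMul_transpose, ← Matrix.dotProduct_mulVec, Matrix.mulVec_mulVec] at this
    simpa [Matrix.mul_assoc] using this
  have h2 : (minkowski ℝ d).det ≠ 0 := by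
    rw [minkowski, Matrix.det_diagonal, Finset.prod_ne_zero_iff]
    intro i _
    refine Fin.cases ?_ (fun j => ?_) i <;> simp
  have h3 := congrArg Matrix.det h1
  rw [Matrix.det_mul, Matrix.det_mul, Matrix.det_transpose] at h3
  refine mul_right_cancel₀ h2 ?_
  linear_combination h3

/-- The determinant of `η, ξ, v₁, ..., vₙ`. -/
def frameDet {n : ℕ} (η ξ : Fin (n + 1 + 1) → ℝ) (v : Fin n → Fin (n + 1 + 1) → ℝ) : ℝ :=
  (Matrix.of (Fin.cons η (Fin.cons ξ v) : Fin (n + 1 + 1) → Fin (n + 1 + 1) → ℝ)).det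

lemma frameDet_single_zero {n : ℕ} (ξ : Fin (n + 1 + 1) → ℝ) (v : Fin n → Fin (n + 1 + 1) → ℝ) :
    frameDet (Pi.single 0 1) ξ v = (Matrix.of (Fin.cons (Fin.tail ξ) (fun b => Fin.tail (v b)) :
      Fin (n + 1) → Fin (n + 1) → ℝ)).det := by
  rw [frameDet, Matrix.det_succ_row_zero, Finset.sum_eq_single 0]
  · simp only [Fin.val_zero, pow_zero, Matrix.of_apply, Fin.cons_zero, Pi.single_eq_same, one_mul]
    congr 1
    ext i j
    refine Fin.cases ?_ (fun b => ?_) i <;> simp [Fin.tail]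
  · intro j _ hj
    simp [hj]
  · simp

lemma frameDet_mulVec {n : ℕ} (L : Matrix (Fin (n + 1 + 1)) (Fin (n + 1 + 1)) ℝ)
    (η ξ : Fin (n + 1 + 1) → ℝ) (v : Fin n → Fin (n + 1 + 1) → ℝ) :
    frameDet (L.mulVec η) (L.mulVec ξ) (fun b => L.mulVec (v b)) = L.det * frameDet η ξ v := by
  have h : (Matrix.of (Fin.cons (L.mulVec η) (Fin.cons (L.mulVec ξ) fun b => L.mulVec (v b)) :
      Fin (n + 1 + 1) → Fin (n + 1 + 1) → ℝ)) =
      (Matrix.of (Fin.cons η (Fin.cons ξ v) : Fin (n + 1 + 1) → Fin (n + 1 + 1) → ℝ)) *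
        L.transpose := by
    ext i j
    rw [Matrix.mul_apply]
    refine Fin.cases ?_ (fun i' => Fin.cases ?_ (fun b => ?_) i') i <;>
      simp [Matrix.mulVec, dotProduct, mul_comm]
  rw [frameDet, h, Matrix.det_mul, Matrix.det_transpose, mul_comm, frameDet]

/-- Both sides are linear in `η`. If `η` is orthogonal to `ξ`, all rows lie in the hyperplane
orthogonal to `ξ` (which contains the null vector `ξ` itself) and the determinant vanishes; the time
axis fixes the remaining factor. This describes `α` on tangent vectors of the cone without a
preferred frame. -/
lemma frameDet_eq_mdot_mul {n : ℕ} (η : Fin (n + 1 + 1) → ℝ) {ξ : Fin (n + 1 + 1) → ℝ}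
    (hξ : ξ ∈ lightCone (n + 1)) {v : Fin n → Fin (n + 1 + 1) → ℝ} (hv : ∀ b, mdot ξ (v b) = 0) :
    frameDet η ξ v = mdot ξ η * alphaForm ξ v := by
  -- This combination is orthogonal to `ξ`, so `minkowski` applied to `ξ` is a nonzero kernel vector
  -- of the frame matrix.
  have h1 : frameDet (ξ 0 • η + (-mdot ξ η) • Pi.single 0 1) ξ v = 0 := by
    refine Matrix.exists_mulVec_eq_zero_iff.1 ⟨(minkowski ℝ (n + 1)).mulVec ξ, fun h => ?_, ?_⟩
    · have := congrFun h 0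
      simp [minkowski, Matrix.mulVec_diagonal] at this
      exact hξ.2.ne' this
    · have he : mdot (Pi.single 0 1) ξ = ξ 0 := by simp [mdot]
      funext i
      change _ ⬝ᵥ (minkowski ℝ (n + 1)).mulVec ξ = 0
      rw [← mdot_eq_dotProduct]
      refine Fin.cases ?_ (fun i' => Fin.cases ?_ (fun b => ?_) i') i
      · change mdot (ξ 0 • η + (-mdot ξ η) • Pi.single 0 1) ξ = 0
        rw [mdot_add_left, mdot_smul_left, mdot_smul_left, he, mdot_comm ξ η]
        ring
      · exact hξ.1
      · change mdot (v b) ξ = 0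
        rw [mdot_comm, hv]
  have h2 : frameDet (ξ 0 • η + (-mdot ξ η) • Pi.single 0 1) ξ v =
      ξ 0 * frameDet η ξ v + (-mdot ξ η) * frameDet (Pi.single 0 1) ξ v := by
    have ha := (Matrix.detRowAlternating (n := Fin (n + 1 + 1)) (R := ℝ)).toMultilinearMap.cons_add
      (Fin.cons ξ v) (ξ 0 • η) ((-mdot ξ η) • Pi.single 0 1)
    rw [MultilinearMap.cons_smul, MultilinearMap.cons_smul] at ha
    exact ha
  rw [h1, frameDet_single_zero] at h2
  have h0 := hξ.2.ne'
  rw [alphaForm_eq_det]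
  field_simp
  linear_combination -h2

/-- Both forms are read off from the same frame determinant, with the time axis and its image under
`L` as auxiliary vectors; these have the same product with `ξ` and with its image. -/
lemma alphaForm_mulVec {n : ℕ} {L : Matrix (Fin (n + 1 + 1)) (Fin (n + 1 + 1)) ℝ}
    (hL : ∀ x y, mdot (L.mulVec x) (L.mulVec y) = mdot x y) {ξ : Fin (n + 1 + 1) → ℝ}
    (hξ : ξ ∈ lightCone (n + 1)) (hLξ : L.mulVec ξ ∈ lightCone (n + 1))
    {v : Fin n → Fin (n + 1 + 1) → ℝ} (hv : ∀ b, mdot ξ (v b) = 0) :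
    alphaForm (L.mulVec ξ) (fun b => L.mulVec (v b)) = L.det * alphaForm ξ v := by
  have h1 := frameDet_mulVec L (Pi.single 0 1) ξ v
  rw [frameDet_eq_mdot_mul _ hξ hv, frameDet_eq_mdot_mul _ hLξ (fun b => by rw [hL, hv]), hL] at h1
  have he : mdot ξ (Pi.single 0 1) = ξ 0 := by simp [mdot]
  rw [he] at h1
  refine mul_left_cancel₀ hξ.2.ne' ?_
  rw [h1]; ring

lemma boost_mem_lightCone {d : ℕ} (r : ℝ) (j : Fin d) {ξ : Fin (d + 1) → ℝ}
    (hξ : ξ ∈ lightCone d) : boost (Real.cosh r) (Real.sinh r) j ξ ∈ lightCone d := by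
  refine ⟨?_, ?_⟩
  · rw [mdot_boost (Real.cosh_sq_sub_sinh_sq r), hξ.1]
  · have h1 : ξ j.succ * ξ j.succ ≤ ξ 0 * ξ 0 := by
      rw [sub_eq_zero.1 hξ.1]
      exact Finset.single_le_sum (f := fun i : Fin d => ξ i.succ * ξ i.succ)
        (fun i _ => mul_self_nonneg _) (Finset.mem_univ j)
    have h2 : |ξ j.succ| ≤ ξ 0 := abs_le_of_sq_le_sq (by simpa [sq] using h1) hξ.2.le
    have h3 : |Real.sinh r| < Real.cosh r := by
      rw [Real.abs_sinh, ← Real.cosh_abs]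
      exact Real.sinh_lt_cosh _
    rw [boost_zero]
    have h4 : |Real.sinh r * ξ j.succ| < Real.cosh r * ξ 0 := by
      rw [abs_mul]
      calc _ ≤ |Real.sinh r| * ξ 0 := mul_le_mul_of_nonneg_left h2 (abs_nonneg _)
        _ < _ := mul_lt_mul_of_pos_right h3 hξ.2
    linarith [(abs_lt.1 h4).1]

/-- A boost is the square of the boost of half the rapidity, so the determinant enters squared and
no sign has to be determined. -/
lemma alphaForm_boost {n : ℕ} (r : ℝ) (j : Fin (n + 1)) {ξ : Fin (n + 1 + 1) → ℝ}
    (hξ : ξ ∈ lightCone (n + 1)) {v : Fin n → Fin (n + 1 + 1) → ℝ} (hv : ∀ b, mdot ξ (v b) = 0) :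
    alphaForm (boost (Real.cosh r) (Real.sinh r) j ξ)
      (fun b => boost (Real.cosh r) (Real.sinh r) j (v b)) = alphaForm ξ v := by
  let B := boost (Real.cosh (r / 2)) (Real.sinh (r / 2)) j
  let L := LinearMap.toMatrix' B
  have hB : ∀ x, L.mulVec x = B x := fun x => LinearMap.toMatrix'_mulVec B x
  have hL : ∀ x y, mdot (L.mulVec x) (L.mulVec y) = mdot x y := fun x y => by
    rw [hB, hB, mdot_boost (Real.cosh_sq_sub_sinh_sq _)]
  have hLc : ∀ x ∈ lightCone (n + 1), L.mulVec x ∈ lightCone (n + 1) := fun x hx => by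
    rw [hB]; exact boost_mem_lightCone _ _ hx
  have hsq : ∀ x, boost (Real.cosh r) (Real.sinh r) j x = L.mulVec (L.mulVec x) := fun x => by
    rw [hB, hB, boost_boost, ← Real.cosh_add, ← Real.sinh_add, add_halves]
  simp only [hsq]
  rw [alphaForm_mulVec hL (hLc _ hξ) (hLc _ (hLc _ hξ)) fun b => by rw [hL, hv],
    alphaForm_mulVec hL hξ (hLc _ hξ) hv, ← mul_assoc, ← sq, det_sq_of_mdot hL, one_mul]

lemma contDiff_boost {d m : ℕ} {C S : (Fin m → ℝ) → ℝ} {g : (Fin m → ℝ) → (Fin (d + 1) → ℝ)}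
    (hC : ContDiff ℝ ∞ C) (hS : ContDiff ℝ ∞ S) (hg : ContDiff ℝ ∞ g) (j : Fin d) :
    ContDiff ℝ ∞ fun x => boost (C x) (S x) j (g x) := by
  have hgk : ∀ k, ContDiff ℝ ∞ fun x => g x k := fun k => contDiff_pi.1 hg k
  rw [contDiff_pi]
  intro k
  refine Fin.cases ?_ (fun i => ?_) k
  · exact (hC.mul (hgk 0)).add (hS.mul (hgk j.succ))
  · by_cases h : i = j
    · simp only [boost_succ, h, if_true]
      exact (hS.mul (hgk 0)).add (hC.mul (hgk j.succ))
    · simp only [boost_succ, h, if_false]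
      exact hgk _

/-! ### Boosted cubes and the prisms between them -/

namespace SmoothCube

variable {d m : ℕ}

/-- The image of a cube under a boost. -/
def boosted (r : ℝ) (j : Fin d) (σ : SmoothCube d m) : SmoothCube d m where
  toFun t := boost (Real.cosh r) (Real.sinh r) j (σ.toFun t)
  smooth' := by
    obtain ⟨g, hg, h⟩ := σ.smooth'
    exact ⟨_, contDiff_boost (contDiff_const (c := Real.cosh r)) (contDiff_const (c := Real.sinh r))
      hg j, fun t => by rw [h]⟩
  mem_cone' t := boost_mem_lightCone r j (σ.mem_cone' t)

/-- The prism swept out by a cube under boosts of rapidities between `0` and `r`. -/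
def prism (r : ℝ) (j : Fin d) (σ : SmoothCube d m) : SmoothCube d (m + 1) where
  toFun t := boost (Real.cosh (r * t 0)) (Real.sinh (r * t 0)) j (σ.toFun (Fin.tail t))
  smooth' := by
    obtain ⟨g, hg, h⟩ := σ.smooth'
    refine ⟨fun x => boost (Real.cosh (r * x 0)) (Real.sinh (r * x 0)) j (g (Fin.tail x)),
      contDiff_boost (Real.contDiff_cosh.comp ?_) (Real.contDiff_sinh.comp ?_)
        (hg.comp (tailL m).contDiff) j, fun t => ?_⟩
    · exact contDiff_const.mul (contDiff_apply ℝ ℝ 0)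
    · exact contDiff_const.mul (contDiff_apply ℝ ℝ 0)
    · rw [← h]; rfl
  mem_cone' t := boost_mem_lightCone _ j (σ.mem_cone' _)

lemma boost_one_zero (j : Fin d) (ξ : Fin (d + 1) → ℝ) : boost 1 0 j ξ = ξ := by
  funext k
  refine Fin.cases ?_ (fun i => ?_) k
  · simp [boost_zero]
  · by_cases h : i = j <;> simp [boost_succ, h]

lemma face_prism_zero_zero (r : ℝ) (j : Fin d) (σ : SmoothCube d m) :
    (σ.prism r j).face 0 0 = σ := by
  ext t : 2
  simp [face, prism, boost_one_zero]

lemma face_prism_zero_one (r : ℝ) (j : Fin d) (σ : SmoothCube d m) :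
    (σ.prism r j).face 0 1 = σ.boosted r j := by
  ext t : 2
  simp [face, prism, boosted]

/-- The boost parameter is coordinate `0`, whence the index shift. Together with the top and bottom
faces this is the homotopy formula `∂P + P∂ = boosted - id`. -/
lemma face_prism_succ (r : ℝ) (j : Fin d) (σ : SmoothCube d (m + 1)) (i : Fin (m + 1))
    (c : unitInterval) : (σ.prism r j).face i.succ c = (σ.face i c).prism r j := by
  ext t : 2
  have h1 : i.succ.insertNth (α := fun _ => unitInterval) c t 0 = t 0 := by
    rw [← Fin.succ_succAbove_zero i, Fin.insertNth_apply_succAbove]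
  have h2 : Fin.tail (i.succ.insertNth (α := fun _ => unitInterval) c t) =
      i.insertNth (α := fun _ => unitInterval) c (Fin.tail t) := by
    funext k
    refine Fin.succAboveCases i ?_ (fun l => ?_) k
    · simp [Fin.tail]
    · rw [Fin.tail, ← Fin.succ_succAbove_succ, Fin.insertNth_apply_succAbove,
        Fin.insertNth_apply_succAbove, Fin.tail]
  simp only [face, prism, h1, h2]

lemma IsDegenerate.prism {σ : SmoothCube d m} (h : σ.IsDegenerate) (r : ℝ) (j : Fin d) :
    (σ.prism r j).IsDegenerate := by
  obtain ⟨i, hi⟩ := h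
  refine ⟨i.succ, fun t u htu => ?_⟩
  have h0 : t 0 = u 0 := htu 0 (Fin.succ_ne_zero i).symm
  have h1 : σ.toFun (Fin.tail t) = σ.toFun (Fin.tail u) :=
    hi _ _ fun k hk => htu k.succ fun h => hk (Fin.succ_injective _ h)
  simp only [SmoothCube.prism, h0, h1]

end SmoothCube

/-- The linear form `v ↦ ξ · v`. -/
def mdotL {𝕜 : Type*} [NontriviallyNormedField 𝕜] {d : ℕ} (ξ : Fin (d + 1) → 𝕜) :
    (Fin (d + 1) → 𝕜) →L[𝕜] 𝕜 :=
  ξ 0 • ContinuousLinearMap.proj 0 - ∑ i : Fin d, ξ i.succ • ContinuousLinearMap.proj i.succ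

lemma mdotL_apply {𝕜 : Type*} [NontriviallyNormedField 𝕜] {d : ℕ} (ξ v : Fin (d + 1) → 𝕜) :
    mdotL ξ v = mdot ξ v := by
  simp [mdotL, mdot]

lemma hasFDerivAt_mdot_self {𝕜 : Type*} [NontriviallyNormedField 𝕜] {d : ℕ}
    (ξ : Fin (d + 1) → 𝕜) :
    HasFDerivAt (fun ξ => mdot ξ ξ) ((2 : 𝕜) • mdotL ξ) ξ := by
  have h1 : ∀ k : Fin (d + 1), HasFDerivAt (fun ξ : Fin (d + 1) → 𝕜 => ξ k * ξ k)
      (ξ k • ContinuousLinearMap.proj k + ξ k • ContinuousLinearMap.proj k) ξ := fun k =>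
    (hasFDerivAt_apply (𝕜 := 𝕜) k ξ).mul (hasFDerivAt_apply (𝕜 := 𝕜) k ξ)
  refine ((h1 0).sub (HasFDerivAt.fun_sum fun i _ => h1 i.succ)).congr_fderiv ?_
  ext1 v
  simp [mdotL, Finset.sum_add_distrib]
  ring

/-- Differentiating `ξ·ξ = 0` along the cube gives the orthogonality of tangent vectors to `ξ` that
`alphaForm_boost` requires. -/
lemma mdot_fderiv_eq_zero {d m : ℕ} {σ : SmoothCube d m} {g : (Fin m → ℝ) → (Fin (d + 1) → ℝ)}
    (hg : ContDiff ℝ ∞ g) (h : Set.EqOn σ.ext' g (Set.Icc 0 1)) {x : Fin m → ℝ}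
    (hx : x ∈ Set.Icc (0 : Fin m → ℝ) 1) (v : Fin m → ℝ) : mdot (g x) (fderiv ℝ g x v) = 0 := by
  have h1 := ((hasFDerivAt_mdot_self (g x)).comp x
    (hg.differentiable (by simp) x).hasFDerivAt).hasFDerivWithinAt (s := Set.Icc (0 : Fin m → ℝ) 1)
  have h2 : HasFDerivWithinAt ((fun ξ => mdot ξ ξ) ∘ g) (0 : (Fin m → ℝ) →L[ℝ] ℝ)
      (Set.Icc (0 : Fin m → ℝ) 1) x := by
    refine (hasFDerivWithinAt_const (0 : ℝ) x _).congr (fun y hy => ?_) ?_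
    · rw [Function.comp_apply, ← h hy, (σ.ext'_mem y).1]
    · rw [Function.comp_apply, ← h hx, (σ.ext'_mem x).1]
  have h3 := congrArg (fun L : (Fin m → ℝ) →L[ℝ] ℝ => L v) ((uniqueDiffOn_Icc_pi m x hx).eq h1 h2)
  simpa [mdotL_apply] using h3

lemma cubeIntegral_boosted {n : ℕ} (F : (Fin (n + 1 + 1) → ℝ) → ℂ) (r : ℝ) (j : Fin (n + 1))
    (σ : SmoothCube (n + 1) n) :
    cubeIntegral F (σ.boosted r j) =
      cubeIntegral (fun ξ => F (boost (Real.cosh r) (Real.sinh r) j ξ)) σ := by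
  obtain ⟨g, hg, h⟩ := σ.exists_extension
  let B := LinearMap.toContinuousLinearMap (boost (Real.cosh r) (Real.sinh r) j)
  have hB : ContDiff ℝ ∞ fun x => B (g x) := B.contDiff.comp hg
  have hBσ : Set.EqOn (σ.boosted r j).ext' (fun x => B (g x)) (Set.Icc 0 1) := fun x hx => by
    simp only
    rw [← h hx]
    rfl
  refine MeasureTheory.setIntegral_congr_fun measurableSet_Icc fun x hx => ?_
  have h1 : fderiv ℝ (fun x => B (g x)) x = B.comp (fderiv ℝ g x) :=
    (B.hasFDerivAt.comp x (hg.differentiable (by simp) x).hasFDerivAt).fderiv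
  have h2 := alphaForm_boost r j (ξ := g x) (by rw [← h hx]; exact σ.ext'_mem x)
    (v := fun b => fderiv ℝ g x (Pi.single b 1)) fun b => mdot_fderiv_eq_zero hg h hx _
  simp only
  rw [SmoothCube.fderivWithin_ext' hB hBσ hx, SmoothCube.fderivWithin_ext' hg h hx, hBσ hx, h hx,
    ← h2, h1]
  rfl

/-- Integrals of closed forms `F α` over cycles are invariant under boosts. -/
theorem IsConeDensity.chainIntegral_boost {n : ℕ} (hn : 1 ≤ n) {F : (Fin (n + 1 + 1) → ℝ) → ℂ}
    (hF : IsConeDensity F) {γ : Chain (n + 1) n} (hγ : IsCycle γ) (r : ℝ) (j : Fin (n + 1)) :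
    chainIntegral (fun ξ => F (boost (Real.cosh r) (Real.sinh r) j ξ)) γ = chainIntegral F γ := by
  -- In degree zero `IsCycle` is vacuous; only for positive degree does it say that the boundary is
  -- degenerate.
  obtain ⟨m, rfl⟩ : ∃ m, n = m + 1 := ⟨n - 1, by omega⟩
  have h1 : boundary γ ∈ degenerateChains (m + 1 + 1) m := hγ
  -- Prisms over degenerate cubes are degenerate, so the side faces of the total prism contribute
  -- nothing.
  have h2 : chainSum (fun ρ => cubeIntegral F (ρ.prism r j)) (boundary γ) = 0 :=
    chainSum_eq_zero_of_mem_degenerate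
      (fun σ hσ => cubeIntegral_eq_zero_of_isDegenerate F (hσ.prism r j)) h1
  rw [chainSum_boundary] at h2
  -- Stokes on the prism over `σ`: the side faces account for the difference between the boosted and
  -- the original cube.
  have h3 : ∀ σ : SmoothCube (m + 1 + 1) (m + 1), ∑ i : Fin (m + 1), (-1 : ℂ) ^ (i : ℕ) *
      (cubeIntegral F ((σ.face i 1).prism r j) - cubeIntegral F ((σ.face i 0).prism r j)) =
      cubeIntegral (fun ξ => F (boost (Real.cosh r) (Real.sinh r) j ξ)) σ - cubeIntegral F σ := by
    intro σ
    have h4 := hF.stokes_cube (σ.prism r j)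
    rw [Fin.sum_univ_succ, SmoothCube.face_prism_zero_zero, SmoothCube.face_prism_zero_one,
      cubeIntegral_boosted] at h4
    simp only [SmoothCube.face_prism_succ, Fin.val_succ, pow_succ, mul_neg_one, neg_mul,
      Finset.sum_neg_distrib, Fin.val_zero, pow_zero, one_mul] at h4
    linear_combination -h4
  simp only [h3] at h2
  rw [chainIntegral, chainIntegral, ← sub_eq_zero, ← h2, chainSum_apply, ← Finsupp.sum_sub]
  exact Finsupp.sum_congr fun σ _ => by ring

/-! ### The integral of `(ξ · Z)^(-n)` over a cycle -/

lemma add_mem_openCone {d : ℕ} {x y : Fin (d + 1) → ℝ} (hx : x ∈ openCone d)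
    (hy : y ∈ openCone d) : x + y ∈ openCone d := by
  refine ⟨?_, add_pos hx.2 hy.2⟩
  have h1 := mdot_pos hx.1.le hx.2 hy
  have := hx.1
  have := hy.1
  rw [mdot_add_left, mdot_add_right, mdot_add_right, mdot_comm y x]
  linarith

lemma smul_mem_openCone {d : ℕ} {x : Fin (d + 1) → ℝ} (hx : x ∈ openCone d) {r : ℝ} (hr : 0 < r) :
    r • x ∈ openCone d := by
  refine ⟨?_, mul_pos hr hx.2⟩
  rw [mdot_smul_left, mdot_smul_right]
  exact mul_pos hr (mul_pos hr hx.1)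

lemma continuous_mdot {R : Type*} [CommRing R] [TopologicalSpace R] [IsTopologicalRing R] {d : ℕ}
    {X : Type*} [TopologicalSpace X] {f g : X → Fin (d + 1) → R} (hf : Continuous f)
    (hg : Continuous g) : Continuous fun x => mdot (f x) (g x) := by
  unfold mdot
  fun_prop

lemma isOpen_openCone (d : ℕ) : IsOpen (openCone d) :=
  (isOpen_lt continuous_const (continuous_mdot continuous_id continuous_id)).inter
    (isOpen_lt continuous_const (continuous_apply 0))

/-- The ambient past tube `ℝ^(d+1) - i V₊`. -/
def ambientPast (d : ℕ) : Set (Fin (d + 1) → ℂ) := {z | (fun i => -(z i).im) ∈ openCone d}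

/-- The ambient future tube `ℝ^(d+1) + i V₊`. -/
def ambientFuture (d : ℕ) : Set (Fin (d + 1) → ℂ) := {z | (fun i => (z i).im) ∈ openCone d}

lemma isOpen_ambientPast (d : ℕ) : IsOpen (ambientPast d) :=
  (isOpen_openCone d).preimage (by fun_prop)

lemma isOpen_ambientFuture (d : ℕ) : IsOpen (ambientFuture d) :=
  (isOpen_openCone d).preimage (by fun_prop)

lemma neg_mem_ambientPast {d : ℕ} {z : Fin (d + 1) → ℂ} (hz : z ∈ ambientFuture d) :
    -z ∈ ambientPast d := by
  simpa [ambientPast, ambientFuture] using hz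

lemma add_mem_ambientPast {d : ℕ} {z w : Fin (d + 1) → ℂ} (hz : z ∈ ambientPast d)
    (hw : w ∈ ambientPast d) : z + w ∈ ambientPast d := by
  have h : (fun i => -((z + w) i).im) = (fun i => -(z i).im) + fun i => -(w i).im := by
    funext i
    simp [add_comm]
  rw [ambientPast, Set.mem_ofPred_eq, h]
  exact add_mem_openCone hz hw

lemma smul_mem_ambientPast {d : ℕ} {z : Fin (d + 1) → ℂ} (hz : z ∈ ambientPast d) {r : ℝ}
    (hr : 0 < r) : (r : ℂ) • z ∈ ambientPast d := by
  have h : (fun i => -(((r : ℂ) • z) i).im) = r • fun i => -(z i).im := by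
    funext i
    simp
  rw [ambientPast, Set.mem_ofPred_eq, h]
  exact smul_mem_openCone hz hr

lemma convex_ambientPast (d : ℕ) : Convex ℝ (ambientPast d) := by
  rw [convex_iff_forall_pos]
  intro x hx y hy a b ha hb _
  have := add_mem_ambientPast (smul_mem_ambientPast hx ha) (smul_mem_ambientPast hy hb)
  convert! this using 1

lemma mdot_re_im {d : ℕ} (z w : Fin (d + 1) → ℂ) :
    (mdot z w).re = mdot (fun i => (z i).re) (fun i => (w i).re) -
      mdot (fun i => (z i).im) (fun i => (w i).im) ∧
    (mdot z w).im = mdot (fun i => (z i).re) (fun i => (w i).im) +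
      mdot (fun i => (z i).im) (fun i => (w i).re) := by
  constructor
  · simp only [mdot, Complex.sub_re, Complex.mul_re, Complex.re_sum, Finset.sum_sub_distrib]
    ring
  · simp only [mdot, Complex.sub_im, Complex.mul_im, Complex.im_sum, Finset.sum_add_distrib]
    ring

lemma mdot_toC_im {d : ℕ} (ξ : Fin (d + 1) → ℝ) (z : Fin (d + 1) → ℂ) :
    (mdot (toC ξ) z).im = mdot ξ fun i => (z i).im := by
  rw [(mdot_re_im _ _).2]
  simp [toC, mdot]

lemma mdot_toC_im_neg {d : ℕ} {ξ : Fin (d + 1) → ℝ} (hξ : ξ ∈ lightCone d) {z : Fin (d + 1) → ℂ}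
    (hz : z ∈ ambientPast d) : (mdot (toC ξ) z).im < 0 := by
  have h1 := mdot_lightCone_pos hξ hz
  have h2 : (fun i => -(z i).im) = -fun i => (z i).im := rfl
  rw [h2, mdot_neg_right] at h1
  rw [mdot_toC_im]
  linarith

lemma mdot_toC_im_pos {d : ℕ} {ξ : Fin (d + 1) → ℝ} (hξ : ξ ∈ lightCone d) {z : Fin (d + 1) → ℂ}
    (hz : z ∈ ambientFuture d) : 0 < (mdot (toC ξ) z).im := by
  rw [mdot_toC_im]
  exact mdot_lightCone_pos hξ hz

/-- Write `z = x - iy`. If `-z·z` were real and nonpositive, then `x·y = 0` and `x·x ≥ y·y > 0`, but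
two timelike vectors are never orthogonal. -/
lemma neg_mdot_self_mem_slitPlane {d : ℕ} {z : Fin (d + 1) → ℂ} (hz : z ∈ ambientPast d) :
    -mdot z z ∈ Complex.slitPlane := by
  by_contra h
  rw [Complex.mem_slitPlane_iff, not_or, not_lt, not_not] at h
  obtain ⟨h1, h2⟩ := h
  let x : Fin (d + 1) → ℝ := fun i => (z i).re
  let y : Fin (d + 1) → ℝ := fun i => -(z i).im
  have hy : y ∈ openCone d := hz
  have hyi : (fun i => (z i).im) = -y := by funext i; simp [y]
  rw [Complex.neg_re, (mdot_re_im z z).1, hyi, mdot_neg_left, mdot_neg_right] at h1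
  rw [Complex.neg_im, (mdot_re_im z z).2, hyi, mdot_neg_left, mdot_neg_right,
    mdot_comm y (fun i => (z i).re)] at h2
  have hxy : mdot x y = 0 := by linarith
  have hxx : 0 < mdot x x := by have := hy.1; linarith
  rcases lt_trichotomy (x 0) 0 with h0 | h0 | h0
  · have := mdot_pos (x := -x) (by rw [mdot_neg_left, mdot_neg_right, neg_neg]; exact hxx.le)
      (by simpa using h0) hy
    rw [mdot_neg_left, hxy] at this
    simp at this
  · simp only [mdot, h0] at hxx
    have : 0 ≤ ∑ i : Fin d, x i.succ * x i.succ := Finset.sum_nonneg fun i _ => mul_self_nonneg _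
    linarith
  · exact (mdot_pos hxx.le h0 hy).ne' hxy

lemma toC_boost {d : ℕ} (C S : ℝ) (j : Fin d) (ξ : Fin (d + 1) → ℝ) :
    toC (boost C S j ξ) = boost (C : ℂ) (S : ℂ) j (toC ξ) := by
  funext k
  refine Fin.cases ?_ (fun i => ?_) k
  · simp [toC, boost_zero]
  · by_cases h : i = j <;> simp [toC, boost_succ, h]

lemma toC_smul {d : ℕ} (r : ℝ) (ξ : Fin (d + 1) → ℝ) : toC (r • ξ) = (r : ℂ) • toC ξ := by
  funext k
  simp [toC]

lemma contDiff_mdot {E : Type*} [NormedAddCommGroup E] [NormedSpace ℂ E] {d : ℕ}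
    {f g : E → Fin (d + 1) → ℂ} {N : ℕ∞ω} (hf : ContDiff ℂ N f) (hg : ContDiff ℂ N g) :
    ContDiff ℂ N fun x => mdot (f x) (g x) := by
  have hf' := contDiff_pi.1 hf
  have hg' := contDiff_pi.1 hg
  exact ((hf' 0).mul (hg' 0)).sub (ContDiff.sum fun i _ => (hf' _).mul (hg' _))

lemma differentiableAt_mdot_toC {d : ℕ} (z : Fin (d + 1) → ℂ) (ξ : Fin (d + 1) → ℝ) :
    DifferentiableAt ℝ (fun ξ => mdot (toC ξ) z) ξ := by
  have h : ∀ k : Fin (d + 1), DifferentiableAt ℝ (fun ξ : Fin (d + 1) → ℝ => ((ξ k : ℝ) : ℂ)) ξ :=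
    fun k => Complex.ofRealCLM.differentiableAt.comp ξ (differentiableAt_apply k ξ)
  exact ((h 0).mul_const _).sub (DifferentiableAt.fun_sum fun i _ => (h i.succ).mul_const _)

/-! ### The integral as a function on the past tube -/

/-- `∫_γ (ξ · Z)^(-n) α(ξ)`. -/
def poissonIntegral {n : ℕ} (γ : Chain (n + 1) n) (z : Fin (n + 1 + 1) → ℂ) : ℂ :=
  chainIntegral (fun ξ => (mdot (toC ξ) z ^ n)⁻¹) γ

lemma isConeDensity_inv_pow {n : ℕ} {z : Fin (n + 1 + 1) → ℂ} (hz : z ∈ ambientPast (n + 1)) :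
    IsConeDensity fun ξ => (mdot (toC ξ) z ^ n)⁻¹ := by
  intro ξ hξ
  have h0 : mdot (toC ξ) z ≠ 0 := fun h => by
    have := mdot_toC_im_neg hξ hz
    rw [h] at this
    exact lt_irrefl _ this
  refine ⟨?_, fun r _ => ?_⟩
  · exact ((differentiableAt_mdot_toC z ξ).pow n).fun_inv (pow_ne_zero n h0)
  · simp only
    rw [toC_smul, mdot_smul_left, mul_pow, mul_inv]

lemma differentiableAt_poissonIntegral {n : ℕ} (γ : Chain (n + 1) n) {z : Fin (n + 1 + 1) → ℂ}
    (hz : z ∈ ambientPast (n + 1)) : DifferentiableAt ℂ (poissonIntegral γ) z := by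
  let O : Set ((Fin (n + 1 + 1) → ℂ) × (Fin (n + 1 + 1) → ℂ)) := {p | mdot p.2 p.1 ≠ 0}
  have hc : ContDiff ℂ 1 fun p : (Fin (n + 1 + 1) → ℂ) × (Fin (n + 1 + 1) → ℂ) => mdot p.2 p.1 :=
    contDiff_mdot contDiff_snd contDiff_fst
  have hO : IsOpen O := isOpen_ne_fun hc.continuous continuous_const
  obtain ⟨L, hL, -⟩ := hasFDerivAt_chainIntegral (Ψ := fun p => (mdot p.2 p.1 ^ n)⁻¹) hO
    ((hc.pow n).contDiffOn.inv fun p hp => pow_ne_zero n hp) (p₀ := z) (fun ξ hξ h => by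
      have := mdot_toC_im_neg hξ hz
      simp only at h
      rw [h] at this
      exact lt_irrefl _ this) γ
  exact hL.differentiableAt

/-- The invariance of the product moves the boost from `Z` to `ξ` with opposite rapidity, where
`IsConeDensity.chainIntegral_boost` absorbs it. -/
lemma poissonIntegral_boost {n : ℕ} (hn : 1 ≤ n) {γ : Chain (n + 1) n} (hγ : IsCycle γ)
    {z : Fin (n + 1 + 1) → ℂ} (hz : z ∈ ambientPast (n + 1)) (r : ℝ) (j : Fin (n + 1)) :
    poissonIntegral γ (boost (Real.cosh r : ℂ) (Real.sinh r : ℂ) j z) = poissonIntegral γ z := by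
  rw [poissonIntegral, poissonIntegral,
    ← (isConeDensity_inv_pow hz).chainIntegral_boost hn hγ (-r) j]
  refine chainIntegral_congr (fun ξ _ => ?_) γ
  have h : (Real.cosh r : ℂ) ^ 2 - (Real.sinh r : ℂ) ^ 2 = 1 := by
    exact_mod_cast Real.cosh_sq_sub_sinh_sq r
  rw [← mdot_boost h j (toC (boost _ _ j ξ)) z, toC_boost, boost_boost]
  congr 3
  have h1 : (Real.cosh r : ℂ) * (Real.cosh (-r) : ℂ) + (Real.sinh r : ℂ) * (Real.sinh (-r) : ℂ) = 1 := by
    rw [Real.cosh_neg, Real.sinh_neg, ← h]; push_cast; ring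
  have h2 : (Real.sinh r : ℂ) * (Real.cosh (-r) : ℂ) + (Real.cosh r : ℂ) * (Real.sinh (-r) : ℂ) = 0 := by
    rw [Real.cosh_neg, Real.sinh_neg]; push_cast; ring
  rw [h1, h2, ← Complex.ofReal_one, ← Complex.ofReal_zero, ← toC_boost,
    SmoothCube.boost_one_zero]

/-- Infinitesimal boosts force the gradient to be proportional to `Z` and homogeneity of degree `-n`
fixes the factor. Boosts alone suffice because `z 0 ≠ 0` in the tube. -/
lemma fderiv_poissonIntegral {n : ℕ} (hn : 1 ≤ n) {γ : Chain (n + 1) n} (hγ : IsCycle γ)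
    {z : Fin (n + 1 + 1) → ℂ} (hz : z ∈ ambientPast (n + 1)) (v : Fin (n + 1 + 1) → ℂ) :
    mdot z z * fderiv ℂ (poissonIntegral γ) z v = -(n : ℂ) * poissonIntegral γ z * mdot z v := by
  have hL := (differentiableAt_poissonIntegral γ hz).hasFDerivAt
  set L := fderiv ℂ (poissonIntegral γ) z
  have hLr : HasFDerivAt (poissonIntegral γ) (L.restrictScalars ℝ) z := hL.restrictScalars ℝ
  have hz0 : z 0 ≠ 0 := fun h => by
    have := hz.2
    simp [h] at this
  -- boosts
  have hB : ∀ j : Fin (n + 1), z j.succ * L (Pi.single 0 1) + z 0 * L (Pi.single j.succ 1) = 0 := by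
    intro j
    have hc : HasDerivAt (fun r : ℝ => (Real.cosh r : ℂ)) 0 0 := by
      simpa using (Real.hasDerivAt_cosh 0).ofReal_comp
    have hs : HasDerivAt (fun r : ℝ => (Real.sinh r : ℂ)) 1 0 := by
      simpa using (Real.hasDerivAt_sinh 0).ofReal_comp
    have h1 : HasDerivAt (fun r : ℝ => boost (Real.cosh r : ℂ) (Real.sinh r : ℂ) j z)
        (z j.succ • Pi.single 0 1 + z 0 • Pi.single j.succ 1) 0 := by
      rw [hasDerivAt_pi]
      intro k
      refine Fin.cases ?_ (fun i => ?_) k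
      · have := (hc.mul_const (z 0)).fun_add (hs.mul_const (z j.succ))
        simpa [boost_zero] using this
      · by_cases h : i = j
        · have := (hs.mul_const (z 0)).fun_add (hc.mul_const (z j.succ))
          simpa [boost_succ, h] using this
        · simp only [boost_succ, h, if_false]
          simpa [h] using hasDerivAt_const (0 : ℝ) (z i.succ)
    have hz' : boost (Real.cosh 0 : ℂ) (Real.sinh 0 : ℂ) j z = z := by
      funext k
      refine Fin.cases ?_ (fun i => ?_) k
      · simp [boost_zero]
      · by_cases h : i = j <;> simp [boost_succ, h]
    have h2 : HasDerivAt (fun r : ℝ => poissonIntegral γ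
        (boost (Real.cosh r : ℂ) (Real.sinh r : ℂ) j z)) _ 0 :=
      HasFDerivAt.comp_hasDerivAt (l' := L.restrictScalars ℝ) (l := poissonIntegral γ) 0
        (by rw [hz']; exact hLr) h1
    simp only [poissonIntegral_boost hn hγ hz] at h2
    have h3 := h2.unique (hasDerivAt_const (0 : ℝ) (poissonIntegral γ z))
    simpa using h3
  -- homogeneity
  have hE : L z = -(n : ℂ) * poissonIntegral γ z := by
    have h1 : HasDerivAt (fun r : ℂ => r • z) z 1 := by
      simpa using (hasDerivAt_id (1 : ℂ)).smul_const z
    have h2 : HasDerivAt (fun r : ℂ => poissonIntegral γ (r • z)) (L z) 1 :=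
      HasFDerivAt.comp_hasDerivAt (l := poissonIntegral γ) 1 (by rw [one_smul]; exact hL) h1
    have h3 : (fun r : ℂ => poissonIntegral γ (r • z)) =
        fun r => (r ^ n)⁻¹ * poissonIntegral γ z := by
      funext r
      rw [poissonIntegral, poissonIntegral, ← chainIntegral_const_mul]
      refine chainIntegral_congr (fun ξ _ => ?_) γ
      rw [mdot_smul_right, mul_pow, mul_inv]
    rw [h3] at h2
    have h4 : HasDerivAt (fun r : ℂ => (r ^ n)⁻¹ * poissonIntegral γ z)
        (-(n : ℂ) * poissonIntegral γ z) 1 := by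
      refine HasDerivAt.mul_const ?_ _
      have := (hasDerivAt_pow n (1 : ℂ)).fun_inv (by simp)
      simpa using this
    exact h2.unique h4
  have hexp : ∀ v : Fin (n + 1 + 1) → ℂ, L v = v 0 * L (Pi.single 0 1) +
      ∑ j : Fin (n + 1), v j.succ * L (Pi.single j.succ 1) := by
    intro v
    have h6 : v = ∑ i, v i • (Pi.single i 1 : Fin (n + 1 + 1) → ℂ) := by
      simpa [Pi.basisFun_apply] using ((Pi.basisFun ℂ (Fin (n + 1 + 1))).sum_repr v).symm
    conv_lhs => rw [h6]
    rw [map_sum, Fin.sum_univ_succ]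
    simp
  -- Each boost equation expresses a spatial partial derivative through the time derivative.
  have hv : ∀ v, z 0 * L v = mdot z v * L (Pi.single 0 1) := by
    intro v
    have h1 : ∀ j : Fin (n + 1), z 0 * (v j.succ * L (Pi.single j.succ 1)) =
        -(z j.succ * v j.succ) * L (Pi.single 0 1) := fun j => by
      linear_combination v j.succ * hB j
    rw [hexp v, mul_add, Finset.mul_sum, Finset.sum_congr rfl fun j _ => h1 j, ← Finset.sum_mul,
      Finset.sum_neg_distrib, mdot]
    ring
  refine mul_left_cancel₀ hz0 ?_
  have e1 := hv v
  have e2 := hv z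
  rw [hE] at e2
  linear_combination mdot z z * e1 - mdot z v * e2

/-- Up to a constant, `∫_γ (ξ · Z)^(-n) α(ξ)` is `(-Z · Z)^(-n/2)`. -/
theorem poissonIntegral_eq {n : ℕ} (hn : 1 ≤ n) {γ : Chain (n + 1) n} (hγ : IsCycle γ)
    {z : Fin (n + 1 + 1) → ℂ} (hz : z ∈ ambientPast (n + 1)) :
    poissonIntegral γ z =
      poissonIntegral γ (Pi.single 0 (-Complex.I)) * (-mdot z z) ^ (-(n : ℂ) / 2) := by
  -- The differentials of the two factors cancel by the preceding identity, so `H` is constant on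
  -- the convex tube.
  let H : (Fin (n + 1 + 1) → ℂ) → ℂ := fun z => (-mdot z z) ^ ((n : ℂ) / 2) * poissonIntegral γ z
  have hH : ∀ w ∈ ambientPast (n + 1), HasFDerivAt H (0 : (Fin (n + 1 + 1) → ℂ) →L[ℂ] ℂ) w := by
    intro w hw
    have hs := neg_mdot_self_mem_slitPlane hw
    have h0 : HasDerivAt (fun u : ℂ => u ^ ((n : ℂ) / 2))
        ((n : ℂ) / 2 * (-mdot w w) ^ ((n : ℂ) / 2 - 1)) (-mdot w w) := by
      simpa using (hasDerivAt_id (-mdot w w)).cpow_const (c := (n : ℂ) / 2) hs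
    have h1 := h0.comp_hasFDerivAt w (hasFDerivAt_mdot_self w).fun_neg
    have h2 : HasFDerivAt H _ w :=
      h1.mul (differentiableAt_poissonIntegral γ hw).hasFDerivAt
    refine h2.congr_fderiv ?_
    ext1 v
    have h3 := fderiv_poissonIntegral hn hγ hw v
    have h4 : (-mdot w w) ^ ((n : ℂ) / 2) = (-mdot w w) ^ ((n : ℂ) / 2 - 1) * (-mdot w w) := by
      rw [Complex.cpow_sub _ _ (Complex.slitPlane_ne_zero hs), Complex.cpow_one,
        div_mul_cancel₀ _ (Complex.slitPlane_ne_zero hs)]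
    simp only [FunLike.coe_add, Pi.add_apply, FunLike.coe_smul, Pi.smul_apply,
      FunLike.coe_neg, Pi.neg_apply, smul_eq_mul, FunLike.coe_zero, Pi.zero_apply, mdotL_apply, Function.comp_apply]
    rw [h4]
    linear_combination -(-mdot w w) ^ ((n : ℂ) / 2 - 1) * h3
  -- The base point `-i e₀`, where `-Z·Z = 1`.
  have he : (Pi.single 0 (-Complex.I) : Fin (n + 1 + 1) → ℂ) ∈ ambientPast (n + 1) := by
    simp [ambientPast, openCone, mdot]
  have hc : H z = H (Pi.single 0 (-Complex.I)) :=
    (isOpen_ambientPast (n + 1)).is_const_of_fderiv_eq_zero (convex_ambientPast (n + 1)).isPreconnected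
      (fun w hw => (hH w hw).differentiableAt.differentiableWithinAt) (fun w hw => (hH w hw).fderiv)
      hz he
  have h1 : -mdot (Pi.single 0 (-Complex.I)) (Pi.single 0 (-Complex.I) : Fin (n + 1 + 1) → ℂ) = 1 := by
    simp [mdot]
  simp only [H, h1, Complex.one_cpow, one_mul] at hc
  rw [← hc, neg_div, Complex.cpow_neg]
  have := Complex.slitPlane_ne_zero (neg_mdot_self_mem_slitPlane hz)
  have h2 : (-mdot z z) ^ ((n : ℂ) / 2) ≠ 0 := by simp [Complex.cpow_eq_zero_iff, this]
  field_simp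

/-! ### Feynman's parametrization -/

open MeasureTheory in
/-- Differentiation of weighted integrals over `[0,1]` depending on a complex parameter. -/
lemma hasDerivAt_weighted_integral {wt : ℝ → ℂ} (hwt : IntervalIntegrable wt volume 0 1)
    {U : Set ℂ} (hU : IsOpen U) {Φ Φ' : ℂ → ℝ → ℂ}
    (hΦ : ∀ p ∈ U, ContinuousOn (Φ p) (Set.Icc 0 1))
    (hΦ' : ContinuousOn (fun q : ℂ × ℝ => Φ' q.1 q.2) (U ×ˢ Set.Icc 0 1))
    (hd : ∀ p ∈ U, ∀ x ∈ Set.Icc (0 : ℝ) 1, HasDerivAt (fun q => Φ q x) (Φ' p x) p)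
    {p₀ : ℂ} (hp₀ : p₀ ∈ U) :
    HasDerivAt (fun p => ∫ x in (0 : ℝ)..1, wt x * Φ p x) (∫ x in (0 : ℝ)..1, wt x * Φ' p₀ x) p₀ := by
  obtain ⟨ε, hε, hball⟩ := Metric.isOpen_iff.1 hU p₀ hp₀
  have hcl : Metric.closedBall p₀ (ε / 2) ⊆ U :=
    (Metric.closedBall_subset_ball (by linarith)).trans hball
  obtain ⟨C, hC⟩ := ((isCompact_closedBall p₀ (ε / 2)).prod isCompact_Icc).exists_bound_of_continuousOn
    (hΦ'.mono (Set.prod_mono_left hcl))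
  have hsub : Set.uIoc (0 : ℝ) 1 ⊆ Set.Icc 0 1 := by
    rw [Set.uIoc_of_le zero_le_one]; exact Set.Ioc_subset_Icc_self
  have hwt' : Integrable wt (volume.restrict (Set.uIoc 0 1)) := hwt.def'
  have hmeas : ∀ g : ℝ → ℂ, ContinuousOn g (Set.Icc 0 1) →
      AEStronglyMeasurable (fun x => wt x * g x) (volume.restrict (Set.uIoc 0 1)) := fun g hg =>
    hwt'.aestronglyMeasurable.mul ((hg.mono hsub).aestronglyMeasurable measurableSet_uIoc)
  refine (intervalIntegral.hasDerivAt_integral_of_dominated_loc_of_deriv_le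
    (F := fun p x => wt x * Φ p x) (F' := fun p x => wt x * Φ' p x)
    (s := Metric.closedBall p₀ (ε / 2)) (bound := fun x => ‖wt x‖ * C)
    (Metric.closedBall_mem_nhds _ (half_pos hε)) ?_ ?_ ?_ ?_ ?_ ?_).2
  · exact Filter.eventually_of_mem (hU.mem_nhds hp₀) fun p hp => hmeas _ (hΦ p hp)
  · refine hwt.mul_continuousOn ?_
    rw [Set.uIcc_of_le zero_le_one]
    exact hΦ p₀ hp₀
  · exact hmeas _ (hΦ'.comp (f := fun x : ℝ => (p₀, x)) (t := U ×ˢ Set.Icc 0 1)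
      (Continuous.continuousOn (by fun_prop)) fun x hx => ⟨hp₀, hx⟩)
  · refine Filter.Eventually.of_forall fun x hx p hp => ?_
    rw [norm_mul]
    exact mul_le_mul_of_nonneg_left (hC (p, x) ⟨hp, hsub hx⟩) (norm_nonneg _)
  · exact hwt.norm.mul_const C
  · exact Filter.Eventually.of_forall fun x hx p hp => (hd p (hcl hp) x (hsub hx)).const_mul _

/-- The weight `x^(a-1) (1-x)^(b-1)` of Euler's beta integral. -/
def betaWeight (a b : ℂ) (x : ℝ) : ℂ := (x : ℂ) ^ (a - 1) * (1 - (x : ℂ)) ^ (b - 1)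

lemma intervalIntegrable_betaWeight {a b : ℂ} (ha : 0 < a.re) (hb : 0 < b.re) :
    IntervalIntegrable (betaWeight a b) MeasureTheory.volume 0 1 :=
  Complex.betaIntegral_convergent ha hb

lemma feynman_im_neg {A B : ℂ} (hA : A.im < 0) (hB : B.im < 0) {x : ℝ}
    (hx : x ∈ Set.Icc (0 : ℝ) 1) : ((x : ℂ) * A + (1 - (x : ℂ)) * B).im < 0 := by
  have h : ((x : ℂ) * A + (1 - (x : ℂ)) * B).im = x * A.im + (1 - x) * B.im := by
    simp
  rw [h]
  rcases hx.1.eq_or_lt with h0 | h0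
  · rw [← h0]; simpa using hB
  · nlinarith [mul_neg_of_pos_of_neg h0 hA, mul_nonneg (sub_nonneg.2 hx.2) (neg_pos.2 hB).le]

lemma hasDerivAt_ofReal_cpow_pos (r : ℂ) {x : ℝ} (hx : 0 < x) :
    HasDerivAt (fun x : ℝ => (x : ℂ) ^ r) (r * (x : ℂ) ^ (r - 1)) x := by
  have h : HasDerivAt (fun u : ℂ => u ^ r) (r * (x : ℂ) ^ (r - 1)) (x : ℂ) := by
    simpa using (hasDerivAt_id (x : ℂ)).cpow_const (c := r) (Or.inl hx)
  exact h.comp_ofReal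

/-- The integration by parts behind Feynman's parametrization. -/
lemma feynman_by_parts {n : ℕ} {a b : ℂ} (ha : 0 < a.re) (hb : 0 < b.re) (hab : a + b = n)
    {A B : ℂ} (hA : A.im < 0) (hB : B.im < 0) :
    ∫ x in (0 : ℝ)..1, betaWeight a b x * (a * (((x : ℂ) * A + (1 - (x : ℂ)) * B) ^ n)⁻¹ -
      n * x * A * (((x : ℂ) * A + (1 - (x : ℂ)) * B) ^ (n + 1))⁻¹) = 0 := by
  set D : ℝ → ℂ := fun x => (x : ℂ) * A + (1 - (x : ℂ)) * B with hD
  have hD0 : ∀ x ∈ Set.Icc (0 : ℝ) 1, D x ≠ 0 := fun x hx h => by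
    have := feynman_im_neg hA hB hx
    simp only [hD] at h
    rw [h] at this
    exact lt_irrefl _ this
  have hDc : Continuous D := by simp only [hD]; fun_prop
  have ha0 : a ≠ 0 := fun h => by simp [h] at ha
  have hb0 : b ≠ 0 := fun h => by simp [h] at hb
  -- A primitive of the integrand. It vanishes at both endpoints because `a` and `b` have positive
  -- real part; `a + b = n` is what brings its derivative to the stated form.
  let G : ℝ → ℂ := fun x => (x : ℂ) ^ a * (((1 - x : ℝ) : ℂ) ^ b) * (D x ^ n)⁻¹
  have hGc : ContinuousOn G (Set.Icc 0 1) := by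
    refine ContinuousOn.mul (Continuous.continuousOn ?_) ?_
    · exact (Complex.continuous_ofReal_cpow_const ha).mul
        ((Complex.continuous_ofReal_cpow_const hb).comp (by fun_prop))
    · exact (hDc.pow n).continuousOn.inv₀ fun x hx => pow_ne_zero n (hD0 x hx)
  have hGd : ∀ x ∈ Set.Ioo (0 : ℝ) 1, HasDerivAt G (betaWeight a b x * (a * (D x ^ n)⁻¹ -
      n * x * A * (D x ^ (n + 1))⁻¹)) x := by
    intro x hx
    have hDx := hD0 x ⟨hx.1.le, hx.2.le⟩
    have h1 := hasDerivAt_ofReal_cpow_pos a hx.1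
    have h2 : HasDerivAt (fun x : ℝ => ((1 - x : ℝ) : ℂ) ^ b)
        (-(b * ((1 - x : ℝ) : ℂ) ^ (b - 1))) x := by
      have := (hasDerivAt_ofReal_cpow_pos b (sub_pos.2 hx.2)).scomp x
        ((hasDerivAt_id x).const_sub 1)
      simp only [neg_one_smul] at this
      exact this
    have h3 : HasDerivAt D (A - B) x := by
      have h4 : HasDerivAt (fun x : ℝ => (x : ℂ)) 1 x := Complex.ofRealCLM.hasDerivAt
      have := (h4.mul_const A).fun_add ((h4.const_sub 1).mul_const B)
      simp only [hD]
      convert! this using 1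
      ring
    have h4 : HasDerivAt G _ x := (h1.mul h2).mul ((h3.fun_pow n).fun_inv (pow_ne_zero n hDx))
    refine h4.congr_deriv ?_
    have hx0 : (x : ℂ) ≠ 0 := by exact_mod_cast hx.1.ne'
    have hx1 : (1 - (x : ℂ)) ≠ 0 := by exact_mod_cast (sub_pos.2 hx.2).ne'
    have e1 : (x : ℂ) ^ a = (x : ℂ) ^ (a - 1) * x := by
      rw [Complex.cpow_sub _ _ hx0, Complex.cpow_one, div_mul_cancel₀ _ hx0]
    have e2 : (1 - (x : ℂ)) ^ b = (1 - (x : ℂ)) ^ (b - 1) * (1 - x) := by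
      rw [Complex.cpow_sub _ _ hx1, Complex.cpow_one, div_mul_cancel₀ _ hx1]
    simp only [Pi.mul_apply, betaWeight]
    push_cast
    rw [e1, e2]
    -- The power rule produces the truncated exponent `n - 1`, hence the separate case `n = 0`.
    rcases Nat.eq_zero_or_pos n with hn | hn
    · subst hn
      have : b = -a := by linear_combination hab
      simp [this]
      ring
    · obtain ⟨k, rfl⟩ : ∃ k, n = k + 1 := ⟨n - 1, by omega⟩
      have hDe : D x = x * A + (1 - x) * B := rfl
      have hb' : b = (k : ℂ) + 1 - a := by push_cast at hab; linear_combination hab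
      rw [hb']
      simp only [Nat.add_sub_cancel]
      field_simp
      rw [hDe]
      push_cast
      ring
  have hint : IntervalIntegrable (fun x => betaWeight a b x * (a * (D x ^ n)⁻¹ -
      n * x * A * (D x ^ (n + 1))⁻¹)) MeasureTheory.volume 0 1 := by
    refine (intervalIntegrable_betaWeight ha hb).mul_continuousOn ?_
    rw [Set.uIcc_of_le zero_le_one]
    refine ContinuousOn.sub ?_ ?_
    · exact continuousOn_const.mul
        ((hDc.pow n).continuousOn.inv₀ fun x hx => pow_ne_zero n (hD0 x hx))
    · refine ContinuousOn.mul (by fun_prop) ?_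
      exact (hDc.pow _).continuousOn.inv₀ fun x hx => pow_ne_zero _ (hD0 x hx)
  rw [intervalIntegral.integral_eq_sub_of_hasDerivAt_of_le zero_le_one hGc hGd hint]
  simp [G, Complex.zero_cpow ha0, Complex.zero_cpow hb0]

/-- **Feynman's parametrization** in the lower half-plane. -/
theorem feynman {n : ℕ} {a b : ℂ} (ha : 0 < a.re) (hb : 0 < b.re) (hab : a + b = n)
    {A B : ℂ} (hA : A.im < 0) (hB : B.im < 0) :
    ∫ x in (0 : ℝ)..1, betaWeight a b x * (((x : ℂ) * A + (1 - (x : ℂ)) * B) ^ n)⁻¹ =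
      Complex.betaIntegral a b * (A ^ (-a) * B ^ (-b)) := by
  have hU : IsOpen {A : ℂ | A.im < 0} := isOpen_lt Complex.continuous_im continuous_const
  have hD0 : ∀ A : ℂ, A.im < 0 → ∀ x ∈ Set.Icc (0 : ℝ) 1, (x : ℂ) * A + (1 - (x : ℂ)) * B ≠ 0 :=
    fun A hA x hx h => by
      have := feynman_im_neg hA hB hx
      rw [h] at this
      exact lt_irrefl _ this
  have hslit : ∀ A : ℂ, A.im < 0 → A ∈ Complex.slitPlane := fun A hA => Or.inr hA.ne
  let h : ℂ → ℂ := fun A => ∫ x in (0 : ℝ)..1, betaWeight a b x *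
    (((x : ℂ) * A + (1 - (x : ℂ)) * B) ^ n)⁻¹
  have hder : ∀ A : ℂ, A.im < 0 → HasDerivAt h (∫ x in (0 : ℝ)..1, betaWeight a b x *
      (-(n * x * (((x : ℂ) * A + (1 - (x : ℂ)) * B) ^ (n + 1))⁻¹))) A := by
    intro A hA
    refine hasDerivAt_weighted_integral (intervalIntegrable_betaWeight ha hb) hU
      (Φ := fun A x => (((x : ℂ) * A + (1 - (x : ℂ)) * B) ^ n)⁻¹)
      (Φ' := fun A x => -(n * x * (((x : ℂ) * A + (1 - (x : ℂ)) * B) ^ (n + 1))⁻¹)) ?_ ?_ ?_ hA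
    · intro p hp
      exact ContinuousOn.inv₀ (by fun_prop) fun x hx => pow_ne_zero n (hD0 p hp x hx)
    · refine ContinuousOn.neg (ContinuousOn.mul (by fun_prop) ?_)
      exact ContinuousOn.inv₀ (by fun_prop) fun q hq => pow_ne_zero _ (hD0 q.1 hq.1 q.2 hq.2)
    · intro p hp x hx
      have h0 := hD0 p hp x hx
      have h1 : HasDerivAt (fun q : ℂ => (x : ℂ) * q + (1 - (x : ℂ)) * B) x p := by
        simpa using ((hasDerivAt_id p).const_mul (x : ℂ)).add_const ((1 - (x : ℂ)) * B)
      refine ((h1.fun_pow n).fun_inv (pow_ne_zero n h0)).congr_deriv ?_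
      rcases Nat.eq_zero_or_pos n with hn | hn
      · subst hn; simp
      · obtain ⟨k, rfl⟩ : ∃ k, n = k + 1 := ⟨n - 1, by omega⟩
        simp only [Nat.add_sub_cancel]
        field_simp
        ring
  -- The integration by parts is Euler's equation `A h'(A) = -a h(A)`.
  have hode : ∀ A : ℂ, (hA : A.im < 0) → A * (∫ x in (0 : ℝ)..1, betaWeight a b x *
      (-(n * x * (((x : ℂ) * A + (1 - (x : ℂ)) * B) ^ (n + 1))⁻¹))) = -(a * h A) := by
    intro A hA
    have hp := feynman_by_parts ha hb hab hA hB
    have hi1 : IntervalIntegrable (fun x : ℝ => betaWeight a b x *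
        (((x : ℂ) * A + (1 - (x : ℂ)) * B) ^ n)⁻¹) MeasureTheory.volume 0 1 := by
      refine (intervalIntegrable_betaWeight ha hb).mul_continuousOn ?_
      rw [Set.uIcc_of_le zero_le_one]
      exact ContinuousOn.inv₀ (by fun_prop) fun x hx => pow_ne_zero _ (hD0 A hA x hx)
    have hi2 : IntervalIntegrable (fun x : ℝ => betaWeight a b x *
        (-(n * x * (((x : ℂ) * A + (1 - (x : ℂ)) * B) ^ (n + 1))⁻¹))) MeasureTheory.volume 0 1 := by
      refine (intervalIntegrable_betaWeight ha hb).mul_continuousOn ?_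
      rw [Set.uIcc_of_le zero_le_one]
      refine ContinuousOn.neg (ContinuousOn.mul (by fun_prop) ?_)
      exact ContinuousOn.inv₀ (by fun_prop) fun x hx => pow_ne_zero _ (hD0 A hA x hx)
    have hsum : (∫ x in (0 : ℝ)..1, betaWeight a b x *
        (a * (((x : ℂ) * A + (1 - (x : ℂ)) * B) ^ n)⁻¹ -
        n * x * A * (((x : ℂ) * A + (1 - (x : ℂ)) * B) ^ (n + 1))⁻¹)) =
        a * h A + A * ∫ x in (0 : ℝ)..1, betaWeight a b x *
      (-(n * x * (((x : ℂ) * A + (1 - (x : ℂ)) * B) ^ (n + 1))⁻¹)) := by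
      simp only [h]
      rw [← intervalIntegral.integral_const_mul, ← intervalIntegral.integral_const_mul,
        ← intervalIntegral.integral_add (hi1.const_mul a) (hi2.const_mul A)]
      refine intervalIntegral.integral_congr fun x _ => ?_
      ring
    rw [hsum] at hp
    linear_combination hp
  -- By Euler's equation this is constant on the lower half-plane, so it may be evaluated at `A =
  -- B`.
  let H : ℂ → ℂ := fun A => A ^ a * h A
  have hH : ∀ A : ℂ, A.im < 0 → HasDerivAt H 0 A := by
    intro A hA
    have hA0 := Complex.slitPlane_ne_zero (hslit A hA)
    have h1 : HasDerivAt (fun u : ℂ => u ^ a) (a * A ^ (a - 1)) A := by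
      simpa using (hasDerivAt_id A).cpow_const (c := a) (hslit A hA)
    refine (h1.mul (hder A hA)).congr_deriv ?_
    have h2 := hode A hA
    have e1 : A ^ a = A ^ (a - 1) * A := by
      rw [Complex.cpow_sub _ _ hA0, Complex.cpow_one, div_mul_cancel₀ _ hA0]
    rw [e1]
    linear_combination A ^ (a - 1) * h2
  have hconn : IsPreconnected {A : ℂ | A.im < 0} := (convex_halfSpace_im_lt 0).isPreconnected
  have hc : H A = H B := hU.is_const_of_deriv_eq_zero hconn
    (fun w hw => (hH w hw).differentiableAt.differentiableWithinAt) (fun w hw => (hH w hw).deriv) hA hB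
  -- At `A = B` the denominator no longer depends on `x` and a beta integral remains.
  have hB1 : h B = Complex.betaIntegral a b * (B ^ n)⁻¹ := by
    simp only [h]
    rw [Complex.betaIntegral, ← intervalIntegral.integral_mul_const]
    refine intervalIntegral.integral_congr fun x _ => ?_
    simp only [betaWeight]
    congr 3
    ring
  have hA0 := Complex.slitPlane_ne_zero (hslit A hA)
  have hB0 := Complex.slitPlane_ne_zero (hslit B hB)
  have hAa : A ^ a ≠ 0 := by simp [Complex.cpow_eq_zero_iff, hA0]
  have hBn : B ^ n = B ^ a * B ^ b := by
    rw [← Complex.cpow_add _ _ hB0, hab, Complex.cpow_natCast]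
  have hBa : B ^ a ≠ 0 := by simp [Complex.cpow_eq_zero_iff, hB0]
  have hBb : B ^ b ≠ 0 := by simp [Complex.cpow_eq_zero_iff, hB0]
  simp only [H] at hc
  rw [hB1, hBn] at hc
  rw [Complex.cpow_neg, Complex.cpow_neg]
  change h A = _
  field_simp
  field_simp at hc
  linear_combination hc

/-! ### The plane wave integral in the strip `|Im ν| < n / 2` -/

-- Fubini. The weight may be singular at the endpoints and is only integrable, while `f` is bounded
-- on the compact product; integrability follows from that of the product of the two weights.
open MeasureTheory in
lemma integral_mul_cubeIntegral {n : ℕ} {wt : ℝ → ℂ} (hwt : IntervalIntegrable wt volume 0 1)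
    {f : ℝ → (Fin (n + 1 + 1) → ℝ) → ℂ}
    (hf : ContinuousOn (fun q : ℝ × (Fin (n + 1 + 1) → ℝ) => f q.1 q.2)
      (Set.Icc 0 1 ×ˢ lightCone (n + 1))) (σ : SmoothCube (n + 1) n) :
    IntervalIntegrable (fun x => wt x * cubeIntegral (f x) σ) volume 0 1 ∧
    ∫ x in (0 : ℝ)..1, wt x * cubeIntegral (f x) σ =
      cubeIntegral (fun ξ => ∫ x in (0 : ℝ)..1, wt x * f x ξ) σ := by
  have hc : ContinuousOn (fun q : ℝ × (Fin n → ℝ) => f q.1 (σ.ext' q.2)) (Set.Icc 0 1 ×ˢ Set.Icc 0 1) :=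
    hf.comp (continuousOn_fst.prodMk ((continuousOn_ext' σ).comp continuousOn_snd fun q hq => hq.2))
      fun q hq => ⟨hq.1, σ.ext'_mem _⟩
  obtain ⟨C, hC⟩ := (isCompact_Icc.prod isCompact_Icc).exists_bound_of_continuousOn hc
  have hsub : Set.Ioc (0 : ℝ) 1 ×ˢ Set.Icc (0 : Fin n → ℝ) 1 ⊆ Set.Icc 0 1 ×ˢ Set.Icc 0 1 :=
    Set.prod_mono_left Set.Ioc_subset_Icc_self
  have hI : Integrable (Function.uncurry fun (x : ℝ) (y : Fin n → ℝ) =>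
      f x (σ.ext' y) * (wt x * cubeWeight σ y))
      ((volume.restrict (Set.Ioc (0 : ℝ) 1)).prod (volume.restrict (Set.Icc (0 : Fin n → ℝ) 1))) := by
    refine Integrable.bdd_mul (c := C)
      (f := fun q : ℝ × (Fin n → ℝ) => f q.1 (σ.ext' q.2))
      (g := fun q : ℝ × (Fin n → ℝ) => wt q.1 * cubeWeight σ q.2) ?_ ?_ ?_
    · exact Integrable.mul_prod hwt.1
        ((continuousOn_cubeWeight σ).integrableOn_compact isCompact_Icc)
    · rw [Measure.prod_restrict]
      exact (hc.mono hsub).aestronglyMeasurable (measurableSet_Ioc.prod measurableSet_Icc)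
    · rw [Measure.prod_restrict]
      exact (ae_restrict_iff' (measurableSet_Ioc.prod measurableSet_Icc)).2
        (Filter.Eventually.of_forall fun q hq => hC q (hsub hq))
  simp only [cubeIntegral_eq_weight, intervalIntegral.integral_of_le zero_le_one]
  have hx : ∀ x, wt x * ∫ y in Set.Icc (0 : Fin n → ℝ) 1, f x (σ.ext' y) * cubeWeight σ y =
      ∫ y in Set.Icc (0 : Fin n → ℝ) 1, f x (σ.ext' y) * (wt x * cubeWeight σ y) := fun x => by
    rw [← integral_const_mul]
    refine integral_congr_ae (Filter.Eventually.of_forall fun y => ?_)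
    simp only
    ring
  simp only [hx]
  refine ⟨(intervalIntegrable_iff_integrableOn_Ioc_of_le zero_le_one).2 hI.integral_prod_left, ?_⟩
  calc _ = _ := integral_integral_swap hI
    _ = _ := by
        refine integral_congr_ae (Filter.Eventually.of_forall fun y => ?_)
        simp only
        rw [← integral_mul_const]
        refine integral_congr_ae (Filter.Eventually.of_forall fun x => ?_)
        simp only
        ring

open MeasureTheory in
lemma integral_mul_chainIntegral {n : ℕ} {wt : ℝ → ℂ} (hwt : IntervalIntegrable wt volume 0 1)
    {f : ℝ → (Fin (n + 1 + 1) → ℝ) → ℂ}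
    (hf : ContinuousOn (fun q : ℝ × (Fin (n + 1 + 1) → ℝ) => f q.1 q.2)
      (Set.Icc 0 1 ×ˢ lightCone (n + 1))) (γ : Chain (n + 1) n) :
    ∫ x in (0 : ℝ)..1, wt x * chainIntegral (f x) γ =
      chainIntegral (fun ξ => ∫ x in (0 : ℝ)..1, wt x * f x ξ) γ := by
  simp only [chainIntegral, Finsupp.sum, Finset.mul_sum]
  rw [intervalIntegral.integral_finsetSum]
  · refine Finset.sum_congr rfl fun σ _ => ?_
    rw [← (integral_mul_cubeIntegral hwt hf σ).2, ← intervalIntegral.integral_const_mul]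
    refine intervalIntegral.integral_congr fun x _ => ?_
    ring
  · intro σ _
    refine ((integral_mul_cubeIntegral hwt hf σ).1.const_mul (γ σ : ℂ)).congr fun x _ => ?_
    ring

/-- Euler's integral for `F(a, b; (a + b + 1)/2; z)` after a quadratic transformation. -/
def eulerIntegral (a b : ℂ) (z : ℂ) : ℂ :=
  ∫ x in (0 : ℝ)..1, betaWeight a b x * (1 - 4 * x * (1 - x) * z) ^ (-((a + b) / 2))

lemma continuousOn_mdot_toC_pow {n : ℕ} {z₁ z₂ : Fin (n + 1 + 1) → ℂ}
    (hz₁ : z₁ ∈ ambientPast (n + 1)) (hz₂ : z₂ ∈ ambientPast (n + 1)) :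
    ContinuousOn (fun q : ℝ × (Fin (n + 1 + 1) → ℝ) =>
      (((q.1 : ℂ) * mdot (toC q.2) z₁ + (1 - (q.1 : ℂ)) * mdot (toC q.2) z₂) ^ n)⁻¹)
      (Set.Icc 0 1 ×ˢ lightCone (n + 1)) := by
  have h : ∀ z : Fin (n + 1 + 1) → ℂ,
      Continuous fun q : ℝ × (Fin (n + 1 + 1) → ℝ) => mdot (toC q.2) z := fun z =>
    continuous_mdot (continuous_toC.comp continuous_snd) continuous_const
  have h1 := h z₁
  have h2 := h z₂
  refine ContinuousOn.inv₀ (Continuous.continuousOn (by fun_prop)) fun q hq =>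
    pow_ne_zero n fun h => ?_
  have := feynman_im_neg (mdot_toC_im_neg hq.2 hz₁) (mdot_toC_im_neg hq.2 hz₂) hq.1
  rw [h] at this
  exact lt_irrefl _ this

/-- Below the real axis, `arg (-B) = arg B + π`. Replacing `z₂` by `-z₂` brings both plane waves
into the lower half-plane, and this phase is what the factor `e^(πν)` later compensates. -/
lemma neg_cpow_of_im_neg {B : ℂ} (hB : B.im < 0) (s : ℂ) :
    (-B) ^ s = Complex.exp (Real.pi * Complex.I * s) * B ^ s := by
  have hB0 : B ≠ 0 := fun h => by simp [h] at hB
  rw [Complex.cpow_def_of_ne_zero (neg_ne_zero.2 hB0), Complex.cpow_def_of_ne_zero hB0,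
    ← Complex.exp_add]
  congr 1
  rw [Complex.log, Complex.log, norm_neg, Complex.arg_neg_eq_arg_add_pi_of_im_neg hB]
  push_cast
  ring

lemma neg_mdot_feynman {d : ℕ} {z₁ z₂ : Fin (d + 1) → ℂ} (h₁ : z₁ ∈ complexDS d)
    (h₂ : z₂ ∈ complexDS d) (x : ℂ) :
    -mdot (x • z₁ + (1 - x) • (-z₂)) (x • z₁ + (1 - x) • (-z₂)) =
      1 - 4 * x * (1 - x) * ((1 - mdot z₁ z₂) / 2) := by
  have e1 : mdot z₁ z₁ = -1 := h₁
  have e2 : mdot z₂ z₂ = -1 := h₂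
  simp only [mdot_add_left, mdot_add_right, mdot_smul_left, mdot_smul_right, mdot_neg_left,
    mdot_neg_right, e1, e2, mdot_comm z₂ z₁]
  ring

lemma feynman_mem_ambientPast {d : ℕ} {z₁ z₂ : Fin (d + 1) → ℂ} (h₁ : z₁ ∈ ambientPast d)
    (h₂ : z₂ ∈ ambientPast d) {x : ℝ} (hx : x ∈ Set.Icc (0 : ℝ) 1) :
    (x : ℂ) • z₁ + (1 - (x : ℂ)) • z₂ ∈ ambientPast d := by
  have := convex_ambientPast d h₁ h₂ hx.1 (sub_nonneg.2 hx.2) (by ring)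
  have e : (x : ℂ) • z₁ + (1 - (x : ℂ)) • z₂ = x • z₁ + (1 - x) • z₂ := by
    funext i
    simp
  rwa [e]

/-- The midpoint `Z = (z₁ - z₂)/2` lies in the ambient past tube and `-Z·Z = (1 + ζ)/2` there, which
must avoid the negative half-line. -/
lemma mdot_mem_cutPlane {d : ℕ} {z₁ z₂ : Fin (d + 1) → ℂ} (h₁ : z₁ ∈ pastTube d)
    (h₂ : z₂ ∈ futureTube d) : mdot z₁ z₂ ∈ cutPlane := by
  rintro ⟨r, hr, h⟩
  have h3 := neg_mdot_self_mem_slitPlane (feynman_mem_ambientPast h₁.2 (neg_mem_ambientPast h₂.2)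
    (x := 1 / 2) ⟨by norm_num, by norm_num⟩)
  rw [neg_mdot_feynman h₁.1 h₂.1, h] at h3
  have h4 : 1 - 4 * ((1 / 2 : ℝ) : ℂ) * (1 - ((1 / 2 : ℝ) : ℂ)) * ((1 - (r : ℂ)) / 2) =
      (((1 + r) / 2 : ℝ) : ℂ) := by
    push_cast; ring
  rw [h4, Complex.ofReal_mem_slitPlane] at h3
  linarith

/-- The parameters `(d-1)/2 ± iν` of the plane waves. -/
def waveParam (n : ℕ) (ν : ℂ) : ℂ := (n : ℂ) / 2 + Complex.I * ν

lemma waveParam_add_neg (n : ℕ) (ν : ℂ) : waveParam n ν + waveParam n (-ν) = n := by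
  simp only [waveParam]; ring

lemma waveParam_re (n : ℕ) (ν : ℂ) : (waveParam n ν).re = n / 2 - ν.im := by
  simp [waveParam, sub_eq_add_neg]

lemma waveIntegral_eq_chainIntegral {n : ℕ} (ν : ℂ) (γ : Chain (n + 1) n)
    (z₁ z₂ : Fin (n + 1 + 1) → ℂ) : waveIntegral ν γ z₁ z₂ = chainIntegral (fun ξ =>
      mdot (toC ξ) z₁ ^ (-waveParam n ν) * mdot (toC ξ) z₂ ^ (-waveParam n (-ν))) γ := by
  have h1 : -(((n + 1 : ℕ) : ℂ) - 1) / 2 - Complex.I * ν = -waveParam n ν := by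
    simp only [waveParam]; push_cast; ring
  have h2 : -(((n + 1 : ℕ) : ℂ) - 1) / 2 + Complex.I * ν = -waveParam n (-ν) := by
    simp only [waveParam]; push_cast; ring
  rw [waveIntegral, h1, h2]
  rfl

/-- Feynman's formula merges the two waves into one power `(ξ·Z)^(-n)`. After exchanging the
integrals, the cycle integral is a power of `-Z·Z`, which involves the two points only through `ζ`.
-/
theorem betaIntegral_mul_waveIntegral {n : ℕ} (hn : 1 ≤ n) {γ : Chain (n + 1) n} (hγ : IsCycle γ)
    {ν : ℂ} (hν : |ν.im| < n / 2) {z₁ z₂ : Fin (n + 1 + 1) → ℂ} (h₁ : z₁ ∈ pastTube (n + 1))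
    (h₂ : z₂ ∈ futureTube (n + 1)) :
    Complex.betaIntegral (waveParam n ν) (waveParam n (-ν)) * waveIntegral ν γ z₁ z₂ =
      Complex.exp (-(Real.pi * Complex.I * waveParam n (-ν))) *
        poissonIntegral γ (Pi.single 0 (-Complex.I)) *
        eulerIntegral (waveParam n ν) (waveParam n (-ν)) ((1 - mdot z₁ z₂) / 2) := by
  have ha : 0 < (waveParam n ν).re := by
    rw [waveParam_re]; linarith [(abs_lt.1 hν).2]
  have hb : 0 < (waveParam n (-ν)).re := by
    rw [waveParam_re, Complex.neg_im]; linarith [(abs_lt.1 hν).1]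
  have hab := waveParam_add_neg n ν
  set a := waveParam n ν
  set b := waveParam n (-ν)
  have h₂' := neg_mem_ambientPast h₂.2
  have hwt := intervalIntegrable_betaWeight ha hb
  have hpt : ∀ ξ ∈ lightCone (n + 1), Complex.betaIntegral a b *
      (mdot (toC ξ) z₁ ^ (-a) * mdot (toC ξ) z₂ ^ (-b)) =
      Complex.exp (-(Real.pi * Complex.I * b)) * ∫ x in (0 : ℝ)..1, betaWeight a b x *
        (((x : ℂ) * mdot (toC ξ) z₁ + (1 - (x : ℂ)) * mdot (toC ξ) (-z₂)) ^ n)⁻¹ := by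
    intro ξ hξ
    have hB := mdot_toC_im_neg hξ h₂'
    rw [feynman ha hb hab (mdot_toC_im_neg hξ h₁.2) hB]
    have h3 : mdot (toC ξ) z₂ ^ (-b) = Complex.exp (-(Real.pi * Complex.I * b)) *
        mdot (toC ξ) (-z₂) ^ (-b) := by
      rw [← mul_neg, ← neg_cpow_of_im_neg hB, mdot_neg_right, neg_neg]
    rw [h3]
    ring
  rw [waveIntegral_eq_chainIntegral, ← chainIntegral_const_mul, chainIntegral_congr hpt,
    chainIntegral_const_mul, ← integral_mul_chainIntegral hwt (continuousOn_mdot_toC_pow h₁.2 h₂'),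
    mul_assoc (Complex.exp _)]
  congr 1
  unfold eulerIntegral
  rw [← intervalIntegral.integral_const_mul]
  refine intervalIntegral.integral_congr fun x hx => ?_
  rw [Set.uIcc_of_le zero_le_one] at hx
  have h3 := poissonIntegral_eq hn hγ (feynman_mem_ambientPast h₁.2 h₂' hx)
  rw [neg_mdot_feynman h₁.1 h₂.1] at h3
  have h4 : poissonIntegral γ ((x : ℂ) • z₁ + (1 - (x : ℂ)) • -z₂) = chainIntegral (fun ξ =>
      (((x : ℂ) * mdot (toC ξ) z₁ + (1 - (x : ℂ)) * mdot (toC ξ) (-z₂)) ^ n)⁻¹) γ := by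
    refine chainIntegral_congr (fun ξ _ => ?_) γ
    rw [mdot_add_right, mdot_smul_right, mdot_smul_right]
  rw [← h4, h3, hab, neg_div]
  ring

/-! ### Plane waves -/

lemma cpow_ofReal_mul {r : ℝ} (hr : 0 < r) {w : ℂ} (hw : w ≠ 0) (s : ℂ) :
    ((r : ℂ) * w) ^ s = (r : ℂ) ^ s * w ^ s := by
  have hr0 : (r : ℂ) ≠ 0 := by exact_mod_cast hr.ne'
  rw [Complex.cpow_def_of_ne_zero (mul_ne_zero hr0 hw), Complex.cpow_def_of_ne_zero hr0,
    Complex.cpow_def_of_ne_zero hw, ← Complex.exp_add, Complex.log_ofReal_mul hr hw,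
    Complex.ofReal_log hr.le]
  ring_nf

/-- The two exponents add up to `-n`, the degree that makes the form closed. -/
lemma isConeDensity_planeWaves {n : ℕ} (ν : ℂ) {z₁ z₂ : Fin (n + 1 + 1) → ℂ}
    (h₁ : z₁ ∈ ambientPast (n + 1)) (h₂ : z₂ ∈ ambientFuture (n + 1)) :
    IsConeDensity (n := n) fun ξ =>
      mdot (toC ξ) z₁ ^ (-waveParam n ν) * mdot (toC ξ) z₂ ^ (-waveParam n (-ν)) := by
  intro ξ hξ
  have hA := mdot_toC_im_neg hξ h₁
  have hB := mdot_toC_im_pos hξ h₂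
  refine ⟨?_, fun r hr => ?_⟩
  · refine DifferentiableAt.mul ?_ ?_
    · exact (((hasDerivAt_id _).cpow_const (Or.inr hA.ne)).differentiableAt.restrictScalars ℝ).comp ξ
        (differentiableAt_mdot_toC z₁ ξ)
    · exact (((hasDerivAt_id _).cpow_const (Or.inr hB.ne')).differentiableAt.restrictScalars ℝ).comp ξ
        (differentiableAt_mdot_toC z₂ ξ)
  · simp only
    have hr0 : (r : ℂ) ≠ 0 := by exact_mod_cast hr.ne'
    rw [toC_smul, mdot_smul_left, mdot_smul_left, cpow_ofReal_mul hr fun h => by simp [h] at hA,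
      cpow_ofReal_mul hr fun h => by simp [h] at hB]
    have : (r : ℂ) ^ n = (r : ℂ) ^ (waveParam n ν) * (r : ℂ) ^ (waveParam n (-ν)) := by
      rw [← Complex.cpow_add _ _ hr0, waveParam_add_neg, Complex.cpow_natCast]
    rw [this, mul_inv, Complex.cpow_neg, Complex.cpow_neg (r : ℂ)]
    ring

theorem waveIntegral_eq_of_homologous {n : ℕ} (ν : ℂ) {γ γ' : Chain (n + 1) n}
    (h : Homologous γ γ') {z₁ z₂ : Fin (n + 1 + 1) → ℂ}
    (h₁ : z₁ ∈ ambientPast (n + 1)) (h₂ : z₂ ∈ ambientFuture (n + 1)) :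
    waveIntegral ν γ z₁ z₂ = waveIntegral ν γ' z₁ z₂ := by
  rw [waveIntegral_eq_chainIntegral, waveIntegral_eq_chainIntegral]
  exact (isConeDensity_planeWaves ν h₁ h₂).chainIntegral_eq_of_homologous h

/-! ### Holomorphy of chain integrals -/

lemma chainIntegral_finset_sum {n : ℕ} {ι : Type*} (s : Finset ι)
    {F : ι → (Fin (n + 1 + 1) → ℝ) → ℂ} (hF : ∀ i ∈ s, ContinuousOn (F i) (lightCone (n + 1)))
    (γ : Chain (n + 1) n) :
    chainIntegral (fun ξ => ∑ i ∈ s, F i ξ) γ = ∑ i ∈ s, chainIntegral (F i) γ := by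
  have h : ∀ σ : SmoothCube (n + 1) n,
      cubeIntegral (fun ξ => ∑ i ∈ s, F i ξ) σ = ∑ i ∈ s, cubeIntegral (F i) σ := fun σ => by
    simp only [cubeIntegral_eq_weight, Finset.sum_mul]
    refine MeasureTheory.integral_finsetSum _ fun i hi => ?_
    exact (((hF i hi).comp (continuousOn_ext' σ) fun x _ => σ.ext'_mem x).mul
      (continuousOn_cubeWeight σ)).integrableOn_compact isCompact_Icc
  simp only [chainIntegral, Finsupp.sum, h, Finset.mul_sum]
  rw [Finset.sum_comm]

/-- The set of points of analyticity is open and contains the required slice, so it serves as the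
domain of the differentiation lemma. -/
lemma hasFDerivAt_chainIntegral_of_analyticAt {n : ℕ} {P : Type*} [NormedAddCommGroup P]
    [NormedSpace ℂ P] {Ψ : P × (Fin (n + 1 + 1) → ℂ) → ℂ} {p₀ : P}
    (h : ∀ ξ ∈ lightCone (n + 1), AnalyticAt ℂ Ψ (p₀, toC ξ)) (γ : Chain (n + 1) n) :
    ∃ L : P →L[ℂ] ℂ, HasFDerivAt (fun p => chainIntegral (fun ξ => Ψ (p, toC ξ)) γ) L p₀ ∧
      ∀ v, L v = chainIntegral (fun ξ => fderiv ℂ Ψ (p₀, toC ξ) (v, 0)) γ :=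
  hasFDerivAt_chainIntegral (O := {p | AnalyticAt ℂ Ψ p}) (isOpen_analyticAt ℂ Ψ)
    (fun _ hp => (AnalyticAt.contDiffAt hp).contDiffWithinAt) h γ

lemma hasDerivAt_chainIntegral {n : ℕ} {Ψ : ℂ × (Fin (n + 1 + 1) → ℂ) → ℂ} {s : ℂ}
    (h : ∀ ξ ∈ lightCone (n + 1), AnalyticAt ℂ Ψ (s, toC ξ)) (γ : Chain (n + 1) n) :
    HasDerivAt (fun s => chainIntegral (fun ξ => Ψ (s, toC ξ)) γ)
      (chainIntegral (fun ξ => fderiv ℂ Ψ (s, toC ξ) (1, 0)) γ) s := by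
  obtain ⟨L, hL, hv⟩ := hasFDerivAt_chainIntegral_of_analyticAt h γ
  rw [← hv]
  exact hL.hasDerivAt

lemma iteratedDeriv_two_eq {φ φ₁ : ℂ → ℂ} {c s : ℂ}
    (h : ∀ᶠ t in nhds s, HasDerivAt φ (φ₁ t) t) (h₁ : HasDerivAt φ₁ c s) :
    iteratedDeriv 2 φ s = c := by
  have h2 : deriv φ =ᶠ[nhds s] φ₁ := h.mono fun t ht => ht.deriv
  rw [iteratedDeriv_succ, iteratedDeriv_one, h2.deriv_eq, h₁.deriv]

lemma iteratedDeriv_two_chainIntegral {n : ℕ} {Ψ : ℂ × (Fin (n + 1 + 1) → ℂ) → ℂ} {s : ℂ}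
    (h : ∀ᶠ t in nhds s, ∀ ξ ∈ lightCone (n + 1), AnalyticAt ℂ Ψ (t, toC ξ))
    (γ : Chain (n + 1) n) :
    iteratedDeriv 2 (fun s => chainIntegral (fun ξ => Ψ (s, toC ξ)) γ) s =
      chainIntegral (fun ξ => iteratedDeriv 2 (fun t => Ψ (t, toC ξ)) s) γ := by
  have hd : ∀ {Φ : ℂ × (Fin (n + 1 + 1) → ℂ) → ℂ} {t : ℂ} {q : Fin (n + 1 + 1) → ℂ},
      AnalyticAt ℂ Φ (t, q) →
      HasDerivAt (fun t => Φ (t, q)) (fderiv ℂ Φ (t, q) (1, 0)) t := fun hΦ =>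
    HasFDerivAt.comp_hasDerivAt _ hΦ.differentiableAt.hasFDerivAt
      ((hasDerivAt_id _).prodMk (hasDerivAt_const _ _))
  have h1 : ∀ {t : ℂ} {q : Fin (n + 1 + 1) → ℂ}, AnalyticAt ℂ Ψ (t, q) →
      AnalyticAt ℂ (fun p => fderiv ℂ Ψ p (1, 0)) (t, q) := fun hΦ =>
    ((ContinuousLinearMap.apply ℂ ℂ ((1 : ℂ), (0 : Fin (n + 1 + 1) → ℂ))).analyticAt _).comp
      (AnalyticAt.fderiv hΦ)
  rw [iteratedDeriv_two_eq (h.mono fun t ht => hasDerivAt_chainIntegral ht γ)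
    (hasDerivAt_chainIntegral (fun ξ hξ => h1 (h.self_of_nhds ξ hξ)) γ)]
  refine chainIntegral_congr (fun ξ hξ => ?_) γ
  rw [iteratedDeriv_two_eq (h.mono fun t ht => hd (ht ξ hξ))
    (hd (h1 (h.self_of_nhds ξ hξ)))]

lemma analyticAt_mdot {E : Type*} [NormedAddCommGroup E] [NormedSpace ℂ E] {d : ℕ}
    {f g : E → Fin (d + 1) → ℂ} {x : E} (hf : AnalyticAt ℂ f x) (hg : AnalyticAt ℂ g x) :
    AnalyticAt ℂ (fun x => mdot (f x) (g x)) x := by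
  have hf' := analyticAt_pi_iff.1 hf
  have hg' := analyticAt_pi_iff.1 hg
  refine ((hf' 0).mul (hg' 0)).sub ?_
  refine Finset.analyticAt_fun_sum _ fun i _ => (hf' _).mul (hg' _)

lemma mem_slitPlane_of_im_neg {z : ℂ} (h : z.im < 0) : z ∈ Complex.slitPlane := Or.inr h.ne
lemma mem_slitPlane_of_im_pos {z : ℂ} (h : 0 < z.im) : z ∈ Complex.slitPlane := Or.inr h.ne'

/-- Joint holomorphy in `(ν, z₁, z₂)` serves both the holomorphy on the tubes and the continuation
in `ν`. -/
theorem differentiableAt_waveIntegral {n : ℕ} (γ : Chain (n + 1) n) (ν : ℂ)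
    {z₁ z₂ : Fin (n + 1 + 1) → ℂ} (h₁ : z₁ ∈ ambientPast (n + 1))
    (h₂ : z₂ ∈ ambientFuture (n + 1)) :
    DifferentiableAt ℂ (fun p : ℂ × (Fin (n + 1 + 1) → ℂ) × (Fin (n + 1 + 1) → ℂ) =>
      waveIntegral p.1 γ p.2.1 p.2.2) (ν, z₁, z₂) := by
  let Ψ : (ℂ × (Fin (n + 1 + 1) → ℂ) × (Fin (n + 1 + 1) → ℂ)) × (Fin (n + 1 + 1) → ℂ) → ℂ :=
    fun q => mdot q.2 q.1.2.1 ^ (-waveParam n q.1.1) * mdot q.2 q.1.2.2 ^ (-waveParam n (-q.1.1))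
  have hP : ∀ {W : Type} [NormedAddCommGroup W] [NormedSpace ℂ W]
      {f : (ℂ × (Fin (n + 1 + 1) → ℂ) × (Fin (n + 1 + 1) → ℂ)) × (Fin (n + 1 + 1) → ℂ) → W}
      {x : (ℂ × (Fin (n + 1 + 1) → ℂ) × (Fin (n + 1 + 1) → ℂ)) × (Fin (n + 1 + 1) → ℂ)},
      ContDiff ℂ ω f → AnalyticAt ℂ f x := fun hf => hf.contDiffAt.analyticAt
  obtain ⟨L, hL, -⟩ := hasFDerivAt_chainIntegral_of_analyticAt (Ψ := Ψ) (p₀ := (ν, z₁, z₂))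
    (fun ξ hξ => by
      refine AnalyticAt.mul ?_ ?_
      · refine AnalyticAt.cpow (analyticAt_mdot analyticAt_snd (hP (by fun_prop))) (hP ?_)
          (mem_slitPlane_of_im_neg (mdot_toC_im_neg hξ h₁))
        unfold waveParam
        fun_prop
      · refine AnalyticAt.cpow (analyticAt_mdot analyticAt_snd (hP (by fun_prop))) (hP ?_)
          (mem_slitPlane_of_im_pos (mdot_toC_im_pos hξ h₂))
        unfold waveParam
        fun_prop) γ
  simp only [waveIntegral_eq_chainIntegral]
  exact hL.differentiableAt

theorem holomorphicOn_waveIntegral {n : ℕ} (γ : Chain (n + 1) n) (ν : ℂ) :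
    HolomorphicOn (pastTube (n + 1) ×ˢ futureTube (n + 1))
      (fun p => waveIntegral ν γ p.1 p.2) := fun _ hp =>
  ⟨ambientPast (n + 1) ×ˢ ambientFuture (n + 1),
    (isOpen_ambientPast _).prod (isOpen_ambientFuture _), ⟨hp.1.2, hp.2.2⟩, _,
    fun _ hq => ((differentiableAt_waveIntegral γ ν hq.1 hq.2).comp _
      ((differentiableAt_const ν).prodMk differentiableAt_id)).differentiableWithinAt,
    fun _ _ => rfl⟩

lemma differentiable_waveIntegral_param {n : ℕ} (γ : Chain (n + 1) n)
    {z₁ z₂ : Fin (n + 1 + 1) → ℂ} (h₁ : z₁ ∈ ambientPast (n + 1))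
    (h₂ : z₂ ∈ ambientFuture (n + 1)) :
    Differentiable ℂ (fun ν => waveIntegral ν γ z₁ z₂) := fun ν =>
  DifferentiableAt.comp (f := fun ν : ℂ => (ν, z₁, z₂))
    (g := fun p : ℂ × (Fin (n + 1 + 1) → ℂ) × (Fin (n + 1 + 1) → ℂ) => waveIntegral p.1 γ p.2.1 p.2.2)
    ν (differentiableAt_waveIntegral γ ν h₁ h₂)
    (differentiableAt_id.prodMk (differentiableAt_const (z₁, z₂)))

/-! ### The Klein-Gordon equation -/

/-- The second derivative of a radially normalized plane wave along `z + s e`. In the application `A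
= ξ·z`, `k = ξ·e`, `p = z·e`, `ε = e·e`, and `-(z + s e)² = 1 - 2ps - εs²`. -/
lemma iteratedDeriv_two_normalized_cpow {A : ℂ} (hA : A ∈ Complex.slitPlane) (k p ε lam g : ℂ) :
    iteratedDeriv 2 (fun s : ℂ =>
      ((1 - 2 * p * s - ε * s ^ 2) ^ (-(1 / 2) : ℂ) * (A + s * k)) ^ lam * g) 0 =
      A ^ lam * (lam * (lam - 1) * (p + k / A) ^ 2 + lam * (3 * p ^ 2 + ε + 2 * p * k / A)) * g := by
  have hA0 : A ≠ 0 := Complex.slitPlane_ne_zero hA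
  have hu : ∀ s : ℂ, HasDerivAt (fun s : ℂ => 1 - 2 * p * s - ε * s ^ 2) (-2 * p - 2 * ε * s) s := by
    intro s
    have := (((hasDerivAt_id s).const_mul (2 * p)).const_sub 1).sub ((hasDerivAt_pow 2 s).const_mul ε)
    convert! this using 1
    simp
    ring
  have hpow : ∀ (e s : ℂ), 1 - 2 * p * s - ε * s ^ 2 ∈ Complex.slitPlane →
      HasDerivAt (fun s : ℂ => (1 - 2 * p * s - ε * s ^ 2) ^ e)
        (e * (1 - 2 * p * s - ε * s ^ 2) ^ (e - 1) * (-2 * p - 2 * ε * s)) s := fun e s hs =>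
    (hu s).cpow_const hs
  have hl : ∀ s : ℂ, HasDerivAt (fun s : ℂ => A + s * k) k s := fun s => by
    simpa using ((hasDerivAt_id s).mul_const k).const_add A
  have hh : ∀ s : ℂ, 1 - 2 * p * s - ε * s ^ 2 ∈ Complex.slitPlane →
      HasDerivAt (fun s : ℂ => (1 - 2 * p * s - ε * s ^ 2) ^ (-(1 / 2) : ℂ) * (A + s * k))
        (-(1 / 2) * (1 - 2 * p * s - ε * s ^ 2) ^ (-(1 / 2) - 1 : ℂ) * (-2 * p - 2 * ε * s)
          * (A + s * k) + (1 - 2 * p * s - ε * s ^ 2) ^ (-(1 / 2) : ℂ) * k) s := fun s hs =>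
    (hpow _ s hs).mul (hl s)
  have hu0 : (1 : ℂ) - 2 * p * 0 - ε * 0 ^ 2 = 1 := by ring
  have h1s : (1 : ℂ) - 2 * p * 0 - ε * 0 ^ 2 ∈ Complex.slitPlane := by
    rw [hu0]; exact Complex.one_mem_slitPlane
  have hh0 : ((1 : ℂ) - 2 * p * 0 - ε * 0 ^ 2) ^ (-(1 / 2) : ℂ) * (A + 0 * k) = A := by
    rw [hu0, Complex.one_cpow]; ring
  have he1 : ∀ᶠ s : ℂ in nhds 0, 1 - 2 * p * s - ε * s ^ 2 ∈ Complex.slitPlane :=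
    (hu 0).continuousAt.eventually_mem (Complex.isOpen_slitPlane.mem_nhds h1s)
  have he2 : ∀ᶠ s : ℂ in nhds 0, (1 - 2 * p * s - ε * s ^ 2) ^ (-(1 / 2) : ℂ) * (A + s * k) ∈
      Complex.slitPlane :=
    (hh 0 h1s).continuousAt.eventually_mem (Complex.isOpen_slitPlane.mem_nhds (by rwa [hh0]))
  have hA' : (1 - 2 * p * 0 - ε * 0 ^ 2) ^ (-(1 / 2) : ℂ) * (A + 0 * k) ∈ Complex.slitPlane := by
    rwa [hh0]
  rw [iteratedDeriv_two_eq (he1.and he2 |>.mono fun s hs => ((hh s hs.1).cpow_const hs.2).mul_const g)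
    (((((hh 0 h1s).cpow_const (c := lam - 1) hA').const_mul lam).mul
      (((((hpow (-(1 / 2) - 1) 0 h1s).const_mul (-(1 / 2) : ℂ)).mul
        (((hasDerivAt_id 0).const_mul (2 * ε)).const_sub (-2 * p))).mul (hl 0)).add
        ((hpow (-(1 / 2)) 0 h1s).mul_const k))).mul_const g)]
  simp only [hh0]
  simp only [Pi.mul_apply, Pi.add_apply, hu0, Complex.one_cpow, Complex.cpow_sub _ _ hA0, Complex.cpow_one, id]
  field_simp
  ring

lemma mdot_single_zero {R : Type*} [CommRing R] {d : ℕ} (x : Fin (d + 1) → R) :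
    mdot x (Pi.single 0 1) = x 0 := by
  simp [mdot]

lemma mdot_single_succ {R : Type*} [CommRing R] {d : ℕ} (x : Fin (d + 1) → R) (i : Fin d) :
    mdot x (Pi.single i.succ 1) = -x i.succ := by
  simp [mdot, Pi.single_apply, Fin.succ_ne_zero]

lemma normalize_segment {d : ℕ} {z : Fin (d + 1) → ℂ} (hz : z ∈ complexDS d)
    (e : Fin (d + 1) → ℂ) (t : ℂ) :
    -mdot (z + t • e) (z + t • e) = 1 - 2 * mdot z e * t - mdot e e * t ^ 2 := by
  have e1 : mdot z z = -1 := hz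
  simp only [mdot_add_left, mdot_add_right, mdot_smul_left, mdot_smul_right, e1, mdot_comm e z]
  ring

/-- A plane wave of exponent `lam` is an eigenfunction of `box` with eigenvalue `lam (lam + d - 1)`.
The contraction with the metric uses only `z·z = -1`, `ξ·ξ = 0` and the number `n + 2` of
coordinates. -/
theorem box_chainIntegral {n : ℕ} {g : (Fin (n + 1 + 1) → ℂ) → ℂ} {T : Set (Fin (n + 1 + 1) → ℂ)}
    {lam : ℂ} (γ : Chain (n + 1) n) (hg : ∀ ξ ∈ lightCone (n + 1), AnalyticAt ℂ g (toC ξ))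
    (hT : IsOpen T) (hs : ∀ w ∈ T, ∀ ξ ∈ lightCone (n + 1), mdot (toC ξ) w ∈ Complex.slitPlane)
    {z : Fin (n + 1 + 1) → ℂ} (hz : z ∈ T) (hzd : z ∈ complexDS (n + 1)) :
    box (fun z => chainIntegral (fun ξ => mdot (toC ξ) z ^ lam * g (toC ξ)) γ) z =
      (lam ^ 2 + n * lam) * chainIntegral (fun ξ => mdot (toC ξ) z ^ lam * g (toC ξ)) γ := by
  let F : (Fin (n + 1 + 1) → ℂ) → (Fin (n + 1 + 1) → ℝ) → ℂ := fun e ξ =>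
    mdot (toC ξ) z ^ lam * (lam * (lam - 1) *
      (mdot z e + mdot (toC ξ) e / mdot (toC ξ) z) ^ 2 + lam * (3 * mdot z e ^ 2 +
        mdot e e + 2 * mdot z e * mdot (toC ξ) e / mdot (toC ξ) z)) * g (toC ξ)
  have hD : ∀ e : Fin (n + 1 + 1) → ℂ, iteratedDeriv 2 (fun s : ℂ => radialExt
      (fun z => chainIntegral (fun ξ => mdot (toC ξ) z ^ lam * g (toC ξ)) γ) (z + s • e)) 0 =
      chainIntegral (F e) γ := by
    intro e
    let Ψ : ℂ × (Fin (n + 1 + 1) → ℂ) → ℂ := fun p => mdot p.2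
      (((-mdot (z + p.1 • e) (z + p.1 • e)) ^ (-(1 / 2) : ℂ)) • (z + p.1 • e)) ^ lam * g p.2
    have hl : ∀ t : ℂ, AnalyticAt ℂ (fun t : ℂ => z + t • e) t := fun t =>
      (show ContDiff ℂ ω (fun t : ℂ => z + t • e) by fun_prop).contDiffAt.analyticAt
    have hu : ∀ t : ℂ, AnalyticAt ℂ (fun t : ℂ => -mdot (z + t • e) (z + t • e)) t := fun t =>
      (analyticAt_mdot (hl t) (hl t)).neg
    have hq : ∀ t : ℂ, -mdot (z + t • e) (z + t • e) ∈ Complex.slitPlane → AnalyticAt ℂ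
        (fun t : ℂ => ((-mdot (z + t • e) (z + t • e)) ^ (-(1 / 2) : ℂ)) • (z + t • e)) t :=
      fun t ht => ((hu t).cpow analyticAt_const ht).smul (hl t)
    have h0 : -mdot (z + (0 : ℂ) • e) (z + (0 : ℂ) • e) = 1 := by
      rw [normalize_segment hzd]; ring
    have h0s : -mdot (z + (0 : ℂ) • e) (z + (0 : ℂ) • e) ∈ Complex.slitPlane := by
      rw [h0]; exact Complex.one_mem_slitPlane
    have hz0 : ((-mdot (z + (0 : ℂ) • e) (z + (0 : ℂ) • e)) ^ (-(1 / 2) : ℂ)) •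
        (z + (0 : ℂ) • e) = z := by
      rw [h0, Complex.one_cpow]; simp
    -- For small `t` the normalized point stays in the open set `T`, so analyticity holds for all
    -- `ξ` of the cone at once.
    have hev : ∀ᶠ t : ℂ in nhds 0, ∀ ξ ∈ lightCone (n + 1), AnalyticAt ℂ Ψ (t, toC ξ) := by
      filter_upwards [(hu 0).continuousAt.eventually_mem (Complex.isOpen_slitPlane.mem_nhds h0s),
        (hq 0 h0s).continuousAt.eventually_mem (hT.mem_nhds (by rwa [hz0]))] with t ht1 ht2 ξ hξ
      refine AnalyticAt.mul (AnalyticAt.cpow (analyticAt_mdot analyticAt_snd ?_) analyticAt_const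
        (hs _ ht2 ξ hξ)) ?_
      · exact AnalyticAt.fun_comp (x := (t, toC ξ)) (hq t ht1) analyticAt_fst
      · exact AnalyticAt.fun_comp (x := (t, toC ξ)) (hg ξ hξ) analyticAt_snd
    refine (iteratedDeriv_two_chainIntegral (Ψ := Ψ) hev γ).trans ?_
    refine chainIntegral_congr (fun ξ hξ => ?_) γ
    simp only [Ψ, F]
    rw [← iteratedDeriv_two_normalized_cpow (hs z hz ξ hξ)]
    simp only [mdot_smul_right, normalize_segment hzd, mdot_add_right (toC ξ) z]
  have hF : ∀ e : Fin (n + 1 + 1) → ℂ, ContinuousOn (F e) (lightCone (n + 1)) := by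
    intro e
    have hc : ∀ w : Fin (n + 1 + 1) → ℂ, ContinuousOn
        (fun ξ : Fin (n + 1 + 1) → ℝ => mdot (toC ξ) w) (lightCone (n + 1)) := fun w =>
      (continuous_mdot continuous_toC continuous_const).continuousOn
    have hdiv := (hc e).div (hc z) fun ξ hξ => Complex.slitPlane_ne_zero (hs z hz ξ hξ)
    have hgc : ContinuousOn (fun ξ : Fin (n + 1 + 1) → ℝ => g (toC ξ)) (lightCone (n + 1)) :=
      fun ξ hξ => ((hg ξ hξ).continuousAt.comp continuous_toC.continuousAt).continuousWithinAt
    have hp : ContinuousOn (fun ξ : Fin (n + 1 + 1) → ℝ => mdot (toC ξ) z ^ lam)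
        (lightCone (n + 1)) := (hc z).cpow continuousOn_const fun ξ hξ => hs z hz ξ hξ
    refine (hp.mul ((continuousOn_const.mul ((continuousOn_const.add hdiv).pow 2)).add
      (continuousOn_const.mul (continuousOn_const.add ?_)))).mul hgc
    exact (continuousOn_const.mul (hc e)).div (hc z)
      fun ξ hξ => Complex.slitPlane_ne_zero (hs z hz ξ hξ)
  let η : Fin (n + 1 + 1) → ℂ := Fin.cons 1 fun _ => -1
  have hbox : box (fun z => chainIntegral (fun ξ => mdot (toC ξ) z ^ lam * g (toC ξ)) γ) z =
      ∑ μ, chainIntegral (fun ξ => η μ * F (Pi.single μ 1) ξ) γ := by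
    simp only [box, hD, chainIntegral_const_mul, Fin.sum_univ_succ (n := n + 1), η, Fin.cons_zero,
      Fin.cons_succ, one_mul, neg_mul, Finset.sum_neg_distrib, sub_eq_add_neg]
  rw [hbox, ← chainIntegral_finset_sum (F := fun μ ξ => η μ * F (Pi.single μ 1) ξ) _
    fun μ _ => continuousOn_const.mul (hF _),
    ← chainIntegral_const_mul]
  refine chainIntegral_congr (fun ξ hξ => ?_) γ
  have hA := Complex.slitPlane_ne_zero (hs z hz ξ hξ)
  have e1 : z 0 * z 0 - ∑ i : Fin (n + 1), z i.succ * z i.succ = -1 := hzd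
  have e2 : toC ξ 0 * toC ξ 0 - ∑ i : Fin (n + 1), toC ξ i.succ * toC ξ i.succ = 0 := by
    have := hξ.1
    simp only [mdot] at this
    simp only [toC]
    exact_mod_cast congrArg (fun x : ℝ => (x : ℂ)) this
  have e3 : toC ξ 0 * z 0 - ∑ i : Fin (n + 1), toC ξ i.succ * z i.succ = mdot (toC ξ) z := rfl
  set A := mdot (toC ξ) z
  -- The spatial sums are eliminated through the three Minkowski products of `z` and `ξ`.
  have hS : ∑ i : Fin (n + 1), (lam * (lam - 1) * (-z i.succ + -toC ξ i.succ / A) ^ 2 +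
      lam * (3 * (-z i.succ) ^ 2 + -1 + 2 * (-z i.succ) * (-toC ξ i.succ) / A)) =
      (lam * (lam - 1) + 3 * lam) * (z 0 * z 0 + 1) +
      lam * (lam - 1) / A ^ 2 * (toC ξ 0 * toC ξ 0) +
      (2 * lam * (lam - 1) + 2 * lam) / A * (toC ξ 0 * z 0 - A) - (n + 1) * lam := by
    have f1 : z 0 * z 0 + 1 = ∑ i : Fin (n + 1), z i.succ * z i.succ := by linear_combination e1
    have f2 : toC ξ 0 * toC ξ 0 = ∑ i : Fin (n + 1), toC ξ i.succ * toC ξ i.succ := by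
      linear_combination e2
    have f3 : toC ξ 0 * z 0 - A = ∑ i : Fin (n + 1), toC ξ i.succ * z i.succ := by
      linear_combination e3
    have f4 : ((n : ℂ) + 1) * lam = ∑ i : Fin (n + 1), lam := by simp
    rw [f1, f2, f3, f4, Finset.mul_sum, Finset.mul_sum, Finset.mul_sum, ← Finset.sum_add_distrib,
      ← Finset.sum_add_distrib, ← Finset.sum_sub_distrib]
    refine Finset.sum_congr rfl fun i _ => ?_
    field_simp
    ring
  have hF' : ∀ e, F e ξ = A ^ lam * g (toC ξ) * (lam * (lam - 1) *
      (mdot z e + mdot (toC ξ) e / A) ^ 2 + lam * (3 * mdot z e ^ 2 +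
        mdot e e + 2 * mdot z e * mdot (toC ξ) e / A)) := fun e => by
    simp only [F, A]
    ring
  simp only [Fin.sum_univ_succ (n := n + 1), η, Fin.cons_zero, Fin.cons_succ, hF', one_mul, neg_mul,
    Finset.sum_neg_distrib, ← Finset.mul_sum, mdot_single_zero, mdot_single_succ, Pi.single_eq_same]
  simp only [← neg_mul, hS]
  field_simp
  ring

/-- For `lam = -n/2 ∓ iν` the eigenvalue `lam² + n lam` equals `-(n²/4 + ν²) = -m²`. It is even in
`ν`, so both variables have the same mass. -/
theorem kleinGordon_waveIntegral {n : ℕ} (γ : Chain (n + 1) n) (ν : ℂ)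
    {z₁ z₂ : Fin (n + 1 + 1) → ℂ} (h₁ : z₁ ∈ pastTube (n + 1)) (h₂ : z₂ ∈ futureTube (n + 1)) :
    box (fun z => waveIntegral ν γ z z₂) z₁ + massSq (n + 1) ν * waveIntegral ν γ z₁ z₂ = 0 ∧
    box (fun z => waveIntegral ν γ z₁ z) z₂ + massSq (n + 1) ν * waveIntegral ν γ z₁ z₂ = 0 := by
  have hm : ∀ ν : ℂ, (-waveParam n ν) ^ 2 + n * -waveParam n ν = -massSq (n + 1) ν := fun ν => by
    have := Complex.I_sq
    simp only [waveParam, massSq]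
    push_cast
    linear_combination ν ^ 2 * this
  have hm' : massSq (n + 1) (-ν) = massSq (n + 1) ν := by simp [massSq]
  simp only [waveIntegral_eq_chainIntegral]
  constructor
  · rw [box_chainIntegral (g := fun q => mdot q z₂ ^ (-waveParam n (-ν))) γ (fun ξ hξ => ?_)
      (isOpen_ambientPast _) (fun w hw ξ hξ => mem_slitPlane_of_im_neg (mdot_toC_im_neg hξ hw))
      h₁.2 h₁.1, hm]
    · ring
    · exact (analyticAt_mdot analyticAt_id analyticAt_const).cpow analyticAt_const
        (mem_slitPlane_of_im_pos (mdot_toC_im_pos hξ h₂.2))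
  · simp only [mul_comm (mdot (toC _) z₁ ^ (-waveParam n ν))]
    rw [box_chainIntegral (g := fun q => mdot q z₁ ^ (-waveParam n ν)) γ (fun ξ hξ => ?_)
      (isOpen_ambientFuture _) (fun w hw ξ hξ => mem_slitPlane_of_im_pos (mdot_toC_im_pos hξ hw))
      h₂.2 h₂.1, hm, hm']
    · ring
    · exact (analyticAt_mdot analyticAt_id analyticAt_const).cpow analyticAt_const
        (mem_slitPlane_of_im_neg (mdot_toC_im_neg hξ h₁.2))

/-! ### Dependence on `z₁ · z₂` and invariance -/

lemma isOpen_strip (r : ℝ) : IsOpen {ν : ℂ | |ν.im| < r} :=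
  isOpen_lt (Complex.continuous_im.abs) continuous_const

/-- Entire functions of `ν` which agree on the strip `|Im ν| < r` agree. -/
lemma eq_of_eqOn_strip {f g : ℂ → ℂ} (hf : Differentiable ℂ f) (hg : Differentiable ℂ g) {r : ℝ}
    (hr : 0 < r) (h : ∀ ν : ℂ, |ν.im| < r → f ν = g ν) (ν : ℂ) : f ν = g ν := by
  have hf' : AnalyticOnNhd ℂ f Set.univ := fun x _ => hf.analyticAt x
  have hg' : AnalyticOnNhd ℂ g Set.univ := fun x _ => hg.analyticAt x
  refine congrFun (hf'.eq_of_eventuallyEq hg' (z₀ := 0) ?_) ν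
  filter_upwards [(isOpen_strip r).mem_nhds (show (0 : ℂ) ∈ {ν : ℂ | |ν.im| < r} by simpa using hr)]
    with ν hν using h ν hν

lemma waveParam_re_pos {n : ℕ} {ν : ℂ} (hν : |ν.im| < n / 2) :
    0 < (waveParam n ν).re ∧ 0 < (waveParam n (-ν)).re := by
  constructor
  · rw [waveParam_re]; linarith [(abs_lt.1 hν).2]
  · rw [waveParam_re, Complex.neg_im]; linarith [(abs_lt.1 hν).1]

lemma betaIntegral_waveParam {n : ℕ} {ν : ℂ} (hν : |ν.im| < n / 2) :
    Complex.Gamma (waveParam n ν) * Complex.Gamma (waveParam n (-ν)) =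
      Complex.Gamma n * Complex.betaIntegral (waveParam n ν) (waveParam n (-ν)) := by
  obtain ⟨ha, hb⟩ := waveParam_re_pos hν
  rw [Complex.Gamma_mul_Gamma_eq_betaIntegral ha hb, waveParam_add_neg]

lemma betaIntegral_waveParam_ne_zero {n : ℕ} {ν : ℂ} (hν : |ν.im| < n / 2) :
    Complex.betaIntegral (waveParam n ν) (waveParam n (-ν)) ≠ 0 := fun h => by
  obtain ⟨ha, hb⟩ := waveParam_re_pos hν
  have := betaIntegral_waveParam hν
  rw [h, mul_zero] at this
  exact mul_ne_zero (Complex.Gamma_ne_zero_of_re_pos ha) (Complex.Gamma_ne_zero_of_re_pos hb) this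

/-- In the strip the explicit formula contains only `ζ`; both sides are entire in `ν`, so the
equality persists for all `ν`. -/
theorem waveIntegral_eq_of_mdot_eq {n : ℕ} (hn : 1 ≤ n) {γ : Chain (n + 1) n} (hγ : IsCycle γ)
    (ν : ℂ) {z₁ z₂ w₁ w₂ : Fin (n + 1 + 1) → ℂ} (h₁ : z₁ ∈ pastTube (n + 1))
    (h₂ : z₂ ∈ futureTube (n + 1)) (k₁ : w₁ ∈ pastTube (n + 1)) (k₂ : w₂ ∈ futureTube (n + 1))
    (h : mdot z₁ z₂ = mdot w₁ w₂) : waveIntegral ν γ z₁ z₂ = waveIntegral ν γ w₁ w₂ := by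
  refine eq_of_eqOn_strip (differentiable_waveIntegral_param γ h₁.2 h₂.2)
    (differentiable_waveIntegral_param γ k₁.2 k₂.2) (r := n / 2)
    (by have : (1 : ℝ) ≤ n := by exact_mod_cast hn
        linarith) (fun ν hν => ?_) ν
  refine mul_left_cancel₀ (betaIntegral_waveParam_ne_zero hν) ?_
  rw [betaIntegral_mul_waveIntegral hn hγ hν h₁ h₂, betaIntegral_mul_waveIntegral hn hγ hν k₁ k₂, h]

lemma mulVec_im {d : ℕ} (L : Matrix (Fin (d + 1)) (Fin (d + 1)) ℝ) (z : Fin (d + 1) → ℂ) :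
    (fun i => ((L.map (algebraMap ℝ ℂ)).mulVec z i).im) = L.mulVec fun i => (z i).im := by
  funext i
  simp [Matrix.mulVec, dotProduct]

lemma mulVec_re {d : ℕ} (L : Matrix (Fin (d + 1)) (Fin (d + 1)) ℝ) (z : Fin (d + 1) → ℂ) :
    (fun i => ((L.map (algebraMap ℝ ℂ)).mulVec z i).re) = L.mulVec fun i => (z i).re := by
  funext i
  simp [Matrix.mulVec, dotProduct]

lemma mdot_mulVec_complex {d : ℕ} {L : Matrix (Fin (d + 1)) (Fin (d + 1)) ℝ}
    (hL : ∀ x y, mdot (L.mulVec x) (L.mulVec y) = mdot x y) (z w : Fin (d + 1) → ℂ) :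
    mdot ((L.map (algebraMap ℝ ℂ)).mulVec z) ((L.map (algebraMap ℝ ℂ)).mulVec w) = mdot z w := by
  refine Complex.ext ?_ ?_
  · rw [(mdot_re_im _ _).1, (mdot_re_im _ _).1]
    simp only [mulVec_re, mulVec_im, hL]
  · rw [(mdot_re_im _ _).2, (mdot_re_im _ _).2]
    simp only [mulVec_re, mulVec_im, hL]

/-- Since `L 0 0 > 0`, the image of the time axis is future directed. If the image of `y` were past
directed, its product with that vector would be negative, contradicting invariance of the product; a
zero time component would make it spacelike or zero. -/
lemma mulVec_mem_openCone {d : ℕ} {L : Matrix (Fin (d + 1)) (Fin (d + 1)) ℝ}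
    (hL : L ∈ deSitterGroup d) {y : Fin (d + 1) → ℝ} (hy : y ∈ openCone d) :
    L.mulVec y ∈ openCone d := by
  obtain ⟨h, -, h0⟩ := hL
  refine ⟨by rw [h]; exact hy.1, ?_⟩
  have he : (Pi.single 0 1 : Fin (d + 1) → ℝ) ∈ openCone d := by simp [openCone, mdot]
  have hle : L.mulVec (Pi.single 0 1) ∈ openCone d := by
    refine ⟨by rw [h]; exact he.1, ?_⟩
    simpa using h0
  by_contra hneg
  rw [not_lt] at hneg
  rcases hneg.lt_or_eq with hlt | heq
  · have hny : -(L.mulVec y) ∈ openCone d := by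
      refine ⟨?_, by simpa using hlt⟩
      rw [mdot_neg_left, mdot_neg_right, neg_neg, h]
      exact hy.1
    have h1 := mdot_pos hle.1.le hle.2 hny
    rw [mdot_neg_right, h] at h1
    have h2 := mdot_pos he.1.le he.2 hy
    linarith
  · have h1 : 0 < mdot (L.mulVec y) (L.mulVec y) := by rw [h]; exact hy.1
    have h2 : 0 ≤ ∑ i : Fin d, L.mulVec y i.succ * L.mulVec y i.succ :=
      Finset.sum_nonneg fun i _ => mul_self_nonneg _
    rw [mdot, heq] at h1
    linarith

lemma mulVec_mem_tubes {d : ℕ} {L : Matrix (Fin (d + 1)) (Fin (d + 1)) ℝ}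
    (hL : L ∈ deSitterGroup d) {z : Fin (d + 1) → ℂ} :
    (z ∈ pastTube d → (L.map (algebraMap ℝ ℂ)).mulVec z ∈ pastTube d) ∧
    (z ∈ futureTube d → (L.map (algebraMap ℝ ℂ)).mulVec z ∈ futureTube d) := by
  have hds : z ∈ complexDS d → (L.map (algebraMap ℝ ℂ)).mulVec z ∈ complexDS d := fun h =>
    (mdot_mulVec_complex hL.1 z z).trans h
  refine ⟨fun h => ⟨hds h.1, ?_⟩, fun h => ⟨hds h.1, ?_⟩⟩
  · have := mulVec_mem_openCone hL h.2
    have e : (fun i => -((L.map (algebraMap ℝ ℂ)).mulVec z i).im) =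
        L.mulVec fun i => -(z i).im := by
      have h1 : (fun i => -(z i).im) = -fun i => (z i).im := rfl
      rw [h1, Matrix.mulVec_neg, ← mulVec_im]
      rfl
    rwa [e]
  · have := mulVec_mem_openCone hL h.2
    rwa [mulVec_im]

theorem waveIntegral_mulVec {n : ℕ} (hn : 1 ≤ n) {γ : Chain (n + 1) n} (hγ : IsCycle γ)
    (ν : ℂ) {L : Matrix (Fin (n + 1 + 1)) (Fin (n + 1 + 1)) ℝ} (hL : L ∈ deSitterGroup (n + 1))
    {z₁ z₂ : Fin (n + 1 + 1) → ℂ} (h₁ : z₁ ∈ pastTube (n + 1)) (h₂ : z₂ ∈ futureTube (n + 1)) :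
    waveIntegral ν γ ((L.map (algebraMap ℝ ℂ)).mulVec z₁) ((L.map (algebraMap ℝ ℂ)).mulVec z₂) =
      waveIntegral ν γ z₁ z₂ :=
  waveIntegral_eq_of_mdot_eq hn hγ ν ((mulVec_mem_tubes hL).1 h₁) ((mulVec_mem_tubes hL).2 h₂)
    h₁ h₂ (mdot_mulVec_complex hL.1 _ _)

/-! ### The Gauss hypergeometric function -/

/-- A nonpositive integer parameter makes all but finitely many coefficients vanish (for `c` because
the inverse of zero is zero), and the radius is infinite; otherwise it is `1`. -/
lemma one_le_radius_ordinaryHypergeometricSeries (a b c : ℂ) :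
    1 ≤ (ordinaryHypergeometricSeries ℂ a b c).radius := by
  by_cases ha : ∃ k : ℕ, a = -k
  · obtain ⟨k, rfl⟩ := ha
    rw [ordinaryHypergeometric_radius_top_of_neg_nat₁]
    exact le_top
  by_cases hb : ∃ k : ℕ, b = -k
  · obtain ⟨k, rfl⟩ := hb
    rw [ordinaryHypergeometric_radius_top_of_neg_nat₂]
    exact le_top
  by_cases hc : ∃ k : ℕ, c = -k
  · obtain ⟨k, rfl⟩ := hc
    rw [ordinaryHypergeometric_radius_top_of_neg_nat₃]
    exact le_top
  push Not at ha hb hc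
  rw [ordinaryHypergeometricSeries_radius_eq_one]
  exact fun k => ⟨fun h => ha k (by rw [h, neg_neg]), fun h => hb k (by rw [h, neg_neg]),
    fun h => hc k (by rw [h, neg_neg])⟩

lemma hasFPowerSeriesOnBall_ordinaryHypergeometric (a b c : ℂ) :
    HasFPowerSeriesOnBall (ordinaryHypergeometric a b c : ℂ → ℂ)
      (ordinaryHypergeometricSeries ℂ a b c) 0 1 :=
  ((ordinaryHypergeometricSeries ℂ a b c).hasFPowerSeriesOnBall (zero_lt_one.trans_le
    (one_le_radius_ordinaryHypergeometricSeries a b c))).mono zero_lt_one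
    (one_le_radius_ordinaryHypergeometricSeries a b c)

lemma differentiableOn_ordinaryHypergeometric (a b c : ℂ) :
    DifferentiableOn ℂ (ordinaryHypergeometric a b c : ℂ → ℂ) (Metric.ball 0 1) := by
  have := (hasFPowerSeriesOnBall_ordinaryHypergeometric a b c).differentiableOn
  rwa [← ENNReal.ofReal_one, Metric.eball_ofReal] at this

lemma iteratedDeriv_ordinaryHypergeometric (a b c : ℂ) (k : ℕ) :
    iteratedDeriv k (ordinaryHypergeometric a b c : ℂ → ℂ) 0 =
      (ascPochhammer ℂ k).eval a * (ascPochhammer ℂ k).eval b * ((ascPochhammer ℂ k).eval c)⁻¹ := by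
  have h := (hasFPowerSeriesOnBall_ordinaryHypergeometric a b c).factorial_smul 1 k
  rw [iteratedDeriv_eq_iteratedFDeriv, ← h, ordinaryHypergeometricSeries_apply_eq]
  have : (k.factorial : ℂ) ≠ 0 := by exact_mod_cast k.factorial_ne_zero
  simp only [one_pow, smul_eq_mul, mul_one, nsmul_eq_mul]
  field_simp

/-- A function holomorphic on a disc is determined by its derivatives at the center. -/
lemma eqOn_ball_of_iteratedDeriv_eq {f g : ℂ → ℂ} {r : ℝ}
    (hf : DifferentiableOn ℂ f (Metric.ball 0 r)) (hg : DifferentiableOn ℂ g (Metric.ball 0 r))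
    (h : ∀ k, iteratedDeriv k f 0 = iteratedDeriv k g 0) : Set.EqOn f g (Metric.ball 0 r) := by
  intro z hz
  rw [← Complex.taylorSeries_eq_on_ball hf hz, ← Complex.taylorSeries_eq_on_ball hg hz]
  simp only [h]

lemma ascPochhammer_succ_eval_left (k : ℕ) (a : ℂ) :
    (ascPochhammer ℂ (k + 1)).eval a = a * (ascPochhammer ℂ k).eval (a + 1) := by
  simp [ascPochhammer_succ_left]

lemma eqOn_ordinaryHypergeometric {a b c : ℂ} (hc : ∀ k : ℕ, c ≠ -k) {f : ℂ → ℂ}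
    (hf : DifferentiableOn ℂ f (Metric.ball 0 1)) (h0 : f 0 = 1)
    (h : ∀ k : ℕ, (c + k) * iteratedDeriv (k + 1) f 0 = (a + k) * (b + k) * iteratedDeriv k f 0) :
    Set.EqOn f (ordinaryHypergeometric a b c) (Metric.ball 0 1) := by
  refine eqOn_ball_of_iteratedDeriv_eq hf (differentiableOn_ordinaryHypergeometric a b c) fun k => ?_
  rw [iteratedDeriv_ordinaryHypergeometric]
  induction k with
  | zero => simp [h0]
  | succ k ih =>
    have hck : c + k ≠ 0 := fun h => hc k (eq_neg_of_add_eq_zero_left h)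
    refine mul_left_cancel₀ hck ?_
    rw [h k, ih, ascPochhammer_succ_eval, ascPochhammer_succ_eval, ascPochhammer_succ_eval, mul_inv]
    field_simp

lemma recurrence_ordinaryHypergeometric {a b c : ℂ} (hc : ∀ k : ℕ, c ≠ -k) (k : ℕ) :
    (c + k) * iteratedDeriv (k + 1) (ordinaryHypergeometric a b c : ℂ → ℂ) 0 =
      (a + k) * (b + k) * iteratedDeriv k (ordinaryHypergeometric a b c : ℂ → ℂ) 0 := by
  have hck : c + k ≠ 0 := fun h => hc k (eq_neg_of_add_eq_zero_left h)
  rw [iteratedDeriv_ordinaryHypergeometric, iteratedDeriv_ordinaryHypergeometric,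
    ascPochhammer_succ_eval, ascPochhammer_succ_eval, ascPochhammer_succ_eval, mul_inv]
  field_simp

/-- The hypergeometric differential operator. -/
def gaussOperator (a b c : ℂ) (f : ℂ → ℂ) (z : ℂ) : ℂ :=
  z * (1 - z) * deriv (deriv f) z + (c - (a + b + 1) * z) * deriv f z - a * b * f z

lemma deriv_gaussOperator (a b c : ℂ) {f : ℂ → ℂ} {U : Set ℂ} (hU : IsOpen U)
    (hf : DifferentiableOn ℂ f U) {z : ℂ} (hz : z ∈ U) :
    HasDerivAt (gaussOperator a b c f)
      (gaussOperator (a + 1) (b + 1) (c + 1) (deriv f) z) z := by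
  have h1 := hf.deriv hU
  have h2 := h1.deriv hU
  have d0 := (hf.differentiableAt (hU.mem_nhds hz)).hasDerivAt
  have d1 := (h1.differentiableAt (hU.mem_nhds hz)).hasDerivAt
  have d2 := (h2.differentiableAt (hU.mem_nhds hz)).hasDerivAt
  have e1 : HasDerivAt (fun z : ℂ => z * (1 - z)) (1 - 2 * z) z := by
    refine ((hasDerivAt_id z).mul ((hasDerivAt_id z).const_sub 1)).congr_deriv ?_
    simp
    ring
  have e2 : HasDerivAt (fun z : ℂ => c - (a + b + 1) * z) (-(a + b + 1)) z := by
    simpa using ((hasDerivAt_id z).const_mul (a + b + 1)).const_sub c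
  refine (((e1.mul d2).add (e2.mul d1)).sub (d0.const_mul (a * b))).congr_deriv ?_
  simp only [gaussOperator]
  ring

/-- Differentiation intertwines Gauss' operator with the one whose three parameters are raised by
one. At `0` its iterated derivatives are therefore the two-term recurrence of the Taylor
coefficients, so solving Gauss' equation near `0` is equivalent to that recurrence. -/
lemma iteratedDeriv_gaussOperator {U : Set ℂ} (hU : IsOpen U) (h0 : (0 : ℂ) ∈ U) (k : ℕ) :
    ∀ (a b c : ℂ) {f : ℂ → ℂ}, DifferentiableOn ℂ f U →
      iteratedDeriv k (gaussOperator a b c f) 0 =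
        (c + k) * iteratedDeriv (k + 1) f 0 - (a + k) * (b + k) * iteratedDeriv k f 0 := by
  induction k with
  | zero =>
    intro a b c f hf
    simp [gaussOperator, iteratedDeriv_one]
  | succ k ih =>
    intro a b c f hf
    have h : deriv (gaussOperator a b c f) =ᶠ[nhds 0]
        gaussOperator (a + 1) (b + 1) (c + 1) (deriv f) := by
      filter_upwards [hU.mem_nhds h0] with z hz using (deriv_gaussOperator a b c hU hf hz).deriv
    rw [iteratedDeriv_succ', h.iteratedDeriv_eq, ih _ _ _ (hf.deriv hU), ← iteratedDeriv_succ',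
      ← iteratedDeriv_succ']
    push_cast
    ring

lemma gaussOperator_ordinaryHypergeometric {a b c : ℂ} (hc : ∀ k : ℕ, c ≠ -k) {z : ℂ}
    (hz : z ∈ Metric.ball (0 : ℂ) 1) : gaussOperator a b c (ordinaryHypergeometric a b c) z = 0 := by
  have hf := differentiableOn_ordinaryHypergeometric a b c
  have hd : DifferentiableOn ℂ (gaussOperator a b c (ordinaryHypergeometric a b c))
      (Metric.ball 0 1) := fun z hz =>
    (deriv_gaussOperator a b c Metric.isOpen_ball hf hz).differentiableAt.differentiableWithinAt
  refine eqOn_ball_of_iteratedDeriv_eq (g := fun _ => 0) hd (differentiableOn_const 0)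
    (fun k => ?_) hz
  rw [iteratedDeriv_gaussOperator Metric.isOpen_ball (Metric.mem_ball_self one_pos) k a b c hf,
    recurrence_ordinaryHypergeometric hc, sub_self]
  simp

lemma eqOn_ordinaryHypergeometric_of_gaussOperator {a b c : ℂ} (hc : ∀ k : ℕ, c ≠ -k) {f : ℂ → ℂ}
    (hf : DifferentiableOn ℂ f (Metric.ball 0 1)) (h0 : f 0 = 1)
    (h : ∀ z ∈ Metric.ball (0 : ℂ) 1, gaussOperator a b c f z = 0) :
    Set.EqOn f (ordinaryHypergeometric a b c) (Metric.ball 0 1) := by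
  refine eqOn_ordinaryHypergeometric hc hf h0 fun k => ?_
  have h1 := iteratedDeriv_gaussOperator Metric.isOpen_ball (Metric.mem_ball_self one_pos) k a b c hf
  have h2 : gaussOperator a b c f =ᶠ[nhds 0] fun _ => 0 := by
    filter_upwards [Metric.isOpen_ball.mem_nhds (Metric.mem_ball_self one_pos)] with z hz
      using h z hz
  rw [h2.iteratedDeriv_eq] at h1
  rw [← sub_eq_zero, ← h1]
  simp

lemma deriv_ordinaryHypergeometric {a b c z : ℂ}
    (hz : z ∈ Metric.ball (0 : ℂ) 1) : deriv (ordinaryHypergeometric a b c : ℂ → ℂ) z =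
      a * b / c * ordinaryHypergeometric (a + 1) (b + 1) (c + 1) z := by
  have hf := differentiableOn_ordinaryHypergeometric a b c
  refine eqOn_ball_of_iteratedDeriv_eq
    (g := fun z => a * b / c * ordinaryHypergeometric (a + 1) (b + 1) (c + 1) z)
    (hf.deriv Metric.isOpen_ball)
    ((differentiableOn_ordinaryHypergeometric _ _ _).const_mul _) (fun k => ?_) hz
  rw [← iteratedDeriv_succ', iteratedDeriv_const_mul_field, iteratedDeriv_ordinaryHypergeometric,
    iteratedDeriv_ordinaryHypergeometric, ascPochhammer_succ_eval_left,
    ascPochhammer_succ_eval_left, ascPochhammer_succ_eval_left, mul_inv]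
  ring

lemma one_sub_mem_slitPlane_of_mem_ball {z : ℂ} (hz : z ∈ Metric.ball (0 : ℂ) 1) :
    1 - z ∈ Complex.slitPlane := by
  refine Or.inl ?_
  rw [mem_ball_zero_iff] at hz
  have := (Complex.re_le_norm z).trans_lt hz
  simpa using this

/-- **Euler's transformation.** -/
theorem ordinaryHypergeometric_euler {a b c : ℂ} (hc : ∀ k : ℕ, c ≠ -k) {z : ℂ}
    (hz : z ∈ Metric.ball (0 : ℂ) 1) : (ordinaryHypergeometric (c - a) (c - b) c z : ℂ) =
      (1 - z) ^ (a + b - c) * ordinaryHypergeometric a b c z := by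
  set f : ℂ → ℂ := ordinaryHypergeometric a b c
  have hf : DifferentiableOn ℂ f (Metric.ball 0 1) := differentiableOn_ordinaryHypergeometric a b c
  have hpow : ∀ s : ℂ, ∀ w ∈ Metric.ball (0 : ℂ) 1,
      HasDerivAt (fun w : ℂ => (1 - w) ^ s) (-s * (1 - w) ^ (s - 1)) w := fun s w hw => by
    simpa using ((hasDerivAt_id w).const_sub 1).cpow_const (c := s)
      (one_sub_mem_slitPlane_of_mem_ball hw)
  have hB : IsOpen (Metric.ball (0 : ℂ) 1) := Metric.isOpen_ball
  have d0 : ∀ w ∈ Metric.ball (0 : ℂ) 1, HasDerivAt f (deriv f w) w := fun w hw =>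
    (hf.differentiableAt (hB.mem_nhds hw)).hasDerivAt
  have d1 : ∀ w ∈ Metric.ball (0 : ℂ) 1, HasDerivAt (deriv f) (deriv (deriv f) w) w := fun w hw =>
    ((hf.deriv hB).differentiableAt (hB.mem_nhds hw)).hasDerivAt
  set s := a + b - c
  have e1 : ∀ w ∈ Metric.ball (0 : ℂ) 1, HasDerivAt (fun w => (1 - w) ^ s * f w)
      (-s * (1 - w) ^ (s - 1) * f w + (1 - w) ^ s * deriv f w) w := fun w hw =>
    (hpow s w hw).mul (d0 w hw)
  have e2 : ∀ w ∈ Metric.ball (0 : ℂ) 1, HasDerivAt (deriv fun w => (1 - w) ^ s * f w)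
      (-s * (-(s - 1) * (1 - w) ^ (s - 1 - 1)) * f w + -s * (1 - w) ^ (s - 1) * deriv f w +
        (-s * (1 - w) ^ (s - 1) * deriv f w + (1 - w) ^ s * deriv (deriv f) w)) w := by
    intro w hw
    refine ((((hpow (s - 1) w hw).const_mul (-s)).mul (d0 w hw)).add
      ((hpow s w hw).mul (d1 w hw))).congr_of_eventuallyEq ?_
    filter_upwards [hB.mem_nhds hw] with x hx using (e1 x hx).deriv
  -- The product satisfies Gauss' equation with parameters `c - a`, `c - b`, `c` and equals `1` at
  -- `0`, which characterizes the series.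
  refine (eqOn_ordinaryHypergeometric_of_gaussOperator (a := c - a) (b := c - b) hc
    (f := fun w => (1 - w) ^ s * f w)
    (fun w hw => (e1 w hw).differentiableAt.differentiableWithinAt) (by simp [f]) (fun w hw => ?_)
    hz).symm
  have h := gaussOperator_ordinaryHypergeometric (a := a) (b := b) hc hw
  change gaussOperator a b c f w = 0 at h
  have hw1 := Complex.slitPlane_ne_zero (one_sub_mem_slitPlane_of_mem_ball hw)
  simp only [gaussOperator, (e1 w hw).deriv, (e2 w hw).deriv] at h ⊢
  rw [Complex.cpow_sub _ _ hw1, Complex.cpow_sub _ _ hw1, Complex.cpow_one]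
  field_simp
  simp only [s]
  linear_combination (1 - w) ^ (a + b - c) * (1 - w) * h

/-! ### Analytic continuation to `ℂ \ [1, ∞)` -/

/-- The domain `ℂ \ [1, ∞)` of the Gauss hypergeometric function. -/
def gaussDomain : Set ℂ := {x | ¬ ∃ r : ℝ, 1 ≤ r ∧ x = (r : ℂ)}

lemma mem_gaussDomain_iff {z : ℂ} : z ∈ gaussDomain ↔ 1 - z ∈ Complex.slitPlane := by
  rw [← not_iff_not, gaussDomain, Set.mem_ofPred_eq, not_not, Complex.mem_slitPlane_iff, not_or,
    not_lt, not_not]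
  constructor
  · rintro ⟨r, hr, rfl⟩
    simpa using hr
  · rintro ⟨h1, h2⟩
    refine ⟨z.re, by simpa using h1, Complex.ext rfl ?_⟩
    simpa using h2

lemma isOpen_gaussDomain : IsOpen gaussDomain := by
  have : gaussDomain = (fun z => 1 - z) ⁻¹' Complex.slitPlane := Set.ext fun z => mem_gaussDomain_iff
  rw [this]
  exact Complex.isOpen_slitPlane.preimage (by fun_prop)

lemma ball_subset_gaussDomain : Metric.ball (0 : ℂ) 1 ⊆ gaussDomain := fun _ hz =>
  mem_gaussDomain_iff.2 (one_sub_mem_slitPlane_of_mem_ball hz)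

lemma ofReal_mul_mem_gaussDomain {z : ℂ} (hz : z ∈ gaussDomain) {x : ℝ}
    (hx : x ∈ Set.Icc (0 : ℝ) 1) : (x : ℂ) * z ∈ gaussDomain := by
  rintro ⟨r, hr, h⟩
  have hx0 : x ≠ 0 := by
    rintro rfl
    rw [Complex.ofReal_zero, zero_mul] at h
    have : r = 0 := by exact_mod_cast h.symm
    linarith
  have hxp : 0 < x := lt_of_le_of_ne hx.1 (Ne.symm hx0)
  refine hz ⟨r / x, ?_, ?_⟩
  · rw [le_div_iff₀ hxp]; linarith [hx.2]
  · have : (x : ℂ) ≠ 0 := by exact_mod_cast hx0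
    rw [Complex.ofReal_div, eq_div_iff this, mul_comm, h]

lemma isPreconnected_gaussDomain : IsPreconnected gaussDomain := by
  have h : StarConvex ℝ (0 : ℂ) gaussDomain := by
    rw [starConvex_zero_iff]
    intro z hz x h0 h1
    rw [Complex.real_smul]
    exact ofReal_mul_mem_gaussDomain hz ⟨h0, h1⟩
  exact (h.isPathConnected (ball_subset_gaussDomain (Metric.mem_ball_self one_pos))).isConnected.isPreconnected

lemma eqOn_gaussDomain {f g : ℂ → ℂ} (hf : DifferentiableOn ℂ f gaussDomain)
    (hg : DifferentiableOn ℂ g gaussDomain) (h : Set.EqOn f g (Metric.ball 0 1)) :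
    Set.EqOn f g gaussDomain := by
  refine (hf.analyticOnNhd isOpen_gaussDomain).eqOn_of_preconnected_of_eventuallyEq
    (hg.analyticOnNhd isOpen_gaussDomain) isPreconnected_gaussDomain
    (ball_subset_gaussDomain (Metric.mem_ball_self one_pos)) ?_
  filter_upwards [Metric.isOpen_ball.mem_nhds (Metric.mem_ball_self one_pos)] with z hz using h hz

/-- The hypergeometric series has a continuation to `ℂ \ [1, ∞)`. -/
def HasGaussContinuation (a b c : ℂ) : Prop :=
  ∃ F : ℂ → ℂ, DifferentiableOn ℂ F gaussDomain ∧
    ∀ x ∈ Metric.ball (0 : ℂ) 1, F x = ordinaryHypergeometric a b c x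

lemma HasGaussContinuation.spec {a b c : ℂ} (h : HasGaussContinuation a b c) :
    DifferentiableOn ℂ (hypergeometricF a b c) gaussDomain ∧
      Set.EqOn (hypergeometricF a b c) (ordinaryHypergeometric a b c) (Metric.ball 0 1) := by
  have e : hypergeometricF a b c = Classical.choose h := dif_pos h
  rw [e]
  exact Classical.choose_spec h

lemma eqOn_hypergeometricF {a b c : ℂ} {F : ℂ → ℂ} (hF : DifferentiableOn ℂ F gaussDomain)
    (h : Set.EqOn F (ordinaryHypergeometric a b c) (Metric.ball 0 1)) :
    Set.EqOn F (hypergeometricF a b c) gaussDomain := by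
  have hc : HasGaussContinuation a b c := ⟨F, hF, h⟩
  exact eqOn_gaussDomain hF hc.spec.1 fun z hz => (h hz).trans (hc.spec.2 hz).symm

/-- The domain is star-shaped about `0`, so integration along rays gives a primitive. -/
lemma exists_primitive_gaussDomain {f : ℂ → ℂ} (hf : DifferentiableOn ℂ f gaussDomain) :
    ∃ G : ℂ → ℂ, G 0 = 0 ∧ ∀ z ∈ gaussDomain, HasDerivAt G (f z) z := by
  refine ⟨fun z => ∫ x in (0 : ℝ)..1, (1 : ℂ) * (z * f (x * z)), by simp, fun z hz => ?_⟩
  have hd : ∀ w ∈ gaussDomain, HasDerivAt f (deriv f w) w := fun w hw =>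
    (hf.differentiableAt (isOpen_gaussDomain.mem_nhds hw)).hasDerivAt
  have hm : ContinuousOn (fun q : ℂ × ℝ => (q.2 : ℂ) * q.1) (gaussDomain ×ˢ Set.Icc 0 1) := by
    fun_prop
  have hmaps : Set.MapsTo (fun q : ℂ × ℝ => (q.2 : ℂ) * q.1) (gaussDomain ×ˢ Set.Icc 0 1)
      gaussDomain := fun q hq => ofReal_mul_mem_gaussDomain hq.1 hq.2
  have hcont : ContinuousOn (fun q : ℂ × ℝ => f (q.2 * q.1) + q.1 * (q.2 * deriv f (q.2 * q.1)))
      (gaussDomain ×ˢ Set.Icc 0 1) := by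
    refine (hf.continuousOn.comp hm hmaps).add (ContinuousOn.mul (by fun_prop)
      (ContinuousOn.mul (by fun_prop) ?_))
    exact ((hf.deriv isOpen_gaussDomain).continuousOn).comp hm hmaps
  have hz' : ∀ g : ℂ → ℂ, ContinuousOn g gaussDomain →
      ContinuousOn (fun x : ℝ => g (x * z)) (Set.Icc 0 1) := fun g hg =>
    hg.comp (by fun_prop) fun x hx => ofReal_mul_mem_gaussDomain hz hx
  refine (hasDerivAt_weighted_integral (wt := fun _ => 1) (by simp) isOpen_gaussDomain
    (Φ' := fun z x => f (x * z) + z * (x * deriv f (x * z))) (fun p hp => ?_) hcont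
    (fun p hp x hx => ?_) hz).congr_deriv ?_
  · exact continuousOn_const.mul
      (hf.continuousOn.comp (by fun_prop) fun x hx => ofReal_mul_mem_gaussDomain hp hx)
  · have h1 : HasDerivAt (fun q : ℂ => (x : ℂ) * q) x p := by
      simpa using (hasDerivAt_id p).const_mul (x : ℂ)
    have h2 := (hd _ (ofReal_mul_mem_gaussDomain hp hx)).comp p h1
    refine ((hasDerivAt_id p).mul h2).congr_deriv ?_
    simp only [id, Function.comp]
    ring
  -- The differentiated integrand is the derivative in `x` of `x f(xz)`, so the integral telescopes
  -- to `f z`.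
  · have h1 : ∀ x ∈ Set.uIcc (0 : ℝ) 1, HasDerivAt (fun x : ℝ => (x : ℂ) * f (x * z))
        ((1 : ℂ) * (f (x * z) + z * (x * deriv f (x * z)))) x := by
      intro x hx
      rw [Set.uIcc_of_le zero_le_one] at hx
      have h1 : HasDerivAt (fun q : ℂ => q * z) z x := by
        simpa using (hasDerivAt_id (x : ℂ)).mul_const z
      have h2 := ((hasDerivAt_id (x : ℂ)).mul
        ((hd _ (ofReal_mul_mem_gaussDomain hz hx)).comp (x : ℂ) h1)).comp_ofReal
      refine h2.congr_deriv ?_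
      simp
      ring
    rw [intervalIntegral.integral_eq_sub_of_hasDerivAt h1]
    · simp
    · refine ContinuousOn.intervalIntegrable ?_
      rw [Set.uIcc_of_le zero_le_one]
      refine continuousOn_const.mul ((hz' f hf.continuousOn).add (continuousOn_const.mul
        (ContinuousOn.mul (by fun_prop) (hz' _ (hf.deriv isOpen_gaussDomain).continuousOn))))

/-! ### The Euler integral -/

lemma euler_mem_slitPlane {z : ℂ} (hz : z ∈ gaussDomain) {x : ℝ} (hx : x ∈ Set.Icc (0 : ℝ) 1) :
    1 - 4 * x * (1 - x) * z ∈ Complex.slitPlane := by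
  have := ofReal_mul_mem_gaussDomain hz (x := 4 * x * (1 - x))
    ⟨by nlinarith [hx.1, hx.2], by nlinarith [sq_nonneg (2 * x - 1)]⟩
  rw [mem_gaussDomain_iff] at this
  simpa using this

lemma betaWeight_mul {a b : ℂ} (ha : 0 < a.re) (hb : 0 < b.re) (x : ℝ) :
    betaWeight a b x * (x * (1 - x)) = betaWeight (a + 1) (b + 1) x := by
  have h : ∀ {s : ℂ}, 0 < s.re → ∀ y : ℂ, y ^ (s - 1) * y = y ^ (s + 1 - 1) := fun {s} hs y => by
    have hs0 : s ≠ 0 := fun h => by simp [h] at hs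
    rw [add_sub_cancel_right]
    rcases eq_or_ne y 0 with rfl | hy
    · rw [Complex.zero_cpow hs0, mul_zero]
    · rw [Complex.cpow_sub _ _ hy, Complex.cpow_one, div_mul_cancel₀ _ hy]
  rw [betaWeight, betaWeight, ← h ha, ← h hb]
  ring

/-- The derivative brings down `x(1-x)`, raising `a` and `b` by one, and lowers the exponent
`-(a+b)/2` by one: the result is again an Euler integral of the same family. -/
lemma hasDerivAt_eulerIntegral {a b : ℂ} (ha : 0 < a.re) (hb : 0 < b.re) {z : ℂ}
    (hz : z ∈ gaussDomain) :
    HasDerivAt (eulerIntegral a b) (2 * (a + b) * eulerIntegral (a + 1) (b + 1) z) z := by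
  have hc : ∀ s : ℂ, ContinuousOn (fun q : ℂ × ℝ => (1 - 4 * q.2 * (1 - q.2) * q.1) ^ s)
      (gaussDomain ×ˢ Set.Icc 0 1) := fun s =>
    ContinuousOn.cpow (by fun_prop) continuousOn_const fun q hq => euler_mem_slitPlane hq.1 hq.2
  refine (hasDerivAt_weighted_integral (intervalIntegrable_betaWeight ha hb) isOpen_gaussDomain
    (Φ := fun z x => (1 - 4 * x * (1 - x) * z) ^ (-((a + b) / 2)))
    (Φ' := fun z x => -((a + b) / 2) * (1 - 4 * x * (1 - x) * z) ^ (-((a + b) / 2) - 1) *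
      -(4 * x * (1 - x))) (fun p hp => ?_) ?_ (fun p hp x hx => ?_) hz).congr_deriv ?_
  · exact ContinuousOn.cpow (by fun_prop) continuousOn_const fun x hx => euler_mem_slitPlane hp hx
  · exact (continuousOn_const.mul (hc _)).mul (by fun_prop)
  · have h1 : HasDerivAt (fun q : ℂ => 1 - 4 * x * (1 - x) * q) (-(4 * (x : ℂ) * (1 - x))) p := by
      simpa using ((hasDerivAt_id p).const_mul (4 * (x : ℂ) * (1 - x))).const_sub 1
    exact h1.cpow_const (euler_mem_slitPlane hp hx)
  · rw [eulerIntegral, ← intervalIntegral.integral_const_mul]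
    refine intervalIntegral.integral_congr fun x _ => ?_
    simp only [← betaWeight_mul ha hb]
    have : -((a + b) / 2) - 1 = -((a + 1 + (b + 1)) / 2) := by ring
    rw [this]
    ring

lemma differentiableOn_eulerIntegral {a b : ℂ} (ha : 0 < a.re) (hb : 0 < b.re) :
    DifferentiableOn ℂ (eulerIntegral a b) gaussDomain := fun _ hz =>
  (hasDerivAt_eulerIntegral ha hb hz).differentiableAt.differentiableWithinAt

lemma eulerIntegral_zero (a b : ℂ) : eulerIntegral a b 0 = Complex.betaIntegral a b := by
  simp [eulerIntegral, Complex.betaIntegral, betaWeight]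

lemma betaIntegral_add_one {a b : ℂ} (ha : 0 < a.re) (hb : 0 < b.re) :
    (a + b) * (a + b + 1) * Complex.betaIntegral (a + 1) (b + 1) =
      a * b * Complex.betaIntegral a b := by
  have ha1 : 0 < (a + 1).re := by simp; linarith
  have hb1 : 0 < (b + 1).re := by simp; linarith
  have hne : ∀ {s : ℂ}, 0 < s.re → s ≠ 0 := fun hs h => by simp [h] at hs
  have hab : 0 < (a + b).re := by simp; linarith
  have hab1 : 0 < (a + b + 1).re := by simp only [Complex.add_re, Complex.one_re] at *; linarith
  have h1 := Complex.Gamma_mul_Gamma_eq_betaIntegral ha hb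
  have h2 := Complex.Gamma_mul_Gamma_eq_betaIntegral ha1 hb1
  have e : a + 1 + (b + 1) = a + b + 1 + 1 := by ring
  rw [e, Complex.Gamma_add_one _ (hne ha), Complex.Gamma_add_one _ (hne hb),
    Complex.Gamma_add_one _ (hne hab1), Complex.Gamma_add_one _ (hne hab)] at h2
  have hG := Complex.Gamma_ne_zero_of_re_pos hab
  refine mul_left_cancel₀ hG ?_
  linear_combination a * b * h1 - h2

lemma half_add_ne_neg {a b : ℂ} (h : 0 < (a + b).re + 1) (k : ℕ) : (a + b + 1) / 2 ≠ -(k : ℂ) := by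
  intro h'
  have h2 : a + b + 1 = -(2 * (k : ℂ)) := by linear_combination 2 * h'
  have := congrArg Complex.re h2
  have e : (-(2 * (k : ℂ))).re = -(2 * (k : ℝ)) := by simp
  rw [e, Complex.add_re (a + b), Complex.one_re] at this
  have hk : (0 : ℝ) ≤ k := k.cast_nonneg
  linarith

/-- At `z = 0` an Euler integral is a beta integral, so iterating the derivative formula yields
exactly the Taylor coefficients of `F(a, b; (a+b+1)/2)`. -/
lemma iteratedDeriv_eulerIntegral (k : ℕ) : ∀ {a b : ℂ}, 0 < a.re → 0 < b.re →
    iteratedDeriv k (eulerIntegral a b) 0 = Complex.betaIntegral a b *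
      ((ascPochhammer ℂ k).eval a * (ascPochhammer ℂ k).eval b *
        ((ascPochhammer ℂ k).eval ((a + b + 1) / 2))⁻¹) := by
  induction k with
  | zero =>
    intro a b _ _
    simp [eulerIntegral_zero]
  | succ k ih =>
    intro a b ha hb
    have h0 : (0 : ℂ) ∈ gaussDomain := ball_subset_gaussDomain (Metric.mem_ball_self one_pos)
    have h : deriv (eulerIntegral a b) =ᶠ[nhds 0]
        fun z => 2 * (a + b) * eulerIntegral (a + 1) (b + 1) z := by
      filter_upwards [isOpen_gaussDomain.mem_nhds h0] with z hz
        using (hasDerivAt_eulerIntegral ha hb hz).deriv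
    have hb2 := betaIntegral_add_one ha hb
    have hc := half_add_ne_neg (a := a) (b := b) (by simp; linarith) 0
    have hc' : a + b + 1 ≠ 0 := fun h => hc (by simp [h])
    rw [iteratedDeriv_succ', h.iteratedDeriv_eq, iteratedDeriv_const_mul_field,
      ih (by simp; linarith) (by simp; linarith), ascPochhammer_succ_eval_left,
      ascPochhammer_succ_eval_left, ascPochhammer_succ_eval_left]
    have e : (a + 1 + (b + 1) + 1) / 2 = (a + b + 1) / 2 + 1 := by ring
    rw [e]
    generalize (ascPochhammer ℂ k).eval ((a + b + 1) / 2 + 1) = C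
    rw [mul_inv]
    have hb3 : 2 * (a + b) * Complex.betaIntegral (a + 1) (b + 1) =
        Complex.betaIntegral a b * (a * b * ((a + b + 1) / 2)⁻¹) := by
      field_simp
      linear_combination hb2
    linear_combination (Polynomial.eval (a + 1) (ascPochhammer ℂ k) *
      Polynomial.eval (b + 1) (ascPochhammer ℂ k) * C⁻¹) * hb3

lemma betaIntegral_ne_zero {a b : ℂ} (ha : 0 < a.re) (hb : 0 < b.re) :
    Complex.betaIntegral a b ≠ 0 := fun h => by
  have := Complex.Gamma_mul_Gamma_eq_betaIntegral ha hb
  rw [h, mul_zero] at this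
  exact mul_ne_zero (Complex.Gamma_ne_zero_of_re_pos ha) (Complex.Gamma_ne_zero_of_re_pos hb) this

lemma eqOn_eulerIntegral {a b : ℂ} (ha : 0 < a.re) (hb : 0 < b.re) :
    Set.EqOn (fun z => (Complex.betaIntegral a b)⁻¹ * eulerIntegral a b z)
      (ordinaryHypergeometric a b ((a + b + 1) / 2)) (Metric.ball 0 1) := by
  refine eqOn_ball_of_iteratedDeriv_eq
    (((differentiableOn_eulerIntegral ha hb).mono ball_subset_gaussDomain).const_mul _)
    (differentiableOn_ordinaryHypergeometric _ _ _) fun k => ?_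
  rw [iteratedDeriv_const_mul_field, iteratedDeriv_eulerIntegral k ha hb,
    iteratedDeriv_ordinaryHypergeometric, inv_mul_cancel_left₀ (betaIntegral_ne_zero ha hb)]

theorem eulerIntegral_eq {a b : ℂ} (ha : 0 < a.re) (hb : 0 < b.re) {z : ℂ}
    (hz : z ∈ gaussDomain) :
    eulerIntegral a b z = Complex.betaIntegral a b * hypergeometricF a b ((a + b + 1) / 2) z := by
  rw [← eqOn_hypergeometricF ((differentiableOn_eulerIntegral ha hb).const_mul _)
    (eqOn_eulerIntegral ha hb) hz, mul_inv_cancel_left₀ (betaIntegral_ne_zero ha hb)]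

/-- Since `F(a,b;c)' = (ab/c) F(a+1,b+1;c+1)`, a primitive of the continued right-hand side
continues the left. -/
lemma hasGaussContinuation_of_add_one {a b c : ℂ}
    (h : HasGaussContinuation (a + 1) (b + 1) (c + 1)) : HasGaussContinuation a b c := by
  obtain ⟨F, hF, hFe⟩ := h
  obtain ⟨G, hG0, hG⟩ := exists_primitive_gaussDomain hF
  have hG' : ∀ z ∈ gaussDomain, HasDerivAt (fun z => 1 + a * b / c * G z) (a * b / c * F z) z :=
    fun z hz => ((hG z hz).const_mul _).const_add 1
  have hdiff : DifferentiableOn ℂ (fun z => 1 + a * b / c * G z) gaussDomain := fun z hz =>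
    (hG' z hz).differentiableAt.differentiableWithinAt
  refine ⟨_, hdiff, fun x hx => ?_⟩
  have hB : IsOpen (Metric.ball (0 : ℂ) 1) := Metric.isOpen_ball
  refine hB.eqOn_of_deriv_eq (convex_ball 0 1).isPreconnected
    (hdiff.mono ball_subset_gaussDomain) (differentiableOn_ordinaryHypergeometric a b c)
    (fun z hz => ?_) (Metric.mem_ball_self one_pos) (by simp [hG0]) hx
  rw [deriv_ordinaryHypergeometric hz, (hG' z (ball_subset_gaussDomain hz)).deriv, hFe z hz]

/-- The hypergeometric functions which are quadratic transforms of Legendre functions continue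
to `ℂ \ [1, ∞)`. -/
theorem hasGaussContinuation (a b : ℂ) : HasGaussContinuation a b ((a + b + 1) / 2) := by
  -- Raising `a` and `b` by one preserves the relation `c = (a+b+1)/2`; after `k` shifts the Euler
  -- integral converges.
  have key : ∀ (k : ℕ) (a b : ℂ), 0 < a.re + k → 0 < b.re + k →
      HasGaussContinuation a b ((a + b + 1) / 2) := by
    intro k
    induction k with
    | zero =>
      intro a b ha hb
      rw [Nat.cast_zero, add_zero] at ha hb
      exact ⟨_, (differentiableOn_eulerIntegral ha hb).const_mul _, eqOn_eulerIntegral ha hb⟩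
    | succ k ih =>
      intro a b ha hb
      push_cast at ha hb
      refine hasGaussContinuation_of_add_one ?_
      have := ih (a + 1) (b + 1) (by simp; linarith) (by simp; linarith)
      convert! this using 1
      ring
  obtain ⟨k, hk⟩ := exists_nat_gt (max (-a.re) (-b.re))
  exact key k a b (by linarith [(max_lt_iff.1 hk).1]) (by linarith [(max_lt_iff.1 hk).2])

lemma hasDerivAt_hypergeometricF (a b : ℂ) {z : ℂ} (hz : z ∈ gaussDomain) :
    HasDerivAt (hypergeometricF a b ((a + b + 1) / 2)) (a * b / ((a + b + 1) / 2) *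
      hypergeometricF (a + 1) (b + 1) ((a + b + 1) / 2 + 1) z) z := by
  have h1 := (hasGaussContinuation a b).spec
  have h2 := (hasGaussContinuation (a + 1) (b + 1)).spec
  have e : (a + 1 + (b + 1) + 1) / 2 = (a + b + 1) / 2 + 1 := by ring
  rw [e] at h2
  refine (h1.1.differentiableAt (isOpen_gaussDomain.mem_nhds hz)).hasDerivAt.congr_deriv ?_
  refine eqOn_gaussDomain (h1.1.deriv isOpen_gaussDomain) (h2.1.const_mul _) (fun w hw => ?_) hz
  have h3 : hypergeometricF a b ((a + b + 1) / 2) =ᶠ[nhds w]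
      ordinaryHypergeometric a b ((a + b + 1) / 2) := by
    filter_upwards [Metric.isOpen_ball.mem_nhds hw] with x hx using h1.2 hx
  simp only
  rw [h3.deriv_eq, deriv_ordinaryHypergeometric hw, h2.2 hw]

theorem hypergeometricF_euler {a b c : ℂ} (hc : c = (a + b + 1) / 2) (h0 : 0 < (a + b).re + 1)
    {z : ℂ} (hz : z ∈ gaussDomain) : hypergeometricF (c - a) (c - b) c z =
      (1 - z) ^ (a + b - c) * hypergeometricF a b c z := by
  have h1 := (hasGaussContinuation a b).spec
  rw [← hc] at h1
  have hc' : ∀ k : ℕ, c ≠ -k := fun k => by rw [hc]; exact half_add_ne_neg h0 k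
  refine (eqOn_hypergeometricF (F := fun z => (1 - z) ^ (a + b - c) * hypergeometricF a b c z)
    (DifferentiableOn.mul (fun w hw => ?_) h1.1) (fun w hw => ?_) hz).symm
  · have := ((hasDerivAt_id w).const_sub 1).cpow_const (c := a + b - c) (mem_gaussDomain_iff.1 hw)
    exact this.differentiableAt.differentiableWithinAt
  · simp only
    rw [h1.2 hw, ordinaryHypergeometric_euler hc' hw]

/-! ### The wave integral as a hypergeometric function -/

lemma norm_ascPochhammer_eval_le {a : ℂ} {M : ℝ} (ha : ‖a‖ ≤ M) (k : ℕ) :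
    ‖(ascPochhammer ℂ k).eval a‖ ≤ (ascPochhammer ℝ k).eval M := by
  have hM : 0 ≤ M := (norm_nonneg a).trans ha
  induction k with
  | zero => simp
  | succ k ih =>
    rw [ascPochhammer_succ_eval, ascPochhammer_succ_eval, norm_mul]
    have h : ‖a + k‖ ≤ M + k := (norm_add_le _ _).trans (by simpa using ha)
    exact mul_le_mul ih h (norm_nonneg _) ((norm_nonneg _).trans ih)

/-- The hypergeometric series is holomorphic in its parameters. -/
lemma differentiable_ordinaryHypergeometric_param {f g : ℂ → ℂ} (hf : Differentiable ℂ f)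
    (hg : Differentiable ℂ g) {c : ℝ} (hc : 0 < c) {z : ℂ} (hz : z ∈ Metric.ball (0 : ℂ) 1) :
    Differentiable ℂ fun ν => (ordinaryHypergeometric (f ν) (g ν) (c : ℂ) z : ℂ) := by
  intro ν₀
  have hK : IsCompact (Metric.closedBall ν₀ 1) := isCompact_closedBall _ _
  obtain ⟨M₁, hM₁⟩ := hK.exists_bound_of_continuousOn hf.continuous.continuousOn
  obtain ⟨M₂, hM₂⟩ := hK.exists_bound_of_continuousOn hg.continuous.continuousOn
  set M := max 1 (max M₁ M₂)
  have hM0 : 0 < M := zero_lt_one.trans_le (le_max_left _ _)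
  have hpos : ∀ (k : ℕ) (x : ℝ), 0 < x → (k : ℝ) ≠ -x := fun k x hx h => by
    have : (0 : ℝ) ≤ k := k.cast_nonneg
    linarith
  -- A real series with positive parameters dominates termwise on the unit ball around `ν₀`; `M ≥ 1`
  -- and `c > 0` keep it from terminating, so its radius is exactly one.
  have hr : (ordinaryHypergeometricSeries ℝ M M c).radius = 1 :=
    ordinaryHypergeometricSeries_radius_eq_one ℝ M M c fun k =>
      ⟨hpos k M hM0, hpos k M hM0, hpos k c hc⟩
  have hsum : Summable fun k => ‖(ordinaryHypergeometricSeries ℝ M M c) k fun _ => ‖z‖‖ := by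
    refine (ordinaryHypergeometricSeries ℝ M M c).summable_norm_apply ?_
    rw [hr, ← ENNReal.ofReal_one, Metric.eball_ofReal, mem_ball_zero_iff, norm_norm]
    simpa using hz
  have hB : IsOpen (Metric.ball ν₀ (1 : ℝ)) := Metric.isOpen_ball
  have hpd : ∀ (k : ℕ) {f : ℂ → ℂ}, Differentiable ℂ f →
      Differentiable ℂ fun ν => (ascPochhammer ℂ k).eval (f ν) := fun k f hf =>
    fun x => (Polynomial.differentiable (ascPochhammer ℂ k)).differentiableAt.comp x (hf x)
  simp only [ordinaryHypergeometric, ordinaryHypergeometric_sum_eq]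
  refine (Complex.differentiableOn_tsum_of_summable_norm (U := Metric.ball ν₀ 1) hsum
    (fun k => ?_) hB fun k ν hν => ?_).differentiableAt
    (hB.mem_nhds (Metric.mem_ball_self one_pos))
  · exact ((((hpd k hf).const_mul _).mul (hpd k hg)).mul_const _).smul_const _
      |>.differentiableOn
  · have h1 := (hM₁ ν (Metric.ball_subset_closedBall hν)).trans
      ((le_max_left M₁ M₂).trans (le_max_right 1 _))
    have h2 := (hM₂ ν (Metric.ball_subset_closedBall hν)).trans
      ((le_max_right M₁ M₂).trans (le_max_right 1 _))
    have hcp : (ascPochhammer ℂ k).eval (c : ℂ) = (((ascPochhammer ℝ k).eval c : ℝ) : ℂ) := by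
      have := ascPochhammer_map Complex.ofRealHom k
      rw [← this, Polynomial.eval_map]
      exact (Polynomial.eval₂_at_apply Complex.ofRealHom c)
    rw [ordinaryHypergeometricSeries_apply_eq, norm_smul, norm_smul, norm_mul, norm_mul, norm_mul,
      norm_mul, norm_mul, norm_mul, hcp, ← Complex.ofReal_inv, Complex.norm_real, norm_pow, norm_pow,
      norm_norm]
    have e : ‖((k.factorial : ℂ))⁻¹‖ = ‖((k.factorial : ℝ))⁻¹‖ := by simp
    rw [e]
    have hPM : 0 ≤ (ascPochhammer ℝ k).eval M :=
      (norm_nonneg _).trans (norm_ascPochhammer_eval_le h1 k)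
    gcongr
    · rw [Real.norm_of_nonneg hPM]
      exact norm_ascPochhammer_eval_le h1 k
    · rw [Real.norm_of_nonneg hPM]
      exact norm_ascPochhammer_eval_le h2 k

lemma differentiable_waveParam (n : ℕ) : Differentiable ℂ (waveParam n) := by
  unfold waveParam
  fun_prop

/-- The function `F((d-1)/2 + iν, (d-1)/2 - iν; d/2; (1 - ζ)/2)`. -/
def waveF (n : ℕ) (ν ζ : ℂ) : ℂ :=
  hypergeometricF (waveParam n ν) (waveParam n (-ν)) (((n : ℂ) + 1) / 2) ((1 - ζ) / 2)

lemma mem_cutPlane_iff {ζ : ℂ} : ζ ∈ cutPlane ↔ (1 - ζ) / 2 ∈ gaussDomain := by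
  rw [← not_iff_not, cutPlane, gaussDomain, Set.mem_ofPred_eq, Set.mem_ofPred_eq, not_not, not_not]
  constructor
  · rintro ⟨r, hr, rfl⟩
    exact ⟨(1 - r) / 2, by linarith, by push_cast; ring⟩
  · rintro ⟨r, hr, h⟩
    refine ⟨1 - 2 * r, by linarith, ?_⟩
    push_cast
    linear_combination -2 * h

lemma isOpen_cutPlane : IsOpen cutPlane := by
  have : cutPlane = (fun ζ => (1 - ζ) / 2) ⁻¹' gaussDomain := Set.ext fun _ => mem_cutPlane_iff
  rw [this]
  exact isOpen_gaussDomain.preimage (by fun_prop)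

/-- Raising both parameters by one is the same as raising the dimension by two. -/
lemma hasDerivAt_waveF (n : ℕ) (ν : ℂ) {ζ : ℂ} (hζ : ζ ∈ cutPlane) :
    HasDerivAt (waveF n ν) (-(waveParam n ν * waveParam n (-ν) / (n + 1)) * waveF (n + 2) ν ζ) ζ := by
  have h1 := hasDerivAt_hypergeometricF (waveParam n ν) (waveParam n (-ν)) (mem_cutPlane_iff.1 hζ)
  rw [waveParam_add_neg] at h1
  have h2 : HasDerivAt (fun ζ : ℂ => (1 - ζ) / 2) (-1 / 2) ζ :=
    ((hasDerivAt_id ζ).const_sub 1).div_const 2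
  have hp : ∀ ν, waveParam (n + 2) ν = waveParam n ν + 1 := fun ν => by
    simp only [waveParam]
    push_cast
    ring
  have hn : ((n : ℂ) + 1) ≠ 0 := by exact_mod_cast n.succ_ne_zero
  refine (HasDerivAt.comp ζ h1 h2).congr_deriv ?_
  simp only [waveF, hp]
  have e : ((n + 2 : ℕ) + 1 : ℂ) / 2 = (n + 1) / 2 + 1 := by
    push_cast; ring
  rw [e]
  field_simp

lemma differentiableOn_waveF (n : ℕ) (ν : ℂ) : DifferentiableOn ℂ (waveF n ν) cutPlane :=
  fun _ hζ => (hasDerivAt_waveF n ν hζ).differentiableAt.differentiableWithinAt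

lemma waveIntegral_eq_waveF_of_strip {n : ℕ} (hn : 1 ≤ n) {γ : Chain (n + 1) n} (hγ : IsCycle γ)
    {ν : ℂ} (hν : |ν.im| < n / 2) {z₁ z₂ : Fin (n + 1 + 1) → ℂ} (h₁ : z₁ ∈ pastTube (n + 1))
    (h₂ : z₂ ∈ futureTube (n + 1)) : waveIntegral ν γ z₁ z₂ =
      Complex.exp (-(Real.pi * Complex.I * waveParam n (-ν))) *
        poissonIntegral γ (Pi.single 0 (-Complex.I)) * waveF n ν (mdot z₁ z₂) := by
  obtain ⟨ha, hb⟩ := waveParam_re_pos hν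
  refine mul_left_cancel₀ (betaIntegral_ne_zero ha hb) ?_
  rw [betaIntegral_mul_waveIntegral hn hγ hν h₁ h₂,
    eulerIntegral_eq ha hb (mem_cutPlane_iff.1 (mdot_mem_cutPlane h₁ h₂)), waveParam_add_neg, waveF]
  ring

/-- For these `ζ` the right-hand side is a convergent series, entire in `ν`, so the identity leaves
the strip. -/
lemma waveIntegral_eq_waveF_of_small {n : ℕ} (hn : 1 ≤ n) {γ : Chain (n + 1) n} (hγ : IsCycle γ)
    (ν : ℂ) {z₁ z₂ : Fin (n + 1 + 1) → ℂ} (h₁ : z₁ ∈ pastTube (n + 1))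
    (h₂ : z₂ ∈ futureTube (n + 1)) (hz : (1 - mdot z₁ z₂) / 2 ∈ Metric.ball (0 : ℂ) 1) :
    waveIntegral ν γ z₁ z₂ = Complex.exp (-(Real.pi * Complex.I * waveParam n (-ν))) *
      poissonIntegral γ (Pi.single 0 (-Complex.I)) * waveF n ν (mdot z₁ z₂) := by
  have hF : ∀ ν, waveF n ν (mdot z₁ z₂) = ordinaryHypergeometric (waveParam n ν) (waveParam n (-ν))
      ((((n + 1) / 2 : ℝ)) : ℂ) ((1 - mdot z₁ z₂) / 2) := fun ν => by
    have := (hasGaussContinuation (waveParam n ν) (waveParam n (-ν))).spec.2 hz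
    rw [waveParam_add_neg] at this
    rw [waveF, this]
    push_cast
    rfl
  have hp := differentiable_waveParam n
  have hp' : Differentiable ℂ fun ν => waveParam n (-ν) := hp.comp differentiable_neg
  have hn' : (1 : ℝ) ≤ n := by exact_mod_cast hn
  refine eq_of_eqOn_strip (g := fun ν => Complex.exp (-(Real.pi * Complex.I * waveParam n (-ν))) *
      poissonIntegral γ (Pi.single 0 (-Complex.I)) * waveF n ν (mdot z₁ z₂))
    (differentiable_waveIntegral_param γ h₁.2 h₂.2) ?_ (r := n / 2) (by linarith)
    (fun ν hν => waveIntegral_eq_waveF_of_strip hn hγ hν h₁ h₂) ν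
  simp only [hF]
  exact ((hp'.const_mul _).neg.cexp.mul_const _).mul
    (differentiable_ordinaryHypergeometric_param hp hp' (by positivity) hz)

/-! ### Continuation in `ζ` along a holomorphic curve of pairs in the tubes -/

/-- A family of pairs of points of the tubes with `z₁ · z₂ = -cosh t`. -/
def tubePoint {d : ℕ} (i : Fin d) (t : ℂ) : Fin (d + 1) → ℂ :=
  Complex.sinh (t / 2) • Pi.single 0 1 + Complex.cosh (t / 2) • Pi.single i.succ 1

lemma mdot_plane {R : Type*} [CommRing R] {d : ℕ} (i : Fin d) (a b a' b' : R) :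
    mdot (a • Pi.single 0 1 + b • Pi.single i.succ 1 : Fin (d + 1) → R)
      (a' • Pi.single 0 1 + b' • Pi.single i.succ 1) = a * a' - b * b' := by
  rw [mdot_add_right, mdot_smul_right, mdot_smul_right, mdot_single_zero, mdot_single_succ]
  simp [(Fin.succ_ne_zero i).symm]
  ring

lemma mdot_tubePoint {d : ℕ} (i : Fin d) (s t : ℂ) :
    mdot (tubePoint i s) (tubePoint i t) =
      Complex.sinh (s / 2) * Complex.sinh (t / 2) - Complex.cosh (s / 2) * Complex.cosh (t / 2) :=
  mdot_plane i _ _ _ _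

lemma sinh_cosh_im (x y : ℝ) :
    (Complex.sinh ((x : ℂ) + y * Complex.I)).im = Real.cosh x * Real.sin y ∧
    (Complex.cosh ((x : ℂ) + y * Complex.I)).im = Real.sinh x * Real.sin y := by
  rw [Complex.sinh_add, Complex.cosh_add, Complex.sinh_mul_I, Complex.cosh_mul_I,
    ← Complex.ofReal_sinh, ← Complex.ofReal_cosh, ← Complex.ofReal_sin, ← Complex.ofReal_cos]
  constructor <;>
  simp only [Complex.add_im, Complex.mul_im, Complex.mul_re, Complex.ofReal_im, Complex.ofReal_re,
    Complex.I_re, Complex.I_im] <;> ring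

lemma tubePoint_mem_complexDS {d : ℕ} (i : Fin d) (t : ℂ) : tubePoint i t ∈ complexDS d := by
  rw [complexDS, Set.mem_ofPred_eq, mdot_tubePoint]
  linear_combination -Complex.cosh_sq (t / 2)

lemma tubePoint_mem_futureTube {d : ℕ} (i : Fin d) {t : ℂ} (h0 : 0 < t.im)
    (h1 : t.im < 2 * Real.pi) : tubePoint i t ∈ futureTube d := by
  have hs : 0 < Real.sin (t.im / 2) := Real.sin_pos_of_pos_of_lt_pi (by linarith) (by linarith)
  have ht : t / 2 = ((t.re / 2 : ℝ) : ℂ) + ((t.im / 2 : ℝ) : ℂ) * Complex.I := by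
    push_cast
    linear_combination (-1 / 2 : ℂ) * Complex.re_add_im t
  have e0 := (sinh_cosh_im (t.re / 2) (t.im / 2)).1
  have e1 := (sinh_cosh_im (t.re / 2) (t.im / 2)).2
  rw [← ht] at e0 e1
  have e : (fun j => (tubePoint i t j).im) = (Real.cosh (t.re / 2) * Real.sin (t.im / 2)) •
      (Pi.single 0 1 : Fin (d + 1) → ℝ) +
      (Real.sinh (t.re / 2) * Real.sin (t.im / 2)) • Pi.single i.succ 1 := by
    rw [← e0, ← e1]
    funext j
    simp [tubePoint, Pi.single_apply, apply_ite Complex.im]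
  refine ⟨tubePoint_mem_complexDS i t, ?_⟩
  rw [e]
  constructor
  · rw [mdot_plane]
    have := Real.cosh_sq (t.re / 2)
    have h3 : 0 < Real.sin (t.im / 2) ^ 2 := by positivity
    nlinarith
  · have := Real.cosh_pos (t.re / 2)
    simp
    positivity

/-- Complex conjugation exchanges the tubes and carries the point at `-t` to the point at `-conj t`,
whose parameter has the same imaginary part as `t`. -/
lemma tubePoint_neg_mem_pastTube {d : ℕ} (i : Fin d) {t : ℂ} (h0 : 0 < t.im)
    (h1 : t.im < 2 * Real.pi) : tubePoint i (-t) ∈ pastTube d := by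
  have h := (tubePoint_mem_futureTube i (t := -(starRingEnd ℂ) t) (by simpa using h0)
    (by simpa using h1)).2
  have h' := (tubePoint_mem_futureTube i h0 h1).2
  refine ⟨tubePoint_mem_complexDS i _, ?_⟩
  have e : (fun j => -(tubePoint i (-t) j).im) =
      fun j => (tubePoint i (-(starRingEnd ℂ) t) j).im := by
    funext j
    have hc : (starRingEnd ℂ) (tubePoint i (-t) j) = tubePoint i (-(starRingEnd ℂ) t) j := by
      simp only [tubePoint, Pi.add_apply, Pi.smul_apply, smul_eq_mul, map_add, map_mul,
        ← Complex.sinh_conj, ← Complex.cosh_conj, map_div₀, map_neg, map_ofNat, Pi.single_apply,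
        apply_ite (starRingEnd ℂ), map_one, map_zero]
    rw [← hc, Complex.conj_im]
  rw [e]
  exact h

lemma differentiable_tubePoint {d : ℕ} (i : Fin d) : Differentiable ℂ (tubePoint i) := by
  have hs : Differentiable ℂ fun t : ℂ => Complex.sinh (t / 2) :=
    Complex.differentiable_sinh.comp (differentiable_id.div_const 2)
  have hc : Differentiable ℂ fun t : ℂ => Complex.cosh (t / 2) :=
    Complex.differentiable_cosh.comp (differentiable_id.div_const 2)
  exact (hs.smul_const _).add (hc.smul_const _)

/-- By surjectivity of the cosine and `2πi`-periodicity, `Im t` may be taken in `[0, 2π)`; `Im t =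
0` would give `ζ = -cosh t ≤ -1`, on the cut. -/
lemma exists_neg_cosh_eq {ζ : ℂ} (hζ : ζ ∈ cutPlane) :
    ∃ t : ℂ, 0 < t.im ∧ t.im < 2 * Real.pi ∧ -Complex.cosh t = ζ := by
  obtain ⟨x, hx⟩ := Complex.cos_surjective (-ζ)
  have hx' : Complex.cosh (x * Complex.I) = -ζ := by rw [Complex.cosh_mul_I, hx]
  set s := x * Complex.I
  have hpi : (0 : ℝ) < 2 * Real.pi := by positivity
  let k := toIcoDiv hpi 0 s.im
  have hk := toIcoMod_mem_Ico hpi 0 s.im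
  have hkm : toIcoMod hpi 0 s.im = s.im - k • (2 * Real.pi) := rfl
  rw [zero_add] at hk
  let t : ℂ := s - k * (2 * Real.pi * Complex.I)
  have htim : t.im = toIcoMod hpi 0 s.im := by
    rw [hkm]; simp [t]
  have hch : Complex.cosh t = -ζ := by
    rw [← hx']
    have h1 : Complex.exp t = Complex.exp s := Complex.exp_eq_exp_iff_exists_int.2 ⟨-k, by
      simp only [t]; push_cast; ring⟩
    rw [Complex.cosh, Complex.cosh, Complex.exp_neg, Complex.exp_neg, h1]
  refine ⟨t, ?_, by rw [htim]; exact hk.2, by rw [hch, neg_neg]⟩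
  refine lt_of_le_of_ne (by rw [htim]; exact hk.1) fun h0 => hζ ⟨-Real.cosh t.re, ?_, ?_⟩
  · linarith [Real.one_le_cosh t.re]
  · have : t = (t.re : ℂ) := Complex.ext rfl (by simp [← h0])
    rw [Complex.ofReal_neg, Complex.ofReal_cosh, ← this, hch, neg_neg]

/-- The curve `t ↦ (z(-t), z(t))` has invariant `-cosh t`, which covers the cut plane as `t` runs
through the strip `0 < Im t < 2π`. Both sides are holomorphic there, and they agree near `t = πi`,
where `ζ = 1`. -/
theorem waveIntegral_eq_waveF {n : ℕ} (hn : 1 ≤ n) {γ : Chain (n + 1) n} (hγ : IsCycle γ)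
    (ν : ℂ) {z₁ z₂ : Fin (n + 1 + 1) → ℂ} (h₁ : z₁ ∈ pastTube (n + 1))
    (h₂ : z₂ ∈ futureTube (n + 1)) : waveIntegral ν γ z₁ z₂ =
      Complex.exp (-(Real.pi * Complex.I * waveParam n (-ν))) *
        poissonIntegral γ (Pi.single 0 (-Complex.I)) * waveF n ν (mdot z₁ z₂) := by
  let i : Fin (n + 1) := 0
  let S : Set ℂ := {t | 0 < t.im ∧ t.im < 2 * Real.pi}
  have hS : IsOpen S := (isOpen_lt continuous_const Complex.continuous_im).inter
    (isOpen_lt Complex.continuous_im continuous_const)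
  have hSc : IsPreconnected S := by
    have : Convex ℝ S := (convex_halfSpace_im_gt 0).inter (convex_halfSpace_im_lt (2 * Real.pi))
    exact this.isPreconnected
  have hm : ∀ t, mdot (tubePoint i (-t)) (tubePoint i t) = -Complex.cosh t := fun t => by
    have h := Complex.cosh_add (t / 2) (t / 2)
    rw [add_halves] at h
    rw [mdot_tubePoint, neg_div, Complex.sinh_neg, Complex.cosh_neg, h]
    ring
  obtain ⟨t, ht0, ht1, ht⟩ := exists_neg_cosh_eq (mdot_mem_cutPlane h₁ h₂)
  rw [waveIntegral_eq_of_mdot_eq hn hγ ν h₁ h₂ (tubePoint_neg_mem_pastTube i ht0 ht1)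
    (tubePoint_mem_futureTube i ht0 ht1) (by rw [hm, ht]), ← ht]
  have hd1 : DifferentiableOn ℂ
      (fun t => waveIntegral ν γ (tubePoint i (-t)) (tubePoint i t)) S := fun t ht => by
    have h1 := differentiableAt_waveIntegral γ ν (tubePoint_neg_mem_pastTube i ht.1 ht.2).2
      (tubePoint_mem_futureTube i ht.1 ht.2).2
    have h2 : DifferentiableAt ℂ (fun t => (ν, tubePoint i (-t), tubePoint i t)) t :=
      (differentiableAt_const ν).prodMk
        ((((differentiable_tubePoint i).comp differentiable_neg) t).prodMk
          (differentiable_tubePoint i t))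
    exact (DifferentiableAt.comp (f := fun t => (ν, tubePoint i (-t), tubePoint i t)) t h1
      h2).differentiableWithinAt
  have hd2 : DifferentiableOn ℂ (fun t => Complex.exp (-(Real.pi * Complex.I * waveParam n (-ν))) *
      poissonIntegral γ (Pi.single 0 (-Complex.I)) * waveF n ν (-Complex.cosh t)) S := by
    refine DifferentiableOn.const_mul (DifferentiableOn.comp (differentiableOn_waveF n ν)
      Complex.differentiable_cosh.neg.differentiableOn fun t ht => ?_) _
    rw [Pi.neg_apply, ← hm]
    exact mdot_mem_cutPlane (tubePoint_neg_mem_pastTube i ht.1 ht.2)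
      (tubePoint_mem_futureTube i ht.1 ht.2)
  have hpi : Real.pi * Complex.I ∈ S := by
    simp [S, Real.pi_pos]
  refine (hd1.analyticOnNhd hS).eqOn_of_preconnected_of_eventuallyEq (hd2.analyticOnNhd hS) hSc hpi
    ?_ ⟨ht0, ht1⟩
  have hball : ∀ᶠ t in nhds ((Real.pi : ℂ) * Complex.I),
      (1 - (-Complex.cosh t)) / 2 ∈ Metric.ball (0 : ℂ) 1 := by
    have hcont : Continuous fun t : ℂ => (1 - (-Complex.cosh t)) / 2 := by fun_prop
    refine hcont.continuousAt.eventually_mem (Metric.isOpen_ball.mem_nhds ?_)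
    simp [Complex.cosh_mul_I]
  filter_upwards [hball, hS.mem_nhds hpi] with t ht1 ht2
  rw [← hm] at ht1 ⊢
  exact waveIntegral_eq_waveF_of_small hn hγ ν (tubePoint_neg_mem_pastTube i ht2.1 ht2.2)
    (tubePoint_mem_futureTube i ht2.1 ht2.2) ht1

/-! ### The spherical cycle -/

/-- Only the first two entries of the first column are nonzero. This is the change of volume when
one polar angle is added to spherical coordinates. -/
lemma det_polar {n : ℕ} (N : Fin (n + 1) → Fin (n + 1) → ℝ) (c s k : ℝ) :
    (Matrix.of (Fin.cons (Fin.cons c (s • N 0)) (Fin.cons (Fin.cons (-(k * s)) ((k * c) • N 0))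
      fun b : Fin n => Fin.cons 0 (s • N b.succ)) : Fin (n + 2) → Fin (n + 2) → ℝ)).det =
      k * (c ^ 2 + s ^ 2) * s ^ n * (Matrix.of N).det := by
  have h1 : ∀ r : ℝ, (Matrix.of (Fin.cons (r • N 0) fun b : Fin n => s • N b.succ :
      Fin (n + 1) → Fin (n + 1) → ℝ)).det = r * s ^ n * (Matrix.of N).det := fun r => by
    have := Matrix.det_mul_column (Fin.cons r fun _ : Fin n => s) (Matrix.of N)
    rw [Fin.prod_univ_succ] at this
    simp only [Fin.cons_zero, Fin.cons_succ, Finset.prod_const, Finset.card_univ,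
      Fintype.card_fin] at this
    rw [← this]
    congr 1
    ext i j
    refine Fin.cases ?_ (fun i => ?_) i <;> simp
  rw [Matrix.det_succ_column_zero, Fin.sum_univ_succ, Fin.sum_univ_succ, Finset.sum_eq_zero]
  · have e0 : (Matrix.of (Fin.cons (Fin.cons c (s • N 0)) (Fin.cons (Fin.cons (-(k * s))
        ((k * c) • N 0)) fun b : Fin n => Fin.cons 0 (s • N b.succ)) :
        Fin (n + 2) → Fin (n + 2) → ℝ)).submatrix (Fin.succAbove 0) Fin.succ =
        Matrix.of (Fin.cons ((k * c) • N 0) fun b : Fin n => s • N b.succ) := by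
      ext i j
      refine Fin.cases ?_ (fun i => ?_) i <;> simp
    have e1 : (Matrix.of (Fin.cons (Fin.cons c (s • N 0)) (Fin.cons (Fin.cons (-(k * s))
        ((k * c) • N 0)) fun b : Fin n => Fin.cons 0 (s • N b.succ)) :
        Fin (n + 2) → Fin (n + 2) → ℝ)).submatrix (Fin.succAbove (Fin.succ 0)) Fin.succ =
        Matrix.of (Fin.cons (s • N 0) fun b : Fin n => s • N b.succ) := by
      ext i j
      refine Fin.cases ?_ (fun i => ?_) i
      · simp
      · simp
    rw [e0, e1, h1, h1]
    simp
    ring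
  · intro i _
    simp

/-- The period factors of the hyperspherical angles. -/
def angleScale (n : ℕ) : ℝ := if n = 0 then 2 * Real.pi else Real.pi

lemma sphereAngle_zero (n : ℕ) (t : Fin (n + 1) → ℝ) :
    sphereAngle (n + 1) t 0 = angleScale n * t 0 := by
  by_cases h : n = 0
  · subst h; simp [sphereAngle, angleScale]
  · simp [sphereAngle, angleScale, h]

lemma sphereAngle_succ (n : ℕ) (t : Fin (n + 1) → ℝ) (i : ℕ) :
    sphereAngle (n + 1) t (i + 1) = sphereAngle n (Fin.tail t) i := by
  simp only [sphereAngle, add_lt_add_iff_right, add_left_inj]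
  rfl

lemma sphereParam_succ (n : ℕ) (t : Fin (n + 1) → ℝ) :
    sphereParam (n + 1) t = Fin.cons (Real.cos (angleScale n * t 0))
      (Real.sin (angleScale n * t 0) • sphereParam n (Fin.tail t)) := by
  funext j
  refine Fin.cases ?_ (fun j => ?_) j
  · simp [sphereParam, sphereAngle_zero]
  · simp only [sphereParam, Fin.val_succ, Finset.prod_range_succ', sphereAngle_succ,
      sphereAngle_zero, add_lt_add_iff_right, Fin.cons_succ, Pi.smul_apply, smul_eq_mul]
    ring

lemma contDiff_sphereParam' (n : ℕ) : ContDiff ℝ ∞ (sphereParam n) :=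
  contDiff_pi.2 fun j => contDiff_sphereParam n j

lemma fderiv_sphereParam_succ (n : ℕ) (t v : Fin (n + 1) → ℝ) :
    fderiv ℝ (sphereParam (n + 1)) t v =
      Fin.cons (-(angleScale n * v 0 * Real.sin (angleScale n * t 0)))
        ((angleScale n * v 0 * Real.cos (angleScale n * t 0)) • sphereParam n (Fin.tail t) +
          Real.sin (angleScale n * t 0) •
            fderiv ℝ (sphereParam n) (Fin.tail t) (Fin.tail v)) := by
  have hθ : HasFDerivAt (fun t : Fin (n + 1) → ℝ => angleScale n * t 0)
      (angleScale n • (ContinuousLinearMap.proj 0 : (Fin (n + 1) → ℝ) →L[ℝ] ℝ)) t :=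
    (ContinuousLinearMap.proj (R := ℝ) (φ := fun _ : Fin (n + 1) => ℝ) 0).hasFDerivAt.const_mul _
  have hs := ((contDiff_sphereParam' n).differentiable (by simp) (Fin.tail t)).hasFDerivAt.comp t
    (tailL n).hasFDerivAt
  have hd : HasFDerivAt (sphereParam (n + 1)) (fderiv ℝ (sphereParam (n + 1)) t) t :=
    ((contDiff_sphereParam' (n + 1)).differentiable (by simp) t).hasFDerivAt
  rw [hasFDerivAt_pi'] at hd hs
  funext j
  have hj := hd j
  refine Fin.cases ?_ (fun j => ?_) j
  · have h1 := hd 0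
    have h2 : (fun t => sphereParam (n + 1) t 0) = fun t : Fin (n + 1) → ℝ =>
        Real.cos (angleScale n * t 0) := by
      funext t; rw [sphereParam_succ]; rfl
    rw [h2] at h1
    have h3 := congrArg (fun L => L v) (h1.unique hθ.cos)
    simp only [ContinuousLinearMap.comp_apply, ContinuousLinearMap.proj_apply] at h3
    rw [h3]
    simp
    ring
  · have h1 := hd j.succ
    have h2 : (fun t => sphereParam (n + 1) t j.succ) = fun t : Fin (n + 1) → ℝ =>
        Real.sin (angleScale n * t 0) * sphereParam n (tailL n t) j := by
      funext t; rw [sphereParam_succ]; rfl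
    rw [h2] at h1
    have h3 := congrArg (fun L => L v) (h1.unique (hθ.sin.mul (hs j)))
    simp only [ContinuousLinearMap.comp_apply, ContinuousLinearMap.proj_apply] at h3
    rw [h3]
    simp [tailL_apply]
    ring

/-- The Jacobian of hyperspherical coordinates. -/
def sphereJacobian (n : ℕ) (t : Fin n → ℝ) : ℝ :=
  (Matrix.of (Fin.cons (sphereParam n t) fun b => fderiv ℝ (sphereParam n) t (Pi.single b 1) :
    Fin (n + 1) → Fin (n + 1) → ℝ)).det

lemma sphereJacobian_succ (n : ℕ) (t : Fin (n + 1) → ℝ) : sphereJacobian (n + 1) t =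
    angleScale n * Real.sin (angleScale n * t 0) ^ n * sphereJacobian n (Fin.tail t) := by
  have h := det_polar (Fin.cons (sphereParam n (Fin.tail t)) fun b =>
    fderiv ℝ (sphereParam n) (Fin.tail t) (Pi.single b 1)) (Real.cos (angleScale n * t 0))
    (Real.sin (angleScale n * t 0)) (angleScale n)
  rw [Real.cos_sq_add_sin_sq, mul_one] at h
  rw [sphereJacobian, sphereJacobian, ← h]
  congr 2
  funext i
  refine Fin.cases ?_ (fun i => Fin.cases ?_ (fun i => ?_) i) i
  · rw [sphereParam_succ]; rfl
  · have : Fin.tail (Pi.single 0 1 : Fin (n + 1) → ℝ) = 0 := by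
      funext j; simp [Fin.tail]
    simp only [Fin.cons_succ, Fin.cons_zero, fderiv_sphereParam_succ, this, map_zero, smul_zero,
      add_zero, Pi.single_eq_same, mul_one]
  · have h1 : Fin.tail (Pi.single i.succ 1 : Fin (n + 1) → ℝ) = Pi.single i 1 := by
      funext j; simp [Fin.tail, Pi.single_apply]
    have h2 : (Pi.single i.succ 1 : Fin (n + 1) → ℝ) 0 = 0 := by simp [(Fin.succ_ne_zero i).symm]
    simp only [Fin.cons_succ, fderiv_sphereParam_succ, h1, h2, mul_zero, zero_mul, neg_zero,
      zero_smul, zero_add]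

lemma integral_unitCube_succ {n : ℕ} (f : ℝ → ℝ) (g : (Fin n → ℝ) → ℝ) :
    ∫ t in Set.Icc (0 : Fin (n + 1) → ℝ) 1, f (t 0) * g (Fin.tail t) =
      (∫ x in (0 : ℝ)..1, f x) * ∫ t in Set.Icc (0 : Fin n → ℝ) 1, g t := by
  have e := MeasureTheory.volume_preserving_piFinSuccAbove (fun _ : Fin (n + 1) => ℝ) 0
  have hpre : Set.Icc (0 : Fin (n + 1) → ℝ) 1 =
      (MeasurableEquiv.piFinSuccAbove (fun _ : Fin (n + 1) => ℝ) 0) ⁻¹'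
        (Set.Icc (0 : ℝ) 1 ×ˢ Set.Icc (0 : Fin n → ℝ) 1) := by
    ext t
    simp [Pi.le_def, Fin.forall_fin_succ]
    tauto
  have h := MeasureTheory.MeasurePreserving.setIntegral_preimage_emb e
    (MeasurableEquiv.measurableEmbedding _) (fun q : ℝ × (Fin n → ℝ) => f q.1 * g q.2)
    (Set.Icc (0 : ℝ) 1 ×ˢ Set.Icc (0 : Fin n → ℝ) 1)
  rw [hpre, intervalIntegral.integral_of_le zero_le_one, ← MeasureTheory.integral_Icc_eq_integral_Ioc,
    ← MeasureTheory.setIntegral_prod_mul, ← MeasureTheory.Measure.volume_eq_prod, ← h]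
  rfl

lemma integral_sin_pow_zero_pi (n : ℕ) : ∫ x in (0 : ℝ)..Real.pi, Real.sin x ^ n =
    Real.sqrt Real.pi * Real.Gamma ((n + 1) / 2) / Real.Gamma (n / 2 + 1) := by
  induction n using Nat.twoStepInduction with
  | zero =>
    rw [Nat.cast_zero, zero_add, zero_div, zero_add, Real.Gamma_one, Real.Gamma_one_half_eq]
    simp [Real.mul_self_sqrt Real.pi_pos.le]
  | one =>
    have h : Real.Gamma (1 / 2 + 1) = 1 / 2 * Real.sqrt Real.pi := by
      rw [Real.Gamma_add_one (by norm_num), Real.Gamma_one_half_eq]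
    have := Real.sqrt_pos.2 Real.pi_pos
    have h1 : ((1 : ℕ) + 1 : ℝ) / 2 = 1 := by norm_num
    rw [h1, Nat.cast_one, h, Real.Gamma_one]
    simp only [pow_one, integral_sin, Real.cos_zero, Real.cos_pi]
    field_simp
    norm_num
  | more n ih _ =>
    rw [integral_sin_pow, ih]
    push_cast
    have h1 : ((n : ℝ) + 2 + 1) / 2 = (n + 1) / 2 + 1 := by ring
    have h2 : ((n : ℝ) + 2) / 2 + 1 = (n / 2 + 1) + 1 := by ring
    rw [h1, h2, Real.Gamma_add_one (s := ((n : ℝ) + 1) / 2) (by positivity),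
      Real.Gamma_add_one (s := (n : ℝ) / 2 + 1) (by positivity)]
    have := (Real.Gamma_pos_of_pos (show (0 : ℝ) < n / 2 + 1 by positivity)).ne'
    generalize Real.Gamma ((n : ℝ) / 2 + 1) = x at *
    generalize Real.Gamma (((n : ℝ) + 1) / 2) = y at *
    simp only [Real.sin_zero, Real.sin_pi, zero_pow (Nat.succ_ne_zero n), zero_mul, sub_zero,
      zero_div, zero_add]
    field_simp

/-- The Jacobian splits off one angle at a time; the sine integrals build up the area of the unit
sphere from the circumference of the circle. -/
lemma integral_sphereJacobian_succ (n : ℕ) :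
    ∫ t in Set.Icc (0 : Fin (n + 1) → ℝ) 1, sphereJacobian (n + 1) t =
      2 * Real.pi ^ (((n : ℝ) + 2) / 2) / Real.Gamma ((n + 2) / 2) := by
  simp only [sphereJacobian_succ]
  induction n with
  | zero =>
    have := integral_unitCube_succ (n := 0) (fun x => angleScale 0 * Real.sin (angleScale 0 * x) ^ 0)
      (sphereJacobian 0)
    rw [this]
    have h0 : ∀ t, sphereJacobian 0 t = 1 := fun t => by
      simp [sphereJacobian, sphereParam]
    simp only [h0, MeasureTheory.setIntegral_const, MeasureTheory.Measure.real, Real.volume_Icc_pi]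
    simp [angleScale]
  | succ n ih =>
    have h1 := integral_unitCube_succ (n := n + 1)
      (fun x => angleScale (n + 1) * Real.sin (angleScale (n + 1) * x) ^ (n + 1))
      (sphereJacobian (n + 1))
    rw [h1]
    simp only [sphereJacobian_succ n, ih]
    have hs : angleScale (n + 1) = Real.pi := by simp [angleScale]
    have h2 : ∫ x in (0 : ℝ)..1, Real.pi * Real.sin (Real.pi * x) ^ (n + 1) =
        ∫ x in (0 : ℝ)..Real.pi, Real.sin x ^ (n + 1) := by
      rw [intervalIntegral.integral_const_mul, intervalIntegral.mul_integral_comp_mul_left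
        (f := fun x => Real.sin x ^ (n + 1))]
      simp
    rw [hs, h2, integral_sin_pow_zero_pi]
    push_cast
    have e1 : ((n : ℝ) + 1 + 2) / 2 = (n + 2) / 2 + 1 / 2 := by ring
    have e2 : ((n : ℝ) + 1) / 2 + 1 = (n + 2) / 2 + 1 / 2 := by ring
    have e3 : ((n : ℝ) + 1 + 1) / 2 = (n + 2) / 2 := by ring
    rw [e1, e2, e3, Real.rpow_add Real.pi_pos, ← Real.sqrt_eq_rpow]
    have := (Real.Gamma_pos_of_pos (show (0 : ℝ) < (n + 2) / 2 by positivity)).ne'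
    field_simp

lemma sphereCube_ext' (n : ℕ) : Set.EqOn (sphereCube n).ext'
    (fun x => Fin.cons 1 (sphereParam n x)) (Set.Icc 0 1) := by
  intro x hx
  simp only [SmoothCube.ext', sphereCube]
  congr 2
  funext i
  rw [Set.projIcc_of_mem zero_le_one ⟨hx.1 i, hx.2 i⟩]

/-- On `γ₀` the product of `ξ` with `-i e₀` is the constant `-i`, so the integral is `i^n` times the
area of the sphere. -/
lemma poissonIntegral_sphereCycle {n : ℕ} (hn : 1 ≤ n) :
    poissonIntegral (sphereCycle n) (Pi.single 0 (-Complex.I)) =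
      Complex.I ^ n * ((2 * Real.pi ^ (((n : ℝ) + 1) / 2) / Real.Gamma ((n + 1) / 2) : ℝ) : ℂ) := by
  have hg : ContDiff ℝ ∞ (fun x : Fin n → ℝ => (Fin.cons 1 (sphereParam n x) : Fin (n + 2) → ℝ)) := by
    rw [contDiff_pi]
    intro k
    refine Fin.cases ?_ (fun j => ?_) k
    · simpa using contDiff_const
    · simpa using contDiff_sphereParam n j
  have hw : ∀ x ∈ Set.Icc (0 : Fin n → ℝ) 1, cubeWeight (sphereCube n) x = sphereJacobian n x := by
    intro x hx
    rw [cubeWeight, SmoothCube.fderivWithin_ext' hg (sphereCube_ext' n) hx, sphereCube_ext' n hx,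
      alphaForm_eq_det, sphereJacobian]
    simp only [Fin.cons_zero, inv_one, one_mul, Fin.tail_cons]
    congr 4
    funext b
    have h1 := (hg.differentiable (by simp) x).hasFDerivAt
    have h2 := (tailL (n + 1)).hasFDerivAt.comp x h1
    have h3 := h2.unique ((contDiff_sphereParam' n).differentiable (by simp) x).hasFDerivAt
    rw [← h3]
    rfl
  rw [poissonIntegral, chainIntegral_eq_chainSum, sphereCycle, chainSum_single,
    cubeIntegral_eq_weight]
  have hI : ∀ x ∈ Set.Icc (0 : Fin n → ℝ) 1,
      (mdot (toC ((sphereCube n).ext' x)) (Pi.single 0 (-Complex.I)) ^ n)⁻¹ *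
        cubeWeight (sphereCube n) x = Complex.I ^ n * ((sphereJacobian n x : ℝ) : ℂ) := by
    intro x hx
    rw [hw x hx]
    have h1 : mdot (toC ((sphereCube n).ext' x)) (Pi.single 0 (-Complex.I)) = -Complex.I := by
      have : (Pi.single 0 (-Complex.I) : Fin (n + 1 + 1) → ℂ) = (-Complex.I) • Pi.single 0 1 := by
        rw [← Pi.single_smul, smul_eq_mul, mul_one]
      rw [this, mdot_smul_right, mdot_single_zero, sphereCube_ext' n hx]
      simp [toC]
    rw [h1, ← inv_pow, inv_neg, Complex.inv_I, neg_neg]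
  rw [MeasureTheory.setIntegral_congr_fun measurableSet_Icc hI, MeasureTheory.integral_const_mul,
    integral_complex_ofReal]
  obtain ⟨m, rfl⟩ := Nat.exists_eq_add_of_le' hn
  rw [integral_sphereJacobian_succ]
  push_cast
  rw [add_assoc, one_add_one_eq_two]
  simp

/-- Once the sine of one angle vanishes, every coordinate involving a later angle is zero. -/
lemma sphereParam_congr {n : ℕ} {t u : Fin n → ℝ} {i : Fin n}
    (hi : Real.sin (sphereAngle n t i) = 0) (h : ∀ j : Fin n, j ≤ i → t j = u j) :
    sphereParam n t = sphereParam n u := by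
  have ha : ∀ k : ℕ, k ≤ i → sphereAngle n t k = sphereAngle n u k := by
    intro k hk
    have hkn : k < n := hk.trans_lt i.2
    simp only [sphereAngle, hkn, dif_pos]
    rw [h ⟨k, hkn⟩ hk]
  funext j
  simp only [sphereParam]
  by_cases hj : (j : ℕ) ≤ i
  · rw [ha j hj]
    congr 1
    refine Finset.prod_congr rfl fun k hk => ?_
    rw [ha k ((Finset.mem_range.1 hk).le.trans hj)]
  · have hm : (i : ℕ) ∈ Finset.range j := Finset.mem_range.2 (not_le.1 hj)
    rw [Finset.prod_eq_zero hm hi, Finset.prod_eq_zero hm (by rw [← ha i le_rfl]; exact hi),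
      zero_mul, zero_mul]

/-- The two faces of the last angle coincide by `2π`-periodicity and cancel. At the ends `0`, `π` of
any earlier angle the parametrization forgets the later ones, so these faces are degenerate. -/
lemma isCycle_sphereCycle (n : ℕ) : IsCycle (sphereCycle n) := by
  match n with
  | 0 => trivial
  | m + 1 =>
    have hb : boundary (sphereCycle (m + 1)) = ∑ i : Fin (m + 1), (-1 : ℤ) ^ (i : ℕ) •
        (Finsupp.single ((sphereCube (m + 1)).face i 1) (1 : ℤ) -
          Finsupp.single ((sphereCube (m + 1)).face i 0) (1 : ℤ)) := by
      simp [boundary, sphereCycle]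
    change boundary (sphereCycle (m + 1)) ∈ degenerateChains (m + 2) m
    rw [hb]
    refine sum_mem fun i _ => zsmul_mem ?_ _
    rcases eq_or_ne i (Fin.last m) with rfl | hi
    · have : (sphereCube (m + 1)).face (Fin.last m) 1 = (sphereCube (m + 1)).face (Fin.last m) 0 := by
        ext t : 2
        simp only [SmoothCube.face, sphereCube]
        congr 1
        have hlt : ∀ c : unitInterval, ∀ k : ℕ, k < m → sphereAngle (m + 1) (fun i =>
            ((Fin.insertNth (α := fun _ => unitInterval) (Fin.last m) c t i : unitInterval) : ℝ)) k =
            sphereAngle (m + 1) (fun i => ((Fin.insertNth (α := fun _ => unitInterval)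
              (Fin.last m) 0 t i : unitInterval) : ℝ)) k := by
          intro c k hk
          have hk' : k < m + 1 := by omega
          simp only [sphereAngle, hk', dif_pos]
          have : (⟨k, hk'⟩ : Fin (m + 1)) = (Fin.last m).succAbove ⟨k, hk⟩ := by
            ext; simp
          rw [this, Fin.insertNth_apply_succAbove, Fin.insertNth_apply_succAbove]
        have hl : ∀ c : unitInterval, sphereAngle (m + 1) (fun i =>
            ((Fin.insertNth (α := fun _ => unitInterval) (Fin.last m) c t i : unitInterval) : ℝ)) m =
            2 * Real.pi * c := by
          intro c
          have : (⟨m, Nat.lt_succ_self m⟩ : Fin (m + 1)) = Fin.last m := rfl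
          simp [sphereAngle, this]
        funext j
        simp only [sphereParam]
        rcases Nat.lt_or_ge (j : ℕ) m with hj | hj
        · rw [hlt 1 j hj]
          congr 1
          refine Finset.prod_congr rfl fun k hk => ?_
          rw [hlt 1 k ((Finset.mem_range.1 hk).trans hj)]
        · rcases Nat.lt_or_ge (j : ℕ) (m + 1) with hj' | hj'
          · have hjm : (j : ℕ) = m := by omega
            rw [hjm, hl, hl]
            congr 1
            · refine Finset.prod_congr rfl fun k hk => ?_
              rw [hlt 1 k (Finset.mem_range.1 hk)]
            · simp
          · have hjm : (j : ℕ) = m + 1 := by omega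
            rw [hjm, Finset.prod_range_succ, Finset.prod_range_succ, hl, hl]
            simp
      rw [this, sub_self]
      exact zero_mem _
    · have hilt : (i : ℕ) < m := by
        have h1 := i.2
        have h2 : (i : ℕ) ≠ m := fun h => hi (Fin.ext h)
        omega
      have hdeg : ∀ c : unitInterval, Real.sin (Real.pi * c) = 0 →
          ((sphereCube (m + 1)).face i c).IsDegenerate := by
        intro c hc
        have hm : 0 < m := by omega
        -- The face of the `(m+1)`-cube has `m` variables; the redundant one exhibited is the last
        -- angle.
        refine ⟨⟨m - 1, by omega⟩, fun t u htu => ?_⟩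
        simp only [SmoothCube.face, sphereCube]
        congr 1
        refine sphereParam_congr (i := i) ?_ fun j hj => ?_
        · have h3 : i.1 ≠ m := by omega
          simp [sphereAngle, h3, hc, hilt.le]
        · congr 1
          rcases eq_or_lt_of_le hj with rfl | hlt
          · rw [Fin.insertNth_apply_same, Fin.insertNth_apply_same]
          · have hjm : (j : ℕ) < m := by have : (j : ℕ) < i := hlt; omega
            have : j = i.succAbove ⟨j, hjm⟩ := by
              rw [Fin.succAbove_of_castSucc_lt]
              · rfl
              · exact hlt
            rw [this, Fin.insertNth_apply_succAbove, Fin.insertNth_apply_succAbove]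
            refine htu _ fun h => ?_
            have h4 : (j : ℕ) = m - 1 := congrArg Fin.val h
            have : (j : ℕ) < i := hlt
            omega
      have hmem : ∀ c : unitInterval, Real.sin (Real.pi * c) = 0 →
          Finsupp.single ((sphereCube (m + 1)).face i c) (1 : ℤ) ∈ degenerateChains (m + 2) m :=
        fun c hc => AddSubgroup.subset_closure ⟨_, hdeg c hc, rfl⟩
      exact sub_mem (hmem 1 (by simp)) (hmem 0 (by simp))

/-! ### The two-point function and the Bunch-Davies function -/

/-- The value of the normalized two-point function at `ζ = 1` (after analytic continuation). -/
def waveConst (n : ℕ) (ν : ℂ) : ℂ :=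
  gammaFactor (n + 1) ν /
    ((2 ^ (n + 1) * Real.pi ^ (((n : ℝ) + 1) / 2) * Real.Gamma ((n + 1) / 2) : ℝ) : ℂ)

/-- The phase from replacing `z₂` by `-z₂` and the factor `i^n` from the base point cancel against
`e^(πν)`. -/
lemma exp_mul_I_pow (n : ℕ) (ν : ℂ) :
    Complex.exp (Real.pi * ν) * (Complex.exp (-(Real.pi * Complex.I * waveParam n (-ν))) *
      Complex.I ^ n) = 1 := by
  have hI : Complex.I ^ n = Complex.exp (n * (Real.pi / 2 * Complex.I)) := by
    rw [Complex.exp_nat_mul, Complex.exp_pi_div_two_mul_I]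
  rw [hI, ← Complex.exp_add, ← Complex.exp_add, Complex.exp_eq_one_iff]
  refine ⟨0, ?_⟩
  simp only [waveParam]
  push_cast
  linear_combination Real.pi * ν * Complex.I_sq

theorem twoPoint_eq_waveF {n : ℕ} (hn : 1 ≤ n) {γ : Chain (n + 1) n}
    (hγ : Homologous γ (sphereCycle n)) (ν : ℂ) {z₁ z₂ : Fin (n + 1 + 1) → ℂ}
    (h₁ : z₁ ∈ pastTube (n + 1)) (h₂ : z₂ ∈ futureTube (n + 1)) :
    twoPoint ν γ z₁ z₂ = waveConst n ν * waveF n ν (mdot z₁ z₂) := by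
  rw [twoPoint, waveIntegral_eq_of_homologous ν hγ h₁.2 h₂.2,
    waveIntegral_eq_waveF hn (isCycle_sphereCycle n) ν h₁ h₂, poissonIntegral_sphereCycle hn,
    waveConst]
  have h := exp_mul_I_pow n ν
  have hG : ((Real.Gamma (((n : ℝ) + 1) / 2) : ℝ) : ℂ) ≠ 0 := by
    exact_mod_cast (Real.Gamma_pos_of_pos (by positivity)).ne'
  have hp : ((Real.pi ^ (((n : ℝ) + 1) / 2) : ℝ) : ℂ) ≠ 0 := by
    exact_mod_cast (Real.rpow_pos_of_pos Real.pi_pos _).ne'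
  have hpp : (Real.pi : ℂ) ^ (n + 1) = ((Real.pi ^ (((n : ℝ) + 1) / 2) : ℝ) : ℂ) ^ 2 := by
    rw [← Complex.ofReal_pow, ← Complex.ofReal_pow, ← Real.rpow_natCast, ← Real.rpow_mul_natCast
      Real.pi_pos.le]
    congr 2
    push_cast
    ring
  rw [hpp]
  push_cast at hG hp ⊢
  generalize (Real.Gamma (((n : ℝ) + 1) / 2) : ℂ) = G at *
  generalize ((Real.pi ^ (((n : ℝ) + 1) / 2) : ℝ) : ℂ) = p at *
  field_simp
  linear_combination (gammaFactor (n + 1) ν * waveF n ν (mdot z₁ z₂)) * h * (2 ^ n * 4)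

/-- Off the cut, the arguments of `ζ + 1` and `ζ - 1` lie on the same side of zero, so their
difference stays in the principal range and no branch jump occurs. -/
lemma div_cpow_of_notMem {ζ : ℂ} (hζ : ¬ ∃ r : ℝ, r ≤ 1 ∧ ζ = (r : ℂ)) (s : ℂ) :
    ((ζ + 1) / (ζ - 1)) ^ s = (ζ + 1) ^ s * (ζ - 1) ^ (-s) := by
  have him : ζ.im ≠ 0 ∨ 1 < ζ.re := by
    by_contra h
    push Not at h
    exact hζ ⟨ζ.re, h.2, Complex.ext rfl (by simpa using h.1)⟩
  have h1 : ζ + 1 ∈ Complex.slitPlane := by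
    rw [Complex.mem_slitPlane_iff]
    rcases him with h | h
    · right; simpa using h
    · left; simp; linarith
  have h2 : ζ - 1 ∈ Complex.slitPlane := by
    rw [Complex.mem_slitPlane_iff]
    rcases him with h | h
    · right; simpa using h
    · left; simpa using h
  have n1 := Complex.slitPlane_ne_zero h1
  have n2 := Complex.slitPlane_ne_zero h2
  have harg2 := Complex.mem_slitPlane_iff_arg.1 h2
  have hinv : Complex.log (ζ - 1)⁻¹ = -Complex.log (ζ - 1) := Complex.log_inv _ harg2.1
  have hsum : (ζ + 1).arg + ((ζ - 1)⁻¹).arg ∈ Set.Ioc (-Real.pi) Real.pi := by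
    rw [Complex.arg_inv, if_neg harg2.1]
    have hpi := Real.pi_pos
    rcases lt_trichotomy ζ.im 0 with h | h | h
    · have a1 : (ζ + 1).arg < 0 := Complex.arg_neg_iff.2 (by simpa using h)
      have a2 : (ζ - 1).arg < 0 := Complex.arg_neg_iff.2 (by simpa using h)
      constructor <;> linarith [Complex.neg_pi_lt_arg (ζ + 1), Complex.neg_pi_lt_arg (ζ - 1)]
    · have hr : 1 < ζ.re := by
        rcases him with h' | h'
        · exact absurd h h'
        · exact h'
      have a1 : (ζ + 1).arg = 0 := Complex.arg_eq_zero_iff.2 ⟨by simp; linarith, by simpa using h⟩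
      have a2 : (ζ - 1).arg = 0 := Complex.arg_eq_zero_iff.2 ⟨by simp; linarith, by simpa using h⟩
      rw [a1, a2]
      constructor <;> linarith
    · have a1 : 0 ≤ (ζ + 1).arg := Complex.arg_nonneg_iff.2 (by simpa using h.le)
      have a2 : 0 ≤ (ζ - 1).arg := Complex.arg_nonneg_iff.2 (by simpa using h.le)
      have a3 : (ζ - 1).arg < Real.pi := lt_of_le_of_ne (Complex.arg_le_pi _) harg2.1
      constructor <;> linarith [Complex.arg_le_pi (ζ + 1)]
  have hlog := (Complex.log_mul_eq_add_log_iff n1 (inv_ne_zero n2)).2 hsum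
  rw [hinv] at hlog
  rw [div_eq_mul_inv, Complex.cpow_def_of_ne_zero (mul_ne_zero n1 (inv_ne_zero n2)), hlog,
    Complex.cpow_def_of_ne_zero n1, Complex.cpow_def_of_ne_zero n2, ← Complex.exp_add]
  congr 1
  ring

/-- Euler's transformation turns the Legendre series into `F(a, b; (n+1)/2)` times
`((1+ζ)/2)^((n-1)/2)`. That power cancels the remaining powers of `ζ + 1`, while those of `ζ - 1`
cancel among themselves. -/
theorem bunchDavies_eq_waveF (n : ℕ) (ν : ℂ) {ζ : ℂ}
    (hζ : ¬ ∃ r : ℝ, r ≤ 1 ∧ ζ = (r : ℂ)) :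
    bunchDavies (n + 1) ν ζ = waveConst n ν * waveF n ν ζ := by
  have hcut : ζ ∈ cutPlane := fun ⟨r, hr, h⟩ => hζ ⟨r, by linarith, h⟩
  have hz := mem_cutPlane_iff.1 hcut
  have hab := waveParam_add_neg n ν
  have hE := hypergeometricF_euler (a := waveParam n ν) (b := waveParam n (-ν))
    (c := ((n : ℂ) + 1) / 2) (by rw [hab]) (by rw [hab]; simp; positivity) hz
  have ea : ((n : ℂ) + 1) / 2 - waveParam n ν = -(-(1 / 2) + Complex.I * ν) := by
    simp only [waveParam]; ring
  have eb : ((n : ℂ) + 1) / 2 - waveParam n (-ν) = -(1 / 2) + Complex.I * ν + 1 := by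
    simp only [waveParam]; ring
  have ed : (((n + 1 : ℕ) : ℂ) - 2) = n - 1 := by push_cast; ring
  have em : (1 : ℂ) - -((n : ℂ) - 1) / 2 = (n + 1) / 2 := by ring
  rw [ea, eb] at hE
  rw [bunchDavies, legendreP, ed, em, hE, hab, ← waveF, div_cpow_of_notMem hζ]
  have n1 : ζ + 1 ≠ 0 := fun h => hζ ⟨-1, by norm_num, by push_cast; linear_combination h⟩
  have n2 : ζ - 1 ≠ 0 := fun h => hζ ⟨1, le_rfl, by push_cast; linear_combination h⟩
  have hh : (1 - (1 - ζ) / 2) = ((1 / 2 : ℝ) : ℂ) * (ζ + 1) := by push_cast; ring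
  rw [hh, cpow_ofReal_mul (by norm_num) n1]
  set q : ℂ := (n : ℂ) - 1
  have es : (n : ℂ) - (n + 1) / 2 = q / 2 := by simp only [q]; ring
  have hp1 : (ζ + 1) ^ (-q / 4) * (ζ + 1) ^ (-q / 2 / 2) * (ζ + 1) ^ (q / 2) = 1 := by
    rw [← Complex.cpow_add _ _ n1, ← Complex.cpow_add _ _ n1]
    ring_nf
    exact Complex.cpow_zero _
  have hp2 : (ζ - 1) ^ (-q / 4) * (ζ - 1) ^ (-(-q / 2 / 2)) = 1 := by
    rw [← Complex.cpow_add _ _ n2]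
    ring_nf
    exact Complex.cpow_zero _
  have hG : Complex.Gamma (((n : ℂ) + 1) / 2) = ((Real.Gamma (((n : ℝ) + 1) / 2) : ℝ) : ℂ) := by
    rw [← Complex.Gamma_ofReal]; push_cast; rfl
  have h2pi : (2 * Real.pi : ℂ) ^ (((n + 1 : ℕ) : ℂ) / 2) =
      ((2 ^ (((n : ℝ) + 1) / 2) * Real.pi ^ (((n : ℝ) + 1) / 2) : ℝ) : ℂ) := by
    rw [← Real.mul_rpow (by norm_num) Real.pi_pos.le, Complex.ofReal_cpow (by positivity)]
    push_cast
    rfl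
  have hhalf : (((1 / 2 : ℝ) : ℝ) : ℂ) ^ (q / 2) = (((2 : ℝ) ^ (-(((n : ℝ) - 1) / 2)) : ℝ) : ℂ) := by
    have : q / 2 = (((((n : ℝ) - 1) / 2 : ℝ)) : ℂ) := by simp only [q]; push_cast; ring
    rw [this, ← Complex.ofReal_cpow (by norm_num), one_div, Real.inv_rpow (by norm_num),
      Real.rpow_neg (by norm_num)]
  have h2 : (2 : ℝ) ^ (((n : ℝ) + 1) / 2) = 2 ^ n * (2 : ℝ) ^ (-(((n : ℝ) - 1) / 2)) := by
    rw [← Real.rpow_natCast, ← Real.rpow_add (by norm_num)]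
    congr 1
    ring
  have h2ne : (((2 : ℝ) ^ (-(((n : ℝ) - 1) / 2)) : ℝ) : ℂ) ≠ 0 := by
    exact_mod_cast (Real.rpow_pos_of_pos (by norm_num) _).ne'
  rw [es, hG, h2pi, hhalf, h2, waveConst]
  have hG0 : ((Real.Gamma (((n : ℝ) + 1) / 2) : ℝ) : ℂ) ≠ 0 := by
    exact_mod_cast (Real.Gamma_pos_of_pos (by positivity)).ne'
  have hp0 : ((Real.pi ^ (((n : ℝ) + 1) / 2) : ℝ) : ℂ) ≠ 0 := by
    exact_mod_cast (Real.rpow_pos_of_pos Real.pi_pos _).ne'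
  rw [Complex.ofReal_mul, Complex.ofReal_mul (_ ^ _), Complex.ofReal_mul, Complex.ofReal_mul]
  push_cast at *
  generalize (Real.Gamma (((n : ℝ) + 1) / 2) : ℂ) = G at *
  generalize ((Real.pi ^ (((n : ℝ) + 1) / 2) : ℝ) : ℂ) = p at *
  generalize (((2 : ℝ) ^ (-(((n : ℝ) - 1) / 2)) : ℝ) : ℂ) = r at *
  generalize (ζ + 1) ^ (-q / 4) = x1 at *
  generalize (ζ + 1) ^ (-q / 2 / 2) = x2 at *
  generalize (ζ + 1) ^ (q / 2) = x3 at *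
  generalize (ζ - 1) ^ (-q / 4) = y1 at *
  generalize (ζ - 1) ^ (-(-q / 2 / 2)) = y2 at *
  have h12 : x1 * x2 * x3 * (y1 * y2) = 1 := by rw [hp1, hp2, one_mul]
  field_simp
  linear_combination (gammaFactor (n + 1) ν * waveF n ν ζ) * h12 * (2 ^ n * 2)

lemma holomorphicOn_cutDomain {d : ℕ} {w : ℂ → ℂ} (hw : DifferentiableOn ℂ w cutPlane) :
    HolomorphicOn (cutDomain d) fun p => w (mdot p.1 p.2) := by
  have hc : ContDiff ℂ 1 fun p : (Fin (d + 1) → ℂ) × (Fin (d + 1) → ℂ) => mdot p.1 p.2 :=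
    contDiff_mdot contDiff_fst contDiff_snd
  exact fun p hp => ⟨(fun p => mdot p.1 p.2) ⁻¹' cutPlane, isOpen_cutPlane.preimage hc.continuous,
    hp.2.2, _, hw.comp (hc.differentiable one_ne_zero).differentiableOn fun _ h => h,
    fun _ _ => rfl⟩

/-! ### Behaviour of the hypergeometric function at `1` -/

lemma hypergeometricF_zero_left {b c : ℂ} (hc : ∀ k : ℕ, c ≠ -k) {z : ℂ} (hz : z ∈ gaussDomain) :
    hypergeometricF 0 b c z = 1 := by
  refine (eqOn_hypergeometricF (F := fun _ => 1) (differentiableOn_const 1)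
    (eqOn_ordinaryHypergeometric hc (differentiableOn_const 1) rfl fun k => ?_) hz).symm
  rcases Nat.eq_zero_or_pos k with rfl | hk
  · simp [iteratedDeriv_const]
  · simp [iteratedDeriv_const, hk.ne']

lemma ofReal_mem_gaussDomain {x : ℝ} (hx : x < 1) : (x : ℂ) ∈ gaussDomain := by
  rintro ⟨r, hr, h⟩
  have : x = r := by exact_mod_cast h
  linarith

lemma euler_real_pos {x t : ℝ} (hx : x < 1) (ht : t ∈ Set.Icc (0 : ℝ) 1) :
    0 < 1 - 4 * t * (1 - t) * x := by
  rcases le_or_gt x 0 with h | h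
  · nlinarith [mul_nonneg ht.1 (sub_nonneg.2 ht.2)]
  · nlinarith [mul_nonneg ht.1 (sub_nonneg.2 ht.2), sq_nonneg (2 * t - 1)]

lemma ofReal_cpow_natCast_half {y : ℝ} (hy : 0 ≤ y) (m : ℕ) :
    (y : ℂ) ^ (-((m : ℂ) / 2)) = ((y ^ (-((m : ℝ) / 2)) : ℝ) : ℂ) := by
  rw [Complex.ofReal_cpow hy]
  push_cast
  rfl

open MeasureTheory in
/-- Only the behaviour of the weight at `1/2` matters for Euler's integral near `z = 1`. -/
lemma tendsto_eulerIntegral_sub {m : ℕ} {a b : ℂ} (ha : 0 < a.re) (hb : 0 < b.re)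
    (hab : a + b = m) {a₀ b₀ : ℝ} (ha₀ : 0 < a₀) (hb₀ : 0 < b₀) (hab₀ : a₀ + b₀ = m) {s D : ℝ}
    (hs : 0 < s) (hD : ∀ x : ℝ, x < 1 → (1 - x) ^ s * ‖eulerIntegral a₀ b₀ x‖ ≤ D) :
    Filter.Tendsto (fun x : ℝ => (((1 - x) ^ s : ℝ) : ℂ) *
      (eulerIntegral a b x - eulerIntegral a₀ b₀ x)) (nhdsWithin 1 (Set.Iio 1)) (nhds 0) := by
  have hab₀' : (a₀ : ℂ) + b₀ = m := by exact_mod_cast hab₀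
  let k : ℝ → ℝ → ℝ := fun x t => (1 - 4 * t * (1 - t) * x) ^ (-((m : ℝ) / 2))
  have hk : ∀ x : ℝ, x < 1 → ∀ t ∈ Set.Icc (0 : ℝ) 1,
      (1 - 4 * (t : ℂ) * (1 - t) * x) ^ (-((m : ℂ) / 2)) = (k x t : ℂ) := by
    intro x hx t ht
    rw [← ofReal_cpow_natCast_half (euler_real_pos hx ht).le]
    push_cast
    rfl
  have hkc : ∀ x : ℝ, x < 1 → ContinuousOn (fun t => (k x t : ℂ)) (Set.uIcc 0 1) := by
    intro x hx
    rw [Set.uIcc_of_le zero_le_one]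
    refine Complex.continuous_ofReal.comp_continuousOn (ContinuousOn.rpow_const (by fun_prop)
      fun t ht => Or.inl (euler_real_pos hx ht).ne')
  let β₀ : ℝ → ℝ := fun t => t ^ (a₀ - 1) * (1 - t) ^ (b₀ - 1)
  have hβ : ∀ t ∈ Set.Icc (0 : ℝ) 1, betaWeight a₀ b₀ t = (β₀ t : ℂ) := by
    intro t ht
    have e1 : (t : ℂ) ^ ((a₀ : ℂ) - 1) = ((t ^ (a₀ - 1) : ℝ) : ℂ) := by
      rw [Complex.ofReal_cpow ht.1]; push_cast; rfl
    have e2 : (1 - (t : ℂ)) ^ ((b₀ : ℂ) - 1) = (((1 - t) ^ (b₀ - 1) : ℝ) : ℂ) := by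
      rw [Complex.ofReal_cpow (sub_nonneg.2 ht.2)]; push_cast; rfl
    rw [betaWeight, e1, e2, ← Complex.ofReal_mul]
  have hI := intervalIntegrable_betaWeight ha hb
  have hI₀ := intervalIntegrable_betaWeight (a := a₀) (b := b₀) (by simpa using ha₀)
    (by simpa using hb₀)
  let ρ : ℝ → ℂ := fun t => betaWeight a b t - betaWeight a₀ b₀ t
  have hρ : IntervalIntegrable ρ volume 0 1 := hI.sub hI₀
  have hE : ∀ {a b : ℂ}, a + b = m → ∀ x : ℝ, x < 1 →
      eulerIntegral a b x = ∫ t in (0 : ℝ)..1, betaWeight a b t * (k x t : ℂ) := by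
    intro a b hab x hx
    rw [eulerIntegral]
    refine intervalIntegral.integral_congr fun t ht => ?_
    rw [Set.uIcc_of_le zero_le_one] at ht
    rw [hab, hk x hx t ht]
  have hdiff : ∀ x : ℝ, x < 1 → eulerIntegral a b x - eulerIntegral a₀ b₀ x =
      ∫ t in (0 : ℝ)..1, ρ t * (k x t : ℂ) := by
    intro x hx
    rw [hE hab x hx, hE hab₀' x hx, ← intervalIntegral.integral_sub (hI.mul_continuousOn (hkc x hx))
      (hI₀.mul_continuousOn (hkc x hx))]
    refine intervalIntegral.integral_congr fun t _ => ?_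
    simp only [ρ]
    ring
  have hβpos : ∀ t ∈ Set.Ioo (0 : ℝ) 1, 0 < β₀ t := fun t ht =>
    mul_pos (Real.rpow_pos_of_pos ht.1 _) (Real.rpow_pos_of_pos (sub_pos.2 ht.2) _)
  have hkpos : ∀ x : ℝ, x < 1 → ∀ t ∈ Set.Icc (0 : ℝ) 1, 0 < k x t := fun x hx t ht =>
    Real.rpow_pos_of_pos (euler_real_pos hx ht) _
  have hE₀ : ∀ x : ℝ, x < 1 → ∫ t in (0 : ℝ)..1, β₀ t * k x t = ‖eulerIntegral a₀ b₀ x‖ := by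
    intro x hx
    have h1 : eulerIntegral a₀ b₀ x = ((∫ t in (0 : ℝ)..1, β₀ t * k x t : ℝ) : ℂ) := by
      rw [hE hab₀' x hx, ← intervalIntegral.integral_ofReal]
      refine intervalIntegral.integral_congr fun t ht => ?_
      rw [Set.uIcc_of_le zero_le_one] at ht
      rw [hβ t ht, Complex.ofReal_mul (β₀ t) (k x t)]
    rw [h1, Complex.norm_real, Real.norm_of_nonneg]
    refine intervalIntegral.integral_nonneg zero_le_one fun t ht => ?_
    exact mul_nonneg (mul_nonneg (Real.rpow_nonneg ht.1 _)
      (Real.rpow_nonneg (sub_nonneg.2 ht.2) _)) (hkpos x hx t ht).le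
  have hβI : IntervalIntegrable β₀ volume 0 1 := by
    have := hI₀.norm
    refine this.congr_ae ?_
    rw [Set.uIoc_of_le zero_le_one]
    refine (ae_restrict_iff' measurableSet_Ioc).2 (Filter.Eventually.of_forall fun t ht => ?_)
    show ‖betaWeight a₀ b₀ t‖ = β₀ t
    rw [hβ t ⟨ht.1.le, ht.2⟩, Complex.norm_real, Real.norm_of_nonneg]
    exact mul_nonneg (Real.rpow_nonneg ht.1.le _) (Real.rpow_nonneg (sub_nonneg.2 ht.2) _)
  -- the ratio of the weights is continuous at `1/2`
  have hcont : ContinuousAt (fun t : ℝ => ‖ρ t‖ / β₀ t) (1 / 2) := by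
    have hh : (1 / 2 : ℝ) ∈ Set.Ioo (0 : ℝ) 1 := ⟨by norm_num, by norm_num⟩
    have hcw : ∀ a b : ℂ, ContinuousAt (betaWeight a b) (1 / 2) := fun a b => by
      refine ContinuousAt.mul ?_ ?_
      · refine ContinuousAt.cpow (by fun_prop) continuousAt_const (Or.inl ?_)
        norm_num
      · refine ContinuousAt.cpow (by fun_prop) continuousAt_const (Or.inl ?_)
        norm_num
    refine ContinuousAt.div ((hcw a b).sub (hcw a₀ b₀)).norm ?_ (hβpos _ hh).ne'
    refine ContinuousAt.mul ?_ ?_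
    · exact ContinuousAt.rpow_const continuousAt_id (Or.inl (by norm_num))
    · exact ContinuousAt.rpow_const (by fun_prop) (Or.inl (by norm_num))
  -- At `1/2` both weights equal `(1/2)^(m-2)`, since both pairs of parameters have sum `m`.
  have hzero : ‖ρ (1 / 2)‖ / β₀ (1 / 2) = 0 := by
    have hv : ∀ {a b : ℂ}, a + b = m → betaWeight a b (1 / 2) = (1 / 2 : ℂ) ^ ((m : ℂ) - 2) := by
      intro a b hab
      have e : (1 : ℂ) - ((1 / 2 : ℝ) : ℂ) = 1 / 2 := by push_cast; norm_num
      have e' : ((1 / 2 : ℝ) : ℂ) = 1 / 2 := by push_cast; norm_num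
      rw [betaWeight, e, e', ← Complex.cpow_add _ _ (by norm_num), ← hab]
      congr 1
      ring
    simp only [ρ]
    rw [hv hab, hv hab₀', sub_self, norm_zero, zero_div]
  rw [Metric.tendsto_nhds]
  intro δ hδ
  have hD0 : 0 ≤ D := le_trans (by simp) (hD 0 one_pos)
  set δ' := δ / (2 * (D + 1))
  have hδ' : 0 < δ' := by positivity
  have hev : ∀ᶠ t in nhds (1 / 2 : ℝ), ‖ρ t‖ / β₀ t < δ' := by
    have := hcont.tendsto
    rw [hzero] at this
    exact this.eventually_lt_const hδ'
  obtain ⟨η, hη, hball⟩ := Metric.eventually_nhds_iff.1 hev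
  -- For `|t - 1/2| ≥ η` and `x < 1` one has `1 - 4t(1-t)x ≥ 4η²`, so there the kernel is bounded by
  -- `C` uniformly in `x`; nearer to `1/2` the ratio of the weights is below `δ'`.
  set C : ℝ := (4 * η ^ 2) ^ (-((m : ℝ) / 2))
  have hC : 0 < C := Real.rpow_pos_of_pos (by positivity) _
  set M : ℝ := ∫ t in (0 : ℝ)..1, ‖ρ t‖
  have hM : 0 ≤ M := intervalIntegral.integral_nonneg zero_le_one fun t _ => norm_nonneg _
  have hbound : ∀ x : ℝ, x < 1 → ∀ t ∈ Set.Ioo (0 : ℝ) 1,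
      ‖ρ t * (k x t : ℂ)‖ ≤ δ' * (β₀ t * k x t) + C * ‖ρ t‖ := by
    intro x hx t ht
    have ht' : t ∈ Set.Icc (0 : ℝ) 1 := ⟨ht.1.le, ht.2.le⟩
    have hkp := hkpos x hx t ht'
    rw [norm_mul, Complex.norm_real, Real.norm_of_nonneg hkp.le]
    by_cases h : dist t (1 / 2) < η
    · have h1 := (div_lt_iff₀ (hβpos t ht)).1 (hball h)
      have h2 : 0 ≤ C * ‖ρ t‖ := by positivity
      nlinarith
    · have h1 : k x t ≤ C := by
        rw [not_lt, Real.dist_eq] at h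
        have h2 : η ^ 2 ≤ (t - 1 / 2) ^ 2 := by
          rw [← sq_abs (t - 1 / 2)]
          exact pow_le_pow_left₀ hη.le h 2
        refine Real.rpow_le_rpow_of_nonpos (by positivity) ?_ (by
          have : (0 : ℝ) ≤ m := m.cast_nonneg
          linarith)
        nlinarith [mul_pos ht.1 (sub_pos.2 ht.2)]
      have h2 : 0 ≤ δ' * (β₀ t * k x t) := by have := hβpos t ht; positivity
      nlinarith [mul_le_mul_of_nonneg_left h1 (norm_nonneg (ρ t))]
  have hint : ∀ x : ℝ, x < 1 → ‖eulerIntegral a b x - eulerIntegral a₀ b₀ x‖ ≤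
      δ' * ‖eulerIntegral a₀ b₀ x‖ + C * M := by
    intro x hx
    have hkcr : ContinuousOn (k x) (Set.uIcc 0 1) := by
      rw [Set.uIcc_of_le zero_le_one]
      exact ContinuousOn.rpow_const (by fun_prop) fun t ht => Or.inl (euler_real_pos hx ht).ne'
    rw [hdiff x hx, ← hE₀ x hx, ← intervalIntegral.integral_const_mul,
      ← intervalIntegral.integral_const_mul, ← intervalIntegral.integral_add
        ((hβI.mul_continuousOn hkcr).const_mul _) (hρ.norm.const_mul _)]
    refine intervalIntegral.norm_integral_le_of_norm_le zero_le_one ?_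
      (((hβI.mul_continuousOn hkcr).const_mul _).add (hρ.norm.const_mul _))
    have h1 : ∀ᵐ t : ℝ, t ≠ 1 := by
      rw [ae_iff]; simp
    filter_upwards [h1] with t ht ht'
    exact hbound x hx t ⟨ht'.1, lt_of_le_of_ne ht'.2 ht⟩
  have hsmall : ∀ᶠ x : ℝ in nhdsWithin 1 (Set.Iio 1), (1 - x) ^ s * (C * M) < δ / 2 := by
    have h1 : Filter.Tendsto (fun x : ℝ => (1 - x) ^ s * (C * M)) (nhdsWithin 1 (Set.Iio 1))
        (nhds 0) := by
      have h2 : ContinuousAt (fun x : ℝ => (1 - x) ^ s * (C * M)) 1 :=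
        (ContinuousAt.rpow_const (by fun_prop) (Or.inr hs.le)).mul continuousAt_const
      have h3 := h2.tendsto
      simp only [sub_self, Real.zero_rpow hs.ne', zero_mul] at h3
      exact h3.mono_left nhdsWithin_le_nhds
    exact h1.eventually_lt_const (by positivity)
  filter_upwards [hsmall, self_mem_nhdsWithin] with x hx hx1
  have hx1' : x < 1 := hx1
  have hp : 0 ≤ (1 - x) ^ s := Real.rpow_nonneg (by linarith) _
  rw [dist_zero_right, norm_mul, Complex.norm_real, Real.norm_of_nonneg hp]
  calc (1 - x) ^ s * ‖eulerIntegral a b x - eulerIntegral a₀ b₀ x‖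
      ≤ (1 - x) ^ s * (δ' * ‖eulerIntegral a₀ b₀ x‖ + C * M) :=
        mul_le_mul_of_nonneg_left (hint x hx1') hp
    _ = δ' * ((1 - x) ^ s * ‖eulerIntegral a₀ b₀ x‖) + (1 - x) ^ s * (C * M) := by ring
    _ < δ' * (D + 1) + δ / 2 := by
        have := mul_le_mul_of_nonneg_left (hD x hx1') hδ'.le
        nlinarith
    _ = δ := by
        simp only [δ']
        field_simp
        ring

/-- Integration of the asymptotics `f' ~ ℓ (1 - x)^(-s-1)` as `x → 1`. -/
lemma tendsto_rpow_mul_of_deriv {f f' : ℝ → ℂ} (hf : ∀ x ∈ Set.Ico (0 : ℝ) 1, HasDerivAt f (f' x) x)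
    {s : ℝ} (hs : 0 < s) {ℓ : ℂ}
    (h : Filter.Tendsto (fun x : ℝ => (((1 - x) ^ (s + 1) : ℝ) : ℂ) * f' x)
      (nhdsWithin 1 (Set.Iio 1)) (nhds ℓ)) :
    Filter.Tendsto (fun x : ℝ => (((1 - x) ^ s : ℝ) : ℂ) * f x)
      (nhdsWithin 1 (Set.Iio 1)) (nhds (ℓ / s)) := by
  have hsC : (s : ℂ) ≠ 0 := by exact_mod_cast hs.ne'
  have hpow : ∀ (p : ℝ) (x : ℝ), x < 1 →
      HasDerivAt (fun y : ℝ => (1 - y) ^ (-p)) (p * (1 - x) ^ (-(p + 1))) x := fun p x hx => by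
    have h1 := ((hasDerivAt_id x).const_sub 1).rpow_const (p := -p)
      (Or.inl (by simp only [id]; linarith))
    refine h1.congr_deriv ?_
    rw [show -p - 1 = -(p + 1) by ring]
    simp only [id]
    ring
  -- Subtracts the exact primitive `(ℓ/s)(1-x)^(-s)` of the leading term; what remains has
  -- derivative of smaller order.
  let φ : ℝ → ℂ := fun x => f x - ℓ / s * (((1 - x) ^ (-s) : ℝ) : ℂ)
  have hφ : ∀ x ∈ Set.Ico (0 : ℝ) 1,
      HasDerivAt φ (f' x - ℓ * (((1 - x) ^ (-(s + 1)) : ℝ) : ℂ)) x := fun x hx => by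
    refine ((hf x hx).sub ((hpow s x hx.2).ofReal_comp.const_mul (ℓ / s))).congr_deriv ?_
    push_cast
    field_simp
  rw [Metric.tendsto_nhds] at h ⊢
  intro δ hδ
  have h0 : ∀ᶠ x : ℝ in nhdsWithin 1 (Set.Iio 1), (0 : ℝ) < x :=
    nhdsWithin_le_nhds (lt_mem_nhds one_pos)
  obtain ⟨x₀, hx₀1, hx₀⟩ := (mem_nhdsLT_iff_exists_Ioo_subset' (zero_lt_one' ℝ)).1
    (Filter.inter_mem (h (δ * s / 2) (by positivity)) h0)
  have hx₀1' : x₀ < 1 := hx₀1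
  set x₁ := (max x₀ 0 + 1) / 2
  have hm : max x₀ 0 < 1 := max_lt hx₀1' one_pos
  have hx₁ : x₁ < 1 := by simp only [x₁]; linarith
  have hx₁' : x₀ < x₁ := by
    have := le_max_left x₀ 0
    simp only [x₁]; linarith
  have hx₁0 : 0 < x₁ := by
    have := le_max_right x₀ 0
    simp only [x₁]; linarith
  have hb : ∀ x ∈ Set.Ico x₁ 1, ‖f' x - ℓ * (((1 - x) ^ (-(s + 1)) : ℝ) : ℂ)‖ ≤
      δ / 2 * (s * (1 - x) ^ (-(s + 1))) := by
    intro x hx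
    have h1 : dist ((((1 - x) ^ (s + 1) : ℝ) : ℂ) * f' x) ℓ < δ * s / 2 :=
      (hx₀ ⟨hx₁'.trans_le hx.1, hx.2⟩).1
    have hp : 0 < (1 - x) ^ (s + 1) := Real.rpow_pos_of_pos (by linarith [hx.2]) _
    have hpC : (((1 - x) ^ (s + 1) : ℝ) : ℂ) ≠ 0 := by exact_mod_cast hp.ne'
    have e : f' x - ℓ * (((1 - x) ^ (-(s + 1)) : ℝ) : ℂ) =
        (((1 - x) ^ (-(s + 1)) : ℝ) : ℂ) * ((((1 - x) ^ (s + 1) : ℝ) : ℂ) * f' x - ℓ) := by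
      rw [Real.rpow_neg (by linarith [hx.2]), Complex.ofReal_inv]
      field_simp
    have hp' : 0 < (1 - x) ^ (-(s + 1)) := Real.rpow_pos_of_pos (by linarith [hx.2]) _
    rw [e, norm_mul, Complex.norm_real, Real.norm_of_nonneg hp'.le]
    rw [dist_eq_norm] at h1
    nlinarith
  have hφb : ∀ x ∈ Set.Ico x₁ 1, ‖φ x‖ ≤ ‖φ x₁‖ + δ / 2 * (1 - x) ^ (-s) := by
    intro x hx
    -- A mean value inequality with boundary function `‖φ x₁‖ + (δ/2)(1-y)^(-s)`; multiplication by
    -- `(1-x)^s` makes both terms small.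
    have h2 := image_norm_le_of_norm_deriv_right_le_deriv_boundary' (f := φ) (a := x₁) (b := x)
      (B := fun y => ‖φ x₁‖ + δ / 2 * (1 - y) ^ (-s))
      (B' := fun y => δ / 2 * (s * (1 - y) ^ (-(s + 1))))
      (fun y hy => (hφ y ⟨hx₁0.le.trans hy.1, hy.2.trans_lt hx.2⟩).continuousAt.continuousWithinAt)
      (fun y hy => (hφ y ⟨hx₁0.le.trans hy.1, hy.2.trans hx.2⟩).hasDerivWithinAt)
      (le_add_of_nonneg_right
        (mul_nonneg (by positivity) (Real.rpow_nonneg (by linarith) _)))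
      (fun y hy => (((hpow s y (hy.2.trans_lt hx.2)).const_mul (δ / 2)).const_add
        ‖φ x₁‖).continuousAt.continuousWithinAt)
      (fun y hy => (((hpow s y (hy.2.trans hx.2)).const_mul (δ / 2)).const_add
        ‖φ x₁‖).hasDerivWithinAt)
      (fun y hy => hb y ⟨hy.1, hy.2.trans hx.2⟩)
    exact h2 (Set.right_mem_Icc.2 hx.1)
  have hsmall : ∀ᶠ x : ℝ in nhdsWithin 1 (Set.Iio 1), (1 - x) ^ s * ‖φ x₁‖ < δ / 2 := by
    have h1 : Filter.Tendsto (fun x : ℝ => (1 - x) ^ s * ‖φ x₁‖) (nhdsWithin 1 (Set.Iio 1))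
        (nhds 0) := by
      have h2 : ContinuousAt (fun x : ℝ => (1 - x) ^ s * ‖φ x₁‖) 1 :=
        (ContinuousAt.rpow_const (by fun_prop) (Or.inr hs.le)).mul continuousAt_const
      have h3 := h2.tendsto
      simp only [sub_self, Real.zero_rpow hs.ne', zero_mul] at h3
      exact h3.mono_left nhdsWithin_le_nhds
    exact h1.eventually_lt_const (by positivity)
  have hnear : ∀ᶠ x : ℝ in nhdsWithin 1 (Set.Iio 1), x₁ < x :=
    nhdsWithin_le_nhds (lt_mem_nhds hx₁)
  filter_upwards [hsmall, hnear, self_mem_nhdsWithin] with x hx hx' hx1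
  have hx1' : 0 < 1 - x := sub_pos.2 hx1
  have hp : 0 < (1 - x) ^ s := Real.rpow_pos_of_pos hx1' _
  have hpC : (((1 - x) ^ s : ℝ) : ℂ) ≠ 0 := by exact_mod_cast hp.ne'
  have e : (((1 - x) ^ s : ℝ) : ℂ) * f x - ℓ / s = (((1 - x) ^ s : ℝ) : ℂ) * φ x := by
    simp only [φ]
    rw [Real.rpow_neg hx1'.le, Complex.ofReal_inv]
    field_simp
  rw [dist_eq_norm, e, norm_mul, Complex.norm_real, Real.norm_of_nonneg hp.le]
  have h3 := mul_le_mul_of_nonneg_left (hφb x ⟨hx'.le, hx1⟩) hp.le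
  have h4 : (1 - x) ^ s * (1 - x) ^ (-s) = 1 := by
    rw [← Real.rpow_add hx1', add_neg_cancel, Real.rpow_zero]
  nlinarith

/-- For `a = c` Euler's transformation leads to `F(0, ·; c) = 1`. This elementary case is the
reference function for the asymptotics at `1`. -/
lemma hypergeometricF_eq_rpow {m : ℕ} (hm : 2 ≤ m) {x : ℝ} (hx : x < 1) :
    hypergeometricF (((m : ℂ) + 1) / 2) (((m : ℂ) - 1) / 2) (((m : ℂ) + 1) / 2) x =
      (((1 - x) ^ (-(((m : ℝ) - 1) / 2)) : ℝ) : ℂ) := by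
  have hz := ofReal_mem_gaussDomain hx
  have hm' : (2 : ℝ) ≤ m := by exact_mod_cast hm
  have h1 := hypergeometricF_euler (a := ((m : ℂ) + 1) / 2) (b := ((m : ℂ) - 1) / 2)
    (c := ((m : ℂ) + 1) / 2) (by ring) (by
      have : ((m : ℂ) + 1) / 2 + ((m : ℂ) - 1) / 2 = m := by ring
      rw [this, Complex.natCast_re]; positivity) hz
  rw [sub_self, hypergeometricF_zero_left (fun k hk => by
    have := congrArg Complex.re hk
    simp at this
    have : (0 : ℝ) ≤ k := k.cast_nonneg
    linarith) hz] at h1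
  have hx' : 0 < 1 - x := sub_pos.2 hx
  have e : (1 - (x : ℂ)) ^ (((m : ℂ) + 1) / 2 + ((m : ℂ) - 1) / 2 - ((m : ℂ) + 1) / 2) =
      (((1 - x) ^ (((m : ℝ) - 1) / 2) : ℝ) : ℂ) := by
    rw [Complex.ofReal_cpow hx'.le]
    push_cast
    congr 1
    ring
  rw [e] at h1
  rw [Real.rpow_neg hx'.le, Complex.ofReal_inv]
  exact (inv_eq_of_mul_eq_one_right h1.symm).symm

lemma betaIntegral_eq_div {a b : ℂ} (ha : 0 < a.re) (hb : 0 < b.re) :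
    Complex.betaIntegral a b = Complex.Gamma a * Complex.Gamma b / Complex.Gamma (a + b) := by
  rw [Complex.Gamma_mul_Gamma_eq_betaIntegral ha hb, mul_div_cancel_left₀]
  exact Complex.Gamma_ne_zero_of_re_pos (by simp; linarith)

/-- The Euler integral is compared with that of the elementary pair `(m+1)/2`, `(m-1)/2` of the same
sum, for which `(1-x)^((m-1)/2)` times the integral is exactly the constant `B₀`. The limit is the
quotient of the two beta values. -/
lemma tendsto_hypergeometricF_one_of_re_pos {m : ℕ} (hm : 2 ≤ m) {a b : ℂ} (ha : 0 < a.re)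
    (hb : 0 < b.re) (hab : a + b = m) :
    Filter.Tendsto (fun x : ℝ => (((1 - x) ^ (((m : ℝ) - 1) / 2) : ℝ) : ℂ) *
        hypergeometricF a b (((m : ℂ) + 1) / 2) x) (nhdsWithin 1 (Set.Iio 1))
      (nhds (Complex.Gamma (((m : ℂ) + 1) / 2) * Complex.Gamma (((m : ℂ) - 1) / 2) /
        (Complex.Gamma a * Complex.Gamma b))) := by
  have hm' : (2 : ℝ) ≤ m := by exact_mod_cast hm
  set a₀ : ℝ := ((m : ℝ) + 1) / 2
  set b₀ : ℝ := ((m : ℝ) - 1) / 2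
  have ha₀ : 0 < a₀ := by simp only [a₀]; linarith
  have hb₀ : 0 < b₀ := by simp only [b₀]; linarith
  have ea : ((m : ℂ) + 1) / 2 = a₀ := by simp only [a₀]; push_cast; rfl
  have eb : ((m : ℂ) - 1) / 2 = b₀ := by simp only [b₀]; push_cast; rfl
  have hab₀ : a₀ + b₀ = m := by simp only [a₀, b₀]; ring
  have hab₀' : (a₀ : ℂ) + b₀ = m := by exact_mod_cast hab₀
  have ha₀' : 0 < (a₀ : ℂ).re := by simpa using ha₀
  have hb₀' : 0 < (b₀ : ℂ).re := by simpa using hb₀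
  set B₀ := Complex.betaIntegral a₀ b₀
  have hE₀ : ∀ x : ℝ, x < 1 → (((1 - x) ^ b₀ : ℝ) : ℂ) * eulerIntegral a₀ b₀ x = B₀ := by
    intro x hx
    have hx' : 0 < 1 - x := sub_pos.2 hx
    have := hypergeometricF_eq_rpow hm hx
    rw [ea, eb] at this
    rw [eulerIntegral_eq ha₀' hb₀' (ofReal_mem_gaussDomain hx), hab₀', ea, this,
      mul_left_comm, ← Complex.ofReal_mul, ← Real.rpow_add hx', add_neg_cancel, Real.rpow_zero,
      Complex.ofReal_one, mul_one]
  have h1 := tendsto_eulerIntegral_sub ha hb hab ha₀ hb₀ hab₀ hb₀ (D := ‖B₀‖) fun x hx => by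
    rw [← hE₀ x hx, norm_mul, Complex.norm_real,
      Real.norm_of_nonneg (Real.rpow_nonneg (sub_pos.2 hx).le _)]
  have hB := betaIntegral_ne_zero ha hb
  have h2 : Filter.Tendsto (fun x : ℝ => (Complex.betaIntegral a b)⁻¹ *
      ((((1 - x) ^ b₀ : ℝ) : ℂ) * (eulerIntegral a b x - eulerIntegral a₀ b₀ x) + B₀))
      (nhdsWithin 1 (Set.Iio 1)) (nhds ((Complex.betaIntegral a b)⁻¹ * (0 + B₀))) :=
    (h1.add_const B₀).const_mul _
  have hlim : (Complex.betaIntegral a b)⁻¹ * (0 + B₀) = Complex.Gamma (((m : ℂ) + 1) / 2) *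
      Complex.Gamma (((m : ℂ) - 1) / 2) / (Complex.Gamma a * Complex.Gamma b) := by
    have g1 := Complex.Gamma_ne_zero_of_re_pos ha
    have g2 := Complex.Gamma_ne_zero_of_re_pos hb
    have g3 : Complex.Gamma (m : ℂ) ≠ 0 :=
      Complex.Gamma_ne_zero_of_re_pos (by rw [Complex.natCast_re]; linarith)
    simp only [B₀]
    rw [betaIntegral_eq_div ha hb, betaIntegral_eq_div ha₀' hb₀', hab, hab₀', ea, eb, zero_add]
    field_simp
  rw [hlim] at h2
  refine h2.congr' ?_
  filter_upwards [self_mem_nhdsWithin] with x hx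
  rw [mul_sub, hE₀ x hx, sub_add_cancel,
    eulerIntegral_eq ha hb (ofReal_mem_gaussDomain hx), hab]
  field_simp

/-- The behaviour at `1` of the hypergeometric functions with `a + b = m` and `c = (m + 1) / 2`. -/
theorem tendsto_hypergeometricF_one {m : ℕ} (hm : 2 ≤ m) {a b : ℂ} (hab : a + b = m) :
    Filter.Tendsto (fun x : ℝ => (((1 - x) ^ (((m : ℝ) - 1) / 2) : ℝ) : ℂ) *
        hypergeometricF a b (((m : ℂ) + 1) / 2) x) (nhdsWithin 1 (Set.Iio 1))
      (nhds (Complex.Gamma (((m : ℂ) + 1) / 2) * Complex.Gamma (((m : ℂ) - 1) / 2) /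
        (Complex.Gamma a * Complex.Gamma b))) := by
  -- Induction on how far the real parts may lie to the left: the derivative has parameters `a + 1`,
  -- `b + 1` and sum `m + 2`, and its asymptotics are integrated back.
  have key : ∀ k : ℕ, ∀ {m : ℕ}, 2 ≤ m → ∀ {a b : ℂ}, -(k : ℝ) < a.re → -(k : ℝ) < b.re →
      a + b = m → Filter.Tendsto (fun x : ℝ => (((1 - x) ^ (((m : ℝ) - 1) / 2) : ℝ) : ℂ) *
        hypergeometricF a b (((m : ℂ) + 1) / 2) x) (nhdsWithin 1 (Set.Iio 1))
      (nhds (Complex.Gamma (((m : ℂ) + 1) / 2) * Complex.Gamma (((m : ℂ) - 1) / 2) /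
        (Complex.Gamma a * Complex.Gamma b))) := by
    intro k
    induction k with
    | zero =>
      intro m hm a b ha hb hab
      exact tendsto_hypergeometricF_one_of_re_pos hm (by simpa using ha) (by simpa using hb) hab
    | succ k ih =>
      intro m hm a b ha hb hab
      push_cast at ha hb
      have hm' : (2 : ℝ) ≤ m := by exact_mod_cast hm
      have h1 := ih (m := m + 2) (by omega) (a := a + 1) (b := b + 1) (by simp; linarith)
        (by simp; linarith) (by push_cast; rw [← hab]; ring)
      have e1 : (((m + 2 : ℕ) : ℂ) + 1) / 2 = (m + 1 : ℂ) / 2 + 1 := by push_cast; ring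
      have e2 : (((m + 2 : ℕ) : ℂ) - 1) / 2 = (m - 1 : ℂ) / 2 + 1 := by push_cast; ring
      have e3 : (((m + 2 : ℕ) : ℝ) - 1) / 2 = (m - 1 : ℝ) / 2 + 1 := by push_cast; ring
      rw [e1, e2, e3] at h1
      have h2 := h1.const_mul (a * b / (((m : ℂ) + 1) / 2))
      have h3 := tendsto_rpow_mul_of_deriv
        (f := fun x : ℝ => hypergeometricF a b (((m : ℂ) + 1) / 2) x)
        (f' := fun x : ℝ => a * b / (((m : ℂ) + 1) / 2) *
          hypergeometricF (a + 1) (b + 1) (((m : ℂ) + 1) / 2 + 1) x)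
        (fun x hx => by
          have := (hasDerivAt_hypergeometricF a b (ofReal_mem_gaussDomain hx.2)).comp_ofReal
          rwa [hab] at this) (s := ((m : ℝ) - 1) / 2) (by linarith)
        (by
          refine h2.congr fun x => ?_
          ring)
      convert! h3 using 2
      have hA : ((m : ℂ) + 1) / 2 ≠ 0 := fun h => by
        have := congrArg Complex.re h
        simp at this
        linarith
      have hB : ((m : ℂ) - 1) / 2 ≠ 0 := fun h => by
        have := congrArg Complex.re h
        simp at this
        linarith
      -- Reciprocals of `Γ` satisfy the functional equation even at the poles, so `a` and `b` may be
      -- nonpositive integers here.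
      rw [Complex.Gamma_add_one _ hA, Complex.Gamma_add_one _ hB, div_eq_mul_inv _ (_ * _),
        div_eq_mul_inv _ (Complex.Gamma (a + 1) * _), mul_inv, mul_inv,
        Complex.one_div_Gamma_eq_self_mul_one_div_Gamma_add_one a,
        Complex.one_div_Gamma_eq_self_mul_one_div_Gamma_add_one b]
      push_cast
      generalize ((m : ℂ) + 1) / 2 = A at *
      generalize ((m : ℂ) - 1) / 2 = B at *
      field_simp
  obtain ⟨k, hk⟩ := exists_nat_gt (max (-a.re) (-b.re))
  exact key k hm (by linarith [(max_lt_iff.1 hk).1]) (by linarith [(max_lt_iff.1 hk).2]) hab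

/-! ### A Poisson kernel on the sphere -/

section Sphere

open MeasureTheory Measure Metric

variable {E : Type*} [NormedAddCommGroup E] [NormedSpace ℝ E] [FiniteDimensional ℝ E] [MeasurableSpace E]
  [BorelSpace E]

/-- The volume of the ellipsoid `‖T x‖ < 1` in polar coordinates. -/
lemma lintegral_toSphere_norm_inv_pow [Nontrivial E] (μ : Measure E) [μ.IsAddHaarMeasure] 
    {T : E →ₗ[ℝ] E} (hT : LinearMap.det T ≠ 0) :
    ∫⁻ w : sphere (0 : E) 1, ENNReal.ofReal ((‖T w‖ ^ Module.finrank ℝ E)⁻¹) ∂μ.toSphere =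
      ENNReal.ofReal |(LinearMap.det T)⁻¹| * μ.toSphere Set.univ := by
  set k := Module.finrank ℝ E
  have hk : 0 < k := Module.finrank_pos
  have hinj : ∀ x, T x = 0 → x = 0 := fun x hx =>
    (T.equivOfDetNeZero hT).map_eq_zero_iff.1 hx
  have hTc : Continuous T := T.continuous_of_finiteDimensional
  have hpos : ∀ w : sphere (0 : E) 1, 0 < ‖T w‖ := fun w => norm_pos_iff.2 fun h =>
    ne_zero_of_mem_unit_sphere w (hinj _ h)
  -- The volume of this ellipsoid is computed twice: by the determinant of `T` (`h1`) and in polar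
  -- coordinates (`h2`), where the radius in direction `w` is `‖T w‖⁻¹`.
  let s : Set E := T ⁻¹' ball 0 1
  have hs : MeasurableSet s := (isOpen_ball.preimage hTc).measurableSet
  have h1 : μ s = ENNReal.ofReal |(LinearMap.det T)⁻¹| * μ (ball 0 1) :=
    addHaar_preimage_linearMap μ hT _
  let S : Set (sphere (0 : E) 1 × Set.Ioi (0 : ℝ)) := {p | p.2.1 * ‖T p.1‖ < 1}
  have hS : MeasurableSet S := by
    refine (isOpen_lt (Continuous.mul ?_ ?_) continuous_const).measurableSet
    · exact continuous_subtype_val.comp continuous_snd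
    · exact (hTc.comp (continuous_subtype_val.comp continuous_fst)).norm
  have h2 : μ s = μ.toSphere.prod (volumeIoiPow (k - 1)) S := by
    rw [← μ.measurePreserving_homeomorphUnitSphereProd.measure_preimage hS.nullMeasurableSet,
      comap_apply _ Subtype.val_injective
        (fun t ht => (measurableSet_singleton _).compl.subtype_image ht) _
        ((homeomorphUnitSphereProd E).measurable hS)]
    have e : Subtype.val '' (homeomorphUnitSphereProd E ⁻¹' S) = s \ {0} := by
      ext x
      simp only [Set.mem_image, Set.mem_preimage, S, s, Set.mem_ofPred_eq, Set.mem_sdiff,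
        Set.mem_singleton_iff, mem_ball_zero_iff]
      constructor
      · rintro ⟨y, hy, rfl⟩
        refine ⟨?_, y.2⟩
        rwa [homeomorphUnitSphereProd_apply_snd_coe, homeomorphUnitSphereProd_apply_fst_coe,
          map_smul, norm_smul, norm_inv, norm_norm,
          mul_inv_cancel_left₀ (norm_ne_zero_iff.2 y.2)] at hy
      · rintro ⟨h, h0⟩
        refine ⟨⟨x, h0⟩, ?_, rfl⟩
        rwa [homeomorphUnitSphereProd_apply_snd_coe, homeomorphUnitSphereProd_apply_fst_coe,
          map_smul, norm_smul, norm_inv, norm_norm,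
          mul_inv_cancel_left₀ (norm_ne_zero_iff.2 h0)]
    rw [e, measure_sdiff_null (measure_singleton _)]
  have h3 : ∀ w : sphere (0 : E) 1, volumeIoiPow (k - 1) (Prod.mk w ⁻¹' S) =
      ENNReal.ofReal ((‖T w‖ ^ k)⁻¹) * (k : ENNReal)⁻¹ := by
    intro w
    have e : Prod.mk w ⁻¹' S = Set.Iio ⟨‖T w‖⁻¹, inv_pos.2 (hpos w)⟩ := by
      ext r
      simp only [S, Set.mem_preimage, Set.mem_ofPred_eq, Set.mem_Iio]
      rw [← Subtype.coe_lt_coe, ← lt_div_iff₀ (hpos w), one_div]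
    have hkr : ((k - 1 : ℕ) : ℝ) + 1 = k := by
      rw [← Nat.cast_add_one, Nat.sub_add_cancel hk]
    rw [e, volumeIoiPow_apply_Iio, hkr, Nat.sub_add_cancel hk, inv_pow, div_eq_mul_inv,
      ENNReal.ofReal_mul (by positivity),
      ENNReal.ofReal_inv_of_pos (x := (k : ℝ)) (by exact_mod_cast hk), ENNReal.ofReal_natCast]
  rw [prod_apply hS] at h2
  simp only [h3] at h2
  have hk0 : (k : ENNReal) ≠ 0 := by exact_mod_cast hk.ne'
  rw [lintegral_mul_const'' _ (Continuous.aemeasurable (by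
    refine ENNReal.continuous_ofReal.comp (Continuous.inv₀ (by fun_prop) fun w => ?_)
    exact (pow_pos (hpos w) _).ne'))] at h2
  rw [toSphere_apply_univ, mul_left_comm, ← h1, h2, mul_left_comm,
    ENNReal.mul_inv_cancel hk0 (ENNReal.natCast_ne_top _), mul_one]

lemma measurePreserving_neg_toSphere (μ : Measure E) [μ.IsAddHaarMeasure] :
    MeasurePreserving (fun w : sphere (0 : E) 1 => -w) μ.toSphere μ.toSphere := by
  refine ⟨continuous_neg.measurable, ?_⟩
  ext s hs
  rw [map_apply continuous_neg.measurable hs, toSphere_apply' _ hs,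
    toSphere_apply' _ (continuous_neg.measurable hs)]
  congr 1
  rw [← measure_preimage_neg]
  congr 1
  ext x
  simp only [Set.mem_preimage, Set.mem_smul, Set.mem_image]
  constructor
  · rintro ⟨r, hr, y, ⟨w, hw, rfl⟩, h⟩
    exact ⟨r, hr, _, ⟨-w, hw, rfl⟩, by rw [← neg_neg x, ← h]; simp⟩
  · rintro ⟨r, hr, y, ⟨w, hw, rfl⟩, h⟩
    exact ⟨r, hr, _, ⟨-w, by simpa using hw, rfl⟩, by rw [← h]; simp⟩

end Sphere

section Sphere

open MeasureTheory Measure Metric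

/-- A multiple of the Poisson kernel for the ellipsoid with half axes `1, ..., 1, 1/τ`: as `τ → 0`
it concentrates at `c = ±1`, where `c` is the cosine of the angle to the long axis. -/
def sphereKernel (k : ℕ) (τ c : ℝ) : ℝ := τ * (1 - c ^ 2 + τ ^ 2 * c ^ 2) ^ (-((k : ℝ) / 2))

lemma aspect_pos {τ c : ℝ} (hτ : τ ≠ 0) (hc : |c| ≤ 1) : 0 < 1 - c ^ 2 + τ ^ 2 * c ^ 2 := by
  have h1 : c ^ 2 ≤ 1 := (sq_le_one_iff_abs_le_one c).2 hc
  have h2 : 0 < τ ^ 2 := by positivity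
  rcases eq_or_ne c 0 with rfl | h
  · norm_num
  · have h3 : 0 < τ ^ 2 * c ^ 2 := by positivity
    linarith

lemma sphereKernel_nonneg {k : ℕ} {τ c : ℝ} (hτ : 0 < τ) (hc : |c| ≤ 1) :
    0 ≤ sphereKernel k τ c :=
  mul_nonneg hτ.le (Real.rpow_nonneg (aspect_pos hτ.ne' hc).le _)

variable {E : Type*} [NormedAddCommGroup E] [InnerProductSpace ℝ E]

lemma abs_inner_sphere_le (u w : sphere (0 : E) 1) : |inner ℝ (u : E) w| ≤ 1 := by
  have := abs_real_inner_le_norm (u : E) w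
  rwa [norm_eq_of_mem_sphere, norm_eq_of_mem_sphere, one_mul] at this

lemma continuous_sphereKernel (k : ℕ) {τ : ℝ} (hτ : τ ≠ 0) (u : sphere (0 : E) 1) :
    Continuous fun w : sphere (0 : E) 1 => sphereKernel k τ (inner ℝ (u : E) w) := by
  refine continuous_const.mul (Continuous.rpow_const (by fun_prop) fun w => Or.inl ?_)
  exact (aspect_pos hτ (abs_inner_sphere_le u w)).ne'

variable [FiniteDimensional ℝ E] [MeasurableSpace E] [BorelSpace E] (μ : Measure E)
  [μ.IsAddHaarMeasure]

lemma integrable_toSphere_of_continuous {F : Type*} [NormedAddCommGroup F]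
    {f : sphere (0 : E) 1 → F} (hf : Continuous f) : Integrable f μ.toSphere :=
  hf.integrable_of_hasCompactSupport (HasCompactSupport.of_compactSpace f)

/-- With `T` the scaling by `τ` along `u`, one has `det T = τ` and `‖T w‖² = 1 - c² + τ²c²`. The
ellipsoid formula therefore gives a mass that does not depend on `τ`. -/
theorem integral_sphereKernel {τ : ℝ} (hτ : 0 < τ) (u : sphere (0 : E) 1) :
    ∫ w, sphereKernel (Module.finrank ℝ E) τ (inner ℝ (u : E) w) ∂μ.toSphere =
      μ.toSphere.real Set.univ := by
  have : Nontrivial E := ⟨⟨u, 0, ne_zero_of_mem_unit_sphere u⟩⟩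
  let T : E →ₗ[ℝ] E := LinearMap.transvection ((τ - 1) • (innerₛₗ ℝ (u : E))) u
  have huu : inner ℝ (u : E) u = 1 := by
    rw [real_inner_self_eq_norm_sq, norm_eq_of_mem_sphere, one_pow]
  have hdet : LinearMap.det T = τ := by
    simp only [T]
    rw [LinearMap.transvection.det]
    simp
  have hTn : ∀ w : sphere (0 : E) 1, ‖T w‖ =
      Real.sqrt (1 - inner ℝ (u : E) w ^ 2 + τ ^ 2 * inner ℝ (u : E) w ^ 2) := by
    intro w
    have hT : T w = (w : E) + ((τ - 1) * inner ℝ (u : E) w) • (u : E) := by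
      simp [T, LinearMap.transvection]
    rw [norm_eq_sqrt_real_inner, hT]
    congr 1
    rw [inner_add_add_self, real_inner_smul_left, real_inner_smul_right, real_inner_smul_left,
      real_inner_smul_right, huu, real_inner_self_eq_norm_sq, norm_eq_of_mem_sphere,
      real_inner_comm (u : E) (w : E)]
    ring
  have h1 := lintegral_toSphere_norm_inv_pow μ (T := T) (by rw [hdet]; exact hτ.ne')
  have h2 : ∀ w : sphere (0 : E) 1, sphereKernel (Module.finrank ℝ E) τ (inner ℝ (u : E) w) =
      τ * (‖T w‖ ^ Module.finrank ℝ E)⁻¹ := by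
    intro w
    have hp := aspect_pos hτ.ne' (abs_inner_sphere_le u w)
    rw [sphereKernel, hTn, Real.rpow_neg hp.le, Real.sqrt_eq_rpow]
    generalize 1 - inner ℝ (u : E) w ^ 2 + τ ^ 2 * inner ℝ (u : E) w ^ 2 = q at hp
    rw [← Real.rpow_natCast, ← Real.rpow_mul hp.le]
    congr 3
    ring
  rw [integral_eq_lintegral_of_nonneg_ae
    (Filter.Eventually.of_forall fun w => sphereKernel_nonneg hτ (abs_inner_sphere_le u w))
    (continuous_sphereKernel _ hτ.ne' u).aestronglyMeasurable]
  simp only [h2, ENNReal.ofReal_mul hτ.le]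
  rw [lintegral_const_mul' _ _ ENNReal.ofReal_ne_top, h1, hdet, ← mul_assoc,
    ← ENNReal.ofReal_mul hτ.le, abs_of_pos (inv_pos.2 hτ), mul_inv_cancel₀ hτ.ne',
    ENNReal.ofReal_one, one_mul, measureReal_def]

lemma integral_inner_mul_sphereKernel (k : ℕ) (τ : ℝ) (u : sphere (0 : E) 1) :
    ∫ w, inner ℝ (u : E) w * sphereKernel k τ (inner ℝ (u : E) w) ∂μ.toSphere = 0 := by
  have h := (measurePreserving_neg_toSphere μ).integral_comp
    (Homeomorph.neg (sphere (0 : E) 1)).measurableEmbedding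
    (fun w => inner ℝ (u : E) w * sphereKernel k τ (inner ℝ (u : E) w))
  have e : ∀ w : sphere (0 : E) 1, inner ℝ (u : E) ((-w : sphere (0 : E) 1) : E) *
      sphereKernel k τ (inner ℝ (u : E) ((-w : sphere (0 : E) 1) : E)) =
      -(inner ℝ (u : E) w * sphereKernel k τ (inner ℝ (u : E) w)) := by
    intro w
    have : ((-w : sphere (0 : E) 1) : E) = -(w : E) := rfl
    rw [this, inner_neg_right, sphereKernel, sphereKernel, neg_sq]
    ring
  simp only [e, integral_neg] at h
  linarith

/-- The weight `1 + c` suppresses the pole `-u` without changing the total mass, because `c` times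
the even kernel is odd under `w ↦ -w`. -/
theorem integral_one_add_mul_sphereKernel {τ : ℝ} (hτ : 0 < τ) (u : sphere (0 : E) 1) :
    ∫ w, (1 + inner ℝ (u : E) w) * sphereKernel (Module.finrank ℝ E) τ (inner ℝ (u : E) w)
      ∂μ.toSphere = μ.toSphere.real Set.univ := by
  have hc := continuous_sphereKernel (Module.finrank ℝ E) hτ.ne' u
  have hc' : Continuous fun w : sphere (0 : E) 1 =>
      inner ℝ (u : E) w * sphereKernel (Module.finrank ℝ E) τ (inner ℝ (u : E) w) :=
    Continuous.mul (by fun_prop) hc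
  simp only [add_mul, one_mul]
  rw [integral_add (integrable_toSphere_of_continuous μ hc)
    (integrable_toSphere_of_continuous μ hc'),
    integral_sphereKernel μ hτ, integral_inner_mul_sphereKernel, add_zero]

/-- The kernel concentrates at the two poles. -/
theorem tendsto_integral_mul_sphereKernel {τ : ℝ → ℝ} {l : Filter ℝ}
    (hτ : Filter.Tendsto τ l (nhdsWithin 0 (Set.Ioi 0))) (u : sphere (0 : E) 1)
    {h : ℝ → sphere (0 : E) 1 → ℂ} {B : ℝ} (hB : ∀ᶠ ε in l, ∀ w, ‖h ε w‖ ≤ B)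
    (h₁ : Filter.Tendsto (fun p : ℝ × sphere (0 : E) 1 => h p.1 p.2) (l ×ˢ nhds u) (nhds 0))
    (h₂ : Filter.Tendsto (fun p : ℝ × sphere (0 : E) 1 => h p.1 p.2) (l ×ˢ nhds (-u)) (nhds 0)) :
    Filter.Tendsto (fun ε => ∫ w, h ε w *
      (sphereKernel (Module.finrank ℝ E) (τ ε) (inner ℝ (u : E) w) : ℂ) ∂μ.toSphere) l
      (nhds 0) := by
  rw [Metric.tendsto_nhds] at h₁ h₂ ⊢
  intro δ hδ
  set V := μ.toSphere.real Set.univ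
  have hV : 0 ≤ V := measureReal_nonneg
  set δ' := δ / (2 * (V + 1))
  have hδ' : 0 < δ' := by positivity
  obtain ⟨A₁, hA₁, r₁, hr₁, hr₁'⟩ := (Filter.eventually_prod_iff.1 (h₁ δ' hδ'))
  obtain ⟨A₂, hA₂, r₂, hr₂, hr₂'⟩ := (Filter.eventually_prod_iff.1 (h₂ δ' hδ'))
  obtain ⟨ρ₁, hρ₁, hb₁⟩ := Metric.eventually_nhds_iff.1 hr₁
  obtain ⟨ρ₂, hρ₂, hb₂⟩ := Metric.eventually_nhds_iff.1 hr₂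
  -- On the sphere `dist² = 2 - 2c`, and `1 - |c| ≤ 1 - c²`, so `1 - c² < η` puts `w` within `min ρ₁
  -- ρ₂` of `u` or of `-u`.
  set η := min ρ₁ ρ₂ ^ 2 / 2
  have hη : 0 < η := by have := lt_min hρ₁ hρ₂; positivity
  have hdist : ∀ v w : sphere (0 : E) 1, dist w v ^ 2 = 2 - 2 * inner ℝ (v : E) w := by
    intro v w
    rw [Subtype.dist_eq, dist_eq_norm, norm_sub_sq_real, norm_eq_of_mem_sphere,
      norm_eq_of_mem_sphere, real_inner_comm]
    ring
  have hnear : ∀ w : sphere (0 : E) 1, 1 - inner ℝ (u : E) w ^ 2 < η → r₁ w ∨ r₂ w := by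
    intro w hw
    have hc := abs_le.1 (abs_inner_sphere_le u w)
    have hm : 0 < min ρ₁ ρ₂ := lt_min hρ₁ hρ₂
    rcases le_total 0 (inner ℝ (u : E) w) with h0 | h0
    · refine Or.inl (hb₁ (lt_of_lt_of_le ?_ (min_le_left ρ₁ ρ₂)))
      refine lt_of_pow_lt_pow_left₀ 2 hm.le ?_
      rw [hdist]
      simp only [η] at hw
      nlinarith
    · refine Or.inr (hb₂ (lt_of_lt_of_le ?_ (min_le_right ρ₁ ρ₂)))
      refine lt_of_pow_lt_pow_left₀ 2 hm.le ?_
      have : ((-u : sphere (0 : E) 1) : E) = -(u : E) := rfl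
      rw [hdist, this, inner_neg_left]
      simp only [η] at hw
      nlinarith
  set k := Module.finrank ℝ E
  -- Away from the poles `1 - c² ≥ η`, and the kernel is at most `C τ`.
  set C : ℝ := η ^ (-((k : ℝ) / 2))
  have hC : 0 < C := Real.rpow_pos_of_pos hη _
  have hτpos : ∀ᶠ ε in l, 0 < τ ε := hτ.eventually self_mem_nhdsWithin
  have hτ0 : ∀ᶠ ε in l, |B| * C * V * τ ε < δ / 2 := by
    have h0 : Filter.Tendsto (fun ε => |B| * C * V * τ ε) l (nhds (|B| * C * V * 0)) :=
      (hτ.mono_right nhdsWithin_le_nhds).const_mul _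
    rw [mul_zero] at h0
    exact h0.eventually_lt_const (by positivity)
  filter_upwards [hA₁, hA₂, hτpos, hτ0, hB] with ε e₁ e₂ hpos hsm hBε
  rw [dist_zero_right]
  have hQc := continuous_sphereKernel k hpos.ne' u
  have hQi := integrable_toSphere_of_continuous μ hQc
  have hbound : ∀ w : sphere (0 : E) 1,
      ‖h ε w * (sphereKernel k (τ ε) (inner ℝ (u : E) w) : ℂ)‖ ≤
        δ' * sphereKernel k (τ ε) (inner ℝ (u : E) w) + |B| * C * τ ε := by
    intro w
    have hc := abs_inner_sphere_le u w
    have hQ := sphereKernel_nonneg (k := k) hpos hc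
    rw [norm_mul, Complex.norm_real, Real.norm_of_nonneg hQ]
    have hBC : 0 ≤ |B| * C * τ ε := by positivity
    by_cases hw : 1 - inner ℝ (u : E) w ^ 2 < η
    · have h3 : ‖h ε w‖ ≤ δ' := by
        rcases hnear w hw with h3 | h3
        · simpa using (hr₁' e₁ h3).le
        · simpa using (hr₂' e₂ h3).le
      have := mul_le_mul_of_nonneg_right h3 hQ
      linarith
    · have h3 : sphereKernel k (τ ε) (inner ℝ (u : E) w) ≤ C * τ ε := by
        rw [sphereKernel, mul_comm]
        refine mul_le_mul_of_nonneg_right ?_ hpos.le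
        refine Real.rpow_le_rpow_of_nonpos hη ?_ (by
          have : (0 : ℝ) ≤ k := k.cast_nonneg
          linarith)
        have : 0 ≤ τ ε ^ 2 * inner ℝ (u : E) w ^ 2 := by positivity
        linarith
      have h4 : ‖h ε w‖ ≤ |B| := (hBε w).trans (le_abs_self B)
      have h5 := mul_le_mul h4 h3 hQ (abs_nonneg B)
      have h6 : 0 ≤ δ' * sphereKernel k (τ ε) (inner ℝ (u : E) w) := by positivity
      linarith
  calc _ ≤ ∫ w, (δ' * sphereKernel k (τ ε) (inner ℝ (u : E) w) + |B| * C * τ ε) ∂μ.toSphere :=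
        norm_integral_le_of_norm_le ((hQi.const_mul _).add (integrable_const _))
          (Filter.Eventually.of_forall hbound)
    _ = δ' * V + V * (|B| * C * τ ε) := by
        rw [integral_add (hQi.const_mul _) (integrable_const _), integral_const_mul,
          integral_sphereKernel μ hpos, integral_const, smul_eq_mul]
    _ < δ := by
        have h1 : δ' * (V + 1) = δ / 2 := by
          simp only [δ']
          field_simp
        nlinarith

end Sphere

/-- The area of the unit sphere in `ℝ^(n+1)`. -/
lemma toSphere_real_univ_euclidean (n : ℕ) :
    (MeasureTheory.volume : MeasureTheory.Measure
      (EuclideanSpace ℝ (Fin (n + 1)))).toSphere.real Set.univ =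
      2 * Real.pi ^ (((n : ℝ) + 1) / 2) / Real.Gamma (((n : ℝ) + 1) / 2) := by
  have h0 : (0 : ℝ) < ((n : ℝ) + 1) / 2 := by positivity
  have hg := (Real.Gamma_pos_of_pos h0).ne'
  rw [MeasureTheory.Measure.toSphere_real_apply_univ, finrank_euclideanSpace, Fintype.card_fin,
    MeasureTheory.measureReal_def, EuclideanSpace.volume_ball, Fintype.card_fin, ENNReal.ofReal_one,
    one_pow, one_mul, ENNReal.toReal_ofReal (div_nonneg (by positivity)
      (Real.Gamma_pos_of_pos (by positivity)).le)]
  push_cast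
  rw [Real.Gamma_add_one h0.ne', Real.sqrt_eq_rpow, ← Real.rpow_natCast,
    ← Real.rpow_mul Real.pi_pos.le]
  push_cast
  rw [show (1 : ℝ) / 2 * ((n : ℝ) + 1) = ((n : ℝ) + 1) / 2 by ring]
  field_simp

lemma exists_bound_of_tendsto_left {H : ℝ → ℂ} {L : ℂ} (hH : ContinuousOn H (Set.Ico 0 1))
    (hL : Filter.Tendsto H (nhdsWithin 1 (Set.Iio 1)) (nhds L)) :
    ∃ B, 0 ≤ B ∧ ∀ x ∈ Set.Ico (0 : ℝ) 1, ‖H x‖ ≤ B := by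
  have h1 : ∀ᶠ x in nhdsWithin 1 (Set.Iio 1), ‖H x‖ < ‖L‖ + 1 :=
    hL.norm.eventually_lt_const (lt_add_one _)
  obtain ⟨x₀, hx₀, h⟩ := (mem_nhdsLT_iff_exists_Ioo_subset' (zero_lt_one' ℝ)).1 h1
  obtain ⟨B, hB⟩ := (isCompact_Icc (a := (0 : ℝ)) (b := x₀)).exists_bound_of_continuousOn
    (hH.mono fun x hx => ⟨hx.1, hx.2.trans_lt hx₀⟩)
  refine ⟨max (‖L‖ + 1) B, le_max_of_le_left (by positivity), fun x hx => ?_⟩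
  rcases le_or_gt x x₀ with h2 | h2
  · exact (hB x ⟨hx.1, h2⟩).trans (le_max_right _ _)
  · exact (h ⟨h2, hx.2⟩ : ‖H x‖ < _).le.trans (le_max_left _ _)

/-- Comparison of the argument `y = 1 - (1 - τ²)(1 + c)/2` of the singularity with the denominator
of the kernel. -/
lemma abs_aspect_div_sub_le {τ c : ℝ} (hτ : 0 < τ) (hτ1 : τ ≤ 1) (hc : |c| ≤ 1) :
    0 < 1 - (1 - τ ^ 2) * (1 + c) / 2 ∧
    |(1 - c ^ 2 + (2 * τ) ^ 2 * c ^ 2) / (1 - (1 - τ ^ 2) * (1 + c) / 2) - 2 * (1 + c)| ≤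
      8 * τ ^ 2 := by
  obtain ⟨h1, h2⟩ := abs_le.1 hc
  have hτ2 : 0 < τ ^ 2 := by positivity
  have hτ3 : τ ^ 2 ≤ 1 := by nlinarith
  have hy : 0 < 1 - (1 - τ ^ 2) * (1 + c) / 2 := by
    nlinarith [mul_nonneg (sub_nonneg.2 hτ3) (sub_nonneg.2 h2)]
  refine ⟨hy, ?_⟩
  have hy' : (1 - c) / 2 ≤ 1 - (1 - τ ^ 2) * (1 + c) / 2 := by
    nlinarith [mul_nonneg hτ2.le (by linarith : 0 ≤ 1 + c)]
  rw [div_sub' hy.ne', abs_div, abs_of_pos hy, div_le_iff₀ hy]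
  have e : 1 - c ^ 2 + (2 * τ) ^ 2 * c ^ 2 - (1 - (1 - τ ^ 2) * (1 + c) / 2) * (2 * (1 + c)) =
      -(τ ^ 2 * (1 - c) * (3 * c + 1)) := by ring
  rw [e, abs_neg, abs_mul, abs_of_nonneg (mul_nonneg hτ2.le (sub_nonneg.2 h2))]
  have h3 : |3 * c + 1| ≤ 4 := abs_le.2 ⟨by linarith, by linarith⟩
  have h4 := mul_le_mul_of_nonneg_left h3 (mul_nonneg hτ2.le (sub_nonneg.2 h2))
  have h5 := mul_le_mul_of_nonneg_left hy' hτ2.le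
  linarith

open MeasureTheory Measure Metric

variable {E : Type*} [NormedAddCommGroup E] [InnerProductSpace ℝ E] [FiniteDimensional ℝ E]
  [MeasurableSpace E] [BorelSpace E] (μ : Measure E) [μ.IsAddHaarMeasure]

/-- A function with a singularity of order `dim E / 2` at `1` gives rise to a delta distribution on
the sphere. -/
theorem tendsto_integral_singular {F : ℝ → ℂ} {L : ℂ} (hF : ContinuousOn F (Set.Ico 0 1))
    (hL : Filter.Tendsto
      (fun x : ℝ => (((1 - x) ^ ((Module.finrank ℝ E : ℝ) / 2) : ℝ) : ℂ) * F x)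
      (nhdsWithin 1 (Set.Iio 1)) (nhds L)) (f : C(sphere (0 : E) 1, ℂ)) (u : sphere (0 : E) 1) :
    Filter.Tendsto (fun τ : ℝ => ∫ w, f w * (((2 * τ * (1 + inner ℝ (u : E) w) : ℝ) : ℂ) *
      F ((1 - τ ^ 2) * (1 + inner ℝ (u : E) w) / 2)) ∂μ.toSphere) (nhdsWithin 0 (Set.Ioi 0))
      (nhds (2 ^ Module.finrank ℝ E * L * (μ.toSphere.real Set.univ : ℂ) * f u)) := by
  set k := Module.finrank ℝ E
  set N : ℝ := (k : ℝ) / 2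
  have hN : 0 ≤ N := by positivity
  let l : Filter ℝ := nhdsWithin 0 (Set.Ioi 0)
  let c : sphere (0 : E) 1 → ℝ := fun w => inner ℝ (u : E) w
  have hcc : Continuous c := by simp only [c]; fun_prop
  have hc1 : ∀ w, |c w| ≤ 1 := abs_inner_sphere_le u
  have hcu : c u = 1 := by
    simp only [c]
    rw [real_inner_self_eq_norm_sq, norm_eq_of_mem_sphere, one_pow]
  have hcu' : c (-u) = -1 := (inner_neg_right _ _).trans (congrArg Neg.neg hcu)
  let X : ℝ → sphere (0 : E) 1 → ℝ := fun τ w => (1 - τ ^ 2) * (1 + c w) / 2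
  -- Near `u`, `1 - X ≈ (1-c)/2 + τ²` is a quarter of the denominator of the kernel with parameter
  -- `2τ`; this is why the kernel is taken at `2τ`.
  let R : ℝ → sphere (0 : E) 1 → ℝ := fun τ w =>
    (1 - c w ^ 2 + (2 * τ) ^ 2 * c w ^ 2) / (1 - X τ w)
  let H : ℝ → ℂ := fun x => (((1 - x) ^ N : ℝ) : ℂ) * F x
  have hHc : ContinuousOn H (Set.Ico 0 1) := by
    refine ContinuousOn.mul (Complex.continuous_ofReal.comp_continuousOn ?_) hF
    exact ContinuousOn.rpow_const (by fun_prop) fun x hx => Or.inr hN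
  obtain ⟨B, hB0, hB⟩ := exists_bound_of_tendsto_left hHc hL
  have hX : ∀ {τ : ℝ}, 0 < τ → τ ≤ 1 → ∀ w, X τ w ∈ Set.Ico (0 : ℝ) 1 := by
    intro τ h0 h1 w
    refine ⟨?_, sub_pos.1 (abs_aspect_div_sub_le h0 h1 (hc1 w)).1⟩
    have := (abs_le.1 (hc1 w)).1
    have h2 : 0 ≤ 1 - τ ^ 2 := by nlinarith
    exact div_nonneg (mul_nonneg h2 (by linarith)) (by norm_num)
  have hR : ∀ {τ : ℝ}, 0 < τ → τ ≤ 1 → ∀ w, |R τ w - 2 * (1 + c w)| ≤ 8 * τ ^ 2 :=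
    fun h0 h1 w => (abs_aspect_div_sub_le h0 h1 (hc1 w)).2
  have hR0 : ∀ {τ : ℝ}, 0 < τ → τ ≤ 1 → ∀ w, 0 ≤ R τ w := fun {τ} h0 h1 w =>
    div_nonneg (aspect_pos (by positivity) (hc1 w)).le (sub_pos.2 (hX h0 h1 w).2).le
  have hR12 : ∀ {τ : ℝ}, 0 < τ → τ ≤ 1 → ∀ w, R τ w ≤ 12 := by
    intro τ h0 h1 w
    have h2 := (abs_le.1 (hR h0 h1 w)).2
    have h3 := (abs_le.1 (hc1 w)).2
    nlinarith
  let g : ℝ → sphere (0 : E) 1 → ℂ := fun τ w => f w * H (X τ w) * ((R τ w ^ N : ℝ) : ℂ)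
  -- At `u` the ratio `R` tends to `4`, and `4^(k/2) = 2^k`.
  set g₀ : ℂ := f u * L * 2 ^ k
  have hl : ∀ᶠ τ in l, 0 < τ ∧ τ ≤ 1 := by
    filter_upwards [Ioo_mem_nhdsGT (zero_lt_one' ℝ)] with τ hτ using ⟨hτ.1, hτ.2.le⟩
  let G : ℝ := ‖f‖ * B * 12 ^ N + ‖g₀‖
  have hG0 : 0 ≤ G := by positivity
  have hG : ∀ {τ : ℝ}, 0 < τ → τ ≤ 1 → ∀ w, ‖g τ w - g₀‖ ≤ G := by
    intro τ h0 h1 w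
    refine (norm_sub_le _ _).trans (add_le_add ?_ le_rfl)
    simp only [g]
    rw [norm_mul, norm_mul, Complex.norm_real,
      Real.norm_of_nonneg (Real.rpow_nonneg (hR0 h0 h1 w) _)]
    exact mul_le_mul (mul_le_mul (f.norm_coe_le_norm w) (hB _ (hX h0 h1 w)) (norm_nonneg _)
      (norm_nonneg _)) (Real.rpow_le_rpow (hR0 h0 h1 w) (hR12 h0 h1 w) hN)
      (Real.rpow_nonneg (hR0 h0 h1 w) _) (by positivity)
  -- The factor `1 + c` vanishes at `-u`, so boundedness of `g` is all that is needed there.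
  let h : ℝ → sphere (0 : E) 1 → ℂ := fun τ w => ((1 + c w : ℝ) : ℂ) * (g τ w - g₀)
  have hnorm : ∀ w, ‖((1 + c w : ℝ) : ℂ)‖ = 1 + c w := fun w => by
    rw [Complex.norm_real, Real.norm_of_nonneg (by linarith [(abs_le.1 (hc1 w)).1])]
  have hbound : ∀ᶠ τ in l, ∀ w, ‖h τ w‖ ≤ 2 * G := by
    filter_upwards [hl] with τ hτ w
    simp only [h]
    rw [norm_mul, hnorm]
    exact mul_le_mul (by linarith [(abs_le.1 (hc1 w)).2]) (hG hτ.1 hτ.2 w) (norm_nonneg _)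
      (by norm_num)
  have hfst : Filter.Tendsto (fun p : ℝ × sphere (0 : E) 1 => p.1) (l ×ˢ nhds u) (nhds 0) :=
    Filter.tendsto_fst.mono_right nhdsWithin_le_nhds
  have hsnd : ∀ v, Filter.Tendsto (fun p : ℝ × sphere (0 : E) 1 => c p.2) (l ×ˢ nhds v)
      (nhds (c v)) := fun v => (hcc.tendsto v).comp Filter.tendsto_snd
  have h₂ : Filter.Tendsto (fun p : ℝ × sphere (0 : E) 1 => h p.1 p.2) (l ×ˢ nhds (-u))
      (nhds 0) := by
    refine squeeze_zero_norm' (a := fun p : ℝ × sphere (0 : E) 1 => (1 + c p.2) * G) ?_ ?_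
    · filter_upwards [hl.prod_inl (nhds (-u))] with p hp
      simp only [h]
      rw [norm_mul, hnorm]
      exact mul_le_mul_of_nonneg_left (hG hp.1 hp.2 _) (by linarith [(abs_le.1 (hc1 p.2)).1])
    · have := ((hsnd (-u)).const_add 1).mul_const G
      rwa [hcu', add_neg_cancel, zero_mul] at this
  have h₁ : Filter.Tendsto (fun p : ℝ × sphere (0 : E) 1 => h p.1 p.2) (l ×ˢ nhds u)
      (nhds 0) := by
    have t1 : Filter.Tendsto (fun p : ℝ × sphere (0 : E) 1 => f p.2) (l ×ˢ nhds u)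
        (nhds (f u)) := (f.continuous.tendsto u).comp Filter.tendsto_snd
    have tc := hsnd u
    rw [hcu] at tc
    have t2 : Filter.Tendsto (fun p : ℝ × sphere (0 : E) 1 => X p.1 p.2) (l ×ˢ nhds u)
        (nhdsWithin 1 (Set.Iio 1)) := by
      refine tendsto_nhdsWithin_iff.2 ⟨?_, ?_⟩
      · have := (((hfst.pow 2).const_sub 1).mul (tc.const_add 1)).div_const 2
        norm_num at this
        exact this
      · filter_upwards [hl.prod_inl (nhds u)] with p hp using (hX hp.1 hp.2 _).2
    have t3 : Filter.Tendsto (fun p : ℝ × sphere (0 : E) 1 => R p.1 p.2) (l ×ˢ nhds u)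
        (nhds 4) := by
      have t4 : Filter.Tendsto (fun p : ℝ × sphere (0 : E) 1 => R p.1 p.2 - 2 * (1 + c p.2))
          (l ×ˢ nhds u) (nhds 0) := by
        refine squeeze_zero_norm' (a := fun p => 8 * p.1 ^ 2) ?_ ?_
        · filter_upwards [hl.prod_inl (nhds u)] with p hp using hR hp.1 hp.2 _
        · have := (hfst.pow 2).const_mul 8
          norm_num at this
          exact this
      have := t4.add ((tc.const_add 1).const_mul 2)
      norm_num at this
      exact this
    have t5 : Filter.Tendsto (fun p : ℝ × sphere (0 : E) 1 => ((R p.1 p.2 ^ N : ℝ) : ℂ))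
        (l ×ˢ nhds u) (nhds (2 ^ k)) := by
      have e : ((((4 : ℝ) ^ N : ℝ)) : ℂ) = 2 ^ k := by
        rw [show (4 : ℝ) = 2 ^ (2 : ℝ) by norm_num, ← Real.rpow_mul (by norm_num),
          show 2 * N = (k : ℝ) by simp only [N]; ring, Real.rpow_natCast]
        push_cast
        rfl
      rw [← e]
      exact (Complex.continuous_ofReal.tendsto _).comp (t3.rpow_const (Or.inl (by norm_num)))
    have t6 := ((t1.mul (hL.comp t2)).mul t5).sub_const g₀
    have t7 := ((Complex.continuous_ofReal.tendsto _).comp (tc.const_add 1)).mul t6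
    simp only [g₀, sub_self, mul_zero] at t7
    exact t7
  have hτ2 : Filter.Tendsto (fun τ : ℝ => 2 * τ) l (nhdsWithin 0 (Set.Ioi 0)) := by
    refine tendsto_nhdsWithin_iff.2 ⟨?_, ?_⟩
    · have := (Filter.tendsto_id.mono_right nhdsWithin_le_nhds : Filter.Tendsto id l
        (nhds 0)).const_mul 2
      rwa [mul_zero] at this
    · filter_upwards [hl] with τ hτ using mul_pos two_pos hτ.1
  have hmain := (tendsto_integral_mul_sphereKernel μ hτ2 u hbound h₁ h₂).add_const
    (g₀ * (μ.toSphere.real Set.univ : ℂ))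
  have elim : 0 + g₀ * (μ.toSphere.real Set.univ : ℂ) =
      2 ^ k * L * (μ.toSphere.real Set.univ : ℂ) * f u := by
    simp only [g₀]
    ring
  rw [elim] at hmain
  refine hmain.congr' ?_
  filter_upwards [hl] with τ hτ
  have hτ' : (0 : ℝ) < 2 * τ := mul_pos two_pos hτ.1
  have hQ := continuous_sphereKernel k hτ'.ne' u
  have hid : ∀ w, h τ w * (sphereKernel k (2 * τ) (c w) : ℂ) =
      f w * (((2 * τ * (1 + c w) : ℝ) : ℂ) * F (X τ w)) -
        g₀ * (((1 + c w) * sphereKernel k (2 * τ) (c w) : ℝ) : ℂ) := by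
    intro w
    have hq := aspect_pos hτ'.ne' (hc1 w)
    have hy : 0 < 1 - X τ w := sub_pos.2 (hX hτ.1 hτ.2 w).2
    -- The base of the kernel's power cancels against the numerator of `R`, both being raised to
    -- `k/2 = N` with opposite signs.
    have e : (2 * τ : ℝ) = (1 - X τ w) ^ N * R τ w ^ N * sphereKernel k (2 * τ) (c w) := by
      simp only [R, sphereKernel]
      generalize 1 - c w ^ 2 + (2 * τ) ^ 2 * c w ^ 2 = q at hq
      rw [Real.div_rpow hq.le hy.le, Real.rpow_neg hq.le]
      have h3 := (Real.rpow_pos_of_pos hq N).ne'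
      have h4 := (Real.rpow_pos_of_pos hy N).ne'
      simp only [N] at h3 h4 ⊢
      field_simp
    have e' : ((2 * τ * (1 + c w) : ℝ) : ℂ) = (((1 - X τ w) ^ N : ℝ) : ℂ) * ((R τ w ^ N : ℝ) : ℂ) *
        (sphereKernel k (2 * τ) (c w) : ℂ) * ((1 + c w : ℝ) : ℂ) := by
      rw [← Complex.ofReal_mul, ← Complex.ofReal_mul, ← e, ← Complex.ofReal_mul]
    rw [e']
    simp only [h, g, H]
    push_cast
    ring
  have hi1 : Integrable (fun w => f w * (((2 * τ * (1 + c w) : ℝ) : ℂ) * F (X τ w)))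
      μ.toSphere := by
    refine integrable_toSphere_of_continuous μ (f.continuous.mul (Continuous.mul ?_ ?_))
    · fun_prop
    · exact hF.comp_continuous (by simp only [X]; fun_prop) fun w => hX hτ.1 hτ.2 w
  have hi2 : Integrable (fun w => g₀ * (((1 + c w) * sphereKernel k (2 * τ) (c w) : ℝ) : ℂ))
      μ.toSphere := by
    refine integrable_toSphere_of_continuous μ (continuous_const.mul
      (Complex.continuous_ofReal.comp (Continuous.mul (by fun_prop) hQ)))
  have hI : ∫ w, h τ w * (sphereKernel k (2 * τ) (c w) : ℂ) ∂μ.toSphere =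
      ∫ w, f w * (((2 * τ * (1 + c w) : ℝ) : ℂ) * F (X τ w)) ∂μ.toSphere -
        g₀ * (μ.toSphere.real Set.univ : ℂ) := by
    simp only [hid]
    have h3 : ∫ w, (((1 + c w) * sphereKernel k (2 * τ) (c w) : ℝ) : ℂ) ∂μ.toSphere =
        ((∫ w, (1 + c w) * sphereKernel k (2 * τ) (c w) ∂μ.toSphere : ℝ) : ℂ) := integral_ofReal
    rw [integral_sub hi1 hi2, integral_const_mul, h3, integral_one_add_mul_sphereKernel μ hτ']
  show ∫ w, h τ w * (sphereKernel k (2 * τ) (c w) : ℂ) ∂μ.toSphere + _ = _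
  rw [hI, sub_add_cancel]

/-! ### Canonical commutation relations -/

section GlobalPoint

variable {d : ℕ} (u u' : Metric.sphere (0 : EuclideanSpace ℝ (Fin d)) 1)

lemma sum_sphere_mul (u u' : Metric.sphere (0 : EuclideanSpace ℝ (Fin d)) 1) :
    ∑ i, (u : EuclideanSpace ℝ (Fin d)) i * (u' : EuclideanSpace ℝ (Fin d)) i =
      inner ℝ (u : EuclideanSpace ℝ (Fin d)) u' := by
  rw [PiLp.inner_apply]
  exact Finset.sum_congr rfl fun i _ => by simp [mul_comm]

lemma mdot_globalPoint (z z' : ℂ) : mdot (globalPoint z u) (globalPoint z' u') =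
    Complex.sinh z * Complex.sinh z' - Complex.cosh z * Complex.cosh z' *
      ((inner ℝ (u : EuclideanSpace ℝ (Fin d)) u' : ℝ) : ℂ) := by
  rw [← sum_sphere_mul]
  simp only [mdot, globalPoint, Fin.cons_zero, Fin.cons_succ]
  push_cast
  rw [Finset.mul_sum]
  congr 1
  exact Finset.sum_congr rfl fun i _ => by ring

lemma inner_self_sphere : inner ℝ (u : EuclideanSpace ℝ (Fin d)) u = 1 := by
  rw [real_inner_self_eq_norm_sq, norm_eq_of_mem_sphere, one_pow]

lemma globalPoint_mem_complexDS (z : ℂ) : globalPoint z u ∈ complexDS d := by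
  show mdot _ _ = -1
  rw [mdot_globalPoint, inner_self_sphere, Complex.ofReal_one]
  linear_combination -Complex.cosh_sq_sub_sinh_sq z

lemma sinh_add_mul_I_im (t y : ℝ) :
    (Complex.sinh (t + y * Complex.I)).im = Real.cosh t * Real.sin y := by
  rw [Complex.sinh_add, Complex.sinh_mul_I, Complex.cosh_mul_I, ← Complex.ofReal_sinh,
    ← Complex.ofReal_cosh, ← Complex.ofReal_sin, ← Complex.ofReal_cos]
  simp only [Complex.add_im, Complex.mul_im, Complex.mul_re, Complex.ofReal_im, Complex.ofReal_re,
    Complex.I_re, Complex.I_im]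
  ring

lemma cosh_add_mul_I_im (t y : ℝ) :
    (Complex.cosh (t + y * Complex.I)).im = Real.sinh t * Real.sin y := by
  rw [Complex.cosh_add, Complex.sinh_mul_I, Complex.cosh_mul_I, ← Complex.ofReal_sinh,
    ← Complex.ofReal_cosh, ← Complex.ofReal_sin, ← Complex.ofReal_cos]
  simp only [Complex.add_im, Complex.mul_im, Complex.mul_re, Complex.ofReal_im, Complex.ofReal_re,
    Complex.I_re, Complex.I_im]
  ring

lemma mdot_globalPoint_im (a t y : ℝ) :
    mdot (fun i => a * (globalPoint (t + y * Complex.I) u i).im)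
      (fun i => a * (globalPoint (t + y * Complex.I) u i).im) = (a * Real.sin y) ^ 2 := by
  have h := sum_sphere_mul u u
  rw [inner_self_sphere] at h
  simp only [mdot, globalPoint, Fin.cons_zero, Fin.cons_succ, sinh_add_mul_I_im,
    Complex.mul_im, Complex.ofReal_im, Complex.ofReal_re, mul_zero, zero_add, cosh_add_mul_I_im]
  have e : ∀ i, a * (Real.sinh t * Real.sin y * (u : EuclideanSpace ℝ (Fin d)) i) *
      (a * (Real.sinh t * Real.sin y * (u : EuclideanSpace ℝ (Fin d)) i)) =
      (a * Real.sinh t * Real.sin y) ^ 2 *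
        ((u : EuclideanSpace ℝ (Fin d)) i * (u : EuclideanSpace ℝ (Fin d)) i) := fun i => by ring
  simp only [e]
  rw [← Finset.mul_sum, h]
  linear_combination (a * Real.sin y) ^ 2 * Real.cosh_sq_sub_sinh_sq t

lemma globalPoint_mem_futureTube (t : ℝ) {y : ℝ} (hy : 0 < Real.sin y) :
    globalPoint (t + y * Complex.I) u ∈ futureTube d := by
  refine ⟨globalPoint_mem_complexDS u _, ?_, ?_⟩
  · have := mdot_globalPoint_im u 1 t y
    simp only [one_mul] at this
    rw [this]
    positivity
  · show 0 < (Complex.sinh _).im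
    rw [sinh_add_mul_I_im]
    exact mul_pos (Real.cosh_pos _) hy

lemma globalPoint_mem_pastTube (t : ℝ) {y : ℝ} (hy : 0 < Real.sin y) :
    globalPoint (t - y * Complex.I) u ∈ pastTube d := by
  have e : (t : ℂ) - y * Complex.I = t + ((-y : ℝ) : ℂ) * Complex.I := by push_cast; ring
  rw [e]
  refine ⟨globalPoint_mem_complexDS u _, ?_, ?_⟩
  · have := mdot_globalPoint_im u (-1) t (-y)
    simp only [neg_one_mul] at this
    rw [this, Real.sin_neg, neg_neg]
    positivity
  · show 0 < -(Complex.sinh _).im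
    rw [sinh_add_mul_I_im, Real.sin_neg]
    have := mul_pos (Real.cosh_pos t) hy
    linarith

end GlobalPoint

/-- The invariant of two points at the times `z` and `z'` whose directions have cosine `c`. -/
def timeInvariant (c z z' : ℂ) : ℂ :=
  Complex.sinh z * Complex.sinh z' - Complex.cosh z * Complex.cosh z' * c

lemma hasDerivAt_timeInvariant_left (c z z' : ℂ) : HasDerivAt (fun z => timeInvariant c z z')
    (Complex.cosh z * Complex.sinh z' - Complex.sinh z * Complex.cosh z' * c) z :=
  ((Complex.hasDerivAt_sinh z).mul_const _).sub
    (((Complex.hasDerivAt_cosh z).mul_const _).mul_const _)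

lemma hasDerivAt_timeInvariant_right (c z z' : ℂ) : HasDerivAt (timeInvariant c z)
    (Complex.sinh z * Complex.cosh z' - Complex.cosh z * Complex.sinh z' * c) z' :=
  ((Complex.hasDerivAt_sinh z').const_mul _).sub
    (((Complex.hasDerivAt_cosh z').const_mul _).mul_const _)

section Commutator

variable {n : ℕ} {W : (Fin (n + 1 + 1) → ℂ) → (Fin (n + 1 + 1) → ℂ) → ℂ} {w : ℂ → ℂ}
  (hw : DifferentiableOn ℂ w cutPlane)
  (hW : ∀ z₁ ∈ pastTube (n + 1), ∀ z₂ ∈ futureTube (n + 1), W z₁ z₂ = w (mdot z₁ z₂))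
  {ε : ℝ} (hε : 0 < Real.sin ε) (u u' : Metric.sphere (0 : EuclideanSpace ℝ (Fin (n + 1))) 1)

include hε in
lemma timeInvariant_mem_cutPlane (t s : ℝ) :
    timeInvariant ((inner ℝ (u : EuclideanSpace ℝ (Fin (n + 1))) u' : ℝ) : ℂ)
      (t - ε * Complex.I) (s + ε * Complex.I) ∈ cutPlane := by
  have := mdot_mem_cutPlane (globalPoint_mem_pastTube u t hε) (globalPoint_mem_futureTube u' s hε)
  rwa [mdot_globalPoint] at this

include hW hε in
lemma commutator_eq (t s : ℝ) : commutator W ε t s u u' =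
    w (timeInvariant ((inner ℝ (u : EuclideanSpace ℝ (Fin (n + 1))) u' : ℝ) : ℂ)
      (t - ε * Complex.I) (s + ε * Complex.I)) -
    w (timeInvariant ((inner ℝ (u : EuclideanSpace ℝ (Fin (n + 1))) u' : ℝ) : ℂ)
      (s - ε * Complex.I) (t + ε * Complex.I)) := by
  rw [commutator, hW _ (globalPoint_mem_pastTube u t hε) _ (globalPoint_mem_futureTube u' s hε),
    hW _ (globalPoint_mem_pastTube u' s hε) _ (globalPoint_mem_futureTube u t hε),
    mdot_globalPoint, mdot_globalPoint, real_inner_comm]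
  rfl

-- At equal times both orderings have the same invariant, since it is symmetric in the directions.
include hW hε in
lemma commutator_zero_zero : commutator W ε 0 0 u u' = 0 := by
  rw [commutator_eq hW hε, sub_self]

/-- The derivative of the commutator in the second time, as a function of the (complex) first
time. -/
def commutatorDeriv (w : ℂ → ℂ) (ε : ℝ) (c t : ℂ) : ℂ :=
  deriv w (timeInvariant c (t - ε * Complex.I) (ε * Complex.I)) *
      (Complex.sinh (t - ε * Complex.I) * Complex.cosh (ε * Complex.I) -
        Complex.cosh (t - ε * Complex.I) * Complex.sinh (ε * Complex.I) * c) -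
    deriv w (timeInvariant c (-(ε * Complex.I)) (t + ε * Complex.I)) *
      (Complex.cosh (-(ε * Complex.I)) * Complex.sinh (t + ε * Complex.I) -
        Complex.sinh (-(ε * Complex.I)) * Complex.cosh (t + ε * Complex.I) * c)

include hw hW hε in
lemma deriv_commutator (t : ℝ) : deriv (fun s : ℝ => commutator W ε t s u u') 0 =
    commutatorDeriv w ε ((inner ℝ (u : EuclideanSpace ℝ (Fin (n + 1))) u' : ℝ) : ℂ) t := by
  set c : ℂ := ((inner ℝ (u : EuclideanSpace ℝ (Fin (n + 1))) u' : ℝ) : ℂ)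
  have hd : ∀ {ζ : ℂ}, ζ ∈ cutPlane → HasDerivAt w (deriv w ζ) ζ := fun hζ =>
    (hw.differentiableAt (isOpen_cutPlane.mem_nhds hζ)).hasDerivAt
  have m1 := timeInvariant_mem_cutPlane hε u u' t 0
  have m2 := timeInvariant_mem_cutPlane hε u u' 0 t
  have h1 := (hd m1).comp ((0 : ℝ) : ℂ) ((hasDerivAt_timeInvariant_right c (t - ε * Complex.I)
    ((0 : ℝ) + ε * Complex.I)).comp_add_const ((0 : ℝ) : ℂ) (ε * Complex.I))
  have h2 := (hd m2).comp ((0 : ℝ) : ℂ) ((hasDerivAt_timeInvariant_left c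
    ((0 : ℝ) - ε * Complex.I) (t + ε * Complex.I)).comp_sub_const ((0 : ℝ) : ℂ) (ε * Complex.I))
  have h3 := (h1.sub h2).comp_ofReal
  have e : (fun s : ℝ => commutator W ε t s u u') = fun s : ℝ =>
      w (timeInvariant c (t - ε * Complex.I) (s + ε * Complex.I)) -
        w (timeInvariant c (s - ε * Complex.I) (t + ε * Complex.I)) :=
    funext fun s => commutator_eq hW hε u u' t s
  rw [e]
  refine h3.deriv.trans ?_
  simp only [commutatorDeriv, Complex.ofReal_zero, zero_add, zero_sub]
  rfl

/-- At `t = 0` the two invariants coincide while their derivatives in the second time are opposite,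
so the terms add up. -/
lemma commutatorDeriv_zero (w : ℂ → ℂ) (ε : ℝ) (c : ℂ) : commutatorDeriv w ε c 0 =
    -(deriv w (Real.sin ε ^ 2 - (1 - Real.sin ε ^ 2) * c) *
      (2 * Complex.I * Real.sin ε * Real.cos ε * (1 + c))) := by
  have hc : (Real.cos ε : ℂ) ^ 2 = 1 - (Real.sin ε : ℂ) ^ 2 := by
    rw [← Complex.ofReal_pow, Real.cos_sq']; push_cast; rfl
  have e : timeInvariant c (-(ε * Complex.I)) (ε * Complex.I) =
      Real.sin ε ^ 2 - (1 - Real.sin ε ^ 2) * c := by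
    rw [← hc]
    simp only [timeInvariant, Complex.sinh_neg, Complex.cosh_neg, Complex.sinh_mul_I,
      Complex.cosh_mul_I, Complex.ofReal_sin, Complex.ofReal_cos]
    linear_combination (-Complex.sin ε ^ 2) * Complex.I_sq
  simp only [commutatorDeriv, zero_sub, zero_add, e]
  simp only [Complex.sinh_neg, Complex.cosh_neg, Complex.sinh_mul_I, Complex.cosh_mul_I,
    Complex.ofReal_sin, Complex.ofReal_cos]
  ring

-- At `t = 0` the product rule gives the same two summands for both orderings, the roles of the
-- first and second time derivative being exchanged, and they cancel.
include hw hW hε in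
lemma deriv_deriv_commutator :
    deriv (fun t : ℝ => deriv (fun s : ℝ => commutator W ε t s u u') 0) 0 = 0 := by
  have e : (fun t : ℝ => deriv (fun s : ℝ => commutator W ε t s u u') 0) = fun t : ℝ =>
      commutatorDeriv w ε ((inner ℝ (u : EuclideanSpace ℝ (Fin (n + 1))) u' : ℝ) : ℂ) t :=
    funext fun t => deriv_commutator hw hW hε u u' t
  rw [e]
  set c : ℂ := ((inner ℝ (u : EuclideanSpace ℝ (Fin (n + 1))) u' : ℝ) : ℂ)
  have hd : ∀ {ζ : ℂ}, ζ ∈ cutPlane → HasDerivAt (deriv w) (deriv (deriv w) ζ) ζ := fun hζ =>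
    ((hw.deriv isOpen_cutPlane).differentiableAt (isOpen_cutPlane.mem_nhds hζ)).hasDerivAt
  have m := timeInvariant_mem_cutPlane hε u u' 0 0
  have m1 : timeInvariant c (((0 : ℝ) : ℂ) - ε * Complex.I) (ε * Complex.I) ∈ cutPlane := by
    simpa using m
  have m2 : timeInvariant c (-(ε * Complex.I)) (((0 : ℝ) : ℂ) + ε * Complex.I) ∈ cutPlane := by
    simpa using m
  have h1 := (hd m1).comp ((0 : ℝ) : ℂ) ((hasDerivAt_timeInvariant_left c
    ((0 : ℝ) - ε * Complex.I) (ε * Complex.I)).comp_sub_const ((0 : ℝ) : ℂ) (ε * Complex.I))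
  have h2 := (hd m2).comp ((0 : ℝ) : ℂ) ((hasDerivAt_timeInvariant_right c
    (-(ε * Complex.I)) ((0 : ℝ) + ε * Complex.I)).comp_add_const ((0 : ℝ) : ℂ) (ε * Complex.I))
  have s1 := (Complex.hasDerivAt_sinh (((0 : ℝ) : ℂ) - ε * Complex.I)).comp_sub_const
    ((0 : ℝ) : ℂ) (ε * Complex.I)
  have c1 := (Complex.hasDerivAt_cosh (((0 : ℝ) : ℂ) - ε * Complex.I)).comp_sub_const
    ((0 : ℝ) : ℂ) (ε * Complex.I)
  have s2 := (Complex.hasDerivAt_sinh (((0 : ℝ) : ℂ) + ε * Complex.I)).comp_add_const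
    ((0 : ℝ) : ℂ) (ε * Complex.I)
  have c2 := (Complex.hasDerivAt_cosh (((0 : ℝ) : ℂ) + ε * Complex.I)).comp_add_const
    ((0 : ℝ) : ℂ) (ε * Complex.I)
  have h := ((h1.mul ((s1.mul_const (Complex.cosh (ε * Complex.I))).sub
    ((c1.mul_const (Complex.sinh (ε * Complex.I))).mul_const c))).sub
    (h2.mul ((s2.const_mul (Complex.cosh (-(ε * Complex.I)))).sub
    ((c2.const_mul (Complex.sinh (-(ε * Complex.I)))).mul_const c)))).comp_ofReal
  refine h.deriv.trans ?_
  simp only [Function.comp, Complex.ofReal_zero, zero_sub, zero_add, Complex.sinh_neg,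
    Complex.cosh_neg, Pi.sub_apply]
  ring

end Commutator

/-- The commutation relations for a two-point function `w(z₁ · z₂)` whose derivative has the
appropriate singularity at `-1`. -/
theorem canonicalCommutation_of_tendsto {n : ℕ}
    {W : (Fin (n + 1 + 1) → ℂ) → (Fin (n + 1 + 1) → ℂ) → ℂ} {w : ℂ → ℂ}
    (hw : DifferentiableOn ℂ w cutPlane)
    (hW : ∀ z₁ ∈ pastTube (n + 1), ∀ z₂ ∈ futureTube (n + 1), W z₁ z₂ = w (mdot z₁ z₂))
    (hL : Filter.Tendsto
      (fun x : ℝ => (((1 - x) ^ (((n : ℝ) + 1) / 2) : ℝ) : ℂ) * -deriv w (1 - 2 * x))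
      (nhdsWithin 1 (Set.Iio 1)) (nhds ((Real.Gamma (((n : ℝ) + 1) / 2) /
        (2 ^ (n + 2) * Real.pi ^ (((n : ℝ) + 1) / 2)) : ℝ) : ℂ))) :
    CanonicalCommutation W := by
  intro f u
  have hsin : ∀ᶠ ε in nhdsWithin (0 : ℝ) (Set.Ioi 0), 0 < Real.sin ε := by
    filter_upwards [Ioo_mem_nhdsGT Real.pi_pos] with ε hε using Real.sin_pos_of_pos_of_lt_pi hε.1 hε.2
  refine ⟨?_, ?_, ?_⟩
  · refine tendsto_const_nhds.congr' ?_
    filter_upwards [hsin] with ε hε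
    simp [commutator_zero_zero hW hε]
  · have hF : ContinuousOn (fun x : ℝ => -deriv w (1 - 2 * x)) (Set.Ico 0 1) := by
      refine ContinuousOn.neg ((hw.deriv isOpen_cutPlane).continuousOn.comp (by fun_prop) ?_)
      rintro x hx ⟨r, hr, h⟩
      have : 1 - 2 * x = r := by
        have h' : (1 : ℂ) - 2 * x = r := h
        exact_mod_cast h'
      linarith [hx.2]
    have hfr : Module.finrank ℝ (EuclideanSpace ℝ (Fin (n + 1))) = n + 1 := by simp
    -- Used with `τ = sin ε` and `F(x) = -w'(1 - 2x)`: the argument `x = (1-τ²)(1+c)/2` is `(1-ζ)/2`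
    -- at equal times, and `x → 1` means `ζ → -1`.
    have h1 := tendsto_integral_singular
      (MeasureTheory.volume : MeasureTheory.Measure (EuclideanSpace ℝ (Fin (n + 1)))) hF
      (by rw [hfr]; push_cast; exact hL) f u
    rw [hfr, toSphere_real_univ_euclidean] at h1
    have hs : Filter.Tendsto Real.sin (nhdsWithin (0 : ℝ) (Set.Ioi 0))
        (nhdsWithin 0 (Set.Ioi 0)) := by
      refine tendsto_nhdsWithin_iff.2 ⟨?_, hsin⟩
      have := Real.continuous_sin.tendsto 0
      rw [Real.sin_zero] at this
      exact this.mono_left nhdsWithin_le_nhds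
    have hcos : Filter.Tendsto (fun ε : ℝ => Complex.I * (Real.cos ε : ℂ))
        (nhdsWithin (0 : ℝ) (Set.Ioi 0)) (nhds (Complex.I * 1)) := by
      have : Continuous fun ε : ℝ => Complex.I * (Real.cos ε : ℂ) := by fun_prop
      have h := this.tendsto 0
      rw [Real.cos_zero, Complex.ofReal_one] at h
      exact h.mono_left nhdsWithin_le_nhds
    have h2 := hcos.mul (h1.comp hs)
    -- Here the normalization is checked: `2^d`, the coefficient of the singularity and the area of
    -- the sphere multiply to `1`.
    have elim : Complex.I * 1 * (2 ^ (n + 1) * ((Real.Gamma (((n : ℝ) + 1) / 2) /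
        (2 ^ (n + 2) * Real.pi ^ (((n : ℝ) + 1) / 2)) : ℝ) : ℂ) *
        ((2 * Real.pi ^ (((n : ℝ) + 1) / 2) / Real.Gamma (((n : ℝ) + 1) / 2) : ℝ) : ℂ) * f u) =
        Complex.I * f u := by
      have e : (2 : ℝ) ^ (n + 1) * (Real.Gamma (((n : ℝ) + 1) / 2) /
          (2 ^ (n + 2) * Real.pi ^ (((n : ℝ) + 1) / 2))) *
          (2 * Real.pi ^ (((n : ℝ) + 1) / 2) / Real.Gamma (((n : ℝ) + 1) / 2)) = 1 := by
        have g1 := (Real.Gamma_pos_of_pos (by positivity : (0 : ℝ) < ((n : ℝ) + 1) / 2)).ne'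
        have g2 := (Real.rpow_pos_of_pos Real.pi_pos (((n : ℝ) + 1) / 2)).ne'
        field_simp
        ring
      have e' := congrArg (fun x : ℝ => (x : ℂ)) e
      simp only [Complex.ofReal_mul _ (2 * _ / _), Complex.ofReal_mul (2 ^ (n + 1)) _,
        Complex.ofReal_one] at e'
      push_cast at e' ⊢
      linear_combination Complex.I * f u * e'
    rw [elim] at h2
    refine h2.congr' ?_
    filter_upwards [hsin] with ε hε
    simp only [Function.comp]
    rw [← MeasureTheory.integral_const_mul]
    refine MeasureTheory.integral_congr_ae (Filter.Eventually.of_forall fun u' => ?_)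
    simp only
    rw [deriv_commutator hw hW hε, Complex.ofReal_zero, commutatorDeriv_zero]
    have e : (1 : ℂ) - 2 * (((1 - Real.sin ε ^ 2) *
        (1 + inner ℝ (u : EuclideanSpace ℝ (Fin (n + 1))) u') / 2 : ℝ) : ℂ) =
        Real.sin ε ^ 2 - (1 - Real.sin ε ^ 2) *
          ((inner ℝ (u : EuclideanSpace ℝ (Fin (n + 1))) u' : ℝ) : ℂ) := by
      push_cast
      ring
    rw [e]
    push_cast
    ring
  · refine tendsto_const_nhds.congr' ?_
    filter_upwards [hsin] with ε hε
    simp [deriv_deriv_commutator hw hW hε]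

/-- The derivative is the hypergeometric function of `n + 2`, whose order of growth is `(m-1)/2 =
(n+1)/2` for `m = n + 2`. The gamma functions in its limit cancel `gammaFactor`, leaving a constant
independent of `ν`. -/
lemma tendsto_deriv_waveF (n : ℕ) {ν : ℂ} (hν : Regular (n + 1) ν) :
    Filter.Tendsto (fun x : ℝ => (((1 - x) ^ (((n : ℝ) + 1) / 2) : ℝ) : ℂ) *
        -deriv (fun ζ => waveConst n ν * waveF n ν ζ) (1 - 2 * x))
      (nhdsWithin 1 (Set.Iio 1)) (nhds ((Real.Gamma (((n : ℝ) + 1) / 2) /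
        (2 ^ (n + 2) * Real.pi ^ (((n : ℝ) + 1) / 2)) : ℝ) : ℂ)) := by
  set a := waveParam n ν
  set b := waveParam n (-ν)
  -- Regularity of `ν` makes both gamma values nonzero, so that they can be cancelled.
  have ha : ∀ k : ℕ, a ≠ -k := fun k h => (hν k).1 (by
    rw [← h]; simp only [a, waveParam]; push_cast; ring)
  have hb : ∀ k : ℕ, b ≠ -k := fun k h => (hν k).2 (by
    rw [← h]; simp only [b, waveParam]; push_cast; ring)
  have ea : waveParam (n + 2) ν = a + 1 := by simp only [a, waveParam]; push_cast; ring
  have eb : waveParam (n + 2) (-ν) = b + 1 := by simp only [b, waveParam]; push_cast; ring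
  have h := (tendsto_hypergeometricF_one (m := n + 2) (by omega)
    (waveParam_add_neg (n + 2) ν)).const_mul (waveConst n ν * (a * b / (n + 1)))
  have ha0 : a ≠ 0 := by simpa using ha 0
  have hb0 : b ≠ 0 := by simpa using hb 0
  have hN : ((n : ℂ) + 1) / 2 ≠ 0 := div_ne_zero n.cast_add_one_ne_zero two_ne_zero
  have elim : waveConst n ν * (a * b / (n + 1)) * (Complex.Gamma ((((n + 2 : ℕ) : ℂ) + 1) / 2) *
      Complex.Gamma ((((n + 2 : ℕ) : ℂ) - 1) / 2) / (Complex.Gamma (waveParam (n + 2) ν) *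
      Complex.Gamma (waveParam (n + 2) (-ν)))) = ((Real.Gamma (((n : ℝ) + 1) / 2) /
        (2 ^ (n + 2) * Real.pi ^ (((n : ℝ) + 1) / 2)) : ℝ) : ℂ) := by
    have e1 : (((n + 2 : ℕ) : ℂ) + 1) / 2 = (n + 1 : ℂ) / 2 + 1 := by push_cast; ring
    have e2 : (((n + 2 : ℕ) : ℂ) - 1) / 2 = (n + 1 : ℂ) / 2 := by push_cast; ring
    have eg : gammaFactor (n + 1) ν = Complex.Gamma a * Complex.Gamma b := by
      simp only [gammaFactor, a, b, waveParam]
      push_cast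
      congr 2 <;> ring
    have eG : Complex.Gamma ((n + 1 : ℂ) / 2) = ((Real.Gamma (((n : ℝ) + 1) / 2) : ℝ) : ℂ) := by
      rw [← Complex.Gamma_ofReal]; push_cast; rfl
    have g1 := Complex.Gamma_ne_zero ha
    have g2 := Complex.Gamma_ne_zero hb
    have g3 : ((Real.Gamma (((n : ℝ) + 1) / 2) : ℝ) : ℂ) ≠ 0 := by
      exact_mod_cast (Real.Gamma_pos_of_pos (by positivity)).ne'
    have g4 : ((Real.pi ^ (((n : ℝ) + 1) / 2) : ℝ) : ℂ) ≠ 0 := by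
      exact_mod_cast (Real.rpow_pos_of_pos Real.pi_pos _).ne'
    have g5 : (n : ℂ) + 1 ≠ 0 := n.cast_add_one_ne_zero
    rw [e1, e2, ea, eb, Complex.Gamma_add_one _ hN, Complex.Gamma_add_one _ ha0,
      Complex.Gamma_add_one _ hb0, waveConst, eg, eG]
    push_cast at g3 g4 ⊢
    field_simp
    ring
  rw [elim] at h
  refine h.congr' ?_
  filter_upwards [self_mem_nhdsWithin] with x hx
  have hm : (1 : ℂ) - 2 * x ∈ cutPlane := by
    rw [mem_cutPlane_iff, show (1 - (1 - 2 * (x : ℂ))) / 2 = x by ring]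
    exact ofReal_mem_gaussDomain hx
  rw [((hasDerivAt_waveF n ν hm).const_mul (waveConst n ν)).deriv, waveF,
    show (1 - (1 - 2 * (x : ℂ))) / 2 = x by ring,
    show ((n + 2 : ℕ) - 1 : ℝ) / 2 = ((n : ℝ) + 1) / 2 by push_cast; ring]
  ring

end DeSitter

end

/-! ### The main theorem -/

open DeSitter
theorem mainTheorem1 (n : ℕ) (hn : 1 ≤ n) (ν : ℂ) :
    -- spacetime dimension `d = n + 1`; holomorphy, Klein-Gordon equation and invariance
    (∀ γ : Chain (n + 1) n, IsCycle γ →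
      HolomorphicOn (pastTube (n + 1) ×ˢ futureTube (n + 1))
        (fun p => waveIntegral ν γ p.1 p.2) ∧
      (∀ z₁ ∈ pastTube (n + 1), ∀ z₂ ∈ futureTube (n + 1),
        box (fun z => waveIntegral ν γ z z₂) z₁
            + massSq (n + 1) ν * waveIntegral ν γ z₁ z₂ = 0 ∧
        box (fun z => waveIntegral ν γ z₁ z) z₂
            + massSq (n + 1) ν * waveIntegral ν γ z₁ z₂ = 0) ∧
      (∀ L ∈ deSitterGroup (n + 1), ∀ z₁ ∈ pastTube (n + 1), ∀ z₂ ∈ futureTube (n + 1),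
        waveIntegral ν γ ((L.map (algebraMap ℝ ℂ)).mulVec z₁)
          ((L.map (algebraMap ℝ ℂ)).mulVec z₂) = waveIntegral ν γ z₁ z₂) ∧
      (∀ z₁ ∈ pastTube (n + 1), ∀ z₂ ∈ futureTube (n + 1),
        ∀ z₁' ∈ pastTube (n + 1), ∀ z₂' ∈ futureTube (n + 1),
        mdot z₁ z₂ = mdot z₁' z₂' → waveIntegral ν γ z₁ z₂ = waveIntegral ν γ z₁' z₂')) ∧
    -- independence of the cycle
    (∀ γ γ' : Chain (n + 1) n, IsCycle γ → IsCycle γ' → Homologous γ γ' →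
      ∀ z₁ ∈ pastTube (n + 1), ∀ z₂ ∈ futureTube (n + 1),
        waveIntegral ν γ z₁ z₂ = waveIntegral ν γ' z₁ z₂) ∧
    -- the main formula
    (Regular (n + 1) ν →
      ∃ w : ℂ → ℂ, DifferentiableOn ℂ w cutPlane ∧
        HolomorphicOn (cutDomain (n + 1)) (fun p => w (mdot p.1 p.2)) ∧
        (∀ ζ : ℂ, (¬ ∃ r : ℝ, r ≤ 1 ∧ ζ = (r : ℂ)) → w ζ = bunchDavies (n + 1) ν ζ) ∧
        ∀ γ : Chain (n + 1) n, Homologous γ (sphereCycle n) →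
          (∀ z₁ ∈ pastTube (n + 1), ∀ z₂ ∈ futureTube (n + 1),
            mdot z₁ z₂ ∈ cutPlane ∧ twoPoint ν γ z₁ z₂ = w (mdot z₁ z₂)) ∧
          CanonicalCommutation (twoPoint ν γ)) := by
  refine ⟨fun γ hγ => ⟨holomorphicOn_waveIntegral γ ν,
    fun z₁ h₁ z₂ h₂ => kleinGordon_waveIntegral γ ν h₁ h₂,
    fun L hL z₁ h₁ z₂ h₂ => waveIntegral_mulVec hn hγ ν hL h₁ h₂,
    fun z₁ h₁ z₂ h₂ z₁' h₁' z₂' h₂' h => waveIntegral_eq_of_mdot_eq hn hγ ν h₁ h₂ h₁' h₂' h⟩,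
    fun γ γ' _ _ h z₁ h₁ z₂ h₂ => waveIntegral_eq_of_homologous ν h h₁.2 h₂.2, fun hν => ?_⟩
  have hw : DifferentiableOn ℂ (fun ζ => waveConst n ν * waveF n ν ζ) cutPlane :=
    (differentiableOn_waveF n ν).const_mul _
  refine ⟨_, hw, holomorphicOn_cutDomain hw, fun ζ hζ => (bunchDavies_eq_waveF n ν hζ).symm,
    fun γ hγ => ⟨fun z₁ h₁ z₂ h₂ => ⟨mdot_mem_cutPlane h₁ h₂, twoPoint_eq_waveF hn hγ ν h₁ h₂⟩,
      canonicalCommutation_of_tendsto hw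
        (fun z₁ h₁ z₂ h₂ => twoPoint_eq_waveF hn hγ ν h₁ h₂) (tendsto_deriv_waveF n hν)⟩⟩
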